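/- Proposition 3. Let $0<\underline\sigma\le\overline\sigma<\infty$ and let $\mathcal P$ be the set of probability measures on the canonical space of continuous paths $B$ on $[0,\infty)$ with $B_0=0$, with canonical filtration $(\mathcal F_t)$, under which $B$ is a martingale with $\underline\sigma^2dt\le d\langle B\rangle_t\le\overline\sigma^2dt$; so $B$ is a $G$-Brownian motion under the sublinear expectation $\hat{\mathbb E}[Y]=\sup_{P\in\mathcal P}E_P[Y]$. Let $\mathcal E[Y]=-\hat{\mathbb E}[-Y]$ be the lower expectation; "quasi-surely" means $P$-a.s. for every $P\in\mathcal P$. Let $A,F,C,D,I,P,Q\in\mathbb R$, $M\ge0$, $K>0$, $\rho>0$, $\lambda>0$, and $b(x,u)=Ax+Fu$, $\sigma(x,u)=Cx+Du$, $r(x,u)=-\left(\frac M2x^2+Ixu+\frac K2u^2+Px+Qu\right)$. Non-exploratory problem: $$V^{ne}(x)=\sup_u\mathcal E\Big[\int_0^\infty e^{-\rho t}r(x^u_t,u_t)\,dt\Big],\qquad dx^u_t=b(x^u_t,u_t)\,dt+\sigma(x^u_t,u_t)\,dB_t,\quad x^u_0=x,$$ over the adapted measurable real-valued processes $u$ with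 a strong solution $x^u$ and with $\hat{\mathbb E}\int_0^tu_s^2ds<\infty$ for all $t$, $\liminf_{T\to\infty}e^{-\rho T}\hat{\mathbb E}[(x^u_T)^2]=0$ and $\hat{\mathbb E}\int_0^\infty e^{-\rho t}|r(x^u_t,u_t)|dt<\infty$. Exploratory problem: for a density-valued process $\theta$, let $X^\theta$ be the strong solution of $$dX^\theta_t=\int_{\mathbb R}b(X^\theta_t,u)\theta_t(u)\,du\,dt+\sqrt{\int_{\mathbb R}\sigma^2(X^\theta_t,u)\theta_t(u)\,du}\;dB_t,\qquad X^\theta_0=x,$$ and let $g_t=\int_{\mathbb R}r(X^\theta_t,u)\theta_t(u)du-\lambda\int_{\mathbb R}\theta_t(u)\ln\theta_t(u)du$. Then $V(x)=\sup_\theta\mathcal E\left[\int_0^\infty e^{-\rho t}g_t\,dt\right]$ over the processes $\theta$ such that for each $t$, quasi-surely, $\theta_t$ is a probability density on $\mathbb R$; $\int_S\theta_t(u)du$ is progressively measurable for every Borel set $S$; $\hat{\mathbb E}\int_0^t\int_{\mathbb R}u^2\theta_s(u)\,du\,ds<\infty$ for all $t$; $\liminf_{T\to\infty}e^{-\rho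 T}\hat{\mathbb E}[(X^\theta_T)^2]=0$; and $\hat{\mathbb E}\int_0^\infty e^{-\rho t}|g_t|dt<\infty$. For $\alpha_0,\alpha_1\in\mathbb R$ and $\alpha_2<0$ put $\kappa=K-\alpha_2D^2\overline\sigma^2$ and $\boldsymbol u^*(y)=\frac{(\alpha_2(F+CD\overline\sigma^2)-I)y+\alpha_1F-Q}{\kappa}$, and let $\boldsymbol\theta^*(\cdot\,;y)$ be the density of the normal law $\mathcal N(\boldsymbol u^*(y),\lambda/\kappa)$. Consider the statements (a) for every $x\in\mathbb R$, $V(x)=\frac12\alpha_2x^2+\alpha_1x+\alpha_0+\frac{\lambda}{2\rho}\left(\ln\frac{2\pi e\lambda}{\kappa}-1\right)$, and $\boldsymbol\theta^*$ is an optimal randomized feedback control of the exploratory problem; (b) for every $x\in\mathbb R$, $V^{ne}(x)=\frac12\alpha_2x^2+\alpha_1x+\alpha_0$, and $\boldsymbol u^*$ is an optimal feedback control of the non-exploratory problem. Assume that (a) or (b) holds. Then for every $x\in\mathbb R$ the feedback laws $\boldsymbol u^*$ and $\boldsymbol\theta^*$ generate optimal controls from $x$ of the two problems, and, for the optimal control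 $\theta^*_t=\boldsymbol\theta^*(\cdot\,;X^*_t)$ generated by $\boldsymbol\theta^*$ along its state process $X^*$ with $X^*_0=x$, the exploration cost is well defined and equals $$\mathcal C^{u^*,\theta^*}(x)=V^{ne}(x)-V(x)-\lambda\,\mathcal E\Big[\int_0^\infty e^{-\rho t}\int_{\mathbb R}\theta^*_t(u)\ln\theta^*_t(u)\,du\,dt\Big]=\frac{\lambda}{2\rho},$$ whatever $x$, $\underline\sigma$ and $\overline\sigma$ are. -/

import Mathlib

open MeasureTheory ProbabilityTheory Filter Topology
open scoped NNReal ENNReal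

noncomputable section

/-! ## The canonical `G`-expectation space -/

/-- Canonical path space: continuous real paths on `[0, ∞)` started at `0`, with the σ-algebra
generated by the evaluations (which is the Borel σ-algebra of locally uniform convergence). -/
abbrev PathSpace : Type := {ω : ℝ≥0 → ℝ // Continuous ω ∧ ω 0 = 0}

/-- The canonical process `B`. -/
def canonB (t : ℝ≥0) (ω : PathSpace) : ℝ := ω.1 t

theorem canonB_stronglyMeasurable (t : ℝ≥0) : StronglyMeasurable (canonB t) :=
  ((measurable_pi_apply t).comp measurable_subtype_coe).stronglyMeasurable

/-- The filtration `𝓕 t = σ(B s, s ≤ t)` of events that depend on the path stopped at `t` only. -/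
def pathFiltration :
    Filtration ℝ≥0 (inferInstance : MeasurableSpace PathSpace) :=
  Filtration.natural canonB canonB_stronglyMeasurable

/-- Lebesgue measure on the time axis `[0, ∞)`. -/
def timeMeasure : Measure ℝ≥0 :=
  (volume.restrict (Set.Ici (0 : ℝ))).map Real.toNNReal

/-- The set of probability measures representing the `G`-expectation with volatility bounds `σlo`
and `σhi`: the laws under which the canonical process is a martingale whose quadratic variation
satisfies `σlo ^ 2 dt ≤ d⟨B⟩ ≤ σhi ^ 2 dt`.  As `B ^ 2 - ⟨B⟩` is a martingale, these two bounds say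
that `B ^ 2 - σlo ^ 2 t` is a submartingale and that `B ^ 2 - σhi ^ 2 t` is a supermartingale. -/
def priors (σlo σhi : ℝ) : Set (Measure PathSpace) :=
  {P | IsProbabilityMeasure P ∧
    Martingale canonB pathFiltration P ∧
    Submartingale (fun t ω => canonB t ω ^ 2 - σlo ^ 2 * (t : ℝ)) pathFiltration P ∧
    Supermartingale (fun t ω => canonB t ω ^ 2 - σhi ^ 2 * (t : ℝ)) pathFiltration P}

/-- A property holds quasi-surely if it holds almost surely under every prior. -/
def QuasiSurely (Ps : Set (Measure PathSpace)) (p : PathSpace → Prop) : Prop :=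
  ∀ P ∈ Ps, ∀ᵐ ω ∂P, p ω

/-- The upper (sublinear) expectation `Ê[Y] = sup_P E_P[Y]`. -/
def upperExp (Ps : Set (Measure PathSpace)) (Y : PathSpace → ℝ) : ℝ :=
  ⨆ P : Ps, ∫ ω, Y ω ∂P.1

/-- The lower expectation `-Ê[-Y]`. -/
def lowerExp (Ps : Set (Measure PathSpace)) (Y : PathSpace → ℝ) : ℝ :=
  -upperExp Ps (fun ω => -Y ω)

/-- The upper expectation of a `[0, ∞]`-valued random variable. -/
def upperExpENN (Ps : Set (Measure PathSpace)) (Y : PathSpace → ℝ≥0∞) : ℝ≥0∞ :=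
  ⨆ P ∈ Ps, ∫⁻ ω, Y ω ∂P

/-! ## The stochastic integral with respect to `B` and stochastic differential equations -/

/-- A simple process `∑ i < n, ξ i * 1_(time i, time (i + 1)]` with bounded `ξ i`, measurable with
respect to the σ-algebra at `time i`. -/
structure SimpleProcess where
  n : ℕ
  time : ℕ → ℝ≥0
  time_mono : Monotone time
  ξ : ℕ → PathSpace → ℝ
  ξ_meas : ∀ i, StronglyMeasurable[pathFiltration (time i)] (ξ i)
  ξ_bdd : ∃ c : ℝ, ∀ i ω, |ξ i ω| ≤ c

/-- The value of a simple process. -/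
def SimpleProcess.val (H : SimpleProcess) (s : ℝ≥0) (ω : PathSpace) : ℝ :=
  ∑ i ∈ Finset.range H.n,
    (Set.Ioc (H.time i) (H.time (i + 1))).indicator (fun _ => H.ξ i ω) s

/-- The integral of a simple process against `B` over `[0, t]`. -/
def SimpleProcess.integral (H : SimpleProcess) (t : ℝ≥0) (ω : PathSpace) : ℝ :=
  ∑ i ∈ Finset.range H.n,
    H.ξ i ω * (canonB (min (H.time (i + 1)) t) ω - canonB (min (H.time i) t) ω)

/-- A process is square integrable on every `[0, T]` under `P`. -/
def LocallySquareIntegrable (P : Measure PathSpace) (η : ℝ≥0 → PathSpace → ℝ) : Prop :=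
  ∀ T : ℝ≥0, MemLp (fun p : ℝ≥0 × PathSpace => η p.1 p.2) 2
    ((timeMeasure.restrict (Set.Iic T)).prod P)

/-- `J t = ∫_0^t η dB` for all `t`, `P`-a.s. for each `t`: the Itô integral under `P`, that is the
mean-square limit of the integrals of simple processes that approximate `η` in mean square. -/
def IsItoIntegral (P : Measure PathSpace) (η J : ℝ≥0 → PathSpace → ℝ) : Prop :=
  LocallySquareIntegrable P η ∧
  ∀ T : ℝ≥0, ∃ H : ℕ → SimpleProcess,
    Tendsto (fun k => eLpNorm (fun p : ℝ≥0 × PathSpace => (H k).val p.1 p.2 - η p.1 p.2) 2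
      ((timeMeasure.restrict (Set.Iic T)).prod P)) atTop (𝓝 0) ∧
    ∀ t ≤ T, Tendsto (fun k => eLpNorm (fun ω => (H k).integral t ω - J t ω) 2 P) atTop (𝓝 0)

/-- `X` is a strong solution of `dX = b dt + s dB`, `X 0 = x`, where the drift process `b` and the
volatility process `s` may themselves be functionals of `X`: one progressively measurable process,
quasi-surely continuous, which solves the equation under every prior. -/
structure IsStrongSolution (Ps : Set (Measure PathSpace)) (x : ℝ)
    (b s X : ℝ≥0 → PathSpace → ℝ) : Prop where
  progressive : IsStronglyProgressive pathFiltration X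
  continuous : QuasiSurely Ps (fun ω => Continuous (fun t => X t ω))
  init : QuasiSurely Ps (fun ω => X 0 ω = x)
  drift_memLp : ∀ P ∈ Ps, LocallySquareIntegrable P b
  equation : ∀ P ∈ Ps,
    IsItoIntegral P s (fun t ω => X t ω - x - ∫ r in Set.Iic t, b r ω ∂timeMeasure)

/-! ## The linear-quadratic model -/

/-- Parameters: state dynamics `b(x,u) = A x + F u`, `σ(x,u) = C x + D u`, reward
`r(x,u) = -(M/2 x² + I x u + K/2 u² + P x + Q u)`, discount rate `ρ`, exploration weight `lam`,
and volatility bounds `σlo ≤ σhi` of the `G`-Brownian motion. -/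
structure LQModel where
  (A F C D M I K P Q ρ lam σlo σhi : ℝ)
  M_nonneg : 0 ≤ M
  K_pos : 0 < K
  ρ_pos : 0 < ρ
  lam_pos : 0 < lam
  σlo_pos : 0 < σlo
  σlo_le_σhi : σlo ≤ σhi

namespace LQModel

variable (m : LQModel)

/-- The set of priors of the model. -/
def priorSet : Set (Measure PathSpace) := priors m.σlo m.σhi

def drift (y u : ℝ) : ℝ := m.A * y + m.F * u

def vol (y u : ℝ) : ℝ := m.C * y + m.D * u

def reward (y u : ℝ) : ℝ :=
  -(m.M / 2 * y ^ 2 + m.I * y * u + m.K / 2 * u ^ 2 + m.P * y + m.Q * u)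

/-! ### The non-exploratory problem -/

/-- Admissible open-loop control `u` from the initial state `x`, with state process `X`. -/
structure ClassicalAdmissible (x : ℝ) (u X : ℝ≥0 → PathSpace → ℝ) : Prop where
  adapted : StronglyAdapted pathFiltration u
  measurable : Measurable (fun p : ℝ≥0 × PathSpace => u p.1 p.2)
  moment : ∀ t : ℝ≥0, upperExpENN m.priorSet
    (fun ω => ∫⁻ s in Set.Iic t, ENNReal.ofReal (u s ω ^ 2) ∂timeMeasure) < ∞
  state : IsStrongSolution m.priorSet x (fun t ω => m.drift (X t ω) (u t ω))
    (fun t ω => m.vol (X t ω) (u t ω)) X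
  growth : liminf (fun T : ℝ≥0 => ENNReal.ofReal (Real.exp (-m.ρ * T)) *
    upperExpENN m.priorSet (fun ω => ENNReal.ofReal (X T ω ^ 2))) atTop = 0
  reward_finite : upperExpENN m.priorSet (fun ω => ∫⁻ t : ℝ≥0,
    ENNReal.ofReal (Real.exp (-m.ρ * t) * |m.reward (X t ω) (u t ω)|) ∂timeMeasure) < ∞

/-- The lower expectation of the discounted reward. -/
def classicalPayoff (u X : ℝ≥0 → PathSpace → ℝ) : ℝ :=
  lowerExp m.priorSet (fun ω => ∫ t : ℝ≥0,
    Real.exp (-m.ρ * t) * m.reward (X t ω) (u t ω) ∂timeMeasure)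

def classicalPayoffs (x : ℝ) : Set ℝ :=
  {j | ∃ u X, m.ClassicalAdmissible x u X ∧ j = m.classicalPayoff u X}

/-- The value function of the non-exploratory problem. -/
def classicalValue (x : ℝ) : ℝ := sSup (m.classicalPayoffs x)

/-- The control `u` with state process `X` is optimal from `x`. -/
def ClassicalOptimal (x : ℝ) (u X : ℝ≥0 → PathSpace → ℝ) : Prop :=
  m.ClassicalAdmissible x u X ∧ IsGreatest (m.classicalPayoffs x) (m.classicalPayoff u X)

/-! ### The exploratory problem -/

/-- Densities of probability measures on `ℝ`. -/
def IsDensity (θ : ℝ → ℝ) : Prop :=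
  AEMeasurable θ volume ∧ (∀ᵐ u, 0 ≤ θ u) ∧ ∫ u, θ u = 1

/-- The negative differential entropy `∫ θ ln θ`. -/
def negEntropy (θ : ℝ → ℝ) : ℝ := ∫ u, θ u * Real.log (θ u)

def exploratoryDrift (y : ℝ) (θ : ℝ → ℝ) : ℝ := ∫ u, m.drift y u * θ u

def exploratoryVol (y : ℝ) (θ : ℝ → ℝ) : ℝ := √(∫ u, m.vol y u ^ 2 * θ u)

def exploratoryReward (y : ℝ) (θ : ℝ → ℝ) : ℝ := ∫ u, m.reward y u * θ u

/-- The entropy-regularized running reward. -/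
def runningReward (y : ℝ) (θ : ℝ → ℝ) : ℝ := m.exploratoryReward y θ - m.lam * negEntropy θ

/-- Admissible open-loop randomized control `θ` (a density-valued process) from the initial state
`x`, with state process `X`.  In `moment`, `∫ u² θ(u) du` is the sum of the squared mean and the
variance of `θ`, as an element of `[0, ∞]`.  The conditions `entropy_integrable` and
`reward_measurable` belong to the finiteness of the reward: they say that the running reward is a
genuine integral and not a default value. -/
structure ExploratoryAdmissible (x : ℝ) (θ : ℝ≥0 → PathSpace → ℝ → ℝ)
    (X : ℝ≥0 → PathSpace → ℝ) : Prop where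
  density : ∀ t : ℝ≥0, QuasiSurely m.priorSet (fun ω => IsDensity (θ t ω))
  progressive : ∀ S : Set ℝ, MeasurableSet S →
    IsStronglyProgressive pathFiltration (fun t ω => ∫ u in S, θ t ω u)
  moment : ∀ t : ℝ≥0, upperExpENN m.priorSet
    (fun ω => ∫⁻ s in Set.Iic t, (∫⁻ u : ℝ, ENNReal.ofReal (u ^ 2 * θ s ω u)) ∂timeMeasure) < ∞
  state : IsStrongSolution m.priorSet x (fun t ω => m.exploratoryDrift (X t ω) (θ t ω))
    (fun t ω => m.exploratoryVol (X t ω) (θ t ω)) X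
  growth : liminf (fun T : ℝ≥0 => ENNReal.ofReal (Real.exp (-m.ρ * T)) *
    upperExpENN m.priorSet (fun ω => ENNReal.ofReal (X T ω ^ 2))) atTop = 0
  entropy_integrable : QuasiSurely m.priorSet (fun ω => ∀ᵐ t ∂timeMeasure,
    Integrable (fun u => θ t ω u * Real.log (θ t ω u)))
  reward_measurable : ∀ P ∈ m.priorSet, AEStronglyMeasurable
    (fun p : ℝ≥0 × PathSpace => m.runningReward (X p.1 p.2) (θ p.1 p.2)) (timeMeasure.prod P)
  reward_finite : upperExpENN m.priorSet (fun ω => ∫⁻ t : ℝ≥0,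
    ENNReal.ofReal (Real.exp (-m.ρ * t) * |m.runningReward (X t ω) (θ t ω)|) ∂timeMeasure) < ∞

/-- The lower expectation of the discounted entropy-regularized reward. -/
def exploratoryPayoff (θ : ℝ≥0 → PathSpace → ℝ → ℝ) (X : ℝ≥0 → PathSpace → ℝ) : ℝ :=
  lowerExp m.priorSet (fun ω => ∫ t : ℝ≥0,
    Real.exp (-m.ρ * t) * m.runningReward (X t ω) (θ t ω) ∂timeMeasure)

def exploratoryPayoffs (x : ℝ) : Set ℝ :=
  {j | ∃ θ X, m.ExploratoryAdmissible x θ X ∧ j = m.exploratoryPayoff θ X}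

/-- The value function of the exploratory problem. -/
def exploratoryValue (x : ℝ) : ℝ := sSup (m.exploratoryPayoffs x)

/-- The randomized control `θ` with state process `X` is optimal from `x`. -/
def ExploratoryOptimal (x : ℝ) (θ : ℝ≥0 → PathSpace → ℝ → ℝ) (X : ℝ≥0 → PathSpace → ℝ) : Prop :=
  m.ExploratoryAdmissible x θ X ∧
    IsGreatest (m.exploratoryPayoffs x) (m.exploratoryPayoff θ X)

/-! ### The two solvability statements and the exploration cost -/

/-- The denominator `K - α₂ D² σhi²`. -/
def curvature (α₂ : ℝ) : ℝ := m.K - α₂ * m.D ^ 2 * m.σhi ^ 2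

/-- The feedback law `u*(y)`. -/
def feedback (α₁ α₂ y : ℝ) : ℝ :=
  ((α₂ * (m.F + m.C * m.D * m.σhi ^ 2) - m.I) * y + α₁ * m.F - m.Q) / m.curvature α₂

/-- The randomized feedback law `θ*(u; y)`: the normal density with mean `u*(y)` and variance
`lam / (K - α₂ D² σhi²)`. -/
def randomizedFeedback (α₁ α₂ y : ℝ) : ℝ → ℝ :=
  gaussianPDFReal (m.feedback α₁ α₂ y) (m.lam / m.curvature α₂).toNNReal

/-- The open-loop control generated by the feedback law along the state process `X`. -/
def generatedControl (α₁ α₂ : ℝ) (X : ℝ≥0 → PathSpace → ℝ) : ℝ≥0 → PathSpace → ℝ :=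
  fun t ω => m.feedback α₁ α₂ (X t ω)

/-- The open-loop randomized control generated by the randomized feedback law along `X`. -/
def generatedRandomizedControl (α₁ α₂ : ℝ) (X : ℝ≥0 → PathSpace → ℝ) :
    ℝ≥0 → PathSpace → ℝ → ℝ :=
  fun t ω => m.randomizedFeedback α₁ α₂ (X t ω)

/-- The exploratory problem is solved by the quadratic value function with coefficients
`α₂ < 0`, `α₁`, `α₀` (plus the entropy constant) and by the Gaussian randomized feedback law. -/
def ExploratorySolution (α₀ α₁ α₂ : ℝ) : Prop :=
  α₂ < 0 ∧ ∀ x : ℝ,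
    IsLUB (m.exploratoryPayoffs x)
      (1 / 2 * α₂ * x ^ 2 + α₁ * x + α₀ + m.lam / (2 * m.ρ) *
        (Real.log (2 * Real.pi * Real.exp 1 * m.lam / m.curvature α₂) - 1)) ∧
    ∃ X, m.ExploratoryOptimal x (m.generatedRandomizedControl α₁ α₂ X) X

/-- The non-exploratory problem is solved by the quadratic value function with coefficients
`α₂ < 0`, `α₁`, `α₀` and by the linear feedback law. -/
def ClassicalSolution (α₀ α₁ α₂ : ℝ) : Prop :=
  α₂ < 0 ∧ ∀ x : ℝ,
    IsLUB (m.classicalPayoffs x) (1 / 2 * α₂ * x ^ 2 + α₁ * x + α₀) ∧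
    ∃ X, m.ClassicalOptimal x (m.generatedControl α₁ α₂ X) X

/-- The upper expectation of the discounted integrated absolute entropy is finite. -/
def FiniteDiscountedEntropy (θ : ℝ≥0 → PathSpace → ℝ → ℝ) : Prop :=
  upperExpENN m.priorSet (fun ω => ∫⁻ t : ℝ≥0,
    ENNReal.ofReal (Real.exp (-m.ρ * t) * |negEntropy (θ t ω)|) ∂timeMeasure) < ∞

/-- The exploration cost at `x` of the optimal randomized control `θ`. -/
def explorationCost (x : ℝ) (θ : ℝ≥0 → PathSpace → ℝ → ℝ) : ℝ :=
  (m.classicalValue x - m.exploratoryValue x) -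
    m.lam * lowerExp m.priorSet (fun ω => ∫ t : ℝ≥0,
      Real.exp (-m.ρ * t) * negEntropy (θ t ω) ∂timeMeasure)

end LQModel

end

/-! Each of the statements (a) and (b) is equivalent to the same two facts about the linear feedback
law: the closed loop is stable with respect to discounting (`StableLoop`), and the quadratic
function solves the Hamilton–Jacobi–Bellman equation with equality at the feedback
(`FeedbackEquation`). Either hypothesis therefore yields both solutions, and the cost is an explicit
difference of two constants.

The role of volatility uncertainty is settled by one formula. For a quadratic function with leading
coefficient q₂/2, the discounted Dynkin formula `IsState.dynkin` holds under every prior with the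
generator at volatility bound `σhi`, up to a remainder −½ q₂ R with R ≥ 0, and R = 0 when the
volatility is constantly `σhi`. For q₂ < 0 the remainder has the favourable sign under all priors.
Hence the payoff of a feedback is bounded below by the quadratic function under every prior and
attains it under Wiener measure scaled by `σhi`, while an arbitrary control is bounded above by
testing it under that single prior. These are `IsState.le_integral` and `IsState.integral_le`.
Wiener measure has to be constructed so that this prior is available (`exists_mem_priors`).

From a hypothesis to the two facts: the growth condition at all initial states forces the growth
rate of the second moment below ρ (`growth_rate_lt`), since otherwise a positive quadratic
subsolution would contradict the decay. The payoff of an affine feedback is then the unique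
quadratic solution of a triangular linear system, and comparison with the given value function
identifies its coefficients (`generator_eq_of_payoff_eq`). The exploratory loop has the same drift
as the classical one; the variance `lam / curvature` changes reward and generator together by
−lam/2, and the entropy adds a constant. So both linear equations are the same identity, with α₀
shifted by `entropyBonus` (`feedback_reward_add_generator`).

From the two facts to optimality: completing the square gives the inequality for all classical
controls, and averaging it over a density together with the Gibbs inequality gives it for all
randomized controls (`runningReward_add_generator_le`). Stability supplies all admissibility
conditions of the feedback.

A state process must be one process that solves the equation under all priors at once. It is built
as the limit of Euler schemes, which are functions of the path alone; their error bounds involve the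
prior only through `σhi`, so that Borel–Cantelli applies under each prior
(`isStrongSolution_eulerLimit`). -/

noncomputable section

/-! ## Lebesgue measure on the time axis -/

theorem map_coe_timeMeasure :
    timeMeasure.map ((↑) : ℝ≥0 → ℝ) = volume.restrict (Set.Ici (0 : ℝ)) := by
  rw [timeMeasure, Measure.map_map measurable_coe_nnreal_real measurable_real_toNNReal]
  conv_rhs => rw [← Measure.map_id (μ := volume.restrict (Set.Ici (0 : ℝ)))]
  refine Measure.map_congr ?_
  filter_upwards [ae_restrict_mem measurableSet_Ici] with t ht
  simpa using Real.coe_toNNReal t ht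

theorem measurableEmbedding_nnreal_coe : MeasurableEmbedding ((↑) : ℝ≥0 → ℝ) :=
  MeasurableEmbedding.subtype_coe measurableSet_Ici

theorem integral_timeMeasure_coe (f : ℝ → ℝ) :
    ∫ t : ℝ≥0, f t ∂timeMeasure = ∫ t in Set.Ici (0 : ℝ), f t := by
  rw [← map_coe_timeMeasure, measurableEmbedding_nnreal_coe.integral_map]

theorem integrable_timeMeasure_coe_iff (f : ℝ → ℝ) :
    Integrable (fun t : ℝ≥0 => f t) timeMeasure ↔ IntegrableOn f (Set.Ici 0) := by
  rw [IntegrableOn, ← map_coe_timeMeasure, measurableEmbedding_nnreal_coe.integrable_map_iff]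
  rfl

theorem setIntegral_timeMeasure_coe (f : ℝ → ℝ) (T : ℝ≥0) :
    ∫ t in Set.Iic T, f t ∂timeMeasure = ∫ t in (0 : ℝ)..T, f t := by
  have h : Set.Iic T = ((↑) : ℝ≥0 → ℝ) ⁻¹' Set.Iic (T : ℝ) := by ext; simp
  rw [h, ← measurableEmbedding_nnreal_coe.setIntegral_map, map_coe_timeMeasure,
    Measure.restrict_restrict measurableSet_Iic, Set.inter_comm, Set.Ici_inter_Iic,
    integral_Icc_eq_integral_Ioc, intervalIntegral.integral_of_le T.coe_nonneg]

theorem timeMeasure_preimage_coe {s : Set ℝ} (hs : MeasurableSet s) :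
    timeMeasure (((↑) : ℝ≥0 → ℝ) ⁻¹' s) = volume (s ∩ Set.Ici 0) := by
  rw [← measurableEmbedding_nnreal_coe.map_apply, map_coe_timeMeasure, Measure.restrict_apply hs]

theorem timeMeasure_Iic (T : ℝ≥0) : timeMeasure (Set.Iic T) = T := by
  have h : Set.Iic T = ((↑) : ℝ≥0 → ℝ) ⁻¹' Set.Iic (T : ℝ) := by ext; simp
  rw [h, timeMeasure_preimage_coe measurableSet_Iic, Set.inter_comm, Set.Ici_inter_Iic,
    Real.volume_Icc, sub_zero, ENNReal.ofReal_coe_nnreal]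

theorem timeMeasure_Ioc {s t : ℝ≥0} : timeMeasure (Set.Ioc s t) = ((t - s : ℝ≥0) : ℝ≥0∞) := by
  have h : Set.Ioc s t = ((↑) : ℝ≥0 → ℝ) ⁻¹' Set.Ioc (s : ℝ) t := by ext; simp
  have h' : Set.Ioc (s : ℝ) t ∩ Set.Ici 0 = Set.Ioc (s : ℝ) t := by
    refine Set.inter_eq_left.2 fun x hx => ?_
    exact s.2.trans hx.1.le
  rw [h, timeMeasure_preimage_coe measurableSet_Ioc, h', Real.volume_Ioc, ENNReal.ofReal]
  congr 1

instance nullSingletonClass_timeMeasure : NullSingletonClass timeMeasure := by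
  refine ⟨fun t => ?_⟩
  have h : {t} = ((↑) : ℝ≥0 → ℝ) ⁻¹' {(t : ℝ)} := by ext; simp
  rw [h, timeMeasure_preimage_coe (measurableSet_singleton _)]
  exact measure_mono_null Set.inter_subset_left (by simp)

instance isFiniteMeasure_timeMeasure_Iic (T : ℝ≥0) :
    IsFiniteMeasure (timeMeasure.restrict (Set.Iic T)) :=
  ⟨by rw [Measure.restrict_apply_univ, timeMeasure_Iic]; exact ENNReal.coe_lt_top⟩

instance sigmaFinite_timeMeasure : SigmaFinite timeMeasure := by
  refine ⟨⟨⟨fun n => Set.Iic (n : ℝ≥0), fun _ => trivial, fun n => ?_, ?_⟩⟩⟩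
  · rw [timeMeasure_Iic]; exact ENNReal.coe_lt_top
  · refine Set.eq_univ_of_forall fun t => Set.mem_iUnion.2 ?_
    exact (exists_nat_ge t).imp fun n hn => hn

theorem integrable_exp_neg_timeMeasure {c : ℝ} (hc : 0 < c) :
    Integrable (fun t : ℝ≥0 => Real.exp (-c * t)) timeMeasure := by
  rw [integrable_timeMeasure_coe_iff (fun t => Real.exp (-c * t)), integrableOn_Ici_iff_integrableOn_Ioi]
  exact exp_neg_integrableOn_Ioi 0 hc

theorem integral_exp_neg_timeMeasure {c : ℝ} (hc : 0 < c) :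
    ∫ t : ℝ≥0, Real.exp (-c * t) ∂timeMeasure = 1 / c := by
  rw [integral_timeMeasure_coe (fun t => Real.exp (-c * t)), integral_Ici_eq_integral_Ioi,
    integral_exp_mul_Ioi (by linarith)]
  simp

theorem setIntegral_exp_neg_timeMeasure (c : ℝ) (T : ℝ≥0) :
    ∫ t in Set.Iic T, -c * Real.exp (-c * t) ∂timeMeasure = Real.exp (-c * T) - 1 := by
  rw [setIntegral_timeMeasure_coe (fun t => -c * Real.exp (-c * t)),
    intervalIntegral.integral_eq_sub_of_hasDerivAt (f := fun t => Real.exp (-c * t))]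
  · simp
  · intro t _
    simpa [mul_comm] using ((hasDerivAt_id t).const_mul (-c)).exp
  · exact (by fun_prop : Continuous fun t : ℝ => -c * Real.exp (-c * t)).intervalIntegrable _ _

/-- Integration by parts on the time axis. -/
theorem integral_mul_integral_add_eq_mul {f g : ℝ≥0 → ℝ} {T : ℝ≥0}
    (hf : IntegrableOn f (Set.Iic T) timeMeasure) (hg : IntegrableOn g (Set.Iic T) timeMeasure) :
    (∫ u in Set.Iic T, g u * ∫ r in Set.Iic u, f r ∂timeMeasure ∂timeMeasure) +
      (∫ u in Set.Iic T, f u * ∫ r in Set.Iic u, g r ∂timeMeasure ∂timeMeasure) =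
    (∫ u in Set.Iic T, f u ∂timeMeasure) * ∫ u in Set.Iic T, g u ∂timeMeasure := by
  set μ := timeMeasure.restrict (Set.Iic T) with hμ
  have key : ∀ {f g : ℝ≥0 → ℝ} (_ : Integrable f μ) (_ : Integrable g μ),
      Integrable (fun p : ℝ≥0 × ℝ≥0 => {p : ℝ≥0 × ℝ≥0 | p.2 ≤ p.1}.indicator
        (fun p => g p.1 * f p.2) p) (μ.prod μ) ∧
      ∫ u, g u * ∫ r in Set.Iic u, f r ∂timeMeasure ∂μ =
        ∫ p, {p : ℝ≥0 × ℝ≥0 | p.2 ≤ p.1}.indicator (fun p => g p.1 * f p.2) p ∂(μ.prod μ) := by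
    intro f g hf hg
    have hi : Integrable (fun p : ℝ≥0 × ℝ≥0 => {p : ℝ≥0 × ℝ≥0 | p.2 ≤ p.1}.indicator
        (fun p => g p.1 * f p.2) p) (μ.prod μ) :=
      (hg.mul_prod hf).indicator (measurableSet_le measurable_snd measurable_fst)
    refine ⟨hi, ?_⟩
    rw [integral_prod _ hi]
    refine setIntegral_congr_fun measurableSet_Iic fun u hu => ?_
    have : (fun r => {p : ℝ≥0 × ℝ≥0 | p.2 ≤ p.1}.indicator (fun p => g p.1 * f p.2) (u, r)) =
        (Set.Iic u).indicator fun r => g u * f r := by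
      ext r; simp [Set.indicator_apply]
    simp only [this]
    rw [integral_indicator measurableSet_Iic, hμ, Measure.restrict_restrict measurableSet_Iic,
      Set.Iic_inter_Iic, min_eq_left hu, integral_const_mul]
  obtain ⟨i1, e1⟩ := key hf hg
  obtain ⟨i2, e2⟩ := key hg hf
  have e2' : ∫ p, {p : ℝ≥0 × ℝ≥0 | p.2 ≤ p.1}.indicator (fun p => f p.1 * g p.2) p ∂(μ.prod μ) =
      ∫ p, {p : ℝ≥0 × ℝ≥0 | p.1 ≤ p.2}.indicator (fun p => g p.1 * f p.2) p ∂(μ.prod μ) := by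
    rw [← integral_prod_swap]
    refine integral_congr_ae (ae_of_all _ fun p => ?_)
    simp [Set.indicator_apply, mul_comm]
  have i2' : Integrable (fun p : ℝ≥0 × ℝ≥0 => {p : ℝ≥0 × ℝ≥0 | p.1 ≤ p.2}.indicator
        (fun p => g p.1 * f p.2) p) (μ.prod μ) :=
    (hg.mul_prod hf).indicator (measurableSet_le measurable_fst measurable_snd)
  rw [e1, e2, e2', ← integral_add i1 i2', mul_comm, ← integral_prod_mul]
  refine integral_congr_ae ?_
  -- The square is the union of two triangles which overlap on the diagonal only, and the diagonal
  -- is null because the time measure has no atoms.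
  have hd : ∀ᵐ p ∂(μ.prod μ), p.1 ≠ p.2 := by
    refine (Measure.ae_prod_iff_ae_ae (p := fun p : ℝ≥0 × ℝ≥0 => p.1 ≠ p.2)
      (measurableSet_eq_fun measurable_fst measurable_snd).compl).2 ?_
    refine ae_of_all _ fun u => ?_
    refine (ae_iff.2 ?_ : ∀ᵐ r ∂μ, u ≠ r)
    have : {a | ¬ u ≠ a} = {u} := by ext; simp [eq_comm]
    rw [this]
    exact measure_mono_null (Set.Subset.refl _) (by simp [hμ])
  filter_upwards [hd] with p hp
  rcases lt_or_gt_of_ne hp with h | h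
  · simp [h.le, not_le.2 h]
  · simp [h.le, not_le.2 h]

theorem two_mul_integral_mul_integral_eq_sq {f : ℝ≥0 → ℝ} {T : ℝ≥0}
    (hf : IntegrableOn f (Set.Iic T) timeMeasure) :
    2 * ∫ u in Set.Iic T, f u * ∫ r in Set.Iic u, f r ∂timeMeasure ∂timeMeasure =
    (∫ u in Set.Iic T, f u ∂timeMeasure) ^ 2 := by
  rw [sq, ← integral_mul_integral_add_eq_mul hf hf]; ring

/-- Discounted integration by parts on the time axis. -/
theorem exp_mul_integral_eq {f : ℝ≥0 → ℝ} {T : ℝ≥0} (c : ℝ)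
    (hf : IntegrableOn f (Set.Iic T) timeMeasure) :
    Real.exp (-c * T) * ∫ u in Set.Iic T, f u ∂timeMeasure =
      (∫ u in Set.Iic T, Real.exp (-c * u) * f u ∂timeMeasure) -
      c * ∫ u in Set.Iic T, Real.exp (-c * u) * ∫ r in Set.Iic u, f r ∂timeMeasure ∂timeMeasure := by
  have hc : Continuous fun u : ℝ≥0 => Real.exp (-c * u) := by fun_prop
  have hb : ∀ᵐ u : ℝ≥0 ∂(timeMeasure.restrict (Set.Iic T)), ‖Real.exp (-c * (u : ℝ))‖ ≤ Real.exp (|c| * T) := by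
    filter_upwards [ae_restrict_mem measurableSet_Iic] with u hu
    rw [Real.norm_eq_abs, Real.abs_exp]
    refine Real.exp_le_exp.2 ?_
    have h1 : -c ≤ |c| := neg_le_abs c
    exact mul_le_mul h1 (by exact_mod_cast hu) u.2 (abs_nonneg c)
  have he : IntegrableOn (fun u : ℝ≥0 => Real.exp (-c * u)) (Set.Iic T) timeMeasure :=
    Integrable.of_bound hc.aestronglyMeasurable _ hb
  have hg : IntegrableOn (fun u : ℝ≥0 => -c * Real.exp (-c * u)) (Set.Iic T) timeMeasure :=
    he.const_mul _
  have h := integral_mul_integral_add_eq_mul hf hg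
  simp only [setIntegral_exp_neg_timeMeasure, mul_sub, mul_one] at h
  rw [integral_sub (by
    simpa only [mul_comm, smul_eq_mul] using
      Integrable.bdd_mul hf hc.aestronglyMeasurable hb) hf] at h
  simp only [mul_assoc, integral_const_mul] at h
  have hcomm : ∫ u in Set.Iic T, f u * Real.exp (-c * u) ∂timeMeasure =
      ∫ u in Set.Iic T, Real.exp (-c * u) * f u ∂timeMeasure := by simp only [mul_comm]
  simp only [mul_comm _ (Real.exp _)] at h hcomm ⊢
  linarith

theorem integrableOn_integral_Iic {f : ℝ≥0 → ℝ} {T : ℝ≥0}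
    (hf : IntegrableOn f (Set.Iic T) timeMeasure) :
    IntegrableOn (fun u => ∫ r in Set.Iic u, f r ∂timeMeasure) (Set.Iic T) timeMeasure := by
  set μ := timeMeasure.restrict (Set.Iic T) with hμ
  have hi : Integrable (fun p : ℝ≥0 × ℝ≥0 => {p : ℝ≥0 × ℝ≥0 | p.2 ≤ p.1}.indicator
      (fun p => f p.2) p) (μ.prod μ) :=
    (hf.comp_snd μ).indicator (measurableSet_le measurable_snd measurable_fst)
  refine hi.integral_prod_left.congr ?_
  filter_upwards [ae_restrict_mem measurableSet_Iic] with u hu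
  have : (fun r => {p : ℝ≥0 × ℝ≥0 | p.2 ≤ p.1}.indicator (fun p => f p.2) (u, r)) =
      (Set.Iic u).indicator f := by
    ext r; simp [Set.indicator_apply]
  simp only [this]
  rw [integral_indicator measurableSet_Iic, hμ, Measure.restrict_restrict measurableSet_Iic,
    Set.Iic_inter_Iic, min_eq_left hu]

theorem integrableOn_exp_mul {f : ℝ≥0 → ℝ} {T : ℝ≥0} (c : ℝ)
    (hf : IntegrableOn f (Set.Iic T) timeMeasure) :
    IntegrableOn (fun u : ℝ≥0 => Real.exp (-c * u) * f u) (Set.Iic T) timeMeasure := by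
  have hc : Continuous fun u : ℝ≥0 => Real.exp (-c * u) := by fun_prop
  refine Integrable.bdd_mul (c := Real.exp (|c| * T)) hf hc.aestronglyMeasurable ?_
  filter_upwards [ae_restrict_mem measurableSet_Iic] with u hu
  rw [Real.norm_eq_abs, Real.abs_exp]
  exact Real.exp_le_exp.2 (mul_le_mul (neg_le_abs c) (by exact_mod_cast hu) u.2 (abs_nonneg c))

/-- This is discounted integration by parts for an integral equation with an error term G. Nothing
is assumed about G itself: the equation exhibits it on [0, T] as a combination of integrable
functions. Keeping the two G-terms together makes the sign of the remainder visible when G ≥ 0. -/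
theorem exp_mul_eq_of_integral {m F G : ℝ≥0 → ℝ} {m₀ : ℝ} (c : ℝ) {T : ℝ≥0}
    (hm : IntegrableOn m (Set.Iic T) timeMeasure) (hF : IntegrableOn F (Set.Iic T) timeMeasure)
    (h : ∀ t ≤ T, m t = m₀ + (∫ r in Set.Iic t, F r ∂timeMeasure) - G t) :
    Real.exp (-c * T) * m T = m₀ + (∫ r in Set.Iic T, Real.exp (-c * r) * F r ∂timeMeasure) -
      c * (∫ r in Set.Iic T, Real.exp (-c * r) * m r ∂timeMeasure) -
      (Real.exp (-c * T) * G T + c * ∫ r in Set.Iic T, Real.exp (-c * r) * G r ∂timeMeasure) := by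
  have h1 := exp_mul_integral_eq c hF
  have hΦ := integrableOn_integral_Iic hF
  have hone : IntegrableOn (fun _ : ℝ≥0 => m₀) (Set.Iic T) timeMeasure := integrable_const _
  have h2 : ∫ r in Set.Iic T, Real.exp (-c * r) * G r ∂timeMeasure =
      (∫ r in Set.Iic T, Real.exp (-c * r) * m₀ ∂timeMeasure -
        ∫ r in Set.Iic T, Real.exp (-c * r) * m r ∂timeMeasure) +
      ∫ r in Set.Iic T, Real.exp (-c * r) * ∫ u in Set.Iic r, F u ∂timeMeasure ∂timeMeasure := by
    have k : IntegrableOn (fun r : ℝ≥0 => Real.exp (-c * r) * m₀ - Real.exp (-c * r) * m r)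
        (Set.Iic T) timeMeasure := (integrableOn_exp_mul c hone).sub (integrableOn_exp_mul c hm)
    rw [← integral_sub (integrableOn_exp_mul c hone) (integrableOn_exp_mul c hm),
      ← integral_add k (integrableOn_exp_mul c hΦ)]
    refine setIntegral_congr_fun measurableSet_Iic fun t ht => ?_
    rw [h t ht]; ring
  have h3 : c * ∫ r in Set.Iic T, Real.exp (-c * r) * m₀ ∂timeMeasure =
      m₀ - Real.exp (-c * T) * m₀ := by
    have := setIntegral_exp_neg_timeMeasure c T
    rw [integral_const_mul] at this
    rw [integral_mul_const]
    linear_combination (-m₀) * this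
  rw [h2, h T le_rfl]
  linear_combination h1 + h3

/-! ## Second moments of the canonical process under a prior -/

section Priors

variable {σlo σhi : ℝ} {P : Measure PathSpace}

theorem integrable_canonB_sq (hP : P ∈ priors σlo σhi) (t : ℝ≥0) :
    Integrable (fun ω => canonB t ω ^ 2) P := by
  have := hP.1
  have h := (hP.2.2.1.integrable t).add (integrable_const (σlo ^ 2 * (t : ℝ)))
  refine h.congr (ae_of_all _ fun ω => ?_)
  simp

theorem memLp_canonB (hP : P ∈ priors σlo σhi) (t : ℝ≥0) : MemLp (canonB t) 2 P :=
  (memLp_two_iff_integrable_sq (canonB_stronglyMeasurable t).aestronglyMeasurable).2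
    (integrable_canonB_sq hP t)

theorem MeasureTheory.integral_mul_condExp_of_stronglyMeasurable {Ω : Type*} {m m0 : MeasurableSpace Ω}
    {μ : Measure Ω} (hm : m ≤ m0) [SigmaFinite (μ.trim hm)] {W Y : Ω → ℝ}
    (hW : StronglyMeasurable[m] W) (hWY : Integrable (fun ω => W ω * Y ω) μ) (hY : Integrable Y μ) :
    ∫ ω, W ω * (μ[Y|m]) ω ∂μ = ∫ ω, W ω * Y ω ∂μ := by
  rw [← integral_condExp hm (f := fun ω => W ω * Y ω)]
  refine integral_congr_ae ?_
  exact (condExp_mul_of_stronglyMeasurable_left hW hWY hY).symm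

/-- Martingale increments are orthogonal to the square integrable past: the conditional expectation
of B at time t is moved onto the factor W. -/
theorem integral_mul_canonB_sub (hP : P ∈ priors σlo σhi) {s t : ℝ≥0} (hst : s ≤ t)
    {W : PathSpace → ℝ} (hW : StronglyMeasurable[pathFiltration s] W) (hW2 : MemLp W 2 P) :
    ∫ ω, W ω * (canonB t ω - canonB s ω) ∂P = 0 := by
  have := hP.1
  have hi : ∀ r, Integrable (fun ω => W ω * canonB r ω) P := fun r =>
    hW2.integrable_mul (memLp_canonB hP r)
  simp only [mul_sub]
  rw [integral_sub (hi t) (hi s), sub_eq_zero,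
    ← integral_mul_condExp_of_stronglyMeasurable (pathFiltration.le s) hW (hi t)
      (hP.2.1.integrable t)]
  refine integral_congr_ae ?_
  filter_upwards [hP.2.1.condExp_ae_eq hst] with ω hω
  rw [hω]

theorem MeasureTheory.MemLp.bdd_mul_of_ae {α : Type*} {m0 : MeasurableSpace α} {μ : Measure α}
    {f g : α → ℝ} {c : ℝ} (hg : MemLp g 2 μ) (hf : AEStronglyMeasurable f μ)
    (hc : ∀ᵐ a ∂μ, ‖f a‖ ≤ c) : MemLp (fun a => f a * g a) 2 μ := by
  refine MemLp.of_le_mul (c := c) hg (hf.mul hg.1) ?_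
  filter_upwards [hc] with a ha
  rw [norm_mul]
  exact mul_le_mul_of_nonneg_right ha (norm_nonneg _)

theorem MeasureTheory.MemLp.integrable_fun_mul {α : Type*} {m0 : MeasurableSpace α} {μ : Measure α}
    {f g : α → ℝ} (hf : MemLp f 2 μ) (hg : MemLp g 2 μ) : Integrable (fun a => f a * g a) μ :=
  hf.integrable_mul hg

/-- This is the Itô isometry on one interval, as a pair of inequalities because the volatility is
only bounded. The square equals W²B_t² − W²B_s² minus a multiple of W²B_s(B_t − B_s), which
integrates to zero. Testing the submartingale and the supermartingale property with the nonnegative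
weight W² bounds what remains from both sides. -/
theorem integral_sq_mul_canonB_sub_sq_of_bdd (hP : P ∈ priors σlo σhi) {s t : ℝ≥0} (hst : s ≤ t)
    {W : PathSpace → ℝ} (hW : StronglyMeasurable[pathFiltration s] W) {c : ℝ} (hc : ∀ ω, |W ω| ≤ c) :
    MemLp (fun ω => W ω * (canonB t ω - canonB s ω)) 2 P ∧
    σlo ^ 2 * ((t : ℝ) - s) * ∫ ω, W ω ^ 2 ∂P ≤
      ∫ ω, (W ω * (canonB t ω - canonB s ω)) ^ 2 ∂P ∧
    ∫ ω, (W ω * (canonB t ω - canonB s ω)) ^ 2 ∂P ≤ σhi ^ 2 * ((t : ℝ) - s) * ∫ ω, W ω ^ 2 ∂P := by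
  have := hP.1
  have hle := pathFiltration.le s
  have hW0 : AEStronglyMeasurable W P := (hW.mono hle).aestronglyMeasurable
  have hWb : ∀ᵐ ω ∂P, ‖W ω‖ ≤ c := ae_of_all _ hc
  have hWsq : StronglyMeasurable[pathFiltration s] (fun ω => W ω ^ 2) := hW.pow 2
  have hWsqb : ∀ᵐ ω ∂P, ‖W ω ^ 2‖ ≤ c ^ 2 := ae_of_all _ fun ω => by
    rw [norm_pow]; exact pow_le_pow_left₀ (norm_nonneg _) (hc ω) 2
  have hWsq0 : AEStronglyMeasurable (fun ω => W ω ^ 2) P := (hWsq.mono hle).aestronglyMeasurable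
  have hbd : ∀ {Y : PathSpace → ℝ}, Integrable Y P → Integrable (fun ω => W ω ^ 2 * Y ω) P :=
    fun hY => hY.bdd_mul hWsq0 hWsqb
  have hWB : ∀ r, MemLp (fun ω => W ω * canonB r ω) 2 P := fun r =>
    (memLp_canonB hP r).bdd_mul_of_ae hW0 hWb
  have hm : MemLp (fun ω => W ω * (canonB t ω - canonB s ω)) 2 P := by
    simp only [mul_sub]; exact (hWB t).sub (hWB s)
  have hcross : ∫ ω, (W ω ^ 2 * canonB s ω) * (canonB t ω - canonB s ω) ∂P = 0 := by
    refine integral_mul_canonB_sub hP hst ?_ ?_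
    · refine hWsq.mul ?_
      exact (Filtration.stronglyAdapted_natural canonB_stronglyMeasurable) s
    · exact (memLp_canonB hP s).bdd_mul_of_ae hWsq0 hWsqb
  have hiW : Integrable (fun ω => W ω ^ 2) P := Integrable.of_bound hWsq0 _ hWsqb
  have hcr : Integrable (fun ω => (W ω ^ 2 * canonB s ω) * (canonB t ω - canonB s ω)) P :=
    ((memLp_canonB hP s).bdd_mul_of_ae hWsq0 hWsqb).integrable_mul
      ((memLp_canonB hP t).sub (memLp_canonB hP s))
  have hexp : ∫ ω, (W ω * (canonB t ω - canonB s ω)) ^ 2 ∂P =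
      ∫ ω, W ω ^ 2 * canonB t ω ^ 2 ∂P - ∫ ω, W ω ^ 2 * canonB s ω ^ 2 ∂P := by
    have e : ∀ ω, (W ω * (canonB t ω - canonB s ω)) ^ 2 =
        (W ω ^ 2 * canonB t ω ^ 2 - W ω ^ 2 * canonB s ω ^ 2) -
        2 * ((W ω ^ 2 * canonB s ω) * (canonB t ω - canonB s ω)) := fun ω => by ring
    simp only [e]
    have hd : Integrable (fun ω => W ω ^ 2 * canonB t ω ^ 2 - W ω ^ 2 * canonB s ω ^ 2) P :=
      (hbd (integrable_canonB_sq hP t)).sub (hbd (integrable_canonB_sq hP s))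
    rw [integral_sub hd (hcr.const_mul 2), integral_const_mul, hcross,
      integral_sub (hbd (integrable_canonB_sq hP t)) (hbd (integrable_canonB_sq hP s))]
    ring
  have hone : ∀ (σ : ℝ) (r : ℝ≥0), Integrable (fun ω => canonB r ω ^ 2 - σ ^ 2 * (r : ℝ)) P :=
    fun σ r => (integrable_canonB_sq hP r).sub (integrable_const _)
  have hsplit : ∀ (σ : ℝ) (r : ℝ≥0), ∫ ω, W ω ^ 2 * (canonB r ω ^ 2 - σ ^ 2 * (r : ℝ)) ∂P =
      ∫ ω, W ω ^ 2 * canonB r ω ^ 2 ∂P - σ ^ 2 * r * ∫ ω, W ω ^ 2 ∂P := by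
    intro σ r
    simp only [mul_sub]
    rw [integral_sub (hbd (integrable_canonB_sq hP r)) (hiW.mul_const _), integral_mul_const]
    ring
  refine ⟨hm, ?_, ?_⟩
  · have h : ∫ ω, W ω ^ 2 * (canonB s ω ^ 2 - σlo ^ 2 * (s : ℝ)) ∂P ≤
        ∫ ω, W ω ^ 2 * (canonB t ω ^ 2 - σlo ^ 2 * (t : ℝ)) ∂P := by
      rw [← integral_mul_condExp_of_stronglyMeasurable hle hWsq (hbd (hone σlo t)) (hone σlo t)]
      refine integral_mono_ae (hbd (hone σlo s)) (hbd integrable_condExp) ?_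
      filter_upwards [hP.2.2.1.ae_le_condExp hst] with ω hω
      exact mul_le_mul_of_nonneg_left hω (sq_nonneg _)
    rw [hsplit, hsplit] at h
    rw [hexp]; linarith
  · have h : ∫ ω, W ω ^ 2 * (canonB t ω ^ 2 - σhi ^ 2 * (t : ℝ)) ∂P ≤
        ∫ ω, W ω ^ 2 * (canonB s ω ^ 2 - σhi ^ 2 * (s : ℝ)) ∂P := by
      rw [← integral_mul_condExp_of_stronglyMeasurable hle hWsq (hbd (hone σhi t)) (hone σhi t)]
      refine integral_mono_ae (hbd integrable_condExp) (hbd (hone σhi s)) ?_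
      filter_upwards [hP.2.2.2.condExp_ae_le hst] with ω hω
      exact mul_le_mul_of_nonneg_left hω (sq_nonneg _)
    rw [hsplit, hsplit] at h
    rw [hexp]; linarith

theorem MeasureTheory.eLpNorm_two_sq {α : Type*} {m0 : MeasurableSpace α} (μ : Measure α)
    (f : α → ℝ) : eLpNorm f 2 μ ^ 2 = ∫⁻ a, ENNReal.ofReal (f a ^ 2) ∂μ := by
  have h := eLpNorm_nnreal_pow_eq_lintegral (μ := μ) (f := f) (p := 2) two_ne_zero
  simp only [NNReal.coe_ofNat, ENNReal.rpow_ofNat, ENNReal.coe_ofNat] at h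
  rw [h]
  refine lintegral_congr fun a => ?_
  rw [← sq_abs, ENNReal.ofReal_pow (abs_nonneg _), ← Real.enorm_eq_ofReal_abs]

theorem MeasureTheory.MemLp.eLpNorm_two_sq {α : Type*} {m0 : MeasurableSpace α} {μ : Measure α}
    {f : α → ℝ} (hf : MemLp f 2 μ) : eLpNorm f 2 μ ^ 2 = ENNReal.ofReal (∫ a, f a ^ 2 ∂μ) := by
  rw [MeasureTheory.eLpNorm_two_sq,
    ofReal_integral_eq_lintegral_ofReal hf.integrable_sq (ae_of_all _ fun _ => sq_nonneg _)]

end Priors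

/-! ## The Itô isometry for simple processes -/

namespace SimpleProcess

variable {σlo σhi : ℝ} {P : Measure PathSpace} (H : SimpleProcess)

/-- The first `k` summands of the value of a simple process. -/
def partialVal (k : ℕ) (s : ℝ≥0) (ω : PathSpace) : ℝ :=
  ∑ i ∈ Finset.range k, (Set.Ioc (H.time i) (H.time (i + 1))).indicator (fun _ => H.ξ i ω) s

/-- The first `k` summands of the integral of a simple process. -/
def partialIntegral (k : ℕ) (t : ℝ≥0) (ω : PathSpace) : ℝ :=
  ∑ i ∈ Finset.range k,
    H.ξ i ω * (canonB (min (H.time (i + 1)) t) ω - canonB (min (H.time i) t) ω)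

theorem partialVal_succ (k : ℕ) (s : ℝ≥0) (ω : PathSpace) :
    H.partialVal (k + 1) s ω =
      H.partialVal k s ω + (Set.Ioc (H.time k) (H.time (k + 1))).indicator (fun _ => H.ξ k ω) s :=
  Finset.sum_range_succ _ _

theorem partialIntegral_succ (k : ℕ) (t : ℝ≥0) (ω : PathSpace) :
    H.partialIntegral (k + 1) t ω = H.partialIntegral k t ω +
      H.ξ k ω * (canonB (min (H.time (k + 1)) t) ω - canonB (min (H.time k) t) ω) :=
  Finset.sum_range_succ _ _

theorem partialVal_eq_zero {k : ℕ} {s : ℝ≥0} (hs : H.time k < s) (ω : PathSpace) :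
    H.partialVal k s ω = 0 := by
  refine Finset.sum_eq_zero fun i hi => Set.indicator_of_notMem (fun h => ?_) _
  have h1 : i + 1 ≤ k := Finset.mem_range.1 hi
  exact absurd (h.2.trans (H.time_mono h1)) (not_le.2 hs)

theorem partialVal_succ_sq (k : ℕ) (s : ℝ≥0) (ω : PathSpace) :
    H.partialVal (k + 1) s ω ^ 2 = H.partialVal k s ω ^ 2 +
      (Set.Ioc (H.time k) (H.time (k + 1))).indicator (fun _ => (1 : ℝ)) s * H.ξ k ω ^ 2 := by
  rw [partialVal_succ]
  by_cases h : s ∈ Set.Ioc (H.time k) (H.time (k + 1))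
  · rw [H.partialVal_eq_zero h.1]; simp [h]
  · simp [h]

theorem measurable_ξ (i : ℕ) : Measurable (H.ξ i) :=
  ((H.ξ_meas i).mono (pathFiltration.le _)).measurable

theorem measurable_partialVal (k : ℕ) :
    Measurable (fun p : ℝ≥0 × PathSpace => H.partialVal k p.1 p.2) := by
  unfold partialVal
  refine Finset.measurable_fun_sum _ fun i _ => ?_
  have h := (measurable_fst : Measurable (Prod.fst : ℝ≥0 × PathSpace → ℝ≥0))
    (measurableSet_Ioc (a := H.time i) (b := H.time (i + 1)))
  exact ((H.measurable_ξ i).comp measurable_snd).indicator h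

theorem exists_partialVal_le : ∃ c : ℝ, 0 ≤ c ∧ ∀ k s ω, |H.partialVal k s ω| ≤ k * c := by
  obtain ⟨c, hc⟩ := H.ξ_bdd
  have hc0 : 0 ≤ |c| := abs_nonneg c
  refine ⟨|c|, hc0, fun k s ω => ?_⟩
  refine (Finset.abs_sum_le_sum_abs _ _).trans ?_
  refine (Finset.sum_le_card_nsmul _ _ |c| fun i _ => ?_).trans (by simp)
  by_cases h : s ∈ Set.Ioc (H.time i) (H.time (i + 1))
  · simpa [h] using (hc i ω).trans (le_abs_self c)
  · simp [h]

theorem memLp_partialVal [IsProbabilityMeasure P] (k : ℕ) (T : ℝ≥0) :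
    MemLp (fun p : ℝ≥0 × PathSpace => H.partialVal k p.1 p.2) 2
      ((timeMeasure.restrict (Set.Iic T)).prod P) := by
  obtain ⟨c, -, hc⟩ := H.exists_partialVal_le
  exact MemLp.of_bound (H.measurable_partialVal k).aestronglyMeasurable (k * c)
    (ae_of_all _ fun p => hc k p.1 p.2)

/-- If the k-th interval starts after t, then ξ k is not known at the stopped left endpoint; but the
stopped increment vanishes there, so ξ k may be replaced by zero. This restores adaptedness at the
left endpoint without changing the integral or its norm. -/
theorem exists_adapted_increment (k : ℕ) (t : ℝ≥0) :
    ∃ Z : PathSpace → ℝ, StronglyMeasurable[pathFiltration (min (H.time k) t)] Z ∧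
      (∃ c, ∀ ω, |Z ω| ≤ c) ∧
      (∀ ω, Z ω * (canonB (min (H.time (k + 1)) t) ω - canonB (min (H.time k) t) ω) =
        H.ξ k ω * (canonB (min (H.time (k + 1)) t) ω - canonB (min (H.time k) t) ω)) ∧
      ((min (H.time (k + 1)) t : ℝ≥0) - (min (H.time k) t : ℝ≥0) : ℝ) * ∫ ω, Z ω ^ 2 ∂P =
        ((min (H.time (k + 1)) t : ℝ≥0) - (min (H.time k) t : ℝ≥0) : ℝ) * ∫ ω, H.ξ k ω ^ 2 ∂P := by
  rcases le_or_gt (H.time k) t with h | h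
  · refine ⟨H.ξ k, ?_, ?_, fun _ => rfl, rfl⟩
    · rw [min_eq_left h]; exact H.ξ_meas k
    · obtain ⟨c, hc⟩ := H.ξ_bdd
      exact ⟨c, hc k⟩
  · have h2 : t ≤ H.time (k + 1) := h.le.trans (H.time_mono k.le_succ)
    refine ⟨0, stronglyMeasurable_zero, ⟨0, by simp⟩, fun ω => ?_, ?_⟩
    · rw [min_eq_right h.le, min_eq_right h2]; simp
    · rw [min_eq_right h.le, min_eq_right h2]; simp

theorem stronglyMeasurable_partialIntegral (k : ℕ) (t : ℝ≥0) :
    StronglyMeasurable[pathFiltration (min (H.time k) t)] (H.partialIntegral k t) := by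
  induction k with
  | zero =>
    have : H.partialIntegral 0 t = 0 := by ext; simp [partialIntegral]
    rw [this]
    exact stronglyMeasurable_zero
  | succ k ih =>
    obtain ⟨Z, hZ, -, hZe, -⟩ := H.exists_adapted_increment (P := 0) k t
    have hle : min (H.time k) t ≤ min (H.time (k + 1)) t :=
      min_le_min_right t (H.time_mono k.le_succ)
    have hB := Filtration.stronglyAdapted_natural canonB_stronglyMeasurable
    have : H.partialIntegral (k + 1) t = fun ω => H.partialIntegral k t ω +
        Z ω * (canonB (min (H.time (k + 1)) t) ω - canonB (min (H.time k) t) ω) := by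
      ext ω; rw [hZe, partialIntegral_succ]
    rw [this]
    exact (ih.mono (pathFiltration.mono hle)).add ((hZ.mono (pathFiltration.mono hle)).mul
      ((hB _).sub ((hB _).mono (pathFiltration.mono hle))))

theorem setIntegral_indicator_Ioc (a b t : ℝ≥0) (hab : a ≤ b) :
    ∫ s in Set.Iic t, (Set.Ioc a b).indicator (fun _ => (1 : ℝ)) s ∂timeMeasure =
      (min b t : ℝ≥0) - (min a t : ℝ≥0) := by
  rw [integral_indicator measurableSet_Ioc, Measure.restrict_restrict measurableSet_Ioc,
    integral_const, smul_eq_mul, mul_one, measureReal_restrict_apply_univ]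
  have h : Set.Ioc a b ∩ Set.Iic t = Set.Ioc (min a t) (min b t) := by
    ext s
    simp only [Set.mem_inter_iff, Set.mem_Ioc, Set.mem_Iic, le_min_iff, min_lt_iff]
    constructor
    · rintro ⟨⟨h1, h2⟩, h3⟩; exact ⟨Or.inl h1, h2, h3⟩
    · rintro ⟨h1 | h1, h2, h3⟩
      · exact ⟨⟨h1, h2⟩, h3⟩
      · exact absurd h3 (not_le.2 h1)
  rw [h, Measure.real, timeMeasure_Ioc, ENNReal.coe_toReal, NNReal.coe_sub (min_le_min_right t hab)]

theorem integral_partialVal_succ_sq [IsProbabilityMeasure P] (k : ℕ) (T : ℝ≥0) :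
    ∫ p : ℝ≥0 × PathSpace, H.partialVal (k + 1) p.1 p.2 ^ 2
        ∂((timeMeasure.restrict (Set.Iic T)).prod P) =
      ∫ p : ℝ≥0 × PathSpace, H.partialVal k p.1 p.2 ^ 2
        ∂((timeMeasure.restrict (Set.Iic T)).prod P) +
      ((min (H.time (k + 1)) T : ℝ≥0) - (min (H.time k) T : ℝ≥0) : ℝ) * ∫ ω, H.ξ k ω ^ 2 ∂P := by
  obtain ⟨c, hc⟩ := H.ξ_bdd
  have hξ : Integrable (fun ω => H.ξ k ω ^ 2) P :=
    (MemLp.of_bound (H.measurable_ξ k).aestronglyMeasurable c (ae_of_all _ (hc k)) :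
      MemLp (H.ξ k) 2 P).integrable_sq
  have hind : Integrable ((Set.Ioc (H.time k) (H.time (k + 1))).indicator (fun _ => (1 : ℝ)))
      (timeMeasure.restrict (Set.Iic T)) :=
    (integrable_const _).indicator measurableSet_Ioc
  simp only [partialVal_succ_sq]
  rw [integral_add (H.memLp_partialVal k T).integrable_sq (hind.mul_prod hξ)]
  congr 1
  rw [← setIntegral_indicator_Ioc _ _ _ (H.time_mono k.le_succ)]
  exact integral_prod_mul ((Set.Ioc (H.time k) (H.time (k + 1))).indicator fun _ => (1 : ℝ))
    fun ω => H.ξ k ω ^ 2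

/-- Induction on the number of summands. The cross term vanishes because the preceding sum is
measurable at the start of the next interval, so the one-interval bounds add up; on the side of the
integrand the squares add up because the intervals are disjoint. -/
theorem integral_partialIntegral_sq (hP : P ∈ priors σlo σhi) (k : ℕ) (T : ℝ≥0) :
    MemLp (H.partialIntegral k T) 2 P ∧
    σlo ^ 2 * ∫ p : ℝ≥0 × PathSpace, H.partialVal k p.1 p.2 ^ 2
        ∂((timeMeasure.restrict (Set.Iic T)).prod P) ≤ ∫ ω, H.partialIntegral k T ω ^ 2 ∂P ∧
    ∫ ω, H.partialIntegral k T ω ^ 2 ∂P ≤ σhi ^ 2 *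
      ∫ p : ℝ≥0 × PathSpace, H.partialVal k p.1 p.2 ^ 2
        ∂((timeMeasure.restrict (Set.Iic T)).prod P) := by
  have := hP.1
  induction k with
  | zero =>
    have : H.partialIntegral 0 T = 0 := by ext; simp [partialIntegral]
    simp [this, partialVal]
  | succ k ih =>
    obtain ⟨ih1, ih2, ih3⟩ := ih
    obtain ⟨Z, hZ, ⟨c, hZc⟩, hZe, hZi⟩ := H.exists_adapted_increment (P := P) k T
    have hle : min (H.time k) T ≤ min (H.time (k + 1)) T :=
      min_le_min_right T (H.time_mono k.le_succ)
    obtain ⟨h1, h2, h3⟩ := integral_sq_mul_canonB_sub_sq_of_bdd hP hle hZ hZc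
    have hcross := integral_mul_canonB_sub hP hle
      ((H.stronglyMeasurable_partialIntegral k T).mul hZ) (by
        have : H.partialIntegral k T * Z = fun ω => Z ω * H.partialIntegral k T ω := by
          ext; simp [mul_comm]
        rw [this]
        exact ih1.bdd_mul_of_ae (hZ.mono (pathFiltration.le _)).aestronglyMeasurable
          (ae_of_all _ hZc))
    have he : H.partialIntegral (k + 1) T = fun ω => H.partialIntegral k T ω +
        Z ω * (canonB (min (H.time (k + 1)) T) ω - canonB (min (H.time k) T) ω) := by
      ext ω; rw [hZe, partialIntegral_succ]
    have hsq : ∫ ω, H.partialIntegral (k + 1) T ω ^ 2 ∂P = ∫ ω, H.partialIntegral k T ω ^ 2 ∂P +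
        ∫ ω, (Z ω * (canonB (min (H.time (k + 1)) T) ω - canonB (min (H.time k) T) ω)) ^ 2 ∂P := by
      have e : ∀ ω, H.partialIntegral (k + 1) T ω ^ 2 = (H.partialIntegral k T ω ^ 2 +
          (Z ω * (canonB (min (H.time (k + 1)) T) ω - canonB (min (H.time k) T) ω)) ^ 2) +
          2 * (H.partialIntegral k T ω *
          (Z ω * (canonB (min (H.time (k + 1)) T) ω - canonB (min (H.time k) T) ω))) := by
        intro ω; rw [he]; ring
      simp only [e]
      have i1 : Integrable (fun ω => H.partialIntegral k T ω ^ 2 +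
          (Z ω * (canonB (min (H.time (k + 1)) T) ω - canonB (min (H.time k) T) ω)) ^ 2) P :=
        ih1.integrable_sq.add h1.integrable_sq
      rw [integral_add i1 ((ih1.integrable_fun_mul h1).const_mul 2),
        integral_add ih1.integrable_sq h1.integrable_sq, integral_const_mul]
      simp only [Pi.mul_apply, mul_assoc] at hcross
      rw [hcross]; ring
    rw [hsq, integral_partialVal_succ_sq, ← hZi]
    refine ⟨by rw [he]; exact ih1.add h1, ?_, ?_⟩ <;> nlinarith

theorem memLp_val [IsProbabilityMeasure P] (T : ℝ≥0) :
    MemLp (fun p : ℝ≥0 × PathSpace => H.val p.1 p.2) 2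
      ((timeMeasure.restrict (Set.Iic T)).prod P) := H.memLp_partialVal H.n T

theorem memLp_integral (hP : P ∈ priors σlo σhi) (T : ℝ≥0) : MemLp (H.integral T) 2 P :=
  (H.integral_partialIntegral_sq hP H.n T).1

theorem eLpNorm_integral_le (hP : P ∈ priors σlo σhi) (T : ℝ≥0) :
    eLpNorm (H.integral T) 2 P ^ 2 ≤ ENNReal.ofReal (σhi ^ 2) *
      eLpNorm (fun p : ℝ≥0 × PathSpace => H.val p.1 p.2) 2
        ((timeMeasure.restrict (Set.Iic T)).prod P) ^ 2 := by
  have := hP.1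
  rw [(H.memLp_integral hP T).eLpNorm_two_sq, (H.memLp_val T).eLpNorm_two_sq,
    ← ENNReal.ofReal_mul (sq_nonneg _)]
  exact ENNReal.ofReal_le_ofReal (H.integral_partialIntegral_sq hP H.n T).2.2

theorem le_eLpNorm_integral (hP : P ∈ priors σlo σhi) (T : ℝ≥0) :
    ENNReal.ofReal (σlo ^ 2) * eLpNorm (fun p : ℝ≥0 × PathSpace => H.val p.1 p.2) 2
        ((timeMeasure.restrict (Set.Iic T)).prod P) ^ 2 ≤ eLpNorm (H.integral T) 2 P ^ 2 := by
  have := hP.1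
  rw [(H.memLp_integral hP T).eLpNorm_two_sq, (H.memLp_val T).eLpNorm_two_sq,
    ← ENNReal.ofReal_mul (sq_nonneg _)]
  exact ENNReal.ofReal_le_ofReal (H.integral_partialIntegral_sq hP H.n T).2.1

theorem stronglyMeasurable_integral (t : ℝ≥0) :
    StronglyMeasurable[pathFiltration t] (H.integral t) :=
  (H.stronglyMeasurable_partialIntegral H.n t).mono (pathFiltration.mono (min_le_right _ _))

theorem integral_mul_integral_sub (hP : P ∈ priors σlo σhi) {s t : ℝ≥0} (hst : s ≤ t)
    {W : PathSpace → ℝ} (hW : StronglyMeasurable[pathFiltration s] W) (hW2 : MemLp W 2 P) :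
    ∫ ω, W ω * (H.integral t ω - H.integral s ω) ∂P = 0 := by
  obtain ⟨c, hc⟩ := H.ξ_bdd
  -- Subtracting the integral up to s moves the endpoints min(a, t) to max(min(a, t), s), so that
  -- every remaining increment lies after s and is orthogonal to W.
  have hterm : ∀ i ω, H.ξ i ω * (canonB (min (H.time (i + 1)) t) ω - canonB (min (H.time i) t) ω) -
      H.ξ i ω * (canonB (min (H.time (i + 1)) s) ω - canonB (min (H.time i) s) ω) =
      H.ξ i ω * (canonB (max (min (H.time (i + 1)) t) s) ω -
        canonB (max (min (H.time i) t) s) ω) := by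
    intro i ω
    have hB : ∀ a : ℝ≥0, canonB (min a t) ω - canonB (min a s) ω =
        canonB (max (min a t) s) ω - canonB s ω := by
      intro a
      rcases le_total a s with h | h
      · rw [min_eq_left h, min_eq_left (h.trans hst), max_eq_right h]; ring
      · rw [min_eq_right h, max_eq_left (le_min h hst)]
    linear_combination H.ξ i ω * hB (H.time (i + 1)) - H.ξ i ω * hB (H.time i)
  have hsum : ∀ ω, W ω * (H.integral t ω - H.integral s ω) = ∑ i ∈ Finset.range H.n,
      W ω * (H.ξ i ω * (canonB (max (min (H.time (i + 1)) t) s) ω -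
        canonB (max (min (H.time i) t) s) ω)) := by
    intro ω
    rw [SimpleProcess.integral, SimpleProcess.integral, ← Finset.sum_sub_distrib, Finset.mul_sum]
    simp only [hterm]
  have hξW : ∀ i, MemLp (fun ω => H.ξ i ω * W ω) 2 P := fun i =>
    hW2.bdd_mul_of_ae (H.measurable_ξ i).aestronglyMeasurable (ae_of_all _ (hc i))
  simp only [hsum]
  rw [integral_finsetSum]
  · refine Finset.sum_eq_zero fun i _ => ?_
    have e : ∀ ω, W ω * (H.ξ i ω * (canonB (max (min (H.time (i + 1)) t) s) ω -
        canonB (max (min (H.time i) t) s) ω)) = (H.ξ i ω * W ω) *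
        (canonB (max (min (H.time (i + 1)) t) s) ω - canonB (max (min (H.time i) t) s) ω) :=
      fun ω => by ring
    simp only [e]
    rcases le_or_gt (H.time i) t with h | h
    · refine integral_mul_canonB_sub hP (max_le_max_right _ (min_le_min_right _
        (H.time_mono i.le_succ))) ?_ (hξW i)
      refine ((H.ξ_meas i).mono (pathFiltration.mono ?_)).mul
        (hW.mono (pathFiltration.mono (le_max_right _ _)))
      rw [min_eq_left h]; exact le_max_left _ _
    · have h2 : t ≤ H.time (i + 1) := h.le.trans (H.time_mono i.le_succ)
      rw [min_eq_right h.le, min_eq_right h2]; simp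
  · intro i _
    have e : (fun ω => W ω * (H.ξ i ω * (canonB (max (min (H.time (i + 1)) t) s) ω -
        canonB (max (min (H.time i) t) s) ω))) = fun ω => (H.ξ i ω * W ω) *
        (canonB (max (min (H.time (i + 1)) t) s) ω - canonB (max (min (H.time i) t) s) ω) := by
      ext ω; ring
    rw [e]
    exact (hξW i).integrable_mul ((memLp_canonB hP _).sub (memLp_canonB hP _))

end SimpleProcess

/-! ## Itô integrals under a prior -/

namespace MeasureTheory

variable {α : Type*} {m0 : MeasurableSpace α} {μ : Measure α}

theorem tendsto_eLpNorm_two_of_tendsto_sub {f : ℕ → α → ℝ} {g : α → ℝ}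
    (hf : ∀ k, AEStronglyMeasurable (f k) μ) (hg : MemLp g 2 μ)
    (h : Tendsto (fun k => eLpNorm (fun a => f k a - g a) 2 μ) atTop (𝓝 0)) :
    Tendsto (fun k => eLpNorm (f k) 2 μ) atTop (𝓝 (eLpNorm g 2 μ)) := by
  have hsub : ∀ k, AEStronglyMeasurable (fun a => f k a - g a) μ := fun k => (hf k).sub hg.1
  have l1 : Tendsto (fun k => eLpNorm g 2 μ - eLpNorm (fun a => f k a - g a) 2 μ) atTop
      (𝓝 (eLpNorm g 2 μ)) := by
    simpa using ENNReal.Tendsto.sub (tendsto_const_nhds (x := eLpNorm g 2 μ)) h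
      (Or.inl hg.2.ne)
  have l2 : Tendsto (fun k => eLpNorm g 2 μ + eLpNorm (fun a => f k a - g a) 2 μ) atTop
      (𝓝 (eLpNorm g 2 μ)) := by
    simpa using (tendsto_const_nhds (x := eLpNorm g 2 μ)).add h
  refine tendsto_of_tendsto_of_tendsto_of_le_of_le l1 l2 (fun k => ?_) (fun k => ?_)
  · rw [tsub_le_iff_right]
    have e : g = f k - fun a => f k a - g a := by ext a; simp
    calc eLpNorm g 2 μ = eLpNorm (f k - fun a => f k a - g a) 2 μ := by rw [← e]
      _ ≤ _ := eLpNorm_sub_le (hf k) (hsub k) one_le_two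
  · have e : f k = g + fun a => f k a - g a := by ext a; simp
    calc eLpNorm (f k) 2 μ = eLpNorm (g + fun a => f k a - g a) 2 μ := by rw [← e]
      _ ≤ _ := eLpNorm_add_le hg.1 (hsub k) one_le_two

theorem memLp_two_of_tendsto_sub {f : ℕ → α → ℝ} {g : α → ℝ}
    (hf : ∀ k, MemLp (f k) 2 μ) (hg : AEStronglyMeasurable g μ)
    (h : Tendsto (fun k => eLpNorm (fun a => f k a - g a) 2 μ) atTop (𝓝 0)) : MemLp g 2 μ := by
  obtain ⟨k, hk⟩ := (h.eventually (gt_mem_nhds (zero_lt_one' ℝ≥0∞))).exists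
  have hd : MemLp (fun a => f k a - g a) 2 μ := ⟨(hf k).1.sub hg, hk.trans ENNReal.one_lt_top⟩
  have e : g = f k - fun a => f k a - g a := by ext a; simp
  rw [e]; exact (hf k).sub hd

theorem tendsto_integral_mul_of_tendsto_sub {f : ℕ → α → ℝ} {g W : α → ℝ}
    (hf : ∀ k, MemLp (f k) 2 μ) (hg : MemLp g 2 μ) (hW : MemLp W 2 μ)
    (h : Tendsto (fun k => eLpNorm (fun a => f k a - g a) 2 μ) atTop (𝓝 0)) :
    Tendsto (fun k => ∫ a, W a * f k a ∂μ) atTop (𝓝 (∫ a, W a * g a ∂μ)) := by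
  refine tendsto_integral_of_L1' _ (hW.integrable_fun_mul hg).1
    (Eventually.of_forall fun k => hW.integrable_fun_mul (hf k)) ?_
  have l : Tendsto (fun k => eLpNorm W 2 μ * eLpNorm (fun a => f k a - g a) 2 μ) atTop (𝓝 0) := by
    simpa using ENNReal.Tendsto.const_mul h (Or.inr hW.2.ne)
  refine tendsto_of_tendsto_of_tendsto_of_le_of_le tendsto_const_nhds l (fun _ => zero_le) fun k => ?_
  have e : ((fun a => W a * f k a) - fun a => W a * g a) = W • fun a => f k a - g a := by
    ext a; simp [mul_sub]
  rw [e]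
  exact eLpNorm_smul_le_mul_eLpNorm ((hf k).1.sub hg.1) hW.1

end MeasureTheory

section Ito

variable {σlo σhi : ℝ} {P : Measure PathSpace} {η J : ℝ≥0 → PathSpace → ℝ}

theorem IsItoIntegral.memLp (hP : P ∈ priors σlo σhi) (h : IsItoIntegral P η J) {t : ℝ≥0}
    (hJ : AEStronglyMeasurable (J t) P) : MemLp (J t) 2 P := by
  obtain ⟨H, -, hH⟩ := h.2 t
  exact memLp_two_of_tendsto_sub (fun k => (H k).memLp_integral hP t) hJ (hH t le_rfl)

/-- Along the approximating simple processes the norms of integrands and integrals both converge, so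
the two isometry bounds pass to the limit. -/
theorem IsItoIntegral.eLpNorm_bounds (hP : P ∈ priors σlo σhi) (h : IsItoIntegral P η J) {t : ℝ≥0}
    (hJ : AEStronglyMeasurable (J t) P) :
    ENNReal.ofReal (σlo ^ 2) * eLpNorm (fun p : ℝ≥0 × PathSpace => η p.1 p.2) 2
        ((timeMeasure.restrict (Set.Iic t)).prod P) ^ 2 ≤ eLpNorm (J t) 2 P ^ 2 ∧
    eLpNorm (J t) 2 P ^ 2 ≤ ENNReal.ofReal (σhi ^ 2) *
      eLpNorm (fun p : ℝ≥0 × PathSpace => η p.1 p.2) 2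
        ((timeMeasure.restrict (Set.Iic t)).prod P) ^ 2 := by
  have := hP.1
  have hJ2 := h.memLp hP hJ
  obtain ⟨H, hv, hH⟩ := h.2 t
  have l1 := tendsto_eLpNorm_two_of_tendsto_sub
    (fun k => ((H k).memLp_val (P := P) t).1) (h.1 t) hv
  have l2 := tendsto_eLpNorm_two_of_tendsto_sub
    (fun k => ((H k).memLp_integral hP t).1) hJ2 (hH t le_rfl)
  have hc : ∀ σ : ℝ, Tendsto (fun k => ENNReal.ofReal (σ ^ 2) *
      eLpNorm (fun p : ℝ≥0 × PathSpace => (H k).val p.1 p.2) 2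
        ((timeMeasure.restrict (Set.Iic t)).prod P) ^ 2) atTop (𝓝 (ENNReal.ofReal (σ ^ 2) *
      eLpNorm (fun p : ℝ≥0 × PathSpace => η p.1 p.2) 2
        ((timeMeasure.restrict (Set.Iic t)).prod P) ^ 2)) := fun σ =>
    ENNReal.Tendsto.const_mul (ENNReal.Tendsto.pow l1) (Or.inr ENNReal.ofReal_ne_top)
  exact ⟨le_of_tendsto_of_tendsto' (hc σlo) (ENNReal.Tendsto.pow l2)
      fun k => (H k).le_eLpNorm_integral hP t,
    le_of_tendsto_of_tendsto' (ENNReal.Tendsto.pow l2) (hc σhi)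
      fun k => (H k).eLpNorm_integral_le hP t⟩

theorem IsItoIntegral.integral_sq_bounds (hP : P ∈ priors σlo σhi) (h : IsItoIntegral P η J)
    {t : ℝ≥0} (hJ : AEStronglyMeasurable (J t) P) :
    σlo ^ 2 * ∫ p : ℝ≥0 × PathSpace, η p.1 p.2 ^ 2 ∂((timeMeasure.restrict (Set.Iic t)).prod P) ≤
      ∫ ω, J t ω ^ 2 ∂P ∧
    ∫ ω, J t ω ^ 2 ∂P ≤ σhi ^ 2 *
      ∫ p : ℝ≥0 × PathSpace, η p.1 p.2 ^ 2 ∂((timeMeasure.restrict (Set.Iic t)).prod P) := by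
  have hb := h.eLpNorm_bounds hP hJ
  have h0 : 0 ≤ ∫ p : ℝ≥0 × PathSpace, η p.1 p.2 ^ 2 ∂((timeMeasure.restrict (Set.Iic t)).prod P) :=
    integral_nonneg fun _ => sq_nonneg _
  have h0' : 0 ≤ ∫ ω, J t ω ^ 2 ∂P := integral_nonneg fun _ => sq_nonneg _
  rw [(h.memLp hP hJ).eLpNorm_two_sq, (h.1 t).eLpNorm_two_sq,
    ← ENNReal.ofReal_mul (sq_nonneg _), ← ENNReal.ofReal_mul (sq_nonneg _)] at hb
  exact ⟨(ENNReal.ofReal_le_ofReal_iff h0').1 hb.1,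
    (ENNReal.ofReal_le_ofReal_iff (mul_nonneg (sq_nonneg _) h0)).1 hb.2⟩

/-- The martingale property of the Itô integral in tested form. Both approximating sequences come
from the same simple processes, so their pairings with W agree before the limit. W is allowed to be
adapted only up to a null set, which is all that a randomized drift provides. -/
theorem IsItoIntegral.integral_mul_sub (hP : P ∈ priors σlo σhi) (h : IsItoIntegral P η J)
    {s t : ℝ≥0} (hst : s ≤ t) (hJs : AEStronglyMeasurable (J s) P)
    (hJt : AEStronglyMeasurable (J t) P) {W : PathSpace → ℝ}
    (hW : AEStronglyMeasurable[pathFiltration s] W P) (hW2 : MemLp W 2 P) :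
    ∫ ω, W ω * (J t ω - J s ω) ∂P = 0 := by
  obtain ⟨H, -, hH⟩ := h.2 t
  have e : ∀ k, ∫ ω, W ω * (H k).integral t ω ∂P = ∫ ω, W ω * (H k).integral s ω ∂P := by
    intro k
    have hi : ∀ r, Integrable (fun ω => W ω * (H k).integral r ω) P := fun r =>
      hW2.integrable_fun_mul ((H k).memLp_integral hP r)
    rw [← sub_eq_zero, ← integral_sub (hi t) (hi s)]
    obtain ⟨V, hV, hWV⟩ := hW
    refine Eq.trans (integral_congr_ae ?_)
      ((H k).integral_mul_integral_sub hP hst hV ((memLp_congr_ae hWV).1 hW2))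
    filter_upwards [hWV] with ω hω
    rw [hω]; ring
  have l1 := tendsto_integral_mul_of_tendsto_sub (fun k => (H k).memLp_integral hP t)
    (h.memLp hP hJt) hW2 (hH t le_rfl)
  have l2 := tendsto_integral_mul_of_tendsto_sub (fun k => (H k).memLp_integral hP s)
    (h.memLp hP hJs) hW2 (hH s hst)
  simp only [e] at l1
  simp only [mul_sub]
  rw [integral_sub (hW2.integrable_fun_mul (h.memLp hP hJt))
    (hW2.integrable_fun_mul (h.memLp hP hJs)), tendsto_nhds_unique l1 l2, sub_self]

/-- The time interval up to 0 is a null set, so the upper isometry bound is zero. -/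
theorem IsItoIntegral.ae_zero (hP : P ∈ priors σlo σhi) (h : IsItoIntegral P η J)
    (hJ : AEStronglyMeasurable (J 0) P) : J 0 =ᵐ[P] 0 := by
  have hb := (h.eLpNorm_bounds hP hJ).2
  have hz : (timeMeasure.restrict (Set.Iic (0 : ℝ≥0))).prod P = 0 := by
    rw [Measure.restrict_eq_zero.2 (by rw [timeMeasure_Iic]; simp), Measure.zero_prod]
  rw [hz] at hb
  have : eLpNorm (J 0) 2 P = 0 := by simpa using hb
  exact (eLpNorm_eq_zero_iff hJ two_ne_zero).1 this

/-! ### Square integrable step processes -/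

/-- The step process with value `Z i` on `(τ i, τ (i + 1)]` for `i < n`. -/
def stepVal (τ : ℕ → ℝ≥0) (Z : ℕ → PathSpace → ℝ) (n : ℕ) (s : ℝ≥0) (ω : PathSpace) : ℝ :=
  ∑ i ∈ Finset.range n, (Set.Ioc (τ i) (τ (i + 1))).indicator (fun _ => Z i ω) s

/-- The integral of a step process against `B`. -/
def stepIntegral (τ : ℕ → ℝ≥0) (Z : ℕ → PathSpace → ℝ) (n : ℕ) (t : ℝ≥0) (ω : PathSpace) : ℝ :=
  ∑ i ∈ Finset.range n, Z i ω * (canonB (min (τ (i + 1)) t) ω - canonB (min (τ i) t) ω)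

variable {τ : ℕ → ℝ≥0} {Z : ℕ → PathSpace → ℝ}

/-- The truncation of a step process at the level `c`. -/
def truncatedStep (hτ : Monotone τ) (hZ : ∀ i, StronglyMeasurable[pathFiltration (τ i)] (Z i))
    (n c : ℕ) : SimpleProcess where
  n := n
  time := τ
  time_mono := hτ
  ξ i := {ω | |Z i ω| ≤ c}.indicator (Z i)
  ξ_meas i := (hZ i).indicator
    (StronglyMeasurable.measurableSet_le (hZ i).norm stronglyMeasurable_const)
  ξ_bdd := ⟨c, fun i ω => by
    by_cases h : |Z i ω| ≤ c
    · simp [h]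
    · simp [h]⟩

theorem measurable_stepVal (hZ : ∀ i, StronglyMeasurable[pathFiltration (τ i)] (Z i)) (n : ℕ) :
    Measurable (fun p : ℝ≥0 × PathSpace => stepVal τ Z n p.1 p.2) := by
  unfold stepVal
  refine Finset.measurable_fun_sum _ fun i _ => ?_
  have h := (measurable_fst : Measurable (Prod.fst : ℝ≥0 × PathSpace → ℝ≥0))
    (measurableSet_Ioc (a := τ i) (b := τ (i + 1)))
  exact (((hZ i).mono (pathFiltration.le _)).measurable.comp measurable_snd).indicator h

theorem stronglyMeasurable_stepIntegral (hτ : Monotone τ)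
    (hZ : ∀ i, StronglyMeasurable[pathFiltration (τ i)] (Z i)) (n : ℕ) (t : ℝ≥0) :
    StronglyMeasurable[pathFiltration t] (stepIntegral τ Z n t) := by
  have hB := Filtration.stronglyAdapted_natural canonB_stronglyMeasurable
  refine Finset.stronglyMeasurable_fun_sum _ fun i _ => ?_
  rcases le_or_gt (τ i) t with h | h
  · exact ((hZ i).mono (pathFiltration.mono h)).mul
      (((hB _).mono (pathFiltration.mono (min_le_right _ _))).sub
        ((hB _).mono (pathFiltration.mono (min_le_right _ _))))
  · have h2 : t ≤ τ (i + 1) := h.le.trans (hτ i.le_succ)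
    simp only [min_eq_right h.le, min_eq_right h2, sub_self, mul_zero]
    exact stronglyMeasurable_const

theorem eventually_truncatedStep (hτ : Monotone τ)
    (hZ : ∀ i, StronglyMeasurable[pathFiltration (τ i)] (Z i)) (n : ℕ) (ω : PathSpace) :
    ∀ᶠ c in atTop, (∀ s, (truncatedStep hτ hZ n c).val s ω = stepVal τ Z n s ω) ∧
      ∀ t, (truncatedStep hτ hZ n c).integral t ω = stepIntegral τ Z n t ω := by
  have h : ∀ᶠ c : ℕ in atTop, ∀ i ∈ Finset.range n, |Z i ω| ≤ c :=
    (Finset.eventually_all _).2 fun i _ =>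
      (eventually_ge_atTop ⌈|Z i ω|⌉₊).mono fun c hc => Nat.ceil_le.1 hc
  filter_upwards [h] with c hc
  constructor
  · intro s
    refine Finset.sum_congr rfl fun i hi => ?_
    simp [truncatedStep, hc i hi]
  · intro t
    refine Finset.sum_congr rfl fun i hi => ?_
    simp [truncatedStep, hc i hi]

theorem stepVal_sq_eq (hτ : Monotone τ) (n : ℕ) (s : ℝ≥0) (ω : PathSpace) :
    stepVal τ Z n s ω ^ 2 =
      ∑ i ∈ Finset.range n, (Set.Ioc (τ i) (τ (i + 1))).indicator (fun _ => Z i ω ^ 2) s := by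
  induction n with
  | zero => simp [stepVal]
  | succ k ih =>
    rw [Finset.sum_range_succ, ← ih]
    have e : stepVal τ Z (k + 1) s ω = stepVal τ Z k s ω +
      (Set.Ioc (τ k) (τ (k + 1))).indicator (fun _ => Z k ω) s := Finset.sum_range_succ _ _
    rw [e]
    by_cases h : s ∈ Set.Ioc (τ k) (τ (k + 1))
    · have h0 : stepVal τ Z k s ω = 0 := by
        refine Finset.sum_eq_zero fun i hi => Set.indicator_of_notMem (fun h' => ?_) _
        exact absurd (h'.2.trans (hτ (Finset.mem_range.1 hi))) (not_le.2 h.1)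
      simp [h, h0]
    · simp [h]

theorem truncatedStep_val_sq_le (hτ : Monotone τ)
    (hZ : ∀ i, StronglyMeasurable[pathFiltration (τ i)] (Z i)) (n c : ℕ) (s : ℝ≥0) (ω : PathSpace) :
    (truncatedStep hτ hZ n c).val s ω ^ 2 ≤ stepVal τ Z n s ω ^ 2 := by
  have e : (truncatedStep hτ hZ n c).val s ω =
    stepVal τ (truncatedStep hτ hZ n c).ξ n s ω := rfl
  rw [e, stepVal_sq_eq hτ, stepVal_sq_eq hτ]
  refine Finset.sum_le_sum fun i _ => Set.indicator_le_indicator ?_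
  by_cases h : |Z i ω| ≤ c
  · simp [truncatedStep, h]
  · simp [truncatedStep, h, sq_nonneg]

/-- The coefficients are unbounded, so the bound is inherited from the truncations: on each path the
truncated integral eventually equals the full one, the truncated integrand is dominated, and Fatou's
lemma concludes. -/
theorem eLpNorm_stepIntegral_le (hP : P ∈ priors σlo σhi) (hτ : Monotone τ)
    (hZ : ∀ i, StronglyMeasurable[pathFiltration (τ i)] (Z i)) (n : ℕ) (t : ℝ≥0) :
    eLpNorm (stepIntegral τ Z n t) 2 P ^ 2 ≤ ENNReal.ofReal (σhi ^ 2) *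
      eLpNorm (fun p : ℝ≥0 × PathSpace => stepVal τ Z n p.1 p.2) 2
        ((timeMeasure.restrict (Set.Iic t)).prod P) ^ 2 := by
  have hb : ∀ c, ∫⁻ ω, ENNReal.ofReal ((truncatedStep hτ hZ n c).integral t ω ^ 2) ∂P ≤
      ENNReal.ofReal (σhi ^ 2) * eLpNorm (fun p : ℝ≥0 × PathSpace => stepVal τ Z n p.1 p.2) 2
        ((timeMeasure.restrict (Set.Iic t)).prod P) ^ 2 := by
    intro c
    rw [← eLpNorm_two_sq]
    refine ((truncatedStep hτ hZ n c).eLpNorm_integral_le hP t).trans ?_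
    rw [eLpNorm_two_sq, eLpNorm_two_sq]
    exact mul_le_mul' le_rfl (lintegral_mono fun p =>
      ENNReal.ofReal_le_ofReal (truncatedStep_val_sq_le hτ hZ n c p.1 p.2))
  rw [eLpNorm_two_sq]
  calc _ = ∫⁻ ω, liminf (fun c =>
        ENNReal.ofReal ((truncatedStep hτ hZ n c).integral t ω ^ 2)) atTop ∂P := by
        refine lintegral_congr fun ω => (Tendsto.liminf_eq ?_).symm
        refine tendsto_const_nhds.congr' ?_
        filter_upwards [eventually_truncatedStep hτ hZ n ω] with c hc
        rw [hc.2]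
    _ ≤ _ := lintegral_liminf_le fun c => by
        have := (((truncatedStep hτ hZ n c).stronglyMeasurable_integral t).mono
          (pathFiltration.le t)).measurable
        fun_prop
    _ ≤ _ := liminf_le_of_frequently_le' (Frequently.of_forall hb)

theorem memLp_stepVal [IsProbabilityMeasure P]
    (hZ2 : ∀ i, MemLp (Z i) 2 P) (n : ℕ) (T : ℝ≥0) :
    MemLp (fun p : ℝ≥0 × PathSpace => stepVal τ Z n p.1 p.2) 2
      ((timeMeasure.restrict (Set.Iic T)).prod P) := by
  unfold stepVal
  refine memLp_finsetSum _ fun i _ => ?_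
  have h := (measurable_fst : Measurable (Prod.fst : ℝ≥0 × PathSpace → ℝ≥0))
    (measurableSet_Ioc (a := τ i) (b := τ (i + 1)))
  exact MemLp.indicator h ((hZ2 i).comp_snd _)

/-- Dominated convergence. The majorant has the factor 4 because (a − b)² ≤ 2a² + 2b² and the
truncated square is at most the full one. -/
theorem tendsto_eLpNorm_truncatedStep [IsProbabilityMeasure P] (hτ : Monotone τ)
    (hZ : ∀ i, StronglyMeasurable[pathFiltration (τ i)] (Z i))
    (hZ2 : ∀ i, MemLp (Z i) 2 P) (n : ℕ) (T : ℝ≥0) :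
    Tendsto (fun c => eLpNorm (fun p : ℝ≥0 × PathSpace =>
      (truncatedStep hτ hZ n c).val p.1 p.2 - stepVal τ Z n p.1 p.2) 2
      ((timeMeasure.restrict (Set.Iic T)).prod P)) atTop (𝓝 0) := by
  have hd := (memLp_stepVal (τ := τ) hZ2 n T).integrable_sq.lintegral_lt_top
  have h2 : Tendsto (fun c => eLpNorm (fun p : ℝ≥0 × PathSpace =>
      (truncatedStep hτ hZ n c).val p.1 p.2 - stepVal τ Z n p.1 p.2) 2
      ((timeMeasure.restrict (Set.Iic T)).prod P) ^ 2) atTop (𝓝 0) := by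
    simp only [eLpNorm_two_sq]
    have := tendsto_lintegral_of_dominated_convergence'
      (μ := (timeMeasure.restrict (Set.Iic T)).prod P)
      (F := fun c (p : ℝ≥0 × PathSpace) => ENNReal.ofReal
        (((truncatedStep hτ hZ n c).val p.1 p.2 - stepVal τ Z n p.1 p.2) ^ 2)) (f := fun _ => 0)
      (fun p => ENNReal.ofReal 4 * ENNReal.ofReal (stepVal τ Z n p.1 p.2 ^ 2)) ?_ ?_ ?_ ?_
    · simpa using this
    · intro c
      have h1 := (truncatedStep hτ hZ n c).measurable_partialVal n
      have h2 := measurable_stepVal hZ n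
      have h3 : Measurable (fun p : ℝ≥0 × PathSpace => (truncatedStep hτ hZ n c).val p.1 p.2) := h1
      fun_prop
    · intro c
      refine ae_of_all _ fun p => ?_
      beta_reduce
      rw [← ENNReal.ofReal_mul (by norm_num)]
      refine ENNReal.ofReal_le_ofReal ?_
      have := truncatedStep_val_sq_le hτ hZ n c p.1 p.2
      nlinarith [sq_nonneg ((truncatedStep hτ hZ n c).val p.1 p.2 + stepVal τ Z n p.1 p.2)]
    · rw [lintegral_const_mul' _ _ ENNReal.ofReal_ne_top]
      exact (ENNReal.mul_lt_top ENNReal.ofReal_lt_top hd).ne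
    · refine ae_of_all _ fun p => tendsto_const_nhds.congr' ?_
      filter_upwards [eventually_truncatedStep hτ hZ n p.2] with c hc
      simp [hc.1]
  have h4 := (ENNReal.continuous_rpow_const (y := 1 / 2)).tendsto 0 |>.comp h2
  simp only [one_div, inv_pos, Nat.ofNat_pos, ENNReal.zero_rpow_of_pos] at h4
  refine h4.congr fun c => ?_
  simp only [Function.comp]
  rw [← ENNReal.rpow_natCast, ← ENNReal.rpow_mul]
  norm_num

/-- The Itô integral is determined by approximation with square integrable step processes. -/
theorem isItoIntegral_of_tendsto_step (hP : P ∈ priors σlo σhi)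
    (hη : LocallySquareIntegrable P η) (hJ : ∀ t, AEStronglyMeasurable (J t) P)
    (h : ∀ T : ℝ≥0, ∃ (τ : ℕ → ℕ → ℝ≥0) (Z : ℕ → ℕ → PathSpace → ℝ) (n : ℕ → ℕ),
      (∀ k, Monotone (τ k)) ∧ (∀ k i, StronglyMeasurable[pathFiltration (τ k i)] (Z k i)) ∧
      (∀ k i, MemLp (Z k i) 2 P) ∧
      Tendsto (fun k => eLpNorm (fun p : ℝ≥0 × PathSpace => stepVal (τ k) (Z k) (n k) p.1 p.2 -
        η p.1 p.2) 2 ((timeMeasure.restrict (Set.Iic T)).prod P)) atTop (𝓝 0) ∧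
      ∀ t ≤ T, Tendsto (fun k => eLpNorm (fun ω => stepIntegral (τ k) (Z k) (n k) t ω - J t ω) 2 P)
        atTop (𝓝 0)) :
    IsItoIntegral P η J := by
  have := hP.1
  refine ⟨hη, fun T => ?_⟩
  obtain ⟨τ, Z, n, hτ, hZ, hZ2, hv, hi⟩ := h T
  -- The truncation level of the k-th step process is chosen so that the error is at most 1/(k+1); a
  -- diagonal sequence of simple processes results.
  have hex : ∀ k : ℕ, ∃ c, eLpNorm (fun p : ℝ≥0 × PathSpace =>
      (truncatedStep (hτ k) (hZ k) (n k) c).val p.1 p.2 - stepVal (τ k) (Z k) (n k) p.1 p.2) 2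
      ((timeMeasure.restrict (Set.Iic T)).prod P) ≤ ((k : ℝ≥0∞) + 1)⁻¹ := by
    intro k
    have hpos : (0 : ℝ≥0∞) < ((k : ℝ≥0∞) + 1)⁻¹ := by simp
    exact ((tendsto_eLpNorm_truncatedStep (hτ k) (hZ k) (hZ2 k) (n k) T).eventually
      (gt_mem_nhds hpos)).exists.imp fun c hc => hc.le
  choose c hc using hex
  have hinv : Tendsto (fun k : ℕ => ((k : ℝ≥0∞) + 1)⁻¹) atTop (𝓝 0) := by
    have := (tendsto_add_atTop_iff_nat 1).2 ENNReal.tendsto_inv_nat_nhds_zero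
    simpa using this
  refine ⟨fun k => truncatedStep (hτ k) (hZ k) (n k) (c k), ?_, fun t ht => ?_⟩
  · refine tendsto_of_tendsto_of_tendsto_of_le_of_le tendsto_const_nhds
      (by simpa using hinv.add hv) (fun _ => zero_le) fun k => ?_
    have e : (fun p : ℝ≥0 × PathSpace => (truncatedStep (hτ k) (hZ k) (n k) (c k)).val p.1 p.2 -
        η p.1 p.2) = (fun p => (truncatedStep (hτ k) (hZ k) (n k) (c k)).val p.1 p.2 -
          stepVal (τ k) (Z k) (n k) p.1 p.2) +
        fun p => stepVal (τ k) (Z k) (n k) p.1 p.2 - η p.1 p.2 := by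
      ext p; simp
    simp only [e]
    refine (eLpNorm_add_le ?_ ?_ one_le_two).trans (add_le_add (hc k) le_rfl)
    · exact ((SimpleProcess.memLp_val _ T).sub (memLp_stepVal (hZ2 k) (n k) T)).1
    · exact ((memLp_stepVal (hZ2 k) (n k) T).sub (hη T)).1
  -- The difference of the two integrals is itself the integral of a step process with coefficients
  -- V, so the isometry bound controls it by the truncation error of the integrands, uniformly in t
  -- ≤ T.
  · have hb : ∀ k, eLpNorm (fun ω => (truncatedStep (hτ k) (hZ k) (n k) (c k)).integral t ω -
        stepIntegral (τ k) (Z k) (n k) t ω) 2 P ≤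
        ENNReal.ofReal |σhi| * ((k : ℝ≥0∞) + 1)⁻¹ := by
      intro k
      set V : ℕ → PathSpace → ℝ := fun i ω =>
        (truncatedStep (hτ k) (hZ k) (n k) (c k)).ξ i ω - Z k i ω with hV
      have hVm : ∀ i, StronglyMeasurable[pathFiltration (τ k i)] (V i) := fun i =>
        ((truncatedStep (hτ k) (hZ k) (n k) (c k)).ξ_meas i).sub (hZ k i)
      have e1 : (fun ω => (truncatedStep (hτ k) (hZ k) (n k) (c k)).integral t ω -
        stepIntegral (τ k) (Z k) (n k) t ω) = stepIntegral (τ k) V (n k) t := by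
        ext ω
        simp only [SimpleProcess.integral, stepIntegral, hV, sub_mul]
        exact (Finset.sum_sub_distrib _ _).symm
      have e2 : (fun p : ℝ≥0 × PathSpace => stepVal (τ k) V (n k) p.1 p.2) = fun p =>
        (truncatedStep (hτ k) (hZ k) (n k) (c k)).val p.1 p.2 -
          stepVal (τ k) (Z k) (n k) p.1 p.2 := by
        ext p
        simp only [SimpleProcess.val, stepVal]
        refine Eq.trans (Finset.sum_congr rfl fun i _ => ?_) (Finset.sum_sub_distrib _ _)
        by_cases hs : p.1 ∈ Set.Ioc (τ k i) (τ k (i + 1))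
        · have hs' : p.1 ∈ Set.Ioc ((truncatedStep (hτ k) (hZ k) (n k) (c k)).time i)
            ((truncatedStep (hτ k) (hZ k) (n k) (c k)).time (i + 1)) := hs
          rw [Set.indicator_of_mem hs, Set.indicator_of_mem hs, Set.indicator_of_mem hs']
        · have hs' : p.1 ∉ Set.Ioc ((truncatedStep (hτ k) (hZ k) (n k) (c k)).time i)
            ((truncatedStep (hτ k) (hZ k) (n k) (c k)).time (i + 1)) := hs
          rw [Set.indicator_of_notMem hs, Set.indicator_of_notMem hs,
            Set.indicator_of_notMem hs', sub_zero]
      have hle := eLpNorm_stepIntegral_le hP (hτ k) hVm (n k) t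
      rw [← e1, e2] at hle
      have hmono : eLpNorm (fun p : ℝ≥0 × PathSpace =>
          (truncatedStep (hτ k) (hZ k) (n k) (c k)).val p.1 p.2 -
            stepVal (τ k) (Z k) (n k) p.1 p.2) 2 ((timeMeasure.restrict (Set.Iic t)).prod P) ≤
          ((k : ℝ≥0∞) + 1)⁻¹ := by
        refine le_trans (eLpNorm_mono_measure _ ?_) (hc k)
        exact Measure.prod_mono (Measure.restrict_mono (Set.Iic_subset_Iic.2 ht) le_rfl) le_rfl
      have hsq : ENNReal.ofReal (σhi ^ 2) = ENNReal.ofReal |σhi| ^ 2 := by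
        rw [← ENNReal.ofReal_pow (abs_nonneg _), sq_abs]
      rw [hsq, ← mul_pow] at hle
      exact ((ENNReal.pow_le_pow_left_iff two_ne_zero).1 hle).trans (mul_le_mul' le_rfl hmono)
    have hz : Tendsto (fun k : ℕ => ENNReal.ofReal |σhi| * ((k : ℝ≥0∞) + 1)⁻¹) atTop (𝓝 0) := by
      simpa using ENNReal.Tendsto.const_mul hinv (Or.inr ENNReal.ofReal_ne_top)
    refine tendsto_of_tendsto_of_tendsto_of_le_of_le tendsto_const_nhds
      (by simpa using hz.add (hi t ht)) (fun _ => zero_le) fun k => ?_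
    have e : (fun ω => (truncatedStep (hτ k) (hZ k) (n k) (c k)).integral t ω - J t ω) =
        (fun ω => (truncatedStep (hτ k) (hZ k) (n k) (c k)).integral t ω -
          stepIntegral (τ k) (Z k) (n k) t ω) +
        fun ω => stepIntegral (τ k) (Z k) (n k) t ω - J t ω := by
      ext ω; simp
    simp only [e]
    have hm := ((stronglyMeasurable_stepIntegral (hτ k) (hZ k) (n k) t).mono
      (pathFiltration.le t)).aestronglyMeasurable (μ := P)
    exact (eLpNorm_add_le ((SimpleProcess.memLp_integral _ hP t).1.sub hm) (hm.sub (hJ t))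
      one_le_two).trans (add_le_add (hb k) le_rfl)

theorem isItoIntegral_step (hP : P ∈ priors σlo σhi) (hτ : Monotone τ)
    (hZ : ∀ i, StronglyMeasurable[pathFiltration (τ i)] (Z i)) (hZ2 : ∀ i, MemLp (Z i) 2 P)
    (n : ℕ) : IsItoIntegral P (stepVal τ Z n) (stepIntegral τ Z n) := by
  have := hP.1
  refine isItoIntegral_of_tendsto_step hP (memLp_stepVal hZ2 n)
    (fun t => ((stronglyMeasurable_stepIntegral hτ hZ n t).mono
      (pathFiltration.le t)).aestronglyMeasurable)
    fun T => ⟨fun _ => τ, fun _ => Z, fun _ => n, fun _ => hτ, fun _ => hZ, fun _ => hZ2, ?_, ?_⟩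
  · simp
  · simp

end Ito

/-! ## Second moments of state processes -/

/-- Cauchy–Schwarz against the constant 1: the integral of (f − c)² is nonnegative, in particular
when c is the mean value of f. The zero measure is treated separately because of the division. -/
theorem MeasureTheory.sq_integral_le_mul_integral_sq {α : Type*} {m0 : MeasurableSpace α}
    {μ : Measure α} [IsFiniteMeasure μ] {f : α → ℝ} (hf : MemLp f 2 μ) :
    (∫ a, f a ∂μ) ^ 2 ≤ μ.real Set.univ * ∫ a, f a ^ 2 ∂μ := by
  set m := μ.real Set.univ with hm
  have hf1 : Integrable f μ := hf.integrable one_le_two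
  have h : ∀ c : ℝ, 0 ≤ ∫ a, f a ^ 2 ∂μ - 2 * c * (∫ a, f a ∂μ) + c ^ 2 * m := by
    intro c
    have h0 : 0 ≤ ∫ a, (f a - c) ^ 2 ∂μ := integral_nonneg fun _ => sq_nonneg _
    have e : ∀ a, (f a - c) ^ 2 = f a ^ 2 - 2 * c * f a + c ^ 2 := fun a => by ring
    simp only [e] at h0
    have i1 : Integrable (fun a => f a ^ 2 - 2 * c * f a) μ :=
      hf.integrable_sq.sub (hf1.const_mul _)
    rw [integral_add i1 (integrable_const _), integral_sub hf.integrable_sq (hf1.const_mul _),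
      integral_const_mul, integral_const, smul_eq_mul] at h0
    linarith
  rcases eq_or_lt_of_le (measureReal_nonneg : 0 ≤ μ.real Set.univ) with h0 | h0
  · have : μ = 0 := by
      rw [← Measure.measure_univ_eq_zero]
      exact (measureReal_eq_zero_iff).1 h0.symm
    simp [this, hm]
  · have h1 := h ((∫ a, f a ∂μ) / m)
    have hm0 : m ≠ 0 := h0.ne'
    have e : ∫ a, f a ^ 2 ∂μ - 2 * ((∫ a, f a ∂μ) / m) * (∫ a, f a ∂μ) +
        ((∫ a, f a ∂μ) / m) ^ 2 * m = ∫ a, f a ^ 2 ∂μ - (∫ a, f a ∂μ) ^ 2 / m := by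
      field_simp; ring
    rw [e, sub_nonneg, div_le_iff₀ h0] at h1
    linarith

/-- Progressive measurability speaks of [0, n] only; stopping the time variable at n and letting n
grow gives joint measurability on the whole time axis. -/
theorem measurable_of_isStronglyProgressive {X : ℝ≥0 → PathSpace → ℝ}
    (hX : IsStronglyProgressive pathFiltration X) :
    Measurable (fun p : ℝ≥0 × PathSpace => X p.1 p.2) := by
  have h : ∀ n : ℕ, Measurable (fun p : ℝ≥0 × PathSpace => X (min p.1 n) p.2) := by
    intro n
    have h1 : Measurable[inferInstance] (fun p : ℝ≥0 × PathSpace =>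
        ((⟨min p.1 n, Set.mem_Iic.2 (min_le_right _ _)⟩ : Set.Iic (n : ℝ≥0)), p.2)) := by
      refine Measurable.prodMk ?_ measurable_snd
      exact (measurable_fst.min measurable_const).subtype_mk
    have h2 : Measurable (fun p : Set.Iic (n : ℝ≥0) × PathSpace => X p.1 p.2) := by
      refine ((hX n).mono ?_).measurable
      exact sup_le_sup le_rfl (MeasurableSpace.comap_mono (pathFiltration.le _))
    exact h2.comp h1
  refine measurable_of_tendsto_metrizable h (tendsto_pi_nhds.2 fun p => ?_)
  refine tendsto_const_nhds.congr' ?_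
  obtain ⟨N, hN⟩ := exists_nat_ge p.1
  filter_upwards [eventually_ge_atTop N] with n hn
  rw [min_eq_left (hN.trans (by exact_mod_cast hn))]

section Moments

variable {σlo σhi : ℝ} {P : Measure PathSpace} {x : ℝ} {b s X : ℝ≥0 → PathSpace → ℝ}

/-- The time integral of a drift process. -/
def timeIntegral (b : ℝ≥0 → PathSpace → ℝ) (t : ℝ≥0) (ω : PathSpace) : ℝ :=
  ∫ r in Set.Iic t, b r ω ∂timeMeasure

theorem LocallySquareIntegrable.ae_memLp [IsProbabilityMeasure P]
    (hb : LocallySquareIntegrable P b) (T : ℝ≥0) :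
    ∀ᵐ ω ∂P, MemLp (fun r => b r ω) 2 (timeMeasure.restrict (Set.Iic T)) := by
  have h1 : ∀ᵐ ω ∂P, Integrable (fun r => b r ω ^ 2) (timeMeasure.restrict (Set.Iic T)) :=
    (hb T).integrable_sq.prod_left_ae
  have h2 := (hb T).1.prodMk_right
  filter_upwards [h1, h2] with ω h1 h2
  exact (memLp_two_iff_integrable_sq h2).2 h1

theorem sq_timeIntegral_le [IsProbabilityMeasure P] (hb : LocallySquareIntegrable P b) (T : ℝ≥0) :
    ∀ᵐ ω ∂P, ∀ t ≤ T, timeIntegral b t ω ^ 2 ≤ T * ∫ r in Set.Iic T, b r ω ^ 2 ∂timeMeasure := by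
  filter_upwards [hb.ae_memLp T] with ω hω t ht
  have hsub : timeMeasure.restrict (Set.Iic t) ≤ timeMeasure.restrict (Set.Iic T) :=
    Measure.restrict_mono (Set.Iic_subset_Iic.2 ht) le_rfl
  have h := sq_integral_le_mul_integral_sq (hω.mono_measure hsub)
  rw [measureReal_restrict_apply_univ, Measure.real, timeMeasure_Iic, ENNReal.coe_toReal] at h
  refine h.trans ?_
  have h1 : ∫ r in Set.Iic t, b r ω ^ 2 ∂timeMeasure ≤ ∫ r in Set.Iic T, b r ω ^ 2 ∂timeMeasure :=
    integral_mono_measure hsub (ae_of_all _ fun _ => sq_nonneg _) hω.integrable_sq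
  exact mul_le_mul (by exact_mod_cast ht) h1 (integral_nonneg fun _ => sq_nonneg _) T.2

theorem aestronglyMeasurable_timeIntegral [IsProbabilityMeasure P]
    (hb : LocallySquareIntegrable P b) (T : ℝ≥0) :
    AEStronglyMeasurable (timeIntegral b T) P :=
  (((hb T).integrable one_le_two).integral_prod_right).1

/-- The drift agrees only almost everywhere with a jointly measurable function b'. The integral of
b' over r ≤ t is measurable in (t, ω) as a parameter integral, and by Fubini the two time integrals
agree for almost every ω at all t ≤ T. -/
theorem aestronglyMeasurable_timeIntegral_prod [IsProbabilityMeasure P]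
    (hb : LocallySquareIntegrable P b) (T : ℝ≥0) :
    AEStronglyMeasurable (fun p : ℝ≥0 × PathSpace => timeIntegral b p.1 p.2)
      ((timeMeasure.restrict (Set.Iic T)).prod P) := by
  set μ := timeMeasure.restrict (Set.Iic T) with hμ
  obtain ⟨b', hb', hbb'⟩ := (hb T).1
  refine ⟨fun p => ∫ r, {q : (ℝ≥0 × PathSpace) × ℝ≥0 | q.2 ≤ q.1.1}.indicator
    (fun q => b' (q.2, q.1.2)) (p, r) ∂μ, ?_, ?_⟩
  · refine StronglyMeasurable.integral_prod_right' (ν := μ) (StronglyMeasurable.indicator ?_ ?_)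
    · exact hb'.comp_measurable (by fun_prop)
    · exact measurableSet_le (by fun_prop) (by fun_prop)
  · have h1 : ∀ᵐ ω ∂P, ∀ᵐ r ∂μ, b r ω = b' (r, ω) := by
      have := (Measure.measurePreserving_swap (μ := P) (ν := μ)).quasiMeasurePreserving.ae hbb'
      exact Measure.ae_ae_of_ae_prod this
    have h2 : ∀ᵐ p ∂(μ.prod P), ∀ᵐ r ∂μ, b r p.2 = b' (r, p.2) :=
      Measure.quasiMeasurePreserving_snd.ae h1
    have h3 : ∀ᵐ p ∂(μ.prod P), p.1 ∈ Set.Iic T :=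
      Measure.quasiMeasurePreserving_fst.ae (ae_restrict_mem measurableSet_Iic)
    filter_upwards [h2, h3] with p hp hpT
    have e : (fun r => {q : (ℝ≥0 × PathSpace) × ℝ≥0 | q.2 ≤ q.1.1}.indicator
        (fun q => b' (q.2, q.1.2)) (p, r)) = (Set.Iic p.1).indicator fun r => b' (r, p.2) := by
      ext r; simp [Set.indicator_apply]
    rw [e, integral_indicator measurableSet_Iic, hμ, Measure.restrict_restrict measurableSet_Iic,
      Set.Iic_inter_Iic, min_eq_left hpT]
    refine integral_congr_ae ?_
    exact ae_mono (Measure.restrict_mono (Set.Iic_subset_Iic.2 hpT) le_rfl) hp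

theorem memLp_timeIntegral_prod [IsProbabilityMeasure P]
    (hb : LocallySquareIntegrable P b) (T : ℝ≥0) :
    MemLp (fun p : ℝ≥0 × PathSpace => timeIntegral b p.1 p.2) 2
      ((timeMeasure.restrict (Set.Iic T)).prod P) := by
  have hm := aestronglyMeasurable_timeIntegral_prod hb T
  refine (memLp_two_iff_integrable_sq hm).2 ?_
  have hi : Integrable (fun p : ℝ≥0 × PathSpace =>
      (T : ℝ) * ∫ r in Set.Iic T, b r p.2 ^ 2 ∂timeMeasure)
      ((timeMeasure.restrict (Set.Iic T)).prod P) :=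
    (((hb T).integrable_sq.integral_prod_right).const_mul (T : ℝ)).comp_snd _
  refine hi.mono' (hm.pow 2) ?_
  have h3 : ∀ᵐ p ∂((timeMeasure.restrict (Set.Iic T)).prod P), p.1 ∈ Set.Iic T :=
    Measure.quasiMeasurePreserving_fst.ae (ae_restrict_mem measurableSet_Iic)
  filter_upwards [h3, Measure.quasiMeasurePreserving_snd.ae (sq_timeIntegral_le hb T)] with p h1 h2
  rw [Real.norm_of_nonneg (sq_nonneg _)]
  exact h2 p.1 h1

theorem memLp_timeIntegral [IsProbabilityMeasure P]
    (hb : LocallySquareIntegrable P b) (T : ℝ≥0) : MemLp (timeIntegral b T) 2 P := by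
  have hm := aestronglyMeasurable_timeIntegral hb T
  refine (memLp_two_iff_integrable_sq hm).2 ?_
  refine (((hb T).integrable_sq.integral_prod_right).const_mul (T : ℝ)).mono' (hm.pow 2) ?_
  filter_upwards [sq_timeIntegral_le hb T] with ω h2
  rw [Real.norm_of_nonneg (sq_nonneg _)]
  exact h2 T le_rfl

/-- `X` solves `dX = b dt + s dB`, `X 0 = x`, under `P`, with adapted drift. -/
structure IsState (P : Measure PathSpace) (x : ℝ) (b s X : ℝ≥0 → PathSpace → ℝ) : Prop where
  measurable : Measurable (fun p : ℝ≥0 × PathSpace => X p.1 p.2)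
  drift_memLp : LocallySquareIntegrable P b
  drift_adapted : ∀ᵐ r ∂timeMeasure, AEStronglyMeasurable[pathFiltration r] (b r) P
  equation : IsItoIntegral P s (fun t ω => X t ω - x - timeIntegral b t ω)

namespace IsState

variable (hX : IsState P x b s X)
include hX

theorem measurable_apply (t : ℝ≥0) : Measurable (X t) :=
  hX.measurable.comp measurable_prodMk_left

theorem aestronglyMeasurable_martingalePart [IsProbabilityMeasure P] (t : ℝ≥0) :
    AEStronglyMeasurable (fun ω => X t ω - x - timeIntegral b t ω) P :=
  ((hX.measurable_apply t).aestronglyMeasurable.sub aestronglyMeasurable_const).sub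
    (aestronglyMeasurable_timeIntegral hX.drift_memLp t)

theorem memLp_martingalePart (hP : P ∈ priors σlo σhi) (t : ℝ≥0) :
    MemLp (fun ω => X t ω - x - timeIntegral b t ω) 2 P :=
  have := hP.1
  hX.equation.memLp hP (hX.aestronglyMeasurable_martingalePart t)

theorem memLp_apply (hP : P ∈ priors σlo σhi) (t : ℝ≥0) : MemLp (X t) 2 P := by
  have := hP.1
  have e : X t = (fun ω => X t ω - x - timeIntegral b t ω) + ((fun _ => x) + timeIntegral b t) := by
    ext ω; simp
  rw [e]
  exact (hX.memLp_martingalePart hP t).add ((memLp_const x).add (memLp_timeIntegral hX.drift_memLp t))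

/-- By Tonelli it suffices to bound the second moment at each time, and the upper isometry bound
does so uniformly on [0, T]. -/
theorem memLp_martingalePart_prod (hP : P ∈ priors σlo σhi) (T : ℝ≥0) :
    MemLp (fun p : ℝ≥0 × PathSpace => X p.1 p.2 - x - timeIntegral b p.1 p.2) 2
      ((timeMeasure.restrict (Set.Iic T)).prod P) := by
  have := hP.1
  have hm : AEStronglyMeasurable (fun p : ℝ≥0 × PathSpace => X p.1 p.2 - x - timeIntegral b p.1 p.2)
      ((timeMeasure.restrict (Set.Iic T)).prod P) :=
    (hX.measurable.aestronglyMeasurable.sub aestronglyMeasurable_const).sub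
      (aestronglyMeasurable_timeIntegral_prod hX.drift_memLp T)
  refine ⟨hm, ?_⟩
  have hs : eLpNorm (fun p : ℝ≥0 × PathSpace => s p.1 p.2) 2
      ((timeMeasure.restrict (Set.Iic T)).prod P) < ∞ := (hX.equation.1 T).2
  have h : eLpNorm (fun p : ℝ≥0 × PathSpace => X p.1 p.2 - x - timeIntegral b p.1 p.2) 2
      ((timeMeasure.restrict (Set.Iic T)).prod P) ^ 2 < ∞ := by
    have hm2 := (hm.aemeasurable.pow_const 2).ennreal_ofReal
    rw [eLpNorm_two_sq, lintegral_prod _ hm2]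
    have hle : ∀ t ∈ Set.Iic T, ∫⁻ ω, ENNReal.ofReal ((X t ω - x - timeIntegral b t ω) ^ 2) ∂P ≤
        ENNReal.ofReal (σhi ^ 2) * eLpNorm (fun p : ℝ≥0 × PathSpace => s p.1 p.2) 2
          ((timeMeasure.restrict (Set.Iic T)).prod P) ^ 2 := by
      intro t ht
      have h1 := (hX.equation.eLpNorm_bounds hP (hX.aestronglyMeasurable_martingalePart t)).2
      rw [eLpNorm_two_sq] at h1
      refine h1.trans (mul_le_mul' le_rfl (ENNReal.pow_le_pow_left ?_))
      exact eLpNorm_mono_measure _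
        (Measure.prod_mono (Measure.restrict_mono (Set.Iic_subset_Iic.2 ht) le_rfl) le_rfl)
    refine (setLIntegral_mono' measurableSet_Iic hle).trans_lt ?_
    rw [lintegral_const]
    exact ENNReal.mul_lt_top (ENNReal.mul_lt_top ENNReal.ofReal_lt_top (ENNReal.pow_lt_top hs))
      (measure_lt_top _ _)
  exact (ENNReal.pow_lt_top_iff.1 h).resolve_right two_ne_zero

theorem memLp_prod (hP : P ∈ priors σlo σhi) (T : ℝ≥0) :
    MemLp (fun p : ℝ≥0 × PathSpace => X p.1 p.2) 2
      ((timeMeasure.restrict (Set.Iic T)).prod P) := by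
  have := hP.1
  have e : (fun p : ℝ≥0 × PathSpace => X p.1 p.2) =
      (fun p : ℝ≥0 × PathSpace => X p.1 p.2 - x - timeIntegral b p.1 p.2) +
      ((fun _ => x) + fun p : ℝ≥0 × PathSpace => timeIntegral b p.1 p.2) := by
    ext ω; simp
  rw [e]
  exact (hX.memLp_martingalePart_prod hP T).add
    ((memLp_const x).add (memLp_timeIntegral_prod hX.drift_memLp T))

theorem integral_martingalePart (hP : P ∈ priors σlo σhi) (t : ℝ≥0) :
    ∫ ω, (X t ω - x - timeIntegral b t ω) ∂P = 0 := by
  have := hP.1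
  have h := hX.equation.integral_mul_sub hP (zero_le (a := t)) (hX.aestronglyMeasurable_martingalePart 0)
    (hX.aestronglyMeasurable_martingalePart t) (W := fun _ => 1) aestronglyMeasurable_const
    (memLp_const 1)
  refine Eq.trans (integral_congr_ae ?_) h
  filter_upwards [hX.equation.ae_zero hP (hX.aestronglyMeasurable_martingalePart 0)] with ω hω
  rw [hω]; simp

theorem integral_apply (hP : P ∈ priors σlo σhi) (T : ℝ≥0) :
    ∫ ω, X T ω ∂P =
      x + ∫ p : ℝ≥0 × PathSpace, b p.1 p.2 ∂((timeMeasure.restrict (Set.Iic T)).prod P) := by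
  have := hP.1
  have h := hX.integral_martingalePart hP T
  have i1 : Integrable (X T) P := (hX.memLp_apply hP T).integrable one_le_two
  have i2 : Integrable (timeIntegral b T) P :=
    (memLp_timeIntegral hX.drift_memLp T).integrable one_le_two
  have i3 : Integrable (fun ω => X T ω - x) P := i1.sub (integrable_const x)
  rw [integral_sub i3 i2, integral_sub i1 (integrable_const x), integral_const,
    probReal_univ, one_smul] at h
  rw [integral_prod_symm _ ((hX.drift_memLp T).integrable one_le_two)]
  unfold timeIntegral at h
  linarith

/-- This is Itô's formula for the square in expectation, obtained without Itô calculus: X = x + Y +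
J with Y the time integral of the drift and J the martingale part is squared, and the terms with Y
are rewritten as integrals of b against x, Y and J. The term E J² is left as it is, since the
isometry only bounds it. -/
theorem integral_sq_apply (hP : P ∈ priors σlo σhi) (T : ℝ≥0) :
    ∫ ω, X T ω ^ 2 ∂P = x ^ 2 + 2 * (∫ p : ℝ≥0 × PathSpace, b p.1 p.2 * X p.1 p.2
        ∂((timeMeasure.restrict (Set.Iic T)).prod P)) +
      ∫ ω, (X T ω - x - timeIntegral b T ω) ^ 2 ∂P := by
  have := hP.1
  set μ := timeMeasure.restrict (Set.Iic T) with hμ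
  set J : ℝ≥0 → PathSpace → ℝ := fun t ω => X t ω - x - timeIntegral b t ω with hJ
  have hb := hX.drift_memLp T
  have hb1 := hb.integrable one_le_two
  have hJT : MemLp (J T) 2 P := hX.memLp_martingalePart hP T
  have hJp : MemLp (fun p : ℝ≥0 × PathSpace => J p.1 p.2) 2 (μ.prod P) :=
    hX.memLp_martingalePart_prod hP T
  have hYT : MemLp (timeIntegral b T) 2 P := memLp_timeIntegral hX.drift_memLp T
  have hYp : MemLp (fun p : ℝ≥0 × PathSpace => timeIntegral b p.1 p.2) 2 (μ.prod P) :=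
    memLp_timeIntegral_prod hX.drift_memLp T
  have hJTp : MemLp (fun p : ℝ≥0 × PathSpace => J T p.2) 2 (μ.prod P) := hJT.comp_snd _
  have eY : ∫ ω, timeIntegral b T ω ∂P = ∫ p, b p.1 p.2 ∂(μ.prod P) := by
    rw [integral_prod_symm _ hb1]; rfl
  have eY2 : ∫ ω, timeIntegral b T ω ^ 2 ∂P =
      2 * ∫ p, b p.1 p.2 * timeIntegral b p.1 p.2 ∂(μ.prod P) := by
    rw [integral_prod_symm _ (hb.integrable_fun_mul hYp), ← integral_const_mul]
    refine integral_congr_ae ?_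
    filter_upwards [hX.drift_memLp.ae_memLp T] with ω hω
    exact (two_mul_integral_mul_integral_eq_sq (hω.integrable one_le_two)).symm
  -- Inside E[b_r J_T] the value J_T may be replaced by J_r, because b_r belongs to the past at time
  -- r up to a null set and the later increment of J is orthogonal to it.
  have eYJ : ∫ ω, timeIntegral b T ω * J T ω ∂P = ∫ p, b p.1 p.2 * J p.1 p.2 ∂(μ.prod P) := by
    have e1 : ∫ ω, timeIntegral b T ω * J T ω ∂P = ∫ p, b p.1 p.2 * J T p.2 ∂(μ.prod P) := by
      rw [integral_prod_symm _ (hb.integrable_fun_mul hJTp)]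
      refine integral_congr_ae (ae_of_all _ fun ω => ?_)
      exact (integral_mul_const _ _).symm
    rw [e1, integral_prod _ (hb.integrable_fun_mul hJTp), integral_prod _ (hb.integrable_fun_mul hJp)]
    refine integral_congr_ae ?_
    have hb2 : ∀ᵐ r ∂μ, Integrable (fun ω => b r ω ^ 2) P := hb.integrable_sq.prod_right_ae
    filter_upwards [ae_restrict_of_ae hX.drift_adapted, hb2, ae_restrict_mem measurableSet_Iic]
      with r h1 h2 h3
    have h4 : MemLp (b r) 2 P :=
      (memLp_two_iff_integrable_sq (h1.mono (pathFiltration.le r))).2 h2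
    have h5 := hX.equation.integral_mul_sub hP h3 (hX.aestronglyMeasurable_martingalePart r)
      (hX.aestronglyMeasurable_martingalePart T) h1 h4
    simp only [mul_sub] at h5
    have i1 : Integrable (fun ω => b r ω * J T ω) P := h4.integrable_fun_mul hJT
    have i2 : Integrable (fun ω => b r ω * J r ω) P :=
      h4.integrable_fun_mul (hX.memLp_martingalePart hP r)
    rw [← sub_eq_zero, ← integral_sub i1 i2]
    refine Eq.trans (integral_congr_ae (ae_of_all _ fun ω => ?_)) h5
    simp only [hJ]; ring
  have eJ0 : ∫ ω, J T ω ∂P = 0 := hX.integral_martingalePart hP T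
  have ebX : ∫ p, b p.1 p.2 * X p.1 p.2 ∂(μ.prod P) = x * ∫ p, b p.1 p.2 ∂(μ.prod P) +
      ∫ p, b p.1 p.2 * timeIntegral b p.1 p.2 ∂(μ.prod P) +
      ∫ p, b p.1 p.2 * J p.1 p.2 ∂(μ.prod P) := by
    have k : Integrable (fun p : ℝ≥0 × PathSpace =>
        x * b p.1 p.2 + b p.1 p.2 * timeIntegral b p.1 p.2) (μ.prod P) :=
      (hb1.const_mul x).add (hb.integrable_fun_mul hYp)
    rw [← integral_const_mul, ← integral_add (hb1.const_mul x) (hb.integrable_fun_mul hYp),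
      ← integral_add k (hb.integrable_fun_mul hJp)]
    refine integral_congr_ae (ae_of_all _ fun p => ?_)
    simp only [hJ]; ring
  have eX : ∀ ω, X T ω ^ 2 = x ^ 2 + (2 * x) * timeIntegral b T ω + timeIntegral b T ω ^ 2 +
      (2 * x) * J T ω + 2 * (timeIntegral b T ω * J T ω) + J T ω ^ 2 := by
    intro ω; simp only [hJ]; ring
  have hY1 := hYT.integrable one_le_two
  have hJ1 := hJT.integrable one_le_two
  have k1 : Integrable (fun ω => x ^ 2 + (2 * x) * timeIntegral b T ω) P :=
    (integrable_const _).add (hY1.const_mul _)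
  have k2 : Integrable (fun ω => x ^ 2 + (2 * x) * timeIntegral b T ω + timeIntegral b T ω ^ 2) P :=
    k1.add hYT.integrable_sq
  have k3 : Integrable (fun ω => x ^ 2 + (2 * x) * timeIntegral b T ω + timeIntegral b T ω ^ 2 +
      (2 * x) * J T ω) P := k2.add (hJ1.const_mul _)
  have k4 : Integrable (fun ω => x ^ 2 + (2 * x) * timeIntegral b T ω + timeIntegral b T ω ^ 2 +
      (2 * x) * J T ω + 2 * (timeIntegral b T ω * J T ω)) P :=
    k3.add ((hYT.integrable_fun_mul hJT).const_mul 2)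
  simp only [eX]
  rw [integral_add k4 hJT.integrable_sq, integral_add k3 ((hYT.integrable_fun_mul hJT).const_mul 2),
    integral_add k2 (hJ1.const_mul _), integral_add k1 hYT.integrable_sq,
    integral_add (integrable_const _) (hY1.const_mul _), integral_const, integral_const_mul,
    integral_const_mul, integral_const_mul, eY, eY2, eYJ, eJ0, ebX, probReal_univ, one_smul]
  ring

end IsState

end Moments

/-! ## The discounted Dynkin formula for quadratic functions -/

section Dynkin

variable {σlo σhi : ℝ} {P : Measure PathSpace} {x : ℝ} {b s X : ℝ≥0 → PathSpace → ℝ}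

theorem integrable_exp_mul_prod [IsProbabilityMeasure P] {f : ℝ≥0 × PathSpace → ℝ} {T : ℝ≥0} (c : ℝ)
    (hf : Integrable f ((timeMeasure.restrict (Set.Iic T)).prod P)) :
    Integrable (fun p => Real.exp (-c * p.1) * f p) ((timeMeasure.restrict (Set.Iic T)).prod P) := by
  have hc : Continuous fun p : ℝ≥0 × PathSpace => Real.exp (-c * p.1) := by fun_prop
  refine Integrable.bdd_mul (c := Real.exp (|c| * T)) hf ?_ ?_
  · have : Measurable fun p : ℝ≥0 × PathSpace => Real.exp (-c * p.1) := by fun_prop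
    exact this.aestronglyMeasurable
  · filter_upwards [Measure.quasiMeasurePreserving_fst.ae (ae_restrict_mem measurableSet_Iic)]
      with p hp
    rw [Real.norm_eq_abs, Real.abs_exp]
    exact Real.exp_le_exp.2 (mul_le_mul (neg_le_abs c) (by exact_mod_cast hp) p.1.2 (abs_nonneg c))

theorem integral_exp_mul_prod [IsProbabilityMeasure P] {f : ℝ≥0 × PathSpace → ℝ} {T : ℝ≥0} (c : ℝ)
    (hf : Integrable f ((timeMeasure.restrict (Set.Iic T)).prod P)) :
    ∫ p, Real.exp (-c * p.1) * f p ∂((timeMeasure.restrict (Set.Iic T)).prod P) =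
      ∫ r in Set.Iic T, Real.exp (-c * r) * ∫ ω, f (r, ω) ∂P ∂timeMeasure := by
  rw [integral_prod _ (integrable_exp_mul_prod c hf)]
  simp only [integral_const_mul]

theorem MeasureTheory.Integrable.mono_Iic {f : ℝ≥0 × PathSpace → ℝ} {t T : ℝ≥0} (ht : t ≤ T)
    (hf : Integrable f ((timeMeasure.restrict (Set.Iic T)).prod P)) [SFinite P] :
    Integrable f ((timeMeasure.restrict (Set.Iic t)).prod P) :=
  hf.mono_measure (Measure.prod_mono (Measure.restrict_mono (Set.Iic_subset_Iic.2 ht) le_rfl) le_rfl)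

theorem IsState.discounted_mean (hX : IsState P x b s X) (hP : P ∈ priors σlo σhi) (c : ℝ) (T : ℝ≥0) :
    Real.exp (-c * T) * ∫ ω, X T ω ∂P = x +
      (∫ p : ℝ≥0 × PathSpace, Real.exp (-c * p.1) * b p.1 p.2
        ∂((timeMeasure.restrict (Set.Iic T)).prod P)) -
      c * ∫ p : ℝ≥0 × PathSpace, Real.exp (-c * p.1) * X p.1 p.2
        ∂((timeMeasure.restrict (Set.Iic T)).prod P) := by
  have := hP.1
  have hb := (hX.drift_memLp T).integrable one_le_two
  have hXp := (hX.memLp_prod hP T).integrable one_le_two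
  rw [integral_exp_mul_prod c hb, integral_exp_mul_prod c hXp]
  have h := exp_mul_eq_of_integral (m := fun t => ∫ ω, X t ω ∂P) (F := fun t => ∫ ω, b t ω ∂P)
    (G := fun _ => 0) (m₀ := x) c (T := T) hXp.integral_prod_left hb.integral_prod_left (fun t ht => by
      rw [hX.integral_apply hP t, integral_prod _ (hb.mono_Iic ht), sub_zero])
  simpa using h

/-- The remainder is a discounted combination of the gap G between σhi² E∫s² and E J². The upper
isometry bound makes G nonnegative, and if the volatility is constantly σhi both isometry bounds
coincide and G vanishes. -/
theorem IsState.discounted_second_moment (hX : IsState P x b s X) (hP : P ∈ priors σlo σhi)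
    {c : ℝ} (hc : 0 ≤ c) (T : ℝ≥0) :
    ∃ R : ℝ, 0 ≤ R ∧ (P ∈ priors σhi σhi → R = 0) ∧
    Real.exp (-c * T) * ∫ ω, X T ω ^ 2 ∂P = x ^ 2 +
      (∫ p : ℝ≥0 × PathSpace, Real.exp (-c * p.1) * (2 * (b p.1 p.2 * X p.1 p.2) +
        σhi ^ 2 * s p.1 p.2 ^ 2) ∂((timeMeasure.restrict (Set.Iic T)).prod P)) -
      c * (∫ p : ℝ≥0 × PathSpace, Real.exp (-c * p.1) * X p.1 p.2 ^ 2
        ∂((timeMeasure.restrict (Set.Iic T)).prod P)) - R := by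
  have := hP.1
  have hb := hX.drift_memLp T
  have hXp := hX.memLp_prod hP T
  have hs := hX.equation.1 T
  have hF : Integrable (fun p : ℝ≥0 × PathSpace => 2 * (b p.1 p.2 * X p.1 p.2) +
        σhi ^ 2 * s p.1 p.2 ^ 2) ((timeMeasure.restrict (Set.Iic T)).prod P) :=
    ((hb.integrable_fun_mul hXp).const_mul 2).add (hs.integrable_sq.const_mul _)
  set G : ℝ≥0 → ℝ := fun t => σhi ^ 2 * ∫ p : ℝ≥0 × PathSpace, s p.1 p.2 ^ 2
    ∂((timeMeasure.restrict (Set.Iic t)).prod P) - ∫ ω, (X t ω - x - timeIntegral b t ω) ^ 2 ∂P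
    with hG
  have hG0 : ∀ t, 0 ≤ G t := fun t => sub_nonneg.2
    (hX.equation.integral_sq_bounds hP (hX.aestronglyMeasurable_martingalePart t)).2
  have hG1 : P ∈ priors σhi σhi → ∀ t, G t = 0 := fun hP' t => by
    have h := hX.equation.integral_sq_bounds hP' (hX.aestronglyMeasurable_martingalePart t)
    have := h.1.antisymm h.2
    simp only [hG]; rw [this, sub_self]
  have h := exp_mul_eq_of_integral (m := fun t => ∫ ω, X t ω ^ 2 ∂P)
    (F := fun t => ∫ ω, (2 * (b t ω * X t ω) + σhi ^ 2 * s t ω ^ 2) ∂P)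
    (G := G) (m₀ := x ^ 2) c (T := T) hXp.integrable_sq.integral_prod_left hF.integral_prod_left
    (fun t ht => by
      have e1 := integral_prod _ (hF.mono_Iic ht)
      have i1 := ((hb.integrable_fun_mul hXp).const_mul 2).mono_Iic ht
      have i2 := (hs.integrable_sq.const_mul (σhi ^ 2)).mono_Iic ht
      rw [integral_add i1 i2, integral_const_mul, integral_const_mul] at e1
      rw [hX.integral_sq_apply hP t, ← e1]
      simp only [hG]; ring)
  refine ⟨Real.exp (-c * T) * G T + c * ∫ r in Set.Iic T, Real.exp (-c * r) * G r ∂timeMeasure,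
    ?_, ?_, ?_⟩
  rotate_left 2
  · rw [integral_exp_mul_prod c hF, integral_exp_mul_prod c hXp.integrable_sq]
    exact h
  · have : 0 ≤ ∫ r in Set.Iic T, Real.exp (-c * r) * G r ∂timeMeasure :=
      integral_nonneg fun r => mul_nonneg (Real.exp_pos _).le (hG0 r)
    have := hG0 T
    positivity
  · intro hP'
    simp [hG1 hP']

/-- The discounted Dynkin formula for quadratic functions under a prior; the nonnegative remainder
`R` accounts for the deviation of the volatility from its upper bound. -/
theorem IsState.dynkin (hX : IsState P x b s X) (hP : P ∈ priors σlo σhi)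
    {c : ℝ} (hc : 0 ≤ c) (T : ℝ≥0) :
    ∃ R : ℝ, 0 ≤ R ∧ (P ∈ priors σhi σhi → R = 0) ∧ ∀ α₀ α₁ α₂ : ℝ,
    Real.exp (-c * T) * ∫ ω, (1 / 2 * α₂ * X T ω ^ 2 + α₁ * X T ω + α₀) ∂P =
      (1 / 2 * α₂ * x ^ 2 + α₁ * x + α₀) +
      (∫ p : ℝ≥0 × PathSpace, Real.exp (-c * p.1) * ((α₂ * X p.1 p.2 + α₁) * b p.1 p.2 +
        1 / 2 * α₂ * σhi ^ 2 * s p.1 p.2 ^ 2 -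
        c * (1 / 2 * α₂ * X p.1 p.2 ^ 2 + α₁ * X p.1 p.2 + α₀))
        ∂((timeMeasure.restrict (Set.Iic T)).prod P)) - 1 / 2 * α₂ * R := by
  have := hP.1
  obtain ⟨R, hR0, hR1, hR⟩ := hX.discounted_second_moment hP hc T
  refine ⟨R, hR0, hR1, fun α₀ α₁ α₂ => ?_⟩
  have hm := hX.discounted_mean hP c T
  have hb := hX.drift_memLp T
  have hb1 := hb.integrable one_le_two
  have hXp := hX.memLp_prod hP T
  have hX1 := hXp.integrable one_le_two
  have hs := hX.equation.1 T
  have hXT := hX.memLp_apply hP T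
  have hF : Integrable (fun p : ℝ≥0 × PathSpace => 2 * (b p.1 p.2 * X p.1 p.2) +
        σhi ^ 2 * s p.1 p.2 ^ 2) ((timeMeasure.restrict (Set.Iic T)).prod P) :=
    ((hb.integrable_fun_mul hXp).const_mul 2).add (hs.integrable_sq.const_mul _)
  have j1 := integrable_exp_mul_prod c hF
  have j2 := integrable_exp_mul_prod c hXp.integrable_sq
  have j3 := integrable_exp_mul_prod c hb1
  have j4 := integrable_exp_mul_prod c hX1
  have j5 := integrable_exp_mul_prod (P := P) c (integrable_const (1 : ℝ) :
    Integrable _ ((timeMeasure.restrict (Set.Iic T)).prod P))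
  have e5 : c * ∫ p : ℝ≥0 × PathSpace, Real.exp (-c * p.1) * 1
      ∂((timeMeasure.restrict (Set.Iic T)).prod P) = 1 - Real.exp (-c * T) := by
    rw [integral_exp_mul_prod c (integrable_const (1 : ℝ))]
    have h := setIntegral_exp_neg_timeMeasure c T
    rw [integral_const_mul] at h
    simp only [integral_const, probReal_univ, smul_eq_mul, mul_one]
    linarith
  have eL : ∫ ω, (1 / 2 * α₂ * X T ω ^ 2 + α₁ * X T ω + α₀) ∂P =
      1 / 2 * α₂ * ∫ ω, X T ω ^ 2 ∂P + α₁ * ∫ ω, X T ω ∂P + α₀ := by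
    have k1 : Integrable (fun ω => 1 / 2 * α₂ * X T ω ^ 2) P := hXT.integrable_sq.const_mul _
    have k2 : Integrable (fun ω => α₁ * X T ω) P := (hXT.integrable one_le_two).const_mul _
    have k3 : Integrable (fun ω => 1 / 2 * α₂ * X T ω ^ 2 + α₁ * X T ω) P := k1.add k2
    rw [integral_add k3 (integrable_const _), integral_add k1 k2, integral_const_mul,
      integral_const_mul, integral_const, probReal_univ, one_smul]
  have eR : ∫ p : ℝ≥0 × PathSpace, Real.exp (-c * p.1) * ((α₂ * X p.1 p.2 + α₁) * b p.1 p.2 +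
        1 / 2 * α₂ * σhi ^ 2 * s p.1 p.2 ^ 2 -
        c * (1 / 2 * α₂ * X p.1 p.2 ^ 2 + α₁ * X p.1 p.2 + α₀))
        ∂((timeMeasure.restrict (Set.Iic T)).prod P) =
      1 / 2 * α₂ * (∫ p : ℝ≥0 × PathSpace, Real.exp (-c * p.1) * (2 * (b p.1 p.2 * X p.1 p.2) +
        σhi ^ 2 * s p.1 p.2 ^ 2) ∂((timeMeasure.restrict (Set.Iic T)).prod P)) +
      α₁ * (∫ p : ℝ≥0 × PathSpace, Real.exp (-c * p.1) * b p.1 p.2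
        ∂((timeMeasure.restrict (Set.Iic T)).prod P)) +
      (-(c * (1 / 2 * α₂))) * (∫ p : ℝ≥0 × PathSpace, Real.exp (-c * p.1) * X p.1 p.2 ^ 2
        ∂((timeMeasure.restrict (Set.Iic T)).prod P)) +
      (-(c * α₁)) * (∫ p : ℝ≥0 × PathSpace, Real.exp (-c * p.1) * X p.1 p.2
        ∂((timeMeasure.restrict (Set.Iic T)).prod P)) +
      (-(c * α₀)) * (∫ p : ℝ≥0 × PathSpace, Real.exp (-c * p.1) * 1
        ∂((timeMeasure.restrict (Set.Iic T)).prod P)) := by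
    have k1 := j1.const_mul (1 / 2 * α₂)
    have k2 := j3.const_mul α₁
    have k3 := j2.const_mul (-(c * (1 / 2 * α₂)))
    have k4 := j4.const_mul (-(c * α₁))
    have k5 := j5.const_mul (-(c * α₀))
    simp only [← integral_const_mul]
    rw [← integral_add k1 k2, ← integral_add (by exact k1.add k2) k3,
      ← integral_add (by exact (k1.add k2).add k3) k4,
      ← integral_add (by exact ((k1.add k2).add k3).add k4) k5]
    refine integral_congr_ae (ae_of_all _ fun p => ?_)
    ring
  rw [eL, eR]
  linear_combination (1 / 2 * α₂) * hR + α₁ * hm + α₀ * e5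

end Dynkin

/-! ## Wiener measure -/

/-! ### Gaussian Hilbert spaces and a pre-Brownian motion -/

namespace MeasureTheory

variable {Ω : Type*} {mΩ : MeasurableSpace Ω} {P : Measure Ω} [IsProbabilityMeasure P]

theorem Lp.integral_norm_le_norm (f : Lp ℝ 2 P) : ∫ ω, ‖f ω‖ ∂P ≤ ‖f‖ := by
  have hf := Lp.memLp f
  rw [integral_norm_eq_lintegral_enorm hf.1, ← eLpNorm_one_eq_lintegral_enorm, Lp.norm_def]
  exact ENNReal.toReal_mono hf.2.ne (eLpNorm_le_eLpNorm_of_exponent_le (by norm_num) hf.1)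

theorem norm_exp_mul_I_sub_le (a b : ℝ) :
    ‖Complex.exp (a * Complex.I) - Complex.exp (b * Complex.I)‖ ≤ |a - b| := by
  have h : Complex.exp (a * Complex.I) - Complex.exp (b * Complex.I)
      = Complex.exp (b * Complex.I) * (Complex.exp (Complex.I * ((a - b : ℝ) : ℂ)) - 1) := by
    rw [mul_sub, ← Complex.exp_add]
    push_cast
    ring_nf
  rw [h, norm_mul, Complex.norm_exp_ofReal_mul_I, one_mul]
  exact Real.norm_exp_I_mul_ofReal_sub_one_le

/-- The complex exponential on the unit circle is 1-Lipschitz in its angle and the L¹ norm is at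
most the L² norm, so the characteristic function at t is |t|-Lipschitz on L². -/
theorem Lp.continuous_integral_exp (t : ℝ) :
    Continuous (fun g : Lp ℝ 2 P => ∫ ω, Complex.exp (t * g ω * Complex.I) ∂P) := by
  have hint : ∀ g : Lp ℝ 2 P, Integrable (fun ω => Complex.exp (t * g ω * Complex.I)) P := by
    intro g
    refine Integrable.of_bound (C := 1) ?_ (ae_of_all _ fun ω => ?_)
    · have := (Lp.memLp g).1.aemeasurable
      exact AEMeasurable.aestronglyMeasurable (by fun_prop)
    · rw [← Complex.ofReal_mul, Complex.norm_exp_ofReal_mul_I]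
  refine (LipschitzWith.of_dist_le_mul (K := ‖t‖₊) fun g h => ?_).continuous
  have hd : dist g h = ‖g - h‖ := dist_eq_norm_sub g h
  have hd' := fun a b : ℂ => dist_eq_norm_sub a b
  rw [hd, hd', ← integral_sub (hint g) (hint h)]
  calc _ ≤ ∫ ω, |t| * ‖(g - h : Lp ℝ 2 P) ω‖ ∂P := by
        refine norm_integral_le_of_norm_le
          (((Lp.memLp (g - h)).integrable (by norm_num)).norm.const_mul _) ?_
        filter_upwards [Lp.coeFn_sub g h] with ω hω
        rw [hω, Pi.sub_apply, Real.norm_eq_abs, ← abs_mul, mul_sub]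
        have := norm_exp_mul_I_sub_le (t * g ω) (t * h ω)
        push_cast at this
        exact this
    _ ≤ _ := by
        rw [integral_const_mul, coe_nnnorm, Real.norm_eq_abs]
        gcongr
        exact Lp.integral_norm_le_norm _

/-- Expressing centred normality with variance ‖g‖² through the characteristic function turns it
into identities between continuous functions of g, hence into a closed condition on L². -/
theorem Lp.hasLaw_gaussianReal_iff (g : Lp ℝ 2 P) :
    HasLaw g (gaussianReal 0 (‖g‖₊ ^ 2)) P ↔
      ∀ t : ℝ, ∫ ω, Complex.exp (t * g ω * Complex.I) ∂P
        = Complex.exp (-(‖g‖ ^ 2 * t ^ 2 / 2 : ℝ)) := by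
  have hm := (Lp.memLp g).1.aemeasurable
  have hc : ∀ t : ℝ, charFun (P.map g) t = ∫ ω, Complex.exp (t * g ω * Complex.I) ∂P := by
    intro t
    rw [charFun_apply_real, integral_map hm (by fun_prop)]
  have hg : ∀ t : ℝ, charFun (gaussianReal 0 (‖g‖₊ ^ 2)) t
      = Complex.exp (-(‖g‖ ^ 2 * t ^ 2 / 2 : ℝ)) := by
    intro t
    rw [charFun_gaussianReal]
    push_cast
    simp
  constructor
  · intro h t
    rw [← hc, h.map_eq, hg]
  · intro h
    have := Measure.isProbabilityMeasure_map hm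
    exact ⟨hm, Measure.ext_of_charFun (funext fun t => by rw [hc, h, hg])⟩

theorem Lp.coeFn_sum_smul {ι : Type*} (s : Finset ι) (c : ι → ℝ) (f : ι → Lp ℝ 2 P) :
    (∑ i ∈ s, c i • f i : Lp ℝ 2 P) =ᵐ[P] fun ω => ∑ i ∈ s, c i * f i ω := by
  classical
  induction s using Finset.induction_on with
  | empty =>
    filter_upwards [Lp.coeFn_zero ℝ 2 P] with ω h
    simp
  | insert i s hi ih =>
    rw [Finset.sum_insert hi]
    filter_upwards [ih, Lp.coeFn_add (c i • f i) (∑ i ∈ s, c i • f i), Lp.coeFn_smul (c i) (f i)]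
      with ω h1 h2 h3
    rw [h2, Pi.add_apply, h1, h3, Finset.sum_insert hi, Pi.smul_apply, smul_eq_mul]

theorem Lp.isClosed_hasLaw_gaussianReal :
    IsClosed {g : Lp ℝ 2 P | HasLaw g (gaussianReal 0 (‖g‖₊ ^ 2)) P} := by
  simp only [Lp.hasLaw_gaussianReal_iff, Set.ofPred_forall]
  exact isClosed_iInter fun t => isClosed_eq (Lp.continuous_integral_exp t) (by fun_prop)

end MeasureTheory

/-- A Hilbert basis is sent to independent standard normal variables, which are orthonormal in L².
Finite combinations are normal with the right variance, and a general image is an L² limit of these;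
the law survives because the condition is closed. -/
theorem ProbabilityTheory.exists_linearIsometry_hasLaw_gaussianReal (E : Type)
    [NormedAddCommGroup E] [InnerProductSpace ℝ E] [CompleteSpace E] :
    ∃ (Ω : Type) (_ : MeasurableSpace Ω) (P : Measure Ω) (_ : IsProbabilityMeasure P)
      (U : E →ₗᵢ[ℝ] Lp ℝ 2 P), ∀ f, HasLaw (U f) (gaussianReal 0 (‖f‖₊ ^ 2)) P := by
  classical
  obtain ⟨w, b, -⟩ := exists_hilbertBasis ℝ E
  obtain ⟨Ω, mΩ, P, Y, hYm, hYl, hYi, hP⟩ := exists_iid w (gaussianReal 0 1)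
  have hL2 : ∀ i, MemLp (Y i) 2 P := fun i => (hYl i).hasGaussianLaw.memLp_two
  have hmean : ∀ i, ∫ ω, Y i ω ∂P = 0 := fun i => by
    rw [(hYl i).integral_eq, integral_id_gaussianReal]
  set ξ : w → Lp ℝ 2 P := fun i => (hL2 i).toLp (Y i) with hξ
  have hinner : ∀ i j, inner ℝ (ξ i) (ξ j) = ∫ ω, Y i ω * Y j ω ∂P := by
    intro i j
    rw [L2.inner_def]
    refine integral_congr_ae ?_
    filter_upwards [(hL2 i).coeFn_toLp, (hL2 j).coeFn_toLp] with ω h1 h2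
    simp only [hξ]
    rw [h1, h2]
    exact mul_comm _ _
  have hon : Orthonormal ℝ ξ := by
    rw [orthonormal_iff_ite]
    intro i j
    rw [hinner]
    split_ifs with h
    · subst h
      have := (hYl i).variance_eq
      rw [variance_id_gaussianReal, variance_of_integral_eq_zero (hYl i).aemeasurable (hmean i)]
        at this
      simpa [sq] using this
    · rw [(hYi.indepFun h).integral_fun_mul_eq_mul_integral (hL2 i).1 (hL2 j).1, hmean, zero_mul]
  have hsum : ∀ (c : w → ℝ) (s : Finset w), HasLaw (∑ i ∈ s, c i • ξ i : Lp ℝ 2 P)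
      (gaussianReal 0 (‖(∑ i ∈ s, c i • ξ i : Lp ℝ 2 P)‖₊ ^ 2)) P := by
    intro c s
    set g : Lp ℝ 2 P := ∑ i ∈ s, c i • ξ i with hg
    have hgY : (fun ω => ∑ i : s, c i * Y i ω) =ᵐ[P] g := by
      have h2 : ∀ᵐ ω ∂P, ∀ i : s, ξ i ω = Y i ω := ae_all_iff.2 fun i => (hL2 i).coeFn_toLp
      filter_upwards [Lp.coeFn_sum_smul s c ξ, h2] with ω h1 h2
      rw [hg, h1, ← Finset.sum_coe_sort s]
      exact Finset.sum_congr rfl fun i _ => by rw [h2 i]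
    have hlaw : HasGaussianLaw g P := by
      refine HasGaussianLaw.congr ?_ hgY
      have hi : iIndepFun (fun (i : s) ω => c i * Y i ω) P :=
        (hYi.precomp Subtype.val_injective).comp (fun (i : s) y => c i * y) (by fun_prop)
      exact iIndepFun.hasGaussianLaw_fun_sum
        (fun i : s => by simpa using ((hYl i).hasGaussianLaw.fun_smul (c i))) hi
    have hg0 : ∫ ω, g ω ∂P = 0 := by
      have hi : ∀ i ∈ (Finset.univ : Finset s), Integrable (fun ω => c i * Y i ω) P :=
        fun i _ => ((hL2 i).integrable (by norm_num)).const_mul _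
      rw [← integral_congr_ae hgY, integral_finsetSum _ hi]
      simp [integral_const_mul, hmean]
    have hgv : Var[g; P].toNNReal = ‖g‖₊ ^ 2 := by
      rw [variance_of_integral_eq_zero hlaw.aemeasurable hg0]
      have : ∫ ω, g ω ^ 2 ∂P = ‖g‖ ^ 2 := by
        rw [← real_inner_self_eq_norm_sq, L2.inner_def]
        simp [sq]
      rw [this, Real.toNNReal_pow (norm_nonneg _), norm_toNNReal]
    refine ⟨hlaw.aemeasurable, ?_⟩
    rw [hlaw.map_eq_gaussianReal, hg0, hgv]
  refine ⟨Ω, mΩ, P, hP, hon.orthogonalFamily.linearIsometry.comp b.repr.toLinearIsometry,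
    fun f => ?_⟩
  have hs := hon.orthogonalFamily.hasSum_linearIsometry (b.repr f)
  have hmem := Lp.isClosed_hasLaw_gaussianReal.mem_of_tendsto hs
    (Eventually.of_forall fun s => by simpa using hsum (b.repr f) s)
  have hn : ‖f‖₊ = ‖hon.orthogonalFamily.linearIsometry (b.repr f)‖₊ := by
    rw [LinearIsometry.nnnorm_map, LinearIsometryEquiv.nnnorm_map]
  rw [hn]
  exact hmem

/-- White noise evaluated at the indicators of (0, t]: their inner products are min(s, t), the
Brownian covariance. The process is Gaussian since any linear combination of images under U is again
such an image. -/
theorem ProbabilityTheory.exists_isPreBrownianReal :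
    ∃ (Ω : Type) (_ : MeasurableSpace Ω) (P : Measure Ω) (X : ℝ≥0 → Ω → ℝ),
      IsPreBrownianReal X P ∧ ∀ t, Measurable (X t) := by
  obtain ⟨Ω, mΩ, P, hP, U, hU⟩ :=
    exists_linearIsometry_hasLaw_gaussianReal (Lp ℝ 2 (volume : Measure ℝ))
  let e : ℝ≥0 → Lp ℝ 2 (volume : Measure ℝ) := fun t =>
    indicatorConstLp 2 (measurableSet_Ioc (a := (0 : ℝ)) (b := t)) (by simp) 1
  have hinner : ∀ s t : ℝ≥0, s ≤ t → inner ℝ (e s) (e t) = (s : ℝ) := by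
    intro s t hst
    have h : Set.Ioc (0 : ℝ) (s : ℝ) ∩ Set.Ioc (0 : ℝ) (t : ℝ) = Set.Ioc (0 : ℝ) (s : ℝ) :=
      Set.inter_eq_left.2 (Set.Ioc_subset_Ioc_right (by exact_mod_cast hst))
    simp only [e, L2.inner_indicatorConstLp_indicatorConstLp, h]
    simp
  refine ⟨Ω, mΩ, P, fun t => U (e t), ?_, fun t => (Lp.stronglyMeasurable _).measurable⟩
  have hmean : ∀ t, ∫ ω, U (e t) ω ∂P = 0 := fun t => by
    rw [(hU _).integral_eq, integral_id_gaussianReal]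
  refine IsGaussianProcess.isPreBrownianReal_of_covariance ⟨fun I => ?_⟩ hmean fun s t hst => ?_
  · have hm : AEMeasurable (fun ω => I.restrict (fun t => U (e t) ω)) P :=
      aemeasurable_pi_lambda _ fun i => (hU (e i)).aemeasurable
    refine ⟨isGaussian_of_map_eq_gaussianReal fun L => ?_⟩
    have hL : (L ∘ fun ω => I.restrict (fun t => U (e t) ω))
        =ᵐ[P] U (∑ i : I, L (Pi.single i 1) • e i) := by
      have h1 := Lp.coeFn_sum_smul (P := P) Finset.univ (fun i : I => L (Pi.single i 1))
        (fun i => U (e i))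
      simp only [map_sum, map_smul]
      filter_upwards [h1] with ω h1
      rw [h1, Function.comp_apply]
      conv_lhs => rw [← Finset.univ_sum_single (I.restrict fun t => U (e t) ω), map_sum]
      refine Finset.sum_congr rfl fun i _ => ?_
      rw [← mul_one (I.restrict (fun t => U (e t) ω) i), ← smul_eq_mul, Pi.single_smul', map_smul]
      simp [mul_comm]
    refine ⟨0, ‖∑ i : I, L (Pi.single i 1) • e i‖₊ ^ 2, ?_⟩
    rw [AEMeasurable.map_map_of_aemeasurable (by fun_prop) hm, Measure.map_congr hL]
    exact (hU _).map_eq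
  · rw [covariance_eq_sub (Lp.memLp _) (Lp.memLp _), hmean, hmean, zero_mul, sub_zero,
      ← hinner s t hst, ← U.inner_map_map, L2.inner_def]
    exact integral_congr_ae (ae_of_all _ fun ω => mul_comm _ _)

/-! ### A continuous modification -/

/-- Functions whose successive differences decay geometrically, locally uniformly, converge locally
uniformly with a geometric rate. -/
theorem exists_limUnder_geometric {f : ℕ → ℝ≥0 → ℝ} {r : ℝ} (hr : r < 1)
    (hf : ∀ T : ℕ, ∃ N, ∀ n ≥ N, ∀ t ≤ (T : ℝ≥0), |f (n + 1) t - f n t| ≤ r ^ n) :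
    (∀ t, Tendsto (fun n => f n t) atTop (𝓝 (limUnder atTop fun n => f n t))) ∧
    ∀ T : ℕ, ∃ N, ∀ n ≥ N, ∀ t ≤ (T : ℝ≥0),
      |f n t - limUnder atTop (fun n => f n t)| ≤ r ^ n / (1 - r) := by
  have hcau : ∀ t, CauchySeq fun n => f n t := by
    intro t
    obtain ⟨T, hT⟩ := exists_nat_ge t
    obtain ⟨N, hN⟩ := hf T
    refine (cauchySeq_shift N).1 (cauchySeq_of_le_geometric r (r ^ N) hr fun n => ?_)
    rw [dist_comm, Real.dist_eq, ← pow_add, add_comm N n, add_right_comm]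
    exact hN _ (by omega) t hT
  have hlim : ∀ t, Tendsto (fun n => f n t) atTop (𝓝 (limUnder atTop fun n => f n t)) :=
    fun t => (hcau t).tendsto_limUnder
  refine ⟨hlim, fun T => ?_⟩
  obtain ⟨N, hN⟩ := hf T
  refine ⟨N, fun n hn t ht => ?_⟩
  have h := dist_le_of_le_geometric_of_tendsto₀ r (r ^ n) hr (f := fun k => f (k + n) t)
    (fun k => by
      rw [dist_comm, Real.dist_eq, ← pow_add, add_comm n k, add_right_comm]
      exact hN _ (by omega) t ht) ((tendsto_add_atTop_iff_nat n).2 (hlim t))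
  simpa [Real.dist_eq] using h

/-- The largest point of the dyadic grid of level `n` below `t`. -/
def dyadicFloor (n : ℕ) (t : ℝ≥0) : ℝ≥0 := (⌊2 ^ n * t⌋₊ : ℝ≥0) / 2 ^ n

theorem dyadicFloor_le (n : ℕ) (t : ℝ≥0) : dyadicFloor n t ≤ t := by
  rw [dyadicFloor, div_le_iff₀ (by positivity), mul_comm t]
  exact Nat.floor_le (by positivity)

theorem lt_dyadicFloor_add (n : ℕ) (t : ℝ≥0) : t < dyadicFloor n t + (2 ^ n)⁻¹ := by
  rw [dyadicFloor, ← one_div, ← add_div, lt_div_iff₀ (by positivity), mul_comm t]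
  exact Nat.lt_floor_add_one _

theorem tendsto_dyadicFloor (t : ℝ≥0) : Tendsto (fun n => dyadicFloor n t) atTop (𝓝 t) := by
  have h : Tendsto (fun n : ℕ => t - (2 ^ n)⁻¹) atTop (𝓝 t) := by
    have h2 : Tendsto (fun n : ℕ => ((2 : ℝ≥0) ^ n)⁻¹) atTop (𝓝 0) := by
      simpa using tendsto_pow_atTop_nhds_zero_of_lt_one (r := (2 : ℝ≥0)⁻¹)
        zero_le (inv_lt_one_of_one_lt₀ one_lt_two)
    simpa using tendsto_const_nhds.sub h2
  exact tendsto_of_tendsto_of_tendsto_of_le_of_le h tendsto_const_nhds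
    (fun n => tsub_le_iff_right.2 (lt_dyadicFloor_add n t).le) (fun n => dyadicFloor_le n t)

theorem floor_two_mul_eq (a : ℝ≥0) : ⌊2 * a⌋₊ = 2 * ⌊a⌋₊ ∨ ⌊2 * a⌋₊ = 2 * ⌊a⌋₊ + 1 := by
  have h1 := Nat.floor_le (zero_le : 0 ≤ a)
  have h2 := Nat.lt_floor_add_one a
  have h3 : 2 * ⌊a⌋₊ ≤ ⌊2 * a⌋₊ := Nat.le_floor (by push_cast; gcongr)
  have h4 : ⌊2 * a⌋₊ < 2 * ⌊a⌋₊ + 2 := by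
    rw [Nat.floor_lt zero_le]
    push_cast
    calc 2 * a < 2 * (⌊a⌋₊ + 1) := by gcongr
      _ = _ := by ring
  omega

section Deterministic

variable {g : ℝ≥0 → ℝ} {n T : ℕ} {c : ℝ}

/-- If the increments over the dyadic grid of level `n + 1` are small, refining the grid changes
little. -/
theorem abs_sub_dyadicFloor_succ_le (hc : 0 ≤ c)
    (h : ∀ k < T * 2 ^ (n + 1), |g ((k + 1 : ℕ) / 2 ^ (n + 1)) - g (k / 2 ^ (n + 1))| ≤ c)
    {t : ℝ≥0} (ht : t ≤ T) : |g (dyadicFloor (n + 1) t) - g (dyadicFloor n t)| ≤ c := by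
  have hn : dyadicFloor n t = ((2 * ⌊2 ^ n * t⌋₊ : ℕ) : ℝ≥0) / 2 ^ (n + 1) := by
    rw [dyadicFloor, pow_succ]
    push_cast
    rw [mul_comm (2 : ℝ≥0), mul_div_mul_right _ _ two_ne_zero]
  have he : (2 : ℝ≥0) ^ (n + 1) * t = 2 * (2 ^ n * t) := by ring
  rcases floor_two_mul_eq (2 ^ n * t) with h2 | h2
  · rw [hn, dyadicFloor, he, h2, sub_self, abs_zero]
    exact hc
  · rw [hn, dyadicFloor, he, h2]
    refine h _ ?_
    have : 2 * ⌊2 ^ n * t⌋₊ + 1 ≤ T * 2 ^ (n + 1) := by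
      rw [← h2, ← he]
      refine Nat.floor_le_of_le ?_
      push_cast
      rw [mul_comm]
      gcongr
    omega

theorem abs_sub_dyadicFloor_le (hc : 0 ≤ c)
    (h : ∀ k < T * 2 ^ n, |g ((k + 1 : ℕ) / 2 ^ n) - g (k / 2 ^ n)| ≤ c)
    {s t : ℝ≥0} (hst : s ≤ t) (hts : t ≤ s + (2 ^ n)⁻¹) (ht : t ≤ T) :
    |g (dyadicFloor n t) - g (dyadicFloor n s)| ≤ c := by
  have h1 : ⌊2 ^ n * s⌋₊ ≤ ⌊2 ^ n * t⌋₊ := Nat.floor_mono (by gcongr)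
  have h2 : ⌊2 ^ n * t⌋₊ ≤ ⌊2 ^ n * s⌋₊ + 1 := by
    rw [← Nat.floor_add_one (by positivity)]
    refine Nat.floor_mono ?_
    calc 2 ^ n * t ≤ 2 ^ n * (s + (2 ^ n)⁻¹) := by gcongr
      _ = 2 ^ n * s + 1 := by rw [mul_add, mul_inv_cancel₀ (by positivity)]
  rcases (by omega : ⌊2 ^ n * t⌋₊ = ⌊2 ^ n * s⌋₊ ∨ ⌊2 ^ n * t⌋₊ = ⌊2 ^ n * s⌋₊ + 1) with h3 | h3
  · rw [dyadicFloor, dyadicFloor, h3, sub_self, abs_zero]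
    exact hc
  · rw [dyadicFloor, dyadicFloor, h3]
    refine h _ ?_
    have : ⌊2 ^ n * s⌋₊ + 1 ≤ T * 2 ^ n := by
      rw [← h3]
      refine Nat.floor_le_of_le ?_
      push_cast
      rw [mul_comm]
      gcongr
    omega

end Deterministic

/-- Chaining: refining the grid costs one small increment per level, so the dyadic approximations
converge at a geometric rate, locally uniformly. Two points at distance at most 2⁻ⁿ have equal or
neighbouring grid points of level n, which bounds the oscillation of the limit. -/
theorem continuous_limUnder_dyadicFloor {g : ℝ≥0 → ℝ} {r : ℝ} (hr0 : 0 < r) (hr : r < 1)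
    (h : ∀ T : ℕ, ∃ N, ∀ n ≥ N, ∀ k < T * 2 ^ n,
      |g ((k + 1 : ℕ) / 2 ^ n) - g (k / 2 ^ n)| ≤ r ^ n) :
    Continuous (fun t => limUnder atTop fun n => g (dyadicFloor n t)) ∧
      ∀ t, Tendsto (fun n => g (dyadicFloor n t)) atTop
        (𝓝 (limUnder atTop fun n => g (dyadicFloor n t))) := by
  obtain ⟨hlim, hrate⟩ := exists_limUnder_geometric (f := fun n t => g (dyadicFloor n t)) hr
    (fun T => by
      obtain ⟨N, hN⟩ := h T
      refine ⟨N, fun n hn t ht => (abs_sub_dyadicFloor_succ_le (by positivity)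
        (hN (n + 1) (by omega)) ht).trans ?_⟩
      exact pow_le_pow_of_le_one hr0.le hr.le (by omega))
  refine ⟨?_, hlim⟩
  set G := fun t => limUnder atTop fun n => g (dyadicFloor n t) with hG
  rw [Metric.continuous_iff]
  intro t ε hε
  obtain ⟨T, hT⟩ := exists_nat_ge (t + 1)
  obtain ⟨N₁, hN₁⟩ := hrate T
  obtain ⟨N₂, hN₂⟩ := h T
  have hz : Tendsto (fun n : ℕ => r ^ n * (2 / (1 - r) + 1)) atTop (𝓝 0) := by
    simpa using (tendsto_pow_atTop_nhds_zero_of_lt_one hr0.le hr).mul_const (2 / (1 - r) + 1)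
  obtain ⟨n, hnε, hn⟩ := ((hz.eventually_lt_const hε).and (eventually_ge_atTop (max N₁ N₂))).exists
  have hpair : ∀ u v : ℝ≥0, u ≤ v → v ≤ u + (2 ^ n)⁻¹ → v ≤ T → |G v - G u| < ε := by
    intro u v huv hvu hv
    have h1 := hN₁ n (le_of_max_le_left hn) v hv
    have h2 := hN₁ n (le_of_max_le_left hn) u (huv.trans hv)
    have h3 := abs_sub_dyadicFloor_le (by positivity) (hN₂ n (le_of_max_le_right hn)) huv hvu hv
    have h4 : r ^ n * (2 / (1 - r) + 1) = r ^ n / (1 - r) + r ^ n / (1 - r) + r ^ n := by ring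
    rw [h4] at hnε
    rw [abs_le] at h1 h2 h3
    rw [abs_lt]
    constructor <;> linarith [h1.1, h1.2, h2.1, h2.2, h3.1, h3.2]
  refine ⟨min 1 (2 ^ n)⁻¹, by positivity, fun s hs => ?_⟩
  have hs1 : |(s : ℝ) - t| < 1 := hs.trans_le (min_le_left _ _)
  have hs2 : |(s : ℝ) - t| < (2 ^ n)⁻¹ := hs.trans_le (min_le_right _ _)
  rw [abs_lt] at hs1 hs2
  have hT' : (t : ℝ) + 1 ≤ T := by exact_mod_cast hT
  rw [Real.dist_eq]
  rcases le_total s t with hst | hst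
  · rw [abs_sub_comm]
    refine hpair s t hst ?_ ?_
    · rw [← NNReal.coe_le_coe]
      push_cast
      linarith [hs2.1]
    · rw [← NNReal.coe_le_coe]
      push_cast
      linarith
  · refine hpair t s hst ?_ ?_
    · rw [← NNReal.coe_le_coe]
      push_cast
      linarith [hs2.2]
    · rw [← NNReal.coe_le_coe]
      push_cast
      linarith [hs1.2]

namespace ProbabilityTheory

/-- Markov's inequality for the fourth moment, which scales like v². Second moments would not
suffice for the union over 2ⁿ increments of variance 2⁻ⁿ. -/
theorem exists_gaussianReal_tail_le : ∃ C : ℝ, 0 ≤ C ∧ ∀ (v : ℝ≥0) (c : ℝ), 0 < c →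
    (gaussianReal 0 v).real {x | c < |x|} ≤ C * v ^ 2 / c ^ 4 := by
  refine ⟨∫ x, x ^ 4 ∂gaussianReal 0 1, integral_nonneg fun x => by positivity, fun v c hc => ?_⟩
  have hint : Integrable (fun x : ℝ => x ^ 4) (gaussianReal 0 1) := by
    have h := (memLp_id_gaussianReal (μ := 0) (v := 1) 4).integrable_norm_pow (by norm_num)
    simpa [Even.pow_abs (by decide : Even 4)] using h
  have hmap : gaussianReal 0 v = (gaussianReal 0 1).map (fun x => √v * x) := by
    rw [gaussianReal_map_const_mul]
    congr 1
    · simp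
    · ext
      simp [Real.sq_sqrt]
  have hset : MeasurableSet {x : ℝ | c < |x|} := measurableSet_lt measurable_const (by fun_prop)
  rw [hmap, map_measureReal_apply (by fun_prop) hset, le_div_iff₀ (by positivity), mul_comm]
  have hM := mul_meas_ge_le_integral_of_nonneg (μ := gaussianReal 0 1)
    (f := fun x : ℝ => v ^ 2 * x ^ 4) (ae_of_all _ fun x => by positivity) (hint.const_mul _) (c ^ 4)
  rw [integral_const_mul] at hM
  calc _ ≤ c ^ 4 * (gaussianReal 0 1).real {x : ℝ | c ^ 4 ≤ v ^ 2 * x ^ 4} := by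
        gcongr
        · simp
        · intro x hx
          have hx' : c < |√v * x| := hx
          have h4 : (√(v : ℝ) * x) ^ 4 = v ^ 2 * x ^ 4 := by
            rw [mul_pow, show (√(v : ℝ)) ^ 4 = ((√(v : ℝ)) ^ 2) ^ 2 by ring,
              Real.sq_sqrt v.coe_nonneg]
          change c ^ 4 ≤ v ^ 2 * x ^ 4
          rw [← h4, ← Even.pow_abs (by decide : Even 4) (√(v : ℝ) * x)]
          gcongr
    _ ≤ _ := by linarith

variable {Ω : Type*} {mΩ : MeasurableSpace Ω} {P : Measure Ω} {X : ℝ≥0 → Ω → ℝ}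

/-- Almost surely the increments of a pre-Brownian motion over dyadic grids decay geometrically. -/
theorem IsPreBrownianReal.ae_dyadic_increments_le (hX : IsPreBrownianReal X P) :
    ∀ᵐ ω ∂P, ∀ T : ℕ, ∃ N, ∀ n ≥ N, ∀ k < T * 2 ^ n,
      |X ((k + 1 : ℕ) / 2 ^ n) ω - X (k / 2 ^ n) ω| ≤ (9 / 10 : ℝ) ^ n := by
  have := hX.isGaussianProcess.isProbabilityMeasure
  obtain ⟨C, hC0, hC⟩ := exists_gaussianReal_tail_le
  refine ae_all_iff.2 fun T => ?_
  let bad : ℕ → Set Ω := fun n => ⋃ k ∈ Finset.range (T * 2 ^ n),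
    {ω | (9 / 10 : ℝ) ^ n < |X ((k + 1 : ℕ) / 2 ^ n) ω - X (k / 2 ^ n) ω|}
  -- There are T · 2ⁿ increments, each with tail at most C · 4⁻ⁿ / (9/10)⁴ⁿ, and (1/2) / (9/10)⁴ =
  -- 5000/6561 < 1, so the bounds are summable.
  have hbad : ∀ n, P (bad n) ≤ ENNReal.ofReal (T * C * (5000 / 6561) ^ n) := by
    intro n
    have hone : ∀ k : ℕ, P {ω | (9 / 10 : ℝ) ^ n < |X ((k + 1 : ℕ) / 2 ^ n) ω - X (k / 2 ^ n) ω|}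
        ≤ ENNReal.ofReal (C * ((2 ^ n)⁻¹) ^ 2 / ((9 / 10) ^ n) ^ 4) := by
      intro k
      have hl := hX.hasLaw_sub ((k + 1 : ℕ) / 2 ^ n) (k / 2 ^ n)
      have hd : nndist (((k + 1 : ℕ) / 2 ^ n : ℝ≥0) : ℝ) ((k / 2 ^ n : ℝ≥0) : ℝ)
          = (2 ^ n)⁻¹ := by
        ext
        rw [coe_nndist, Real.dist_eq]
        push_cast
        rw [← sub_div, add_sub_cancel_left, one_div, abs_of_nonneg (by positivity)]
      have hset : MeasurableSet {x : ℝ | (9 / 10 : ℝ) ^ n < |x|} :=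
        measurableSet_lt measurable_const (by fun_prop)
      have h := hC (2 ^ n)⁻¹ ((9 / 10) ^ n) (by positivity)
      have hPeq : P {ω | (9 / 10 : ℝ) ^ n < |X ((k + 1 : ℕ) / 2 ^ n) ω - X (k / 2 ^ n) ω|}
          = (gaussianReal 0 ((2 ^ n)⁻¹ : ℝ≥0)) {x : ℝ | (9 / 10 : ℝ) ^ n < |x|} := by
        have h2 := hl.map_eq
        change P.map _ = gaussianReal 0 (nndist (((k + 1 : ℕ) / 2 ^ n : ℝ≥0) : ℝ)
          ((k / 2 ^ n : ℝ≥0) : ℝ)) at h2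
        rw [hd] at h2
        rw [← h2, Measure.map_apply_of_aemeasurable hl.aemeasurable hset]
        rfl
      rw [hPeq, ← ENNReal.ofReal_toReal (measure_ne_top (gaussianReal 0 ((2 ^ n)⁻¹ : ℝ≥0)) _)]
      refine ENNReal.ofReal_le_ofReal (h.trans_eq ?_)
      push_cast
      rfl
    calc P (bad n) ≤ ∑ k ∈ Finset.range (T * 2 ^ n),
          ENNReal.ofReal (C * ((2 ^ n)⁻¹) ^ 2 / ((9 / 10) ^ n) ^ 4) :=
          (measure_biUnion_finset_le _ _).trans (Finset.sum_le_sum fun k _ => hone k)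
      _ = _ := by
          rw [Finset.sum_const, Finset.card_range, ← ENNReal.ofReal_nsmul, nsmul_eq_mul]
          congr 1
          push_cast
          rw [← pow_mul, mul_comm n 4, pow_mul]
          have : (5000 / 6561 : ℝ) ^ n = (2 ^ n)⁻¹ / ((9 / 10) ^ 4) ^ n := by
            rw [← inv_pow, ← div_pow]
            norm_num
          rw [this]
          field_simp
  have hsum : ∑' n, P (bad n) ≠ ∞ := by
    refine ne_top_of_le_ne_top ?_ (ENNReal.tsum_le_tsum hbad)
    rw [← ENNReal.ofReal_tsum_of_nonneg (fun n => by positivity)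
      ((summable_geometric_of_lt_one (by norm_num) (by norm_num)).mul_left _)]
    exact ENNReal.ofReal_ne_top
  filter_upwards [ae_eventually_notMem hsum] with ω hω
  obtain ⟨N, hN⟩ := eventually_atTop.1 hω
  refine ⟨N, fun n hn k hk => ?_⟩
  have := hN n hn
  simp only [bad, Set.mem_iUnion, Finset.mem_range, not_exists] at this
  exact not_lt.1 (this k hk)

/-- The process is continuous in L², as increments have variance |u − t|; a subsequence converges
almost surely, and its limit must be the pointwise limit Y. -/
theorem IsPreBrownianReal.ae_eq_of_tendsto (hX : IsPreBrownianReal X P)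
    (hm : ∀ t, Measurable (X t)) {u : ℕ → ℝ≥0} {t : ℝ≥0} (hu : Tendsto u atTop (𝓝 t))
    {Y : Ω → ℝ} (hY : ∀ᵐ ω ∂P, Tendsto (fun n => X (u n) ω) atTop (𝓝 (Y ω))) :
    X t =ᵐ[P] Y := by
  have := hX.isGaussianProcess.isProbabilityMeasure
  have h0 : Tendsto (fun n => eLpNorm (X (u n) - X t) 2 P) atTop (𝓝 0) := by
    have he : ∀ n, eLpNorm (X (u n) - X t) 2 P ^ 2
        = ENNReal.ofReal (dist (u n) t) := by
      intro n
      have hl := hX.hasLaw_sub (u n) t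
      rw [hl.hasGaussianLaw.memLp_two.eLpNorm_two_sq]
      congr 1
      have hv := hl.variance_eq
      have hmean : ∫ ω, (X (u n) - X t) ω ∂P = 0 := by rw [hl.integral_eq, integral_id_gaussianReal]
      rw [variance_of_integral_eq_zero hl.aemeasurable hmean, variance_id_gaussianReal] at hv
      rw [hv]
      rfl
    have h1 : Tendsto (fun n => eLpNorm (X (u n) - X t) 2 P ^ 2) atTop (𝓝 0) := by
      simp only [he]
      simpa using ENNReal.tendsto_ofReal (tendsto_iff_dist_tendsto_zero.1 hu)
    have h2 := ((ENNReal.continuous_rpow_const (y := (1 / 2 : ℝ))).tendsto 0).comp h1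
    simp only [Function.comp_def, ← ENNReal.rpow_natCast, ← ENNReal.rpow_mul] at h2
    simpa using h2
  have hmeas := tendstoInMeasure_of_tendsto_eLpNorm two_ne_zero
    (fun n => (hm (u n)).aestronglyMeasurable) (hm t).aestronglyMeasurable h0
  obtain ⟨ns, hns, hae⟩ := hmeas.exists_seq_tendsto_ae
  filter_upwards [hae, hY] with ω h1 h2
  exact tendsto_nhds_unique h1 (h2.comp hns.tendsto_atTop)

theorem exists_isPreBrownianReal_continuous :
    ∃ (Ω : Type) (_ : MeasurableSpace Ω) (P : Measure Ω) (X : ℝ≥0 → Ω → ℝ),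
      IsPreBrownianReal X P ∧ (∀ t, Measurable (X t)) ∧ ∀ ω, Continuous (X · ω) ∧ X 0 ω = 0 := by
  obtain ⟨Ω, mΩ, P, X, hX, hm⟩ := exists_isPreBrownianReal
  have := hX.isGaussianProcess.isProbabilityMeasure
  set Y : ℝ≥0 → Ω → ℝ := fun t ω => limUnder atTop fun n => X (dyadicFloor n t) ω with hY
  have hYm : ∀ t, Measurable (Y t) := fun t =>
    (StronglyMeasurable.limUnder fun n => (hm _).stronglyMeasurable).measurable
  have hgood : ∀ᵐ ω ∂P, (Continuous (Y · ω) ∧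
      ∀ t, Tendsto (fun n => X (dyadicFloor n t) ω) atTop (𝓝 (Y t ω))) := by
    filter_upwards [hX.ae_dyadic_increments_le] with ω hω
    exact continuous_limUnder_dyadicFloor (g := fun t => X t ω) (by norm_num) (by norm_num) hω
  have hXY : ∀ t, X t =ᵐ[P] Y t := fun t =>
    hX.ae_eq_of_tendsto hm (tendsto_dyadicFloor t) (hgood.mono fun ω h => h.2 t)
  have hgood0 : ∀ᵐ ω ∂P, Continuous (Y · ω) ∧ Y 0 ω = 0 := by
    filter_upwards [hgood, hXY 0, hX.eval_zero_ae_eq_zero] with ω h1 h2 h3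
    exact ⟨h1.1, h2 ▸ h3⟩
  -- Path space admits only continuous paths from 0, so the process is replaced by the zero path off
  -- a measurable set of full measure.
  obtain ⟨G, hG, hGm, hG1⟩ := hgood0.exists_measurable_mem
  refine ⟨Ω, mΩ, P, fun t => G.indicator (Y t), hX.congr fun t => ?_,
    fun t => (hYm t).indicator hGm, fun ω => ?_⟩
  · filter_upwards [hXY t, hG] with ω h1 h2
    rw [h1, Set.indicator_of_mem h2]
  · by_cases h : ω ∈ G
    · simpa [Set.indicator_of_mem h] using hG1 ω h
    · simp [Set.indicator_of_notMem h, continuous_const]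

end ProbabilityTheory

/-! ### Wiener measure is a prior -/

/-- Lowering the lower volatility bound adds a nondecreasing deterministic process, which preserves
the submartingale property. -/
theorem priors_mono {σlo σhi : ℝ} (h0 : 0 ≤ σlo) (h : σlo ≤ σhi) :
    priors σhi σhi ⊆ priors σlo σhi := by
  rintro P ⟨h1, h2, h3, h4⟩
  refine ⟨h1, h2, ?_, h4⟩
  have hc : Submartingale (fun (t : ℝ≥0) (_ : PathSpace) => (σhi ^ 2 - σlo ^ 2) * (t : ℝ))
      pathFiltration P := by
    refine ⟨fun t => stronglyMeasurable_const, fun s t hst => ?_, fun t => integrable_const _⟩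
    rw [condExp_const (pathFiltration.le s)]
    have : σlo ^ 2 ≤ σhi ^ 2 := by gcongr
    exact ae_of_all _ fun ω => mul_le_mul_of_nonneg_left (by exact_mod_cast hst) (by linarith)
  have he : (fun (t : ℝ≥0) ω => canonB t ω ^ 2 - σlo ^ 2 * (t : ℝ))
      = (fun (t : ℝ≥0) ω => canonB t ω ^ 2 - σhi ^ 2 * (t : ℝ))
        + fun (t : ℝ≥0) (_ : PathSpace) => (σhi ^ 2 - σlo ^ 2) * (t : ℝ) := by
    funext t ω
    change _ = (canonB t ω ^ 2 - σhi ^ 2 * (t : ℝ)) + (σhi ^ 2 - σlo ^ 2) * (t : ℝ)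
    ring
  rw [he]
  exact h3.add hc

theorem pathFiltration_le_comap (s : ℝ≥0) :
    pathFiltration s ≤ MeasurableSpace.comap (fun (ω : PathSpace) (r : Set.Iic s) => canonB r ω)
      MeasurableSpace.pi := by
  refine iSup₂_le fun r hr => ?_
  have h : canonB r = (fun f : Set.Iic s → ℝ => f ⟨r, hr⟩) ∘
      fun (ω : PathSpace) (r : Set.Iic s) => canonB r ω := rfl
  rw [h, ← MeasurableSpace.comap_comp]
  refine MeasurableSpace.comap_mono ?_
  exact (measurable_pi_apply (⟨r, hr⟩ : Set.Iic s)).comap_le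

/-- Increments are independent of the natural filtration, centred and of variance σ²(t − s). With D
the increment, B_t² = D² + 2B_sD + B_s², which makes B² − σ²t a martingale and hence gives both
volatility bounds at once. -/
theorem ProbabilityTheory.IsPreBrownianReal.mem_priors {P : Measure PathSpace} {σ : ℝ} (hσ : σ ≠ 0)
    (hW : IsPreBrownianReal (fun t ω => canonB t ω / σ) P) : P ∈ priors σ σ := by
  have hP := hW.isGaussianProcess.isProbabilityMeasure
  have hL2 : ∀ t, MemLp (canonB t) 2 P := by
    intro t
    have h := ((hW.isGaussianProcess.hasGaussianLaw_eval t).memLp_two).const_mul σ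
    simpa [mul_div_cancel₀ _ hσ] using h
  have hadapt : StronglyAdapted pathFiltration canonB :=
    Filtration.stronglyAdapted_natural canonB_stronglyMeasurable
  have hindep : ∀ s t, s ≤ t → Indep (MeasurableSpace.comap (fun ω => canonB t ω - canonB s ω)
      inferInstance) (pathFiltration s) P := by
    intro s t hst
    have h := (hW.indepFun_shift s).comp (φ := fun f : ℝ≥0 → ℝ => σ * f (t - s))
      (ψ := fun (g : Set.Iic s → ℝ) (r : Set.Iic s) => σ * g r)
      (by fun_prop) (by fun_prop)
    have h1 : ((fun f : ℝ≥0 → ℝ => σ * f (t - s)) ∘ fun (ω : PathSpace) (r : ℝ≥0) =>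
        canonB (s + r) ω / σ - canonB s ω / σ) = fun ω => canonB t ω - canonB s ω := by
      ext ω
      simp only [Function.comp_apply, add_tsub_cancel_of_le hst]
      field_simp
    have h2 : ((fun (g : Set.Iic s → ℝ) (r : Set.Iic s) => σ * g r) ∘
        fun (ω : PathSpace) (r : Set.Iic s) => canonB r ω / σ)
        = fun ω (r : Set.Iic s) => canonB r ω := by
      ext ω r
      simp only [Function.comp_apply]
      field_simp
    rw [h1, h2] at h
    exact indep_of_indep_of_le_right h (pathFiltration_le_comap s)
  have hDmeas : ∀ s t, Measurable[MeasurableSpace.comap (fun ω => canonB t ω - canonB s ω)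
      inferInstance] (fun ω => canonB t ω - canonB s ω) := fun s t => comap_measurable _
  have hle : ∀ s t, MeasurableSpace.comap (fun ω : PathSpace => canonB t ω - canonB s ω)
      inferInstance ≤ (inferInstance : MeasurableSpace PathSpace) := fun s t =>
    ((canonB_stronglyMeasurable t).sub (canonB_stronglyMeasurable s)).measurable.comap_le
  have hlaw : ∀ s t, s ≤ t → ∫ ω, (canonB t ω - canonB s ω) ∂P = 0 ∧
      ∫ ω, (canonB t ω - canonB s ω) ^ 2 ∂P = σ ^ 2 * (t - s) := by
    intro s t hst
    have hl := hW.hasLaw_sub t s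
    have hmean : ∫ ω, ((fun ω => canonB t ω / σ) - fun ω => canonB s ω / σ) ω ∂P = 0 := by
      rw [hl.integral_eq, integral_id_gaussianReal]
    have hv := hl.variance_eq
    rw [variance_of_integral_eq_zero hl.aemeasurable hmean, variance_id_gaussianReal] at hv
    have he : ∀ ω, ((fun ω => canonB t ω / σ) - fun ω => canonB s ω / σ) ω
        = σ⁻¹ * (canonB t ω - canonB s ω) := fun ω => by
      simp only [Pi.sub_apply]
      ring
    simp only [he, integral_const_mul, mul_pow] at hmean hv
    refine ⟨by simpa [hσ] using hmean, ?_⟩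
    have hd : ((nndist (t : ℝ) (s : ℝ) : ℝ≥0) : ℝ) = t - s := by
      rw [coe_nndist, Real.dist_eq, abs_of_nonneg (sub_nonneg.2 (by exact_mod_cast hst))]
    change σ⁻¹ ^ 2 * _ = ((nndist (t : ℝ) (s : ℝ) : ℝ≥0) : ℝ) at hv
    rw [hd] at hv
    rw [← hv]
    field_simp
  have hcond : ∀ s t, s ≤ t → P[fun ω => canonB t ω - canonB s ω | pathFiltration s] =ᵐ[P] 0 := by
    intro s t hst
    have h := condExp_indep_eq (hle s t) (pathFiltration.le s) (hDmeas s t).stronglyMeasurable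
      (hindep s t hst)
    simp only [(hlaw s t hst).1] at h
    exact h
  have hcond2 : ∀ s t, s ≤ t → P[fun ω => (canonB t ω - canonB s ω) ^ 2 | pathFiltration s]
      =ᵐ[P] fun _ => σ ^ 2 * (t - s) := by
    intro s t hst
    have h := condExp_indep_eq (hle s t) (pathFiltration.le s)
      ((hDmeas s t).pow_const 2).stronglyMeasurable (hindep s t hst)
    simp only [(hlaw s t hst).2] at h
    exact h
  have hint : ∀ t, Integrable (canonB t) P := fun t => (hL2 t).integrable (by norm_num)
  have hmart : Martingale canonB pathFiltration P := by
    refine ⟨hadapt, fun s t hst => ?_⟩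
    have h1 : canonB t = (fun ω => canonB t ω - canonB s ω) + canonB s := by ext; simp
    have h2 := condExp_of_stronglyMeasurable (pathFiltration.le s) (hadapt s) (hint s)
    conv_lhs => rw [h1]
    filter_upwards [condExp_add ((hint t).sub (hint s)) (hint s) (pathFiltration s),
      hcond s t hst] with ω h3 h4
    refine h3.trans ?_
    rw [Pi.add_apply, h2]
    have h5 : (P[canonB t - canonB s|pathFiltration s]) ω = 0 := h4
    rw [h5, zero_add]
  have hmart2 : Martingale (fun t ω => canonB t ω ^ 2 - σ ^ 2 * (t : ℝ)) pathFiltration P := by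
    refine ⟨fun t => ((hadapt t).pow 2).sub stronglyMeasurable_const, fun s t hst => ?_⟩
    set D : PathSpace → ℝ := fun ω => canonB t ω - canonB s ω with hD
    have hDL : MemLp D 2 P := (hL2 t).sub (hL2 s)
    have hi1 : Integrable (fun ω => D ω ^ 2) P := hDL.integrable_sq
    have hi2 : Integrable ((fun ω => 2 * canonB s ω) * D) P :=
      ((hL2 s).const_mul 2).integrable_mul hDL
    have hi3 : Integrable (fun ω => canonB s ω ^ 2 - σ ^ 2 * (t : ℝ)) P :=
      (hL2 s).integrable_sq.sub (integrable_const _)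
    have h1 : (fun ω => canonB t ω ^ 2 - σ ^ 2 * (t : ℝ))
        = ((fun ω => D ω ^ 2) + (fun ω => 2 * canonB s ω) * D)
          + fun ω => canonB s ω ^ 2 - σ ^ 2 * (t : ℝ) := by
      ext ω
      simp only [hD, Pi.add_apply, Pi.mul_apply]
      ring
    have hm2 : StronglyMeasurable[pathFiltration s] (fun ω => 2 * canonB s ω) :=
      (hadapt s).const_mul 2
    have hm3 : StronglyMeasurable[pathFiltration s] (fun ω => canonB s ω ^ 2 - σ ^ 2 * (t : ℝ)) :=
      ((hadapt s).pow 2).sub stronglyMeasurable_const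
    change P[fun ω => canonB t ω ^ 2 - σ ^ 2 * (t : ℝ) | pathFiltration s]
      =ᵐ[P] fun ω => canonB s ω ^ 2 - σ ^ 2 * (s : ℝ)
    rw [h1]
    filter_upwards [condExp_add (hi1.add hi2) hi3 (pathFiltration s),
      condExp_add hi1 hi2 (pathFiltration s), hcond s t hst, hcond2 s t hst,
      condExp_mul_of_stronglyMeasurable_left hm2 hi2 (hDL.integrable (by norm_num))]
      with ω h2 h3 h4 h5 h6
    rw [h2, Pi.add_apply, h3, Pi.add_apply, h5, h6, Pi.mul_apply, h4,
      condExp_of_stronglyMeasurable (pathFiltration.le s) hm3 hi3]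
    simp only [Pi.zero_apply]
    ring
  exact ⟨hP, hmart, hmart2.submartingale, hmart2.supermartingale⟩

theorem exists_mem_priors {σ : ℝ} (hσ : σ ≠ 0) : (priors σ σ).Nonempty := by
  obtain ⟨Ω, mΩ, P, X, hX, hm, hc⟩ := exists_isPreBrownianReal_continuous
  let Φ : Ω → PathSpace := fun ω => ⟨fun t => σ * X t ω, (hc ω).1.const_mul σ, by simp [(hc ω).2]⟩
  have hΦ : Measurable Φ :=
    Measurable.subtype_mk (measurable_pi_lambda _ fun t => (hm t).const_mul σ)
  refine ⟨P.map Φ, IsPreBrownianReal.mem_priors hσ ⟨fun I => ?_⟩⟩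
  have hmeas : Measurable (fun ω : PathSpace => I.restrict fun t => canonB t ω / σ) :=
    measurable_pi_lambda _ fun i => (canonB_stronglyMeasurable i).measurable.div_const σ
  refine ⟨hmeas.aemeasurable, ?_⟩
  rw [Measure.map_map hmeas hΦ, ← (hX.hasLaw I).map_eq]
  congr 1
  ext ω i
  simp [Φ, canonB, mul_div_cancel_left₀ _ hσ]

/-! ## Verification -/

section Verification

variable {σlo σhi : ℝ} {P : Measure PathSpace} {x : ℝ} {b s X : ℝ≥0 → PathSpace → ℝ}

/-- The admissibility condition is a liminf, so the boundary term of the Dynkin formula vanishes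
only along suitable horizons; this is enough, since the reward integral converges along every
sequence of horizons. -/
theorem exists_seq_tendsto_zero_of_liminf_eq_zero {f : ℝ≥0 → ℝ≥0∞} (h : liminf f atTop = 0) :
    ∃ u : ℕ → ℝ≥0, Tendsto u atTop atTop ∧ Tendsto (fun n => f (u n)) atTop (𝓝 0) := by
  have hf : ∀ n : ℕ, ∃ T : ℝ≥0, n ≤ T ∧ f T < ((n : ℝ≥0∞) + 1)⁻¹ := by
    intro n
    have h1 : liminf f atTop < ((n : ℝ≥0∞) + 1)⁻¹ := by
      rw [h]
      exact ENNReal.inv_pos.2 (ENNReal.add_ne_top.2 ⟨ENNReal.natCast_ne_top n, ENNReal.one_ne_top⟩)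
    obtain ⟨T, h2, h3⟩ := ((frequently_lt_of_liminf_lt (by isBoundedDefault) h1).and_eventually
      (eventually_ge_atTop (n : ℝ≥0))).exists
    exact ⟨T, h3, h2⟩
  choose u hu1 hu2 using hf
  refine ⟨u, tendsto_atTop_mono hu1 tendsto_natCast_atTop_atTop, ?_⟩
  refine tendsto_of_tendsto_of_tendsto_of_le_of_le tendsto_const_nhds ?_ (fun _ => zero_le)
    (fun n => (hu2 n).le)
  have := (tendsto_add_atTop_iff_nat 1).2 ENNReal.tendsto_inv_nat_nhds_zero
  simpa using this

/-- The generator minus the discount rate, applied to `½ q₂ y² + q₁ y + q₀`, at the state `y`, the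
drift `b` and the volatility `s`. -/
def discountedGenerator (σ c q₀ q₁ q₂ y b s : ℝ) : ℝ :=
  (q₂ * y + q₁) * b + 1 / 2 * q₂ * σ ^ 2 * s ^ 2 - c * (1 / 2 * q₂ * y ^ 2 + q₁ * y + q₀)

theorem IsState.integrable_discountedGenerator (hX : IsState P x b s X) (hP : P ∈ priors σlo σhi)
    (c q₀ q₁ q₂ : ℝ) (T : ℝ≥0) :
    Integrable (fun p : ℝ≥0 × PathSpace => Real.exp (-c * p.1) *
      discountedGenerator σhi c q₀ q₁ q₂ (X p.1 p.2) (b p.1 p.2) (s p.1 p.2))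
      ((timeMeasure.restrict (Set.Iic T)).prod P) := by
  have := hP.1
  have hb := hX.drift_memLp T
  have hXp := hX.memLp_prod hP T
  have hs := hX.equation.1 T
  refine integrable_exp_mul_prod c ?_
  have h1 := ((hXp.const_mul q₂).add (memLp_const q₁)).integrable_fun_mul hb
  have h2 := hs.integrable_sq.const_mul (1 / 2 * q₂ * σhi ^ 2)
  have h3 := hXp.integrable_sq.const_mul (1 / 2 * q₂)
  have h4 := (hXp.integrable one_le_two).const_mul q₁
  have h5 := ((h3.add h4).add (integrable_const q₀)).const_mul c
  exact (h1.add h2).sub h5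

theorem tendsto_integral_Iic_prod [SFinite P] {u : ℕ → ℝ≥0} (hu : Tendsto u atTop atTop)
    {f : ℝ≥0 × PathSpace → ℝ} (hf : Integrable f (timeMeasure.prod P)) :
    Tendsto (fun n => ∫ p, f p ∂((timeMeasure.restrict (Set.Iic (u n))).prod P)) atTop
      (𝓝 (∫ p, f p ∂(timeMeasure.prod P))) := by
  have hc : AECover (timeMeasure.prod P) atTop fun n => Set.Iic (u n) ×ˢ (Set.univ : Set PathSpace) :=
    ⟨ae_of_all _ fun p => (hu.eventually_ge_atTop p.1).mono fun n hn => ⟨hn, trivial⟩,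
      fun n => measurableSet_Iic.prod MeasurableSet.univ⟩
  have h := hc.integral_tendsto_of_countably_generated hf
  refine h.congr fun n => ?_
  rw [← Measure.prod_restrict, Measure.restrict_univ]

theorem ae_restrict_Iic_prod [SFinite P] {p : ℝ≥0 × PathSpace → Prop}
    (h : ∀ᵐ z ∂(timeMeasure.prod P), p z) (T : ℝ≥0) :
    ∀ᵐ z ∂((timeMeasure.restrict (Set.Iic T)).prod P), p z :=
  (Measure.absolutelyContinuous_of_le
    (Measure.prod_mono Measure.restrict_le_self le_rfl)).ae_le h

theorem abs_quadratic_le (q₀ q₁ q₂ y : ℝ) :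
    |1 / 2 * q₂ * y ^ 2 + q₁ * y + q₀| ≤ (|q₀| + |q₁| + |q₂|) * (1 + y ^ 2) := by
  have h1 : |y| ≤ 1 + y ^ 2 := by
    rw [abs_le]; constructor <;> nlinarith [sq_nonneg (y - 1), sq_nonneg (y + 1)]
  have h2 : |1 / 2 * q₂ * y ^ 2| ≤ |q₂| * (1 + y ^ 2) := by
    rw [abs_mul, abs_mul, abs_of_nonneg (by norm_num : (0 : ℝ) ≤ 1 / 2), abs_of_nonneg (sq_nonneg y)]
    nlinarith [abs_nonneg q₂, sq_nonneg y, mul_nonneg (abs_nonneg q₂) (sq_nonneg y)]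
  have h3 : |q₁ * y| ≤ |q₁| * (1 + y ^ 2) := by
    rw [abs_mul]; exact mul_le_mul_of_nonneg_left h1 (abs_nonneg _)
  have h4 : |q₀| ≤ |q₀| * (1 + y ^ 2) := by nlinarith [abs_nonneg q₀, sq_nonneg y]
  calc _ ≤ |1 / 2 * q₂ * y ^ 2| + |q₁ * y| + |q₀| := abs_add_three _ _ _
    _ ≤ _ := by linarith

/-- Verification: a quadratic function which is a subsolution along the state process is a lower
bound of the discounted reward. -/
theorem IsState.le_integral (hX : IsState P x b s X) (hP : P ∈ priors σlo σhi) {c : ℝ} (hc : 0 < c)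
    {q₀ q₁ q₂ : ℝ} (hq : q₂ ≤ 0 ∨ P ∈ priors σhi σhi)
    (hgrowth : liminf (fun T : ℝ≥0 => ENNReal.ofReal (Real.exp (-c * T)) *
      ∫⁻ ω, ENNReal.ofReal (X T ω ^ 2) ∂P) atTop = 0)
    {g : ℝ≥0 × PathSpace → ℝ}
    (hg : Integrable (fun p => Real.exp (-c * p.1) * g p) (timeMeasure.prod P))
    (hle : ∀ᵐ p ∂(timeMeasure.prod P), 0 ≤ g p +
      discountedGenerator σhi c q₀ q₁ q₂ (X p.1 p.2) (b p.1 p.2) (s p.1 p.2)) :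
    1 / 2 * q₂ * x ^ 2 + q₁ * x + q₀ ≤
      ∫ p, Real.exp (-c * p.1) * g p ∂(timeMeasure.prod P) := by
  have := hP.1
  obtain ⟨u, hu, hu0⟩ := exists_seq_tendsto_zero_of_liminf_eq_zero hgrowth
  have hkey : ∀ T : ℝ≥0, 1 / 2 * q₂ * x ^ 2 + q₁ * x + q₀ ≤
      Real.exp (-c * T) * ∫ ω, (1 / 2 * q₂ * X T ω ^ 2 + q₁ * X T ω + q₀) ∂P +
      ∫ p, Real.exp (-c * p.1) * g p ∂((timeMeasure.restrict (Set.Iic T)).prod P) := by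
    intro T
    obtain ⟨R, hR0, hR1, hR⟩ := hX.dynkin hP hc.le T
    -- Here concavity or maximal volatility enters: in the bound for the initial value the remainder
    -- appears as ½ q₂ R and may be dropped.
    have hR' : q₂ * R ≤ 0 := by
      rcases hq with h | h
      · exact mul_nonpos_of_nonpos_of_nonneg h hR0
      · rw [hR1 h, mul_zero]
    have hi1 := hX.integrable_discountedGenerator hP c q₀ q₁ q₂ T
    have hi2 : Integrable (fun p => Real.exp (-c * p.1) * g p)
        ((timeMeasure.restrict (Set.Iic T)).prod P) :=
      hg.mono_measure (Measure.prod_mono Measure.restrict_le_self le_rfl)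
    have h0 : 0 ≤ ∫ p, (Real.exp (-c * p.1) * g p + Real.exp (-c * p.1) *
        discountedGenerator σhi c q₀ q₁ q₂ (X p.1 p.2) (b p.1 p.2) (s p.1 p.2))
        ∂((timeMeasure.restrict (Set.Iic T)).prod P) := by
      refine integral_nonneg_of_ae ?_
      filter_upwards [ae_restrict_Iic_prod hle T] with p hp
      have := mul_nonneg (Real.exp_pos (-c * (p.1 : ℝ))).le hp
      simpa [mul_add] using this
    rw [integral_add hi2 hi1] at h0
    have h1 := hR q₀ q₁ q₂
    have h2 : ∫ p : ℝ≥0 × PathSpace, Real.exp (-c * p.1) * ((q₂ * X p.1 p.2 + q₁) * b p.1 p.2 +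
        1 / 2 * q₂ * σhi ^ 2 * s p.1 p.2 ^ 2 -
        c * (1 / 2 * q₂ * X p.1 p.2 ^ 2 + q₁ * X p.1 p.2 + q₀))
        ∂((timeMeasure.restrict (Set.Iic T)).prod P) = ∫ p, Real.exp (-c * p.1) *
        discountedGenerator σhi c q₀ q₁ q₂ (X p.1 p.2) (b p.1 p.2) (s p.1 p.2)
        ∂((timeMeasure.restrict (Set.Iic T)).prod P) := rfl
    rw [h2] at h1
    linarith
  have hexp : Tendsto (fun n => Real.exp (-c * u n)) atTop (𝓝 0) := by
    refine Real.tendsto_exp_atBot.comp ?_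
    exact (NNReal.tendsto_coe_atTop.2 hu).const_mul_atTop_of_neg (by linarith)
  have hsq : Tendsto (fun n => Real.exp (-c * u n) * ∫ ω, X (u n) ω ^ 2 ∂P) atTop (𝓝 0) := by
    have h := (ENNReal.tendsto_toReal ENNReal.zero_ne_top).comp hu0
    refine h.congr fun n => ?_
    simp only [Function.comp_apply]
    rw [ENNReal.toReal_mul, ENNReal.toReal_ofReal (Real.exp_pos _).le,
      integral_eq_lintegral_of_nonneg_ae (ae_of_all _ fun ω => sq_nonneg _)
        (hX.memLp_apply hP (u n)).integrable_sq.1]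
  -- A quadratic function is dominated by 1 + y², so its discounted expectation vanishes together
  -- with that of the square.
  have hq0 : Tendsto (fun n => Real.exp (-c * u n) *
      ∫ ω, (1 / 2 * q₂ * X (u n) ω ^ 2 + q₁ * X (u n) ω + q₀) ∂P) atTop (𝓝 0) := by
    set C := |q₀| + |q₁| + |q₂|
    have hlim : Tendsto (fun n => C * (Real.exp (-c * u n) + Real.exp (-c * u n) *
        ∫ ω, X (u n) ω ^ 2 ∂P)) atTop (𝓝 0) := by
      simpa using (hexp.add hsq).const_mul C
    refine squeeze_zero_norm (fun n => ?_) hlim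
    have hi := (hX.memLp_apply hP (u n)).integrable_sq
    have hi' : Integrable (fun ω => C * (1 + X (u n) ω ^ 2)) P :=
      ((integrable_const 1).add hi).const_mul C
    have h1 : ‖∫ ω, (1 / 2 * q₂ * X (u n) ω ^ 2 + q₁ * X (u n) ω + q₀) ∂P‖ ≤
        C * (1 + ∫ ω, X (u n) ω ^ 2 ∂P) := by
      refine (norm_integral_le_of_norm_le hi' (ae_of_all _ fun ω => abs_quadratic_le _ _ _ _)).trans ?_
      rw [integral_const_mul, integral_add (integrable_const _) hi, integral_const, probReal_univ,
        one_smul]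
    rw [norm_mul, Real.norm_eq_abs, Real.abs_exp]
    calc _ ≤ Real.exp (-c * u n) * (C * (1 + ∫ ω, X (u n) ω ^ 2 ∂P)) := by gcongr
      _ = _ := by ring
  have hfin := hq0.add (tendsto_integral_Iic_prod hu hg)
  rw [zero_add] at hfin
  exact ge_of_tendsto' hfin fun n => hkey (u n)

/-- Verification: a quadratic function which is a supersolution along the state process is an upper
bound of the discounted reward under a prior with maximal volatility. -/
theorem IsState.integral_le (hX : IsState P x b s X) (hP : P ∈ priors σhi σhi) {c : ℝ} (hc : 0 < c)
    {q₀ q₁ q₂ : ℝ}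
    (hgrowth : liminf (fun T : ℝ≥0 => ENNReal.ofReal (Real.exp (-c * T)) *
      ∫⁻ ω, ENNReal.ofReal (X T ω ^ 2) ∂P) atTop = 0)
    {g : ℝ≥0 × PathSpace → ℝ}
    (hg : Integrable (fun p => Real.exp (-c * p.1) * g p) (timeMeasure.prod P))
    (hle : ∀ᵐ p ∂(timeMeasure.prod P), g p +
      discountedGenerator σhi c q₀ q₁ q₂ (X p.1 p.2) (b p.1 p.2) (s p.1 p.2) ≤ 0) :
    ∫ p, Real.exp (-c * p.1) * g p ∂(timeMeasure.prod P) ≤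
      1 / 2 * q₂ * x ^ 2 + q₁ * x + q₀ := by
  -- Negation turns the supersolution into a subsolution; the sign of its leading coefficient plays
  -- no role because the remainder vanishes at maximal volatility.
  have h := hX.le_integral hP hc (q₀ := -q₀) (q₁ := -q₁) (q₂ := -q₂) (Or.inr hP) hgrowth
    (g := fun p => -g p) (by simpa using hg.neg) (by
      filter_upwards [hle] with p hp
      rw [discountedGenerator] at hp ⊢
      linarith)
  simp only [mul_neg, integral_neg] at h
  linarith

/-- Second moments grow at most exponentially. -/
theorem IsState.integral_sq_le (hX : IsState P x b s X) (hP : P ∈ priors σlo σhi) {c C : ℝ}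
    (hc : 0 < c) (hC : 0 ≤ C)
    (hle : ∀ t ω, 2 * X t ω * b t ω + σhi ^ 2 * s t ω ^ 2 ≤ c * X t ω ^ 2 + C) (T : ℝ≥0) :
    ∫ ω, X T ω ^ 2 ∂P ≤ Real.exp (c * T) * (x ^ 2 + C / c) := by
  have := hP.1
  obtain ⟨R, hR0, -, hR⟩ := hX.dynkin hP hc.le T
  -- The coefficients select the function y², for which the remainder enters as −R and only lowers
  -- the second moment.
  have h1 := hR 0 0 2
  have h2 : ∫ p : ℝ≥0 × PathSpace, Real.exp (-c * p.1) * ((2 * X p.1 p.2 + 0) * b p.1 p.2 +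
        1 / 2 * 2 * σhi ^ 2 * s p.1 p.2 ^ 2 -
        c * (1 / 2 * 2 * X p.1 p.2 ^ 2 + 0 * X p.1 p.2 + 0))
        ∂((timeMeasure.restrict (Set.Iic T)).prod P) ≤ C / c := by
    have hi := hX.integrable_discountedGenerator hP c 0 0 2 T
    have hiC := integrable_exp_mul_prod (P := P) (T := T) c (integrable_const C)
    refine (integral_mono hi hiC fun p => ?_).trans ?_
    · refine mul_le_mul_of_nonneg_left ?_ (Real.exp_pos _).le
      have := hle p.1 p.2
      rw [discountedGenerator]
      linarith
    · rw [integral_exp_mul_prod c (integrable_const C)]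
      simp only [integral_const, probReal_univ, one_smul, integral_mul_const]
      have he := setIntegral_exp_neg_timeMeasure c T
      rw [integral_const_mul] at he
      have he' : ∫ t in Set.Iic T, Real.exp (-c * t) ∂timeMeasure ≤ 1 / c := by
        rw [le_div_iff₀ hc]
        have := Real.exp_pos (-c * T)
        linarith
      calc _ ≤ 1 / c * C := mul_le_mul_of_nonneg_right he' hC
        _ = C / c := by ring
  have h3 : ∫ ω, (1 / 2 * 2 * X T ω ^ 2 + 0 * X T ω + 0) ∂P = ∫ ω, X T ω ^ 2 ∂P :=
    integral_congr_ae (ae_of_all _ fun ω => by ring)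
  rw [h3] at h1
  have h4 : ∫ ω, X T ω ^ 2 ∂P = Real.exp (c * T) * (Real.exp (-c * T) * ∫ ω, X T ω ^ 2 ∂P) := by
    rw [← mul_assoc, ← Real.exp_add]
    simp
  rw [h4, h1]
  gcongr
  linarith

end Verification

/-! ## Upper and lower expectations -/

section Expectation

variable {Ps : Set (Measure PathSpace)} {Y : PathSpace → ℝ} {v : ℝ} {P : Measure PathSpace}

theorem lintegral_le_upperExpENN (hP : P ∈ Ps) (Y : PathSpace → ℝ≥0∞) :
    ∫⁻ ω, Y ω ∂P ≤ upperExpENN Ps Y :=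
  le_iSup₂_of_le P hP le_rfl

theorem le_lowerExp (hne : Ps.Nonempty) (h : ∀ P ∈ Ps, v ≤ ∫ ω, Y ω ∂P) : v ≤ lowerExp Ps Y := by
  have : Nonempty Ps := hne.to_subtype
  rw [lowerExp, le_neg, upperExp]
  refine ciSup_le fun P => ?_
  rw [integral_neg]
  exact neg_le_neg (h P.1 P.2)

/-- The uniform bound w makes the real supremum in `upperExp` a genuine one; an unbounded family
would have the default value 0. -/
theorem lowerExp_le {w : ℝ} (h : ∀ P ∈ Ps, w ≤ ∫ ω, Y ω ∂P) (hP : P ∈ Ps) :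
    lowerExp Ps Y ≤ ∫ ω, Y ω ∂P := by
  rw [lowerExp, neg_le, upperExp]
  have hb : BddAbove (Set.range fun P : Ps => ∫ ω, -Y ω ∂P.1) := by
    refine ⟨-w, ?_⟩
    rintro _ ⟨P, rfl⟩
    simp only [integral_neg]
    exact neg_le_neg (h P.1 P.2)
  rw [← integral_neg]
  exact le_ciSup hb ⟨P, hP⟩

theorem lowerExp_eq (h : ∀ P ∈ Ps, v ≤ ∫ ω, Y ω ∂P) (hP : P ∈ Ps) (hv : ∫ ω, Y ω ∂P = v) :
    lowerExp Ps Y = v :=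
  le_antisymm ((lowerExp_le h hP).trans_eq hv) (le_lowerExp ⟨P, hP⟩ h)

theorem lowerExp_const (hne : Ps.Nonempty) (hP : ∀ P ∈ Ps, IsProbabilityMeasure P) :
    lowerExp Ps (fun _ => v) = v := by
  have h : ∀ P ∈ Ps, ∫ _, v ∂P = v := fun P h => by
    have := hP P h
    simp
  obtain ⟨P, hPs⟩ := hne
  exact lowerExp_eq (fun P hP => (h P hP).ge) hPs (h P hPs)

theorem liminf_growth_of_upperExpENN {ρ : ℝ} {X : ℝ≥0 → PathSpace → ℝ}
    (h : liminf (fun T : ℝ≥0 => ENNReal.ofReal (Real.exp (-ρ * T)) *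
      upperExpENN Ps (fun ω => ENNReal.ofReal (X T ω ^ 2))) atTop = 0) (hP : P ∈ Ps) :
    liminf (fun T : ℝ≥0 => ENNReal.ofReal (Real.exp (-ρ * T)) *
      ∫⁻ ω, ENNReal.ofReal (X T ω ^ 2) ∂P) atTop = 0 := by
  refine le_antisymm (le_trans (liminf_le_liminf (Eventually.of_forall fun T => ?_)
    (by isBoundedDefault) (by isBoundedDefault)) h.le) zero_le
  exact mul_le_mul_right (lintegral_le_upperExpENN hP _) _

theorem integrable_prod_of_upperExpENN [SFinite P] {ρ : ℝ} {g : ℝ≥0 → PathSpace → ℝ}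
    (hm : AEStronglyMeasurable (fun p : ℝ≥0 × PathSpace => g p.1 p.2) (timeMeasure.prod P))
    (h : upperExpENN Ps (fun ω => ∫⁻ t : ℝ≥0,
      ENNReal.ofReal (Real.exp (-ρ * t) * |g t ω|) ∂timeMeasure) < ∞) (hP : P ∈ Ps) :
    Integrable (fun p : ℝ≥0 × PathSpace => Real.exp (-ρ * p.1) * g p.1 p.2)
      (timeMeasure.prod P) := by
  have he : Measurable fun p : ℝ≥0 × PathSpace => Real.exp (-ρ * p.1) := by fun_prop
  have hm' := he.aestronglyMeasurable.mul hm
  refine ⟨hm', ?_⟩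
  have h1 := (lintegral_le_upperExpENN hP _).trans_lt h
  have h2 : AEMeasurable (fun p : ℝ≥0 × PathSpace => Real.exp (-ρ * p.1) * |g p.1 p.2|)
      (timeMeasure.prod P) := he.aemeasurable.mul hm.aemeasurable.abs
  rw [← lintegral_prod_symm (fun p : ℝ≥0 × PathSpace =>
    ENNReal.ofReal (Real.exp (-ρ * p.1) * |g p.1 p.2|)) h2.ennreal_ofReal] at h1
  refine lt_of_le_of_lt (lintegral_mono fun p => ?_) h1
  rw [Real.enorm_eq_ofReal_abs, abs_mul, Real.abs_exp]

theorem integral_integral_eq_integral_prod [SFinite P] {f : ℝ≥0 × PathSpace → ℝ}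
    (hf : Integrable f (timeMeasure.prod P)) :
    ∫ ω, ∫ t, f (t, ω) ∂timeMeasure ∂P = ∫ p, f p ∂(timeMeasure.prod P) :=
  (integral_prod_symm f hf).symm

end Expectation

/-! ## Affine feedback -/

section AffineFeedback

variable {σlo σhi : ℝ} {P : Measure PathSpace} {a b c d e ρ : ℝ}

/-- Under the prior `P`, the process `X` is a state process from `x` with drift `a X + b` and squared
volatility `(c X + d)² + e`. -/
def IsAffineState (P : Measure PathSpace) (x a b c d e : ℝ) (X : ℝ≥0 → PathSpace → ℝ) : Prop :=
  ∃ s : ℝ≥0 → PathSpace → ℝ, (∀ t ω, s t ω ^ 2 = (c * X t ω + d) ^ 2 + e) ∧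
    IsState P x (fun t ω => a * X t ω + b) s X

/-- When the square grows at least at rate ρ, lower-order terms can be added to y² so that its
discounted generator is nonnegative. Under strict inequality the positive quadratic coefficient
absorbs the linear term by completing the square. In the boundary case a < ρ, and q₁ is chosen to
cancel the linear term. In both cases q₀ makes the constant nonnegative. -/
theorem exists_subsolution (hρ : 0 < ρ) (he : 0 ≤ e) (h : ρ ≤ 2 * a + c ^ 2 * σhi ^ 2) :
    ∃ q₀ q₁ : ℝ, ∀ y s : ℝ, s ^ 2 = (c * y + d) ^ 2 + e →
      0 ≤ discountedGenerator σhi ρ q₀ q₁ 2 y (a * y + b) s := by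
  have hform : ∀ q₀ q₁ y s : ℝ, s ^ 2 = (c * y + d) ^ 2 + e →
      discountedGenerator σhi ρ q₀ q₁ 2 y (a * y + b) s =
      (2 * a + c ^ 2 * σhi ^ 2 - ρ) * y ^ 2 + (2 * b + 2 * σhi ^ 2 * c * d + q₁ * (a - ρ)) * y +
        (q₁ * b + σhi ^ 2 * (d ^ 2 + e) - ρ * q₀) := by
    intro q₀ q₁ y s hs
    rw [discountedGenerator, hs]
    ring
  have hpos : 0 ≤ σhi ^ 2 * (d ^ 2 + e) := by positivity
  rcases h.lt_or_eq with h | h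
  · set δ := 2 * a + c ^ 2 * σhi ^ 2 - ρ with hδ
    set β := 2 * b + 2 * σhi ^ 2 * c * d with hβ
    have hδ0 : 0 < δ := by linarith
    refine ⟨-(β ^ 2 / (4 * δ) / ρ), 0, fun y s hs => ?_⟩
    rw [hform _ _ _ _ hs]
    have h1 : δ * y ^ 2 + β * y + β ^ 2 / (4 * δ) = δ * (y + β / (2 * δ)) ^ 2 := by
      field_simp
      ring
    have h2 : ρ * -(β ^ 2 / (4 * δ) / ρ) = -(β ^ 2 / (4 * δ)) := by field_simp
    rw [h2]
    have h3 : 0 ≤ δ * (y + β / (2 * δ)) ^ 2 := by positivity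
    linarith
  · have ha : a - ρ < 0 := by nlinarith [sq_nonneg (c * σhi)]
    set β := 2 * b + 2 * σhi ^ 2 * c * d with hβ
    refine ⟨-(|-β / (a - ρ) * b| / ρ), -β / (a - ρ), fun y s hs => ?_⟩
    rw [hform _ _ _ _ hs, ← h, div_mul_cancel₀ _ ha.ne]
    have h2 : ρ * -(|-β / (a - ρ) * b| / ρ) = -|-β / (a - ρ) * b| := by field_simp
    rw [h2]
    have := neg_abs_le (-β / (a - ρ) * b)
    linarith

/-- If the discounted second moment vanishes for all initial states, then the growth rate of the
second moment is smaller than the discount rate. -/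
theorem growth_rate_lt (hρ : 0 < ρ) (he : 0 ≤ e) (hP : P ∈ priors σhi σhi)
    (h : ∀ x, ∃ X, IsAffineState P x a b c d e X ∧
      liminf (fun T : ℝ≥0 => ENNReal.ofReal (Real.exp (-ρ * T)) *
        ∫⁻ ω, ENNReal.ofReal (X T ω ^ 2) ∂P) atTop = 0) :
    2 * a + c ^ 2 * σhi ^ 2 < ρ := by
  by_contra hcon
  obtain ⟨q₀, q₁, hq⟩ := exists_subsolution (b := b) (d := d) hρ he (not_lt.1 hcon)
  -- At this initial state the subsolution x² + q₁x + q₀ is positive, whereas verification with zero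
  -- reward bounds it above by 0.
  set x := |q₁| + |q₀| + 1 with hx
  obtain ⟨X, ⟨s, hs, hX⟩, hgr⟩ := h x
  have hle := hX.le_integral hP hρ (q₀ := q₀) (q₁ := q₁) (q₂ := 2) (Or.inr hP) hgr (g := fun _ => 0)
    (by simp) (ae_of_all _ fun p => by
      rw [zero_add]
      exact hq _ _ (hs _ _))
  simp only [mul_zero, integral_zero] at hle
  have h1 := neg_abs_le q₁
  have h2 := neg_abs_le q₀
  have h3 := abs_nonneg q₁
  have h4 := abs_nonneg q₀
  have h5 : -|q₁| * x ≤ q₁ * x := mul_le_mul_of_nonneg_right h1 (by positivity)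
  nlinarith

/-- The payoff of an affine feedback with quadratic running reward. -/
theorem IsAffineState.lowerExp_eq {X : ℝ≥0 → PathSpace → ℝ} {x : ℝ} (h0 : 0 ≤ σlo) (hσ : σlo ≤ σhi)
    (hPhi : P ∈ priors σhi σhi) (hρ : 0 < ρ)
    (hX : ∀ P ∈ priors σlo σhi, IsAffineState P x a b c d e X)
    (hgr : liminf (fun T : ℝ≥0 => ENNReal.ofReal (Real.exp (-ρ * T)) *
      upperExpENN (priors σlo σhi) (fun ω => ENNReal.ofReal (X T ω ^ 2))) atTop = 0)
    {G : ℝ → ℝ} (hint : ∀ P ∈ priors σlo σhi, Integrable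
      (fun p : ℝ≥0 × PathSpace => Real.exp (-ρ * p.1) * G (X p.1 p.2)) (timeMeasure.prod P))
    {q₀ q₁ q₂ : ℝ} (hq₂ : q₂ ≤ 0) (hq : ∀ y s : ℝ, s ^ 2 = (c * y + d) ^ 2 + e →
      G y + discountedGenerator σhi ρ q₀ q₁ q₂ y (a * y + b) s = 0) :
    lowerExp (priors σlo σhi) (fun ω => ∫ t : ℝ≥0, Real.exp (-ρ * t) * G (X t ω) ∂timeMeasure) =
      1 / 2 * q₂ * x ^ 2 + q₁ * x + q₀ := by
  have hle : ∀ P ∈ priors σlo σhi, 1 / 2 * q₂ * x ^ 2 + q₁ * x + q₀ ≤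
      ∫ ω, ∫ t : ℝ≥0, Real.exp (-ρ * t) * G (X t ω) ∂timeMeasure ∂P := by
    intro P hP
    have := hP.1
    obtain ⟨s, hs, hS⟩ := hX P hP
    rw [integral_integral_eq_integral_prod (hint P hP)]
    exact hS.le_integral hP hρ (Or.inl hq₂) (liminf_growth_of_upperExpENN hgr hP)
      (g := fun p => G (X p.1 p.2)) (hint P hP) (ae_of_all _ fun p => (hq _ _ (hs _ _)).ge)
  have hP := priors_mono h0 hσ hPhi
  refine _root_.lowerExp_eq hle hP (le_antisymm ?_ (hle P hP))
  have := hP.1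
  obtain ⟨s, hs, hS⟩ := hX P hP
  rw [integral_integral_eq_integral_prod (hint P hP)]
  exact hS.integral_le hPhi hρ (liminf_growth_of_upperExpENN hgr hP)
    (g := fun p => G (X p.1 p.2)) (hint P hP) (ae_of_all _ fun p => (hq _ _ (hs _ _)).le)

/-- If the payoff of an affine feedback is a concave quadratic function of the initial state, then
this function solves the corresponding linear equation. -/
theorem generator_eq_of_payoff_eq (h0 : 0 ≤ σlo) (hσ : σlo ≤ σhi) (hPhi : P ∈ priors σhi σhi)
    (hρ : 0 < ρ) (hγ : 2 * a + c ^ 2 * σhi ^ 2 < ρ) {α₀ α₁ α₂ G₀ G₁ G₂ : ℝ} (hα : α₂ < 0)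
    (h : ∀ x, ∃ X, (∀ P ∈ priors σlo σhi, IsAffineState P x a b c d e X) ∧
      liminf (fun T : ℝ≥0 => ENNReal.ofReal (Real.exp (-ρ * T)) *
        upperExpENN (priors σlo σhi) (fun ω => ENNReal.ofReal (X T ω ^ 2))) atTop = 0 ∧
      (∀ P ∈ priors σlo σhi, Integrable (fun p : ℝ≥0 × PathSpace => Real.exp (-ρ * p.1) *
        (1 / 2 * G₂ * X p.1 p.2 ^ 2 + G₁ * X p.1 p.2 + G₀)) (timeMeasure.prod P)) ∧
      lowerExp (priors σlo σhi) (fun ω => ∫ t : ℝ≥0, Real.exp (-ρ * t) *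
        (1 / 2 * G₂ * X t ω ^ 2 + G₁ * X t ω + G₀) ∂timeMeasure) =
        1 / 2 * α₂ * x ^ 2 + α₁ * x + α₀) (y s : ℝ) (hs : s ^ 2 = (c * y + d) ^ 2 + e) :
    1 / 2 * G₂ * y ^ 2 + G₁ * y + G₀ +
      discountedGenerator σhi ρ α₀ α₁ α₂ y (a * y + b) s = 0 := by
  have ha : a < ρ := by nlinarith [sq_nonneg (c * σhi)]
  have hP := priors_mono h0 hσ hPhi
  -- This sign makes k₂ ≤ 0, so that the maximal volatility is the worst case for the solution
  -- constructed below. If G₂ were positive, the running reward and hence the payoff would be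
  -- bounded below uniformly in x, which a concave quadratic payoff with α₂ < 0 is not.
  have hG₂ : G₂ ≤ 0 := by
    by_contra hG
    rw [not_le] at hG
    have hbound : ∀ x, -(G₁ ^ 2 / (2 * G₂) + |G₀|) / ρ ≤ 1 / 2 * α₂ * x ^ 2 + α₁ * x + α₀ := by
      intro x
      obtain ⟨X, hX, hgr, hint, hpay⟩ := h x
      rw [← hpay]
      refine le_lowerExp ⟨P, hP⟩ fun P hP => ?_
      have := hP.1
      obtain ⟨s, hs, hS⟩ := hX P hP
      have hle := hS.le_integral hP hρ (q₀ := -(G₁ ^ 2 / (2 * G₂) + |G₀|) / ρ) (q₁ := 0) (q₂ := 0)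
        (Or.inl le_rfl) (liminf_growth_of_upperExpENN hgr hP)
        (g := fun p => 1 / 2 * G₂ * X p.1 p.2 ^ 2 + G₁ * X p.1 p.2 + G₀) (hint P hP)
        (ae_of_all _ fun p => by
          have h1 : 1 / 2 * G₂ * X p.1 p.2 ^ 2 + G₁ * X p.1 p.2 + G₁ ^ 2 / (2 * G₂)
              = 1 / 2 * G₂ * (X p.1 p.2 + G₁ / G₂) ^ 2 := by
            field_simp
            ring
          have h2 : 0 ≤ 1 / 2 * G₂ * (X p.1 p.2 + G₁ / G₂) ^ 2 := by positivity
          have h3 : ρ * (-(G₁ ^ 2 / (2 * G₂) + |G₀|) / ρ) = -(G₁ ^ 2 / (2 * G₂) + |G₀|) := by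
            field_simp
          have h4 := neg_abs_le G₀
          simp only [discountedGenerator, mul_zero, zero_mul, add_zero, zero_add, h3]
          linarith)
      rw [integral_integral_eq_integral_prod (hint P hP)]
      refine le_trans (le_of_eq (by ring)) hle
    set C := (G₁ ^ 2 / (2 * G₂) + |G₀|) / ρ + |α₀| with hC
    have hC0 : 0 ≤ C := by positivity
    set x := (2 * |α₁| + 2 * C + 2) / (-α₂) + 1 with hx
    have h1 := hbound x
    have hα' : 0 < -α₂ := by linarith
    have hx1 : 1 ≤ x := le_add_of_nonneg_left (by positivity)
    have hx2 : -α₂ * x ≥ 2 * |α₁| + 2 * C + 2 := by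
      have : -α₂ * x = (2 * |α₁| + 2 * C + 2) + -α₂ := by
        rw [hx, mul_add, mul_div_cancel₀ _ hα'.ne', mul_one]
      linarith
    have h2 := le_abs_self α₀
    have h3 : α₁ * x ≤ |α₁| * x := mul_le_mul_of_nonneg_right (le_abs_self _) (by linarith)
    have h4 : (2 * |α₁| + 2 * C + 2) * x ≤ -α₂ * x * x := mul_le_mul_of_nonneg_right hx2 (by linarith)
    have h5 : -(G₁ ^ 2 / (2 * G₂) + |G₀|) / ρ = -((G₁ ^ 2 / (2 * G₂) + |G₀|) / ρ) := neg_div _ _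
    nlinarith
  have hργ : 0 < ρ - (2 * a + c ^ 2 * σhi ^ 2) := by linarith
  have hρa : 0 < ρ - a := by linarith
  -- The linear equation is triangular in the coefficients of y², y and 1, with diagonal entries ρ
  -- minus the growth rate, ρ − a and ρ, all positive by stability. Evaluating the payoff with its
  -- solution identifies k with α.
  set k₂ := G₂ / (ρ - (2 * a + c ^ 2 * σhi ^ 2)) with hk₂
  set k₁ := (G₁ + k₂ * (b + σhi ^ 2 * c * d)) / (ρ - a) with hk₁
  set k₀ := (G₀ + k₁ * b + 1 / 2 * k₂ * σhi ^ 2 * (d ^ 2 + e)) / ρ with hk₀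
  have e₂ : k₂ * (ρ - (2 * a + c ^ 2 * σhi ^ 2)) = G₂ := div_mul_cancel₀ _ hργ.ne'
  have e₁ : k₁ * (ρ - a) = G₁ + k₂ * (b + σhi ^ 2 * c * d) := div_mul_cancel₀ _ hρa.ne'
  have e₀ : k₀ * ρ = G₀ + k₁ * b + 1 / 2 * k₂ * σhi ^ 2 * (d ^ 2 + e) := div_mul_cancel₀ _ hρ.ne'
  have hk : ∀ y s : ℝ, s ^ 2 = (c * y + d) ^ 2 + e → 1 / 2 * G₂ * y ^ 2 + G₁ * y + G₀ +
      discountedGenerator σhi ρ k₀ k₁ k₂ y (a * y + b) s = 0 := by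
    intro y s hs
    rw [discountedGenerator, hs]
    linear_combination (-1 / 2 * y ^ 2) * e₂ - y * e₁ - e₀
  have heq : ∀ x, 1 / 2 * α₂ * x ^ 2 + α₁ * x + α₀ = 1 / 2 * k₂ * x ^ 2 + k₁ * x + k₀ := by
    intro x
    obtain ⟨X, hX, hgr, hint, hpay⟩ := h x
    rw [← hpay]
    exact IsAffineState.lowerExp_eq h0 hσ hPhi hρ hX hgr
      (G := fun y => 1 / 2 * G₂ * y ^ 2 + G₁ * y + G₀) hint
      (div_nonpos_of_nonpos_of_nonneg hG₂ hργ.le) hk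
  have a0 : α₀ = k₀ := by simpa using heq 0
  have a1 : α₁ = k₁ := by linarith [heq 1, heq (-1)]
  have a2 : α₂ = k₂ := by linarith [heq 1, heq (-1)]
  rw [a0, a1, a2]
  exact hk y s hs

/-- Affine feedbacks have a quadratic moment generator bound for every rate above the growth rate. -/
theorem exists_generator_bound {γ' : ℝ} (h : 2 * a + c ^ 2 * σhi ^ 2 < γ') :
    ∃ C : ℝ, 0 ≤ C ∧ ∀ y s : ℝ, s ^ 2 = (c * y + d) ^ 2 + e →
      2 * y * (a * y + b) + σhi ^ 2 * s ^ 2 ≤ γ' * y ^ 2 + C := by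
  set δ := γ' - (2 * a + c ^ 2 * σhi ^ 2) with hδ
  set β := 2 * b + 2 * σhi ^ 2 * c * d with hβ
  have hδ0 : 0 < δ := by linarith
  refine ⟨β ^ 2 / (4 * δ) + |σhi ^ 2 * (d ^ 2 + e)|, by positivity, fun y s hs => ?_⟩
  have h1 : -δ * y ^ 2 + β * y - β ^ 2 / (4 * δ) = -(δ * (y - β / (2 * δ)) ^ 2) := by
    field_simp
    ring
  have h2 : 0 ≤ δ * (y - β / (2 * δ)) ^ 2 := by positivity
  have h3 := le_abs_self (σhi ^ 2 * (d ^ 2 + e))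
  rw [hs]
  have h4 : 2 * y * (a * y + b) + σhi ^ 2 * ((c * y + d) ^ 2 + e)
      = γ' * y ^ 2 + (-δ * y ^ 2 + β * y) + σhi ^ 2 * (d ^ 2 + e) := by
    rw [hδ, hβ]; ring
  linarith

/-- The rate γ' is placed strictly between the growth rate and ρ, and above 0 because the bound
divides by it. The constant depends on neither the prior nor the process, as needed for the upper
expectation. -/
theorem IsAffineState.exists_integral_sq_le {ρ : ℝ} (hρ : 0 < ρ)
    (h : 2 * a + c ^ 2 * σhi ^ 2 < ρ) : ∃ γ' : ℝ, γ' < ρ ∧ ∀ x, ∃ C : ℝ, 0 ≤ C ∧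
    ∀ P ∈ priors σlo σhi, ∀ X, IsAffineState P x a b c d e X → ∀ T : ℝ≥0,
      ∫ ω, X T ω ^ 2 ∂P ≤ C * Real.exp (γ' * T) := by
  set γ' := (max (2 * a + c ^ 2 * σhi ^ 2) 0 + ρ) / 2 with hγ
  have hm : max (2 * a + c ^ 2 * σhi ^ 2) 0 < ρ := max_lt h hρ
  have h0 : 0 < γ' := by have := le_max_right (2 * a + c ^ 2 * σhi ^ 2) 0; linarith
  have h1 : 2 * a + c ^ 2 * σhi ^ 2 < γ' := by
    have := le_max_left (2 * a + c ^ 2 * σhi ^ 2) 0; linarith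
  obtain ⟨C, hC, hb⟩ := exists_generator_bound (b := b) (d := d) (e := e) h1
  refine ⟨γ', by linarith, fun x => ⟨x ^ 2 + C / γ', by positivity, ?_⟩⟩
  rintro P hP X ⟨s, hs, hX⟩ T
  rw [mul_comm]
  exact hX.integral_sq_le hP h0 hC (fun t ω => hb _ _ (hs t ω)) T

end AffineFeedback

/-! ## Moment bounds of state processes and admissibility -/

section Admissibility

variable {Ps : Set (Measure PathSpace)} {X : ℝ≥0 → PathSpace → ℝ} {C γ ρ K : ℝ}

/-- Tonelli under each prior separately; the bound h is common to all priors, so the supremum can be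
taken afterwards. -/
theorem upperExpENN_lintegral_le {μ : Measure ℝ≥0} [SFinite μ] {f : ℝ≥0 → PathSpace → ℝ≥0∞}
    {h : ℝ≥0 → ℝ≥0∞} (hPs : ∀ P ∈ Ps, IsProbabilityMeasure P)
    (hf : Measurable fun p : ℝ≥0 × PathSpace => f p.1 p.2)
    (hle : ∀ P ∈ Ps, ∀ t, ∫⁻ ω, f t ω ∂P ≤ h t) :
    upperExpENN Ps (fun ω => ∫⁻ t, f t ω ∂μ) ≤ ∫⁻ t, h t ∂μ := by
  refine iSup₂_le fun P hP => ?_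
  have := hPs P hP
  rw [← lintegral_lintegral_swap (f := f) hf.aemeasurable]
  exact lintegral_mono fun t => hle P hP t

theorem lintegral_mul_one_add_sq_le {P : Measure PathSpace} [IsProbabilityMeasure P]
    {Y : PathSpace → ℝ} (hY : MemLp Y 2 P) {κ B : ℝ} (hκ : 0 ≤ κ) (hB : ∫ ω, Y ω ^ 2 ∂P ≤ B) :
    ∫⁻ ω, ENNReal.ofReal (κ * (1 + Y ω ^ 2)) ∂P ≤ ENNReal.ofReal (κ * (1 + B)) := by
  have hi : Integrable (fun ω => κ * (1 + Y ω ^ 2)) P :=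
    ((integrable_const 1).add hY.integrable_sq).const_mul κ
  rw [← ofReal_integral_eq_lintegral_ofReal hi (ae_of_all _ fun ω => by positivity),
    integral_const_mul, integral_add (integrable_const _) hY.integrable_sq, integral_const,
    probReal_univ, one_smul]
  exact ENNReal.ofReal_le_ofReal (by gcongr)

theorem liminf_growth_eq_zero (hPs : ∀ P ∈ Ps, ∀ t, MemLp (X t) 2 P)
    (hγ : γ < ρ)
    (h : ∀ P ∈ Ps, ∀ T : ℝ≥0, ∫ ω, X T ω ^ 2 ∂P ≤ C * Real.exp (γ * T)) :
    liminf (fun T : ℝ≥0 => ENNReal.ofReal (Real.exp (-ρ * T)) *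
      upperExpENN Ps (fun ω => ENNReal.ofReal (X T ω ^ 2))) atTop = 0 := by
  refine Tendsto.liminf_eq ?_
  have hlim : Tendsto (fun T : ℝ≥0 => ENNReal.ofReal (C * Real.exp (-(ρ - γ) * T))) atTop (𝓝 0) := by
    have h1 : Tendsto (fun T : ℝ≥0 => C * Real.exp (-(ρ - γ) * T)) atTop (𝓝 (C * 0)) := by
      refine Tendsto.const_mul _ (Real.tendsto_exp_atBot.comp ?_)
      exact (NNReal.tendsto_coe_atTop.2 tendsto_id).const_mul_atTop_of_neg (by linarith)
    simpa using ENNReal.tendsto_ofReal h1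
  refine tendsto_of_tendsto_of_tendsto_of_le_of_le tendsto_const_nhds hlim (fun _ => zero_le)
    fun T => ?_
  have hle : upperExpENN Ps (fun ω => ENNReal.ofReal (X T ω ^ 2)) ≤
      ENNReal.ofReal (C * Real.exp (γ * T)) := by
    refine iSup₂_le fun P hP => ?_
    rw [← ofReal_integral_eq_lintegral_ofReal (hPs P hP T).integrable_sq
      (ae_of_all _ fun ω => sq_nonneg _)]
    exact ENNReal.ofReal_le_ofReal (h P hP T)
  calc _ ≤ ENNReal.ofReal (Real.exp (-ρ * T)) * ENNReal.ofReal (C * Real.exp (γ * T)) := by gcongr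
    _ = ENNReal.ofReal (C * Real.exp (-(ρ - γ) * T)) := by
      rw [← ENNReal.ofReal_mul (Real.exp_pos _).le]
      congr 1
      rw [mul_left_comm, ← Real.exp_add]
      congr 2
      ring

theorem upperExpENN_discounted_lt_top (hPs : ∀ P ∈ Ps, IsProbabilityMeasure P)
    (hX : Measurable fun p : ℝ≥0 × PathSpace => X p.1 p.2)
    (hX2 : ∀ P ∈ Ps, ∀ t, MemLp (X t) 2 P) (hρ : 0 < ρ) (hγ : γ < ρ) (hK : 0 ≤ K)
    (h : ∀ P ∈ Ps, ∀ T : ℝ≥0, ∫ ω, X T ω ^ 2 ∂P ≤ C * Real.exp (γ * T))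
    {g : ℝ≥0 → PathSpace → ℝ} (hg : ∀ t ω, |g t ω| ≤ K * (1 + X t ω ^ 2)) :
    upperExpENN Ps (fun ω => ∫⁻ t : ℝ≥0,
      ENNReal.ofReal (Real.exp (-ρ * t) * |g t ω|) ∂timeMeasure) < ∞ := by
  have h1 : upperExpENN Ps (fun ω => ∫⁻ t : ℝ≥0,
      ENNReal.ofReal (Real.exp (-ρ * t) * |g t ω|) ∂timeMeasure) ≤
      upperExpENN Ps (fun ω => ∫⁻ t : ℝ≥0,
      ENNReal.ofReal (Real.exp (-ρ * t) * K * (1 + X t ω ^ 2)) ∂timeMeasure) := by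
    refine iSup₂_mono fun P hP => lintegral_mono fun ω => lintegral_mono fun t => ?_
    refine ENNReal.ofReal_le_ofReal ?_
    rw [mul_assoc]
    exact mul_le_mul_of_nonneg_left (hg t ω) (Real.exp_pos _).le
  have h2 := upperExpENN_lintegral_le (Ps := Ps) (μ := timeMeasure)
    (f := fun t ω => ENNReal.ofReal (Real.exp (-ρ * t) * K * (1 + X t ω ^ 2)))
    (h := fun t => ENNReal.ofReal (Real.exp (-ρ * t) * K * (1 + C * Real.exp (γ * t)))) hPs
    (by fun_prop) (fun P hP t => by
      have := hPs P hP
      exact lintegral_mul_one_add_sq_le (hX2 P hP t) (by positivity) (h P hP t))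
  refine (h1.trans h2).trans_lt ?_
  have hint : Integrable (fun t : ℝ≥0 => Real.exp (-ρ * t) * K * (1 + C * Real.exp (γ * t)))
      timeMeasure := by
    have i1 := (integrable_exp_neg_timeMeasure hρ).const_mul K
    have i2 := (integrable_exp_neg_timeMeasure (sub_pos.2 hγ)).const_mul (K * C)
    refine (i1.add i2).congr (ae_of_all _ fun t => ?_)
    have he : Real.exp (-(ρ - γ) * t) = Real.exp (-ρ * t) * Real.exp (γ * t) := by
      rw [← Real.exp_add]; congr 1; ring
    simp only [Pi.add_apply, he]
    ring
  exact hint.lintegral_lt_top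

theorem upperExpENN_Iic_lt_top (hPs : ∀ P ∈ Ps, IsProbabilityMeasure P)
    (hX : Measurable fun p : ℝ≥0 × PathSpace => X p.1 p.2)
    (hX2 : ∀ P ∈ Ps, ∀ t, MemLp (X t) 2 P) (hK : 0 ≤ K)
    (h : ∀ P ∈ Ps, ∀ T : ℝ≥0, ∫ ω, X T ω ^ 2 ∂P ≤ C * Real.exp (γ * T))
    {g : ℝ≥0 → PathSpace → ℝ≥0∞} (hg : ∀ t ω, g t ω ≤ ENNReal.ofReal (K * (1 + X t ω ^ 2)))
    (T : ℝ≥0) :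
    upperExpENN Ps (fun ω => ∫⁻ t in Set.Iic T, g t ω ∂timeMeasure) < ∞ := by
  have h1 : upperExpENN Ps (fun ω => ∫⁻ t in Set.Iic T, g t ω ∂timeMeasure) ≤
      upperExpENN Ps (fun ω => ∫⁻ t in Set.Iic T,
      ENNReal.ofReal (K * (1 + X t ω ^ 2)) ∂timeMeasure) :=
    iSup₂_mono fun P hP => lintegral_mono fun ω => lintegral_mono fun t => hg t ω
  have h2 := upperExpENN_lintegral_le (Ps := Ps) (μ := timeMeasure.restrict (Set.Iic T))
    (f := fun t ω => ENNReal.ofReal (K * (1 + X t ω ^ 2)))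
    (h := fun t => ENNReal.ofReal (K * (1 + C * Real.exp (γ * t)))) hPs
    (by fun_prop) (fun P hP t => by
      have := hPs P hP
      exact lintegral_mul_one_add_sq_le (hX2 P hP t) hK (h P hP t))
  refine (h1.trans h2).trans_lt ?_
  have hc : Continuous fun t : ℝ≥0 => K * (1 + C * Real.exp (γ * t)) := by fun_prop
  have hint : Integrable (fun t : ℝ≥0 => K * (1 + C * Real.exp (γ * t)))
      (timeMeasure.restrict (Set.Iic T)) := by
    obtain ⟨M, hM⟩ := (isCompact_Icc (a := (0 : ℝ≥0)) (b := T)).exists_bound_of_continuousOn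
      hc.continuousOn
    refine Integrable.of_bound (C := M) hc.aestronglyMeasurable ?_
    filter_upwards [ae_restrict_mem measurableSet_Iic] with t ht
    exact hM t ⟨zero_le, ht⟩
  exact hint.lintegral_lt_top

theorem IsStrongSolution.isState {x : ℝ} {b s : ℝ≥0 → PathSpace → ℝ}
    (h : IsStrongSolution Ps x b s X) {P : Measure PathSpace} (hP : P ∈ Ps)
    (hb : ∀ᵐ r ∂timeMeasure, AEStronglyMeasurable[pathFiltration r] (b r) P) :
    IsState P x b s X :=
  ⟨measurable_of_isStronglyProgressive h.progressive, h.drift_memLp P hP, hb, h.equation P hP⟩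

theorem IsStrongSolution.isAffineState {x a b c d e : ℝ} {β s : ℝ≥0 → PathSpace → ℝ}
    (h : IsStrongSolution Ps x β s X) (hb : ∀ t ω, β t ω = a * X t ω + b)
    (hs : ∀ t ω, s t ω ^ 2 = (c * X t ω + d) ^ 2 + e) {P : Measure PathSpace} (hP : P ∈ Ps) :
    IsAffineState P x a b c d e X := by
  obtain rfl : β = fun t ω => a * X t ω + b := by ext t ω; exact hb t ω
  refine ⟨s, hs, h.isState hP (ae_of_all _ fun r => ?_)⟩
  have hX := h.progressive.stronglyAdapted r
  exact ((hX.const_mul a).add stronglyMeasurable_const).aestronglyMeasurable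

theorem IsStrongSolution.congr {x : ℝ} {b s b' s' : ℝ≥0 → PathSpace → ℝ}
    (h : IsStrongSolution Ps x b s X) (hb : ∀ t ω, b' t ω = b t ω) (hs : ∀ t ω, s' t ω = s t ω) :
    IsStrongSolution Ps x b' s' X := by
  obtain rfl : b' = b := by ext t ω; exact hb t ω
  obtain rfl : s' = s := by ext t ω; exact hs t ω
  exact h

end Admissibility

/-! ## Integrals against normal densities -/

section Gaussian

variable {μ : ℝ} {v : ℝ≥0}

theorem integrable_gaussianPDFReal_mul_iff (hv : v ≠ 0) {f : ℝ → ℝ} :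
    Integrable (fun u => f u * gaussianPDFReal μ v u) ↔ Integrable f (gaussianReal μ v) := by
  rw [gaussianReal_of_var_ne_zero μ hv, integrable_withDensity_iff_integrable_smul₀'
    (measurable_gaussianPDF μ v).aemeasurable (ae_of_all _ fun u => gaussianPDF_lt_top)]
  simp only [toReal_gaussianPDF, smul_eq_mul, mul_comm]

theorem integral_mul_gaussianPDFReal (hv : v ≠ 0) (f : ℝ → ℝ) :
    ∫ u, f u * gaussianPDFReal μ v u = ∫ u, f u ∂gaussianReal μ v := by
  rw [integral_gaussianReal_eq_integral_smul hv]
  simp only [smul_eq_mul, mul_comm]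

theorem integrable_quadratic_gaussianReal (p₀ p₁ p₂ : ℝ) :
    Integrable (fun u => p₀ + p₁ * u + p₂ * u ^ 2) (gaussianReal μ v) := by
  have h1 : MemLp (fun u : ℝ => u) 2 (gaussianReal μ v) := memLp_id_gaussianReal 2
  exact ((integrable_const p₀).add ((h1.integrable one_le_two).const_mul p₁)).add
    (h1.integrable_sq.const_mul p₂)

theorem integral_sq_gaussianReal : ∫ u, u ^ 2 ∂gaussianReal μ v = μ ^ 2 + v := by
  have h1 : MemLp (fun u : ℝ => u) 2 (gaussianReal μ v) := memLp_id_gaussianReal 2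
  have h := variance_eq_sub h1
  rw [variance_fun_id_gaussianReal, integral_id_gaussianReal] at h
  have h2 : ∫ u, ((fun u : ℝ => u) ^ 2) u ∂gaussianReal μ v = ∫ u, u ^ 2 ∂gaussianReal μ v := rfl
  rw [h2] at h
  linarith

theorem integral_quadratic_gaussianReal (p₀ p₁ p₂ : ℝ) :
    ∫ u, (p₀ + p₁ * u + p₂ * u ^ 2) ∂gaussianReal μ v = p₀ + p₁ * μ + p₂ * (μ ^ 2 + v) := by
  have h1 : MemLp (fun u : ℝ => u) 2 (gaussianReal μ v) := memLp_id_gaussianReal 2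
  have i1 : Integrable (fun u : ℝ => p₁ * u) (gaussianReal μ v) :=
    (h1.integrable one_le_two).const_mul p₁
  have i2 : Integrable (fun u : ℝ => p₂ * u ^ 2) (gaussianReal μ v) := h1.integrable_sq.const_mul p₂
  have i3 : Integrable (fun u : ℝ => p₀ + p₁ * u) (gaussianReal μ v) := (integrable_const p₀).add i1
  rw [integral_add i3 i2, integral_add (integrable_const p₀) i1, integral_const_mul,
    integral_const_mul, integral_id_gaussianReal, integral_sq_gaussianReal]
  simp

theorem log_gaussianPDFReal (hv : v ≠ 0) (u : ℝ) :
    Real.log (gaussianPDFReal μ v u) =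
      (-(1 / 2 * Real.log (2 * Real.pi * v)) - μ ^ 2 / (2 * v)) + μ / v * u
        + -(1 / (2 * v)) * u ^ 2 := by
  have hv' : (0 : ℝ) < v := by exact_mod_cast pos_of_ne_zero hv
  rw [gaussianPDFReal, Real.log_mul (by positivity) (Real.exp_pos _).ne', Real.log_exp, Real.log_inv,
    Real.log_sqrt (by positivity)]
  field_simp
  ring

theorem integrable_gaussianPDFReal_mul_log (hv : v ≠ 0) :
    Integrable fun u => gaussianPDFReal μ v u * Real.log (gaussianPDFReal μ v u) := by
  simp_rw [mul_comm (gaussianPDFReal μ v _)]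
  rw [integrable_gaussianPDFReal_mul_iff hv]
  simp_rw [log_gaussianPDFReal hv]
  exact integrable_quadratic_gaussianReal _ _ _

theorem negEntropy_gaussianPDFReal (hv : v ≠ 0) :
    LQModel.negEntropy (gaussianPDFReal μ v) = -(1 / 2 * Real.log (2 * Real.pi * Real.exp 1 * v)) := by
  have hv' : (0 : ℝ) < v := by exact_mod_cast pos_of_ne_zero hv
  rw [LQModel.negEntropy]
  simp_rw [mul_comm (gaussianPDFReal μ v _)]
  rw [integral_mul_gaussianPDFReal hv]
  simp_rw [log_gaussianPDFReal hv]
  rw [integral_quadratic_gaussianReal]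
  have : Real.log (2 * Real.pi * Real.exp 1 * v) = Real.log (2 * Real.pi * v) + 1 := by
    rw [mul_right_comm, Real.log_mul (by positivity) (Real.exp_pos _).ne', Real.log_exp]
  rw [this]
  field_simp
  ring

theorem isDensity_gaussianPDFReal (hv : v ≠ 0) : LQModel.IsDensity (gaussianPDFReal μ v) :=
  ⟨(measurable_gaussianPDFReal μ v).aemeasurable, ae_of_all _ fun u => gaussianPDFReal_nonneg μ v u,
    integral_gaussianPDFReal_eq_one μ hv⟩

end Gaussian

/-! ## The closed loop of the feedback laws -/

namespace LQModel

variable (m : LQModel) (α₀ α₁ α₂ : ℝ)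

theorem σhi_pos : 0 < m.σhi := m.σlo_pos.trans_le m.σlo_le_σhi

/-- Slope of the feedback law. -/
def slope : ℝ := (α₂ * (m.F + m.C * m.D * m.σhi ^ 2) - m.I) / m.curvature α₂

/-- Intercept of the feedback law. -/
def intercept : ℝ := (α₁ * m.F - m.Q) / m.curvature α₂

theorem feedback_eq (y : ℝ) : m.feedback α₁ α₂ y = m.slope α₂ * y + m.intercept α₁ α₂ := by
  rw [feedback, slope, intercept]
  ring

/-- Linear drift coefficient of the closed loop. -/
def loopDrift : ℝ := m.A + m.F * m.slope α₂

/-- Linear volatility coefficient of the closed loop. -/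
def loopVol : ℝ := m.C + m.D * m.slope α₂

/-- Variance of the randomized feedback law. -/
def loopVar : ℝ := m.lam / m.curvature α₂

theorem drift_feedback (y : ℝ) : m.drift y (m.feedback α₁ α₂ y) =
    m.loopDrift α₂ * y + m.F * m.intercept α₁ α₂ := by
  rw [drift, feedback_eq, loopDrift]
  ring

theorem vol_feedback (y : ℝ) : m.vol y (m.feedback α₁ α₂ y) =
    m.loopVol α₂ * y + m.D * m.intercept α₁ α₂ := by
  rw [vol, feedback_eq, loopVol]
  ring

variable {α₂} in
theorem curvature_pos (hα : α₂ < 0) : 0 < m.curvature α₂ := by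
  have h := m.K_pos
  have : 0 ≤ -α₂ * (m.D ^ 2 * m.σhi ^ 2) := mul_nonneg (by linarith) (by positivity)
  rw [curvature]
  linarith

variable {α₂} in
theorem loopVar_pos (hα : α₂ < 0) : 0 < m.loopVar α₂ := div_pos m.lam_pos (m.curvature_pos hα)

/-- Coefficients of the reward of the feedback law. -/
def loopReward₂ : ℝ := -(m.M + 2 * m.I * m.slope α₂ + m.K * m.slope α₂ ^ 2)

def loopReward₁ : ℝ := -(m.I * m.intercept α₁ α₂ + m.K * m.slope α₂ * m.intercept α₁ α₂ + m.P +
  m.Q * m.slope α₂)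

def loopReward₀ : ℝ := -(m.K / 2 * m.intercept α₁ α₂ ^ 2 + m.Q * m.intercept α₁ α₂)

theorem reward_feedback (y : ℝ) : m.reward y (m.feedback α₁ α₂ y) =
    1 / 2 * m.loopReward₂ α₂ * y ^ 2 + m.loopReward₁ α₁ α₂ * y + m.loopReward₀ α₁ α₂ := by
  rw [reward, feedback_eq, loopReward₂, loopReward₁, loopReward₀]
  ring

/-! ### Moments and entropy of the randomized feedback law -/

section Randomized

variable {α₂} (hα : α₂ < 0) (y : ℝ)
include hα

theorem loopVar_toNNReal_ne_zero : (m.lam / m.curvature α₂).toNNReal ≠ 0 :=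
  (Real.toNNReal_pos.2 (m.loopVar_pos hα)).ne'

theorem coe_loopVar : ((m.lam / m.curvature α₂).toNNReal : ℝ) = m.loopVar α₂ :=
  Real.coe_toNNReal _ (m.loopVar_pos hα).le

theorem exploratoryDrift_randomizedFeedback :
    m.exploratoryDrift y (m.randomizedFeedback α₁ α₂ y) =
      m.loopDrift α₂ * y + m.F * m.intercept α₁ α₂ := by
  rw [exploratoryDrift, randomizedFeedback,
    integral_mul_gaussianPDFReal (m.loopVar_toNNReal_ne_zero hα)]
  have h : ∀ u, m.drift y u = m.A * y + m.F * u + 0 * u ^ 2 := fun u => by rw [drift]; ring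
  simp_rw [h]
  rw [integral_quadratic_gaussianReal, ← m.drift_feedback, drift]
  ring

theorem exploratoryVol_randomizedFeedback_sq :
    m.exploratoryVol y (m.randomizedFeedback α₁ α₂ y) ^ 2 =
      (m.loopVol α₂ * y + m.D * m.intercept α₁ α₂) ^ 2 + m.D ^ 2 * m.loopVar α₂ := by
  have h1 : ∫ u, m.vol y u ^ 2 * m.randomizedFeedback α₁ α₂ y u =
      (m.loopVol α₂ * y + m.D * m.intercept α₁ α₂) ^ 2 + m.D ^ 2 * m.loopVar α₂ := by
    rw [randomizedFeedback, integral_mul_gaussianPDFReal (m.loopVar_toNNReal_ne_zero hα)]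
    have h : ∀ u, m.vol y u ^ 2 = (m.C * y) ^ 2 + 2 * m.C * y * m.D * u + m.D ^ 2 * u ^ 2 :=
      fun u => by rw [vol]; ring
    simp_rw [h]
    rw [integral_quadratic_gaussianReal, ← m.vol_feedback, vol, m.coe_loopVar hα]
    ring
  rw [exploratoryVol, h1, Real.sq_sqrt]
  have := (m.loopVar_pos hα).le
  positivity

theorem exploratoryReward_randomizedFeedback :
    m.exploratoryReward y (m.randomizedFeedback α₁ α₂ y) =
      m.reward y (m.feedback α₁ α₂ y) - m.K / 2 * m.loopVar α₂ := by
  rw [exploratoryReward, randomizedFeedback,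
    integral_mul_gaussianPDFReal (m.loopVar_toNNReal_ne_zero hα)]
  have h : ∀ u, m.reward y u = -(m.M / 2 * y ^ 2 + m.P * y) + -(m.I * y + m.Q) * u
      + -(m.K / 2) * u ^ 2 := fun u => by rw [reward]; ring
  simp_rw [h]
  rw [integral_quadratic_gaussianReal, m.coe_loopVar hα]
  ring

theorem negEntropy_randomizedFeedback :
    negEntropy (m.randomizedFeedback α₁ α₂ y) =
      -(1 / 2 * Real.log (2 * Real.pi * Real.exp 1 * m.lam / m.curvature α₂)) := by
  rw [randomizedFeedback, negEntropy_gaussianPDFReal (m.loopVar_toNNReal_ne_zero hα),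
    m.coe_loopVar hα, loopVar, mul_div_assoc (2 * Real.pi * Real.exp 1)]

theorem runningReward_randomizedFeedback :
    m.runningReward y (m.randomizedFeedback α₁ α₂ y) =
      m.reward y (m.feedback α₁ α₂ y) - m.K / 2 * m.loopVar α₂ +
        m.lam / 2 * Real.log (2 * Real.pi * Real.exp 1 * m.lam / m.curvature α₂) := by
  rw [runningReward, m.exploratoryReward_randomizedFeedback α₁ hα,
    m.negEntropy_randomizedFeedback α₁ hα]
  ring

end Randomized

/-- The entropy term of the exploratory value function. -/
def entropyBonus : ℝ := m.lam / (2 * m.ρ) *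
  (Real.log (2 * Real.pi * Real.exp 1 * m.lam / m.curvature α₂) - 1)

/-- The Riccati identity: the quadratic function solves the Hamilton–Jacobi–Bellman equation with
equality at the feedback law. -/
def FeedbackEquation : Prop := ∀ y : ℝ, m.reward y (m.feedback α₁ α₂ y) +
  discountedGenerator m.σhi m.ρ α₀ α₁ α₂ y (m.drift y (m.feedback α₁ α₂ y))
    (m.vol y (m.feedback α₁ α₂ y)) = 0

/-- The closed loop is stable with respect to discounting. -/
def StableLoop : Prop := 2 * m.loopDrift α₂ + m.loopVol α₂ ^ 2 * m.σhi ^ 2 < m.ρ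

variable {α₂} in
/-- The two closed loops have the same reward up to the entropy bonus. -/
theorem feedback_reward_add_generator (hα : α₂ < 0) (y s s' : ℝ)
    (hs : s ^ 2 = (m.loopVol α₂ * y + m.D * m.intercept α₁ α₂) ^ 2 + m.D ^ 2 * m.loopVar α₂)
    (hs' : s' ^ 2 = (m.loopVol α₂ * y + m.D * m.intercept α₁ α₂) ^ 2) (b : ℝ) :
    m.runningReward y (m.randomizedFeedback α₁ α₂ y) +
      discountedGenerator m.σhi m.ρ (α₀ + m.entropyBonus α₂) α₁ α₂ y b s =
    m.reward y (m.feedback α₁ α₂ y) + discountedGenerator m.σhi m.ρ α₀ α₁ α₂ y b s' := by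
  have hκ := m.curvature_pos hα
  have hρ := m.ρ_pos
  -- The variance changes the reward by −K/2 · `loopVar` and, through the additional squared
  -- volatility, the generator by ½ α₂ D² σhi² · `loopVar`. Their sum is −½ `loopVar` · `curvature`
  -- = −lam/2, the −1 in the entropy bonus.
  have h1 : m.loopVar α₂ * (m.K - α₂ * m.D ^ 2 * m.σhi ^ 2) = m.lam := by
    rw [loopVar, ← curvature, div_mul_cancel₀ _ hκ.ne']
  have h2 : m.ρ * m.entropyBonus α₂ = m.lam / 2 *
      (Real.log (2 * Real.pi * Real.exp 1 * m.lam / m.curvature α₂) - 1) := by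
    rw [entropyBonus]
    field_simp
  rw [m.runningReward_randomizedFeedback α₁ hα, discountedGenerator, discountedGenerator, hs, hs']
  linear_combination (-1 / 2) * h1 - h2

/-! ### Stability and the Riccati identity from either hypothesis -/

variable {m α₀ α₁ α₂}

theorem isAffineState_of_classicalAdmissible {x : ℝ} {X : ℝ≥0 → PathSpace → ℝ}
    (h : m.ClassicalAdmissible x (m.generatedControl α₁ α₂ X) X) {P : Measure PathSpace}
    (hP : P ∈ m.priorSet) : IsAffineState P x (m.loopDrift α₂) (m.F * m.intercept α₁ α₂)
      (m.loopVol α₂) (m.D * m.intercept α₁ α₂) 0 X :=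
  h.state.isAffineState (fun _ _ => m.drift_feedback α₁ α₂ _)
    (fun _ _ => by rw [add_zero, ← m.vol_feedback]; rfl) hP

theorem isAffineState_of_exploratoryAdmissible (hα : α₂ < 0) {x : ℝ} {X : ℝ≥0 → PathSpace → ℝ}
    (h : m.ExploratoryAdmissible x (m.generatedRandomizedControl α₁ α₂ X) X) {P : Measure PathSpace}
    (hP : P ∈ m.priorSet) : IsAffineState P x (m.loopDrift α₂) (m.F * m.intercept α₁ α₂)
      (m.loopVol α₂) (m.D * m.intercept α₁ α₂) (m.D ^ 2 * m.loopVar α₂) X :=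
  h.state.isAffineState (fun _ _ => m.exploratoryDrift_randomizedFeedback α₁ hα _)
    (fun _ _ => m.exploratoryVol_randomizedFeedback_sq α₁ hα _) hP

/-- Only the payoff and the growth of the feedback itself are used here: admissibility from every x
gives stability, and knowledge of the payoff at every x determines the linear equation it solves. -/
theorem stableLoop_and_feedbackEquation_of_classical (h : m.ClassicalSolution α₀ α₁ α₂) :
    m.StableLoop α₂ ∧ m.FeedbackEquation α₀ α₁ α₂ := by
  obtain ⟨hα, h⟩ := h
  obtain ⟨Phi, hPhi⟩ := exists_mem_priors m.σhi_pos.ne'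
  have hP : Phi ∈ m.priorSet := priors_mono m.σlo_pos.le m.σlo_le_σhi hPhi
  have hstab : m.StableLoop α₂ := by
    refine growth_rate_lt (b := m.F * m.intercept α₁ α₂) (d := m.D * m.intercept α₁ α₂) (e := 0)
      m.ρ_pos le_rfl hPhi fun x => ?_
    obtain ⟨X, hX, -⟩ := (h x).2
    exact ⟨X, isAffineState_of_classicalAdmissible hX hP, liminf_growth_of_upperExpENN hX.growth hP⟩
  refine ⟨hstab, fun y => ?_⟩
  rw [m.reward_feedback, m.drift_feedback]
  refine generator_eq_of_payoff_eq (e := 0) m.σlo_pos.le m.σlo_le_σhi hPhi m.ρ_pos hstab hα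
    (fun x => ?_) y _ (by rw [add_zero, m.vol_feedback])
  obtain ⟨X, hX, hgr⟩ := (h x).2
  refine ⟨X, fun P hP => isAffineState_of_classicalAdmissible hX hP, hX.growth, fun P hP => ?_, ?_⟩
  · have := hP.1
    have hm := measurable_of_isStronglyProgressive hX.state.progressive
    simp only [← m.reward_feedback]
    refine integrable_prod_of_upperExpENN
      (g := fun t ω => m.reward (X t ω) (m.feedback α₁ α₂ (X t ω))) ?_ hX.reward_finite hP
    simp only [m.reward_feedback]
    exact Measurable.aestronglyMeasurable (by fun_prop)
  · simp only [← m.reward_feedback]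
    exact hgr.isLUB.unique (h x).1

/-- The randomized loop is again affine, with the extra squared volatility D² · `loopVar`. Its
growth rate is that of the classical loop, since this constant does not enter the rate. -/
theorem stableLoop_and_feedbackEquation_of_exploratory (h : m.ExploratorySolution α₀ α₁ α₂) :
    m.StableLoop α₂ ∧ m.FeedbackEquation α₀ α₁ α₂ := by
  obtain ⟨hα, h⟩ := h
  obtain ⟨Phi, hPhi⟩ := exists_mem_priors m.σhi_pos.ne'
  have hP : Phi ∈ m.priorSet := priors_mono m.σlo_pos.le m.σlo_le_σhi hPhi
  have he : 0 ≤ m.D ^ 2 * m.loopVar α₂ := mul_nonneg (sq_nonneg _) (m.loopVar_pos hα).le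
  have hstab : m.StableLoop α₂ := by
    refine growth_rate_lt (b := m.F * m.intercept α₁ α₂) (d := m.D * m.intercept α₁ α₂) m.ρ_pos he hPhi fun x => ?_
    obtain ⟨X, hX, -⟩ := (h x).2
    exact ⟨X, isAffineState_of_exploratoryAdmissible hα hX hP,
      liminf_growth_of_upperExpENN hX.growth hP⟩
  refine ⟨hstab, fun y => ?_⟩
  set G₀ := m.loopReward₀ α₁ α₂ - m.K / 2 * m.loopVar α₂ +
    m.lam / 2 * Real.log (2 * Real.pi * Real.exp 1 * m.lam / m.curvature α₂) with hG₀
  have hG : ∀ y, 1 / 2 * m.loopReward₂ α₂ * y ^ 2 + m.loopReward₁ α₁ α₂ * y + G₀ =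
      m.runningReward y (m.randomizedFeedback α₁ α₂ y) := by
    intro y
    rw [m.runningReward_randomizedFeedback α₁ hα, m.reward_feedback, hG₀]
    ring
  -- The classical identity is traded for the exploratory one with constant term α₀ +
  -- `entropyBonus`, which is the one that the exploratory payoff determines.
  rw [← m.feedback_reward_add_generator α₀ α₁ hα y
    (m.exploratoryVol y (m.randomizedFeedback α₁ α₂ y)) _
    (m.exploratoryVol_randomizedFeedback_sq α₁ hα y) (by rw [m.vol_feedback]), ← hG,
    m.drift_feedback]
  refine generator_eq_of_payoff_eq m.σlo_pos.le m.σlo_le_σhi hPhi m.ρ_pos hstab hα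
    (fun x => ?_) y _ (m.exploratoryVol_randomizedFeedback_sq α₁ hα y)
  obtain ⟨X, hX, hgr⟩ := (h x).2
  refine ⟨X, fun P hP => isAffineState_of_exploratoryAdmissible hα hX hP, hX.growth,
    fun P hP => ?_, ?_⟩
  · have := hP.1
    simp only [hG]
    exact integrable_prod_of_upperExpENN
      (g := fun t ω => m.runningReward (X t ω) (m.randomizedFeedback α₁ α₂ (X t ω)))
      (hX.reward_measurable P hP) hX.reward_finite hP
  · simp only [hG]
    have := hgr.isLUB.unique (h x).1
    rw [← add_assoc]
    exact this

end LQModel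

/-! ## Density-valued processes -/

section Density

/-- Lebesgue differentiation along balls that contain x without being centred at it allows rational
centres and radii 1/(n+1). With countably many balls, nonnegativity becomes a measurable condition
on a parameter. -/
theorem ae_nonneg_of_forall_setIntegral_closedBall_nonneg {f : ℝ → ℝ} (hf : Integrable f)
    (h : ∀ q r : ℚ, 0 ≤ ∫ u in Metric.closedBall (q : ℝ) r, f u) : ∀ᵐ u, 0 ≤ f u := by
  have hleb := IsUnifLocDoublingMeasure.ae_tendsto_average (μ := (volume : Measure ℝ))
    hf.locallyIntegrable 1
  filter_upwards [hleb] with x hx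
  have hδ : ∀ n : ℕ, ∃ q : ℚ, |x - q| < 1 / ((n : ℝ) + 1) := fun n => by
    obtain ⟨q, hq⟩ := Rat.denseRange_cast.exists_dist_lt x (ε := 1 / ((n : ℝ) + 1)) (by positivity)
    exact ⟨q, hq⟩
  choose q hq using hδ
  have hlim := hx (fun n => (q n : ℝ)) (fun n : ℕ => 1 / ((n : ℝ) + 1))
    (tendsto_nhdsWithin_iff.2 ⟨tendsto_one_div_add_atTop_nhds_zero_nat,
      Eventually.of_forall fun n => by simp only [Set.mem_Ioi]; positivity⟩)
    (Eventually.of_forall fun n => by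
      rw [one_mul, Metric.mem_closedBall, Real.dist_eq]
      exact (hq n).le)
  refine ge_of_tendsto' hlim fun n => ?_
  rw [setAverage_eq, smul_eq_mul]
  refine mul_nonneg (by positivity) ?_
  have := h (q n) (1 / ((n : ℚ) + 1))
  push_cast at this
  exact this

/-- The indices at which a family of functions consists of probability densities, described through
countably many integrals. -/
def densitySet {Ω' : Type*} (θ : Ω' → ℝ → ℝ) : Set Ω' :=
  {z | ∫ u in Set.univ, θ z u = 1 ∧ ∀ q r : ℚ, 0 ≤ ∫ u in Metric.closedBall (q : ℝ) r, θ z u}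

variable {Ω' : Type*} {θ : Ω' → ℝ → ℝ}

/-- Total integral 1 already forces integrability, and thus measurability, because a nonintegrable
function has integral 0 by default. -/
theorem mem_densitySet_iff {z : Ω'} : z ∈ densitySet θ ↔ LQModel.IsDensity (θ z) := by
  constructor
  · rintro ⟨h1, h2⟩
    rw [Measure.restrict_univ] at h1
    have hi : Integrable (θ z) := by
      by_contra hc
      rw [integral_undef hc] at h1
      exact zero_ne_one h1
    exact ⟨hi.1.aemeasurable, ae_nonneg_of_forall_setIntegral_closedBall_nonneg hi h2, h1⟩
  · rintro ⟨-, h2, h3⟩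
    refine ⟨by rwa [Measure.restrict_univ], fun q r => ?_⟩
    exact integral_nonneg_of_ae (ae_restrict_of_ae h2)

theorem LQModel.IsDensity.integrable {f : ℝ → ℝ} (h : LQModel.IsDensity f) : Integrable f := by
  by_contra hc
  have h1 := h.2.2
  rw [integral_undef hc] at h1
  exact zero_ne_one h1

variable {mΩ : MeasurableSpace Ω'}

theorem measurableSet_densitySet
    (hθ : ∀ S, MeasurableSet S → Measurable fun z => ∫ u in S, θ z u) :
    MeasurableSet (densitySet θ) := by
  have h : densitySet θ = {z | ∫ u in Set.univ, θ z u = 1} ∩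
      ⋂ (q : ℚ) (r : ℚ), {z | 0 ≤ ∫ u in Metric.closedBall (q : ℝ) r, θ z u} := by
    ext z
    simp [densitySet]
  rw [h]
  refine (measurableSet_eq_fun (hθ _ MeasurableSet.univ) measurable_const).inter ?_
  exact MeasurableSet.iInter fun q => MeasurableSet.iInter fun r =>
    measurableSet_le measurable_const (hθ _ Metric.isClosed_closedBall.measurableSet)

/-- The Markov kernel with the given densities. -/
theorem exists_kernel_of_density
    (hθ : ∀ S, MeasurableSet S → Measurable fun z => ∫ u in S, θ z u) :
    ∃ κ : Kernel Ω' ℝ, ∀ z ∈ densitySet θ,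
      κ z = volume.withDensity (fun u => ENNReal.ofReal (θ z u)) := by
  classical
  let κ : Ω' → Measure ℝ := fun z =>
    if z ∈ densitySet θ then volume.withDensity (fun u => ENNReal.ofReal (θ z u)) else 0
  refine ⟨⟨κ, Measure.measurable_of_measurable_coe _ fun S hS => ?_⟩, fun z hz => if_pos hz⟩
  have h : (fun z => κ z S) = (densitySet θ).indicator
      (fun z => ENNReal.ofReal (∫ u in S, θ z u)) := by
    ext z
    by_cases hz : z ∈ densitySet θ
    · have hd := mem_densitySet_iff.1 hz
      simp only [κ, if_pos hz, Set.indicator_of_mem hz]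
      rw [withDensity_apply _ hS, ofReal_integral_eq_lintegral_ofReal hd.integrable.integrableOn
        (ae_restrict_of_ae hd.2.1)]
    · simp [κ, if_neg hz, Set.indicator_of_notMem hz]
  rw [h]
  exact (hθ S hS).ennreal_ofReal.indicator (measurableSet_densitySet hθ)

theorem lintegral_kernel_of_density {κ : Kernel Ω' ℝ} {z : Ω'} (hz : z ∈ densitySet θ)
    (hκ : κ z = volume.withDensity (fun u => ENNReal.ofReal (θ z u))) {f : ℝ → ℝ}
    (hf : Measurable f) (hf0 : ∀ u, 0 ≤ f u) :
    ∫⁻ u, ENNReal.ofReal (f u) ∂κ z = ∫⁻ u, ENNReal.ofReal (f u * θ z u) := by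
  have hd := mem_densitySet_iff.1 hz
  rw [hκ, lintegral_withDensity_eq_lintegral_mul₀ hd.1.ennreal_ofReal
    hf.ennreal_ofReal.aemeasurable]
  refine lintegral_congr fun u => ?_
  rw [Pi.mul_apply, mul_comm, ENNReal.ofReal_mul (hf0 u)]

theorem integral_kernel_of_density {κ : Kernel Ω' ℝ} {z : Ω'} (hz : z ∈ densitySet θ)
    (hκ : κ z = volume.withDensity (fun u => ENNReal.ofReal (θ z u))) (f : ℝ → ℝ) :
    ∫ u, f u ∂κ z = ∫ u, f u * θ z u := by
  have hd := mem_densitySet_iff.1 hz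
  rw [hκ, integral_withDensity_eq_integral_toReal_smul₀ hd.1.ennreal_ofReal
    (ae_of_all _ fun u => ENNReal.ofReal_lt_top)]
  refine integral_congr_ae ?_
  filter_upwards [hd.2.1] with u hu
  rw [ENNReal.toReal_ofReal hu, smul_eq_mul, mul_comm]

end Density

/-! ### Moments of densities and the Gibbs inequality -/

namespace LQModel

section Gibbs

variable {θ : ℝ → ℝ} (hθ : IsDensity θ) (h2 : ∫⁻ u, ENNReal.ofReal (u ^ 2 * θ u) < ∞)
include hθ

include h2 in
theorem IsDensity.integrable_sq : Integrable fun u => u ^ 2 * θ u := by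
  refine ⟨((measurable_id.pow_const 2).aemeasurable.mul hθ.1).aestronglyMeasurable, ?_⟩
  refine lt_of_le_of_lt (le_of_eq (lintegral_congr_ae ?_)) h2
  filter_upwards [hθ.2.1] with u hu
  rw [Real.enorm_eq_ofReal (by positivity)]

include h2 in
theorem IsDensity.integrable_id_mul : Integrable fun u => u * θ u := by
  refine (hθ.integrable.add (hθ.integrable_sq h2)).mono'
    ((measurable_id.aemeasurable.mul hθ.1).aestronglyMeasurable) ?_
  filter_upwards [hθ.2.1] with u hu
  rw [norm_mul, Real.norm_eq_abs, Real.norm_eq_abs, abs_of_nonneg hu, Pi.add_apply]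
  have h1 : |u| ≤ 1 + u ^ 2 := by
    rw [abs_le]; constructor <;> nlinarith [sq_nonneg (u - 1), sq_nonneg (u + 1)]
  nlinarith [mul_le_mul_of_nonneg_right h1 hu]

include h2 in
theorem IsDensity.integrable_quadratic (p₀ p₁ p₂ : ℝ) :
    Integrable fun u => (p₀ + p₁ * u + p₂ * u ^ 2) * θ u := by
  refine (((hθ.integrable.const_mul p₀).add ((hθ.integrable_id_mul h2).const_mul p₁)).add
    ((hθ.integrable_sq h2).const_mul p₂)).congr (ae_of_all _ fun u => ?_)
  simp only [Pi.add_apply]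
  ring

include h2 in
theorem IsDensity.integral_quadratic (p₀ p₁ p₂ : ℝ) :
    ∫ u, (p₀ + p₁ * u + p₂ * u ^ 2) * θ u =
      p₀ + p₁ * (∫ u, u * θ u) + p₂ * ∫ u, u ^ 2 * θ u := by
  have i0 := hθ.integrable.const_mul p₀
  have i1 := (hθ.integrable_id_mul h2).const_mul p₁
  have i2 := (hθ.integrable_sq h2).const_mul p₂
  have i3 : Integrable fun u => p₀ * θ u + p₁ * (u * θ u) := i0.add i1
  have h : ∀ u, (p₀ + p₁ * u + p₂ * u ^ 2) * θ u =
      p₀ * θ u + p₁ * (u * θ u) + p₂ * (u ^ 2 * θ u) := fun u => by ring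
  simp_rw [h]
  rw [integral_add i3 i2, integral_add i0 i1, integral_const_mul, integral_const_mul,
    integral_const_mul, hθ.2.2, mul_one]

include h2 in
/-- The Gibbs inequality against a normal density. -/
theorem IsDensity.gibbs (hent : Integrable fun u => θ u * Real.log (θ u)) (μ : ℝ) {v : ℝ≥0}
    (hv : v ≠ 0) :
    -(1 / 2 * Real.log (2 * Real.pi * v)) -
      1 / (2 * v) * ((∫ u, u ^ 2 * θ u) - 2 * μ * (∫ u, u * θ u) + μ ^ 2) ≤ negEntropy θ := by
  have hp := integrable_gaussianPDFReal μ v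
  have hv' : (0 : ℝ) < v := by exact_mod_cast pos_of_ne_zero hv
  set p₀ := -(1 / 2 * Real.log (2 * Real.pi * v)) - μ ^ 2 / (2 * v) with hp₀
  have hlog : ∀ u, Real.log (gaussianPDFReal μ v u) = p₀ + μ / v * u + -(1 / (2 * v)) * u ^ 2 :=
    log_gaussianPDFReal hv
  have hq := hθ.integrable_quadratic h2 p₀ (μ / v) (-(1 / (2 * v)))
  -- The inequality ln t ≤ t − 1 at the ratio t of the normal density to θ, multiplied by θ. Where θ
  -- vanishes, the left side is 0 and the normal density is nonnegative.
  have hle : ∫ u, ((p₀ + μ / v * u + -(1 / (2 * v)) * u ^ 2) * θ u - θ u * Real.log (θ u)) ≤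
      ∫ u, (gaussianPDFReal μ v u - θ u) := by
    refine integral_mono_ae (hq.sub hent) (hp.sub hθ.integrable) ?_
    filter_upwards [hθ.2.1] with u hu
    rw [← hlog]
    have hpos := gaussianPDFReal_pos μ v u hv
    rcases hu.eq_or_lt with h0 | h0
    · rw [← h0]
      simpa using hpos.le
    · have h3 := Real.log_le_sub_one_of_pos (div_pos hpos h0)
      rw [Real.log_div hpos.ne' h0.ne', le_sub_iff_add_le, le_div_iff₀ h0] at h3
      linarith
  rw [integral_sub hq hent, integral_sub hp hθ.integrable, integral_gaussianPDFReal_eq_one μ hv,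
    hθ.2.2, sub_self, hθ.integral_quadratic h2] at hle
  rw [negEntropy]
  refine le_trans (le_of_eq ?_) (sub_nonpos.1 hle)
  rw [hp₀]
  field_simp
  ring

end Gibbs

/-! ### The Hamilton–Jacobi–Bellman inequality -/

variable (m : LQModel) {α₀ α₁ α₂ : ℝ}

/-- Completion of the square in the Hamilton–Jacobi–Bellman equation. -/
theorem reward_add_generator_eq (hα : α₂ < 0) (hF : m.FeedbackEquation α₀ α₁ α₂) (y u : ℝ) :
    m.reward y u + discountedGenerator m.σhi m.ρ α₀ α₁ α₂ y (m.drift y u) (m.vol y u) =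
      -(m.curvature α₂ / 2 * (u - m.feedback α₁ α₂ y) ^ 2) := by
  have h1 := hF y
  -- This is the first-order condition: the feedback is the critical point of a concave quadratic in
  -- u with second derivative −`curvature`.
  have h2 : m.feedback α₁ α₂ y * (m.K - α₂ * m.D ^ 2 * m.σhi ^ 2) =
      (α₂ * (m.F + m.C * m.D * m.σhi ^ 2) - m.I) * y + α₁ * m.F - m.Q := by
    rw [feedback, curvature, div_mul_cancel₀]
    exact (m.curvature_pos hα).ne'
  rw [curvature]
  set w := m.feedback α₁ α₂ y
  rw [reward, discountedGenerator, drift, vol] at h1 ⊢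
  linear_combination h1 - (u - w) * h2

theorem IsDensity.exploratoryDrift_eq {θ : ℝ → ℝ} (hθ : IsDensity θ)
    (h2 : ∫⁻ u, ENNReal.ofReal (u ^ 2 * θ u) < ∞) (y : ℝ) :
    m.exploratoryDrift y θ = m.A * y + m.F * ∫ u, u * θ u := by
  have h := hθ.integral_quadratic h2 (m.A * y) m.F 0
  rw [exploratoryDrift]
  have h' : ∀ u, m.drift y u = m.A * y + m.F * u + 0 * u ^ 2 := fun u => by rw [drift]; ring
  simp_rw [h', h]
  ring

/-- The exploratory squared volatility is the average of the classical one, so averaging the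
completed square over θ gives −κ/2 times the mean of (u − u*)². The Gibbs inequality against the
normal law with mean u* and variance lam/κ bounds the entropy term by exactly this quantity plus a
constant, which the entropy bonus removes. -/
theorem runningReward_add_generator_le (hα : α₂ < 0) (hF : m.FeedbackEquation α₀ α₁ α₂) (y : ℝ)
    {θ : ℝ → ℝ} (hθ : IsDensity θ) (h2 : ∫⁻ u, ENNReal.ofReal (u ^ 2 * θ u) < ∞)
    (hent : Integrable fun u => θ u * Real.log (θ u)) :
    m.runningReward y θ + discountedGenerator m.σhi m.ρ (α₀ + m.entropyBonus α₂) α₁ α₂ y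
      (m.exploratoryDrift y θ) (m.exploratoryVol y θ) ≤ 0 := by
  have hκ := m.curvature_pos hα
  have hρ := m.ρ_pos
  set m₁ := ∫ u, u * θ u with hm₁
  set m₂ := ∫ u, u ^ 2 * θ u with hm₂
  have e1 : m.exploratoryDrift y θ = m.A * y + m.F * m₁ := hθ.exploratoryDrift_eq m h2 y
  have e2 : m.exploratoryVol y θ ^ 2 = (m.C * y) ^ 2 + 2 * m.C * y * m.D * m₁ + m.D ^ 2 * m₂ := by
    rw [exploratoryVol, Real.sq_sqrt (integral_nonneg_of_ae (by
      filter_upwards [hθ.2.1] with u hu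
      exact mul_nonneg (sq_nonneg _) hu))]
    have h := hθ.integral_quadratic h2 ((m.C * y) ^ 2) (2 * m.C * y * m.D) (m.D ^ 2)
    have h' : ∀ u, m.vol y u ^ 2 = (m.C * y) ^ 2 + 2 * m.C * y * m.D * u + m.D ^ 2 * u ^ 2 :=
      fun u => by rw [vol]; ring
    simp_rw [h', h]
    rfl
  have e3 : m.exploratoryReward y θ =
      -(m.M / 2 * y ^ 2 + m.P * y) + -(m.I * y + m.Q) * m₁ + -(m.K / 2) * m₂ := by
    have h := hθ.integral_quadratic h2 (-(m.M / 2 * y ^ 2 + m.P * y)) (-(m.I * y + m.Q)) (-(m.K / 2))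
    have h' : ∀ u, m.reward y u = -(m.M / 2 * y ^ 2 + m.P * y) + -(m.I * y + m.Q) * u
      + -(m.K / 2) * u ^ 2 := fun u => by rw [reward]; ring
    rw [exploratoryReward]
    simp_rw [h', h]
    rfl
  have hg := hθ.gibbs h2 hent (m.feedback α₁ α₂ y) (m.loopVar_toNNReal_ne_zero hα)
  rw [m.coe_loopVar hα, ← hm₁, ← hm₂] at hg
  have hb : m.ρ * m.entropyBonus α₂ = m.lam / 2 * Real.log (2 * Real.pi * m.loopVar α₂) := by
    have hl : Real.log (2 * Real.pi * Real.exp 1 * m.lam / m.curvature α₂) =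
        Real.log (2 * Real.pi * m.loopVar α₂) + 1 := by
      have hv := m.loopVar_pos hα
      rw [mul_div_assoc (2 * Real.pi * Real.exp 1), ← loopVar, mul_right_comm,
        Real.log_mul (by positivity) (Real.exp_pos _).ne', Real.log_exp]
    rw [entropyBonus, hl]
    field_simp
    ring
  have hlv : m.lam * (1 / (2 * m.loopVar α₂)) = m.curvature α₂ / 2 := by
    have hl := m.lam_pos
    rw [loopVar]
    field_simp
  have hg' := mul_le_mul_of_nonneg_left hg m.lam_pos.le
  -- The identity is quadratic in u, so its average over θ is a combination of its values at 0, 1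
  -- and −1: the weights 1 − m₂, (m₁ + m₂)/2 and (m₂ − m₁)/2 reproduce the moments 1, m₁ and m₂.
  have h0 := m.reward_add_generator_eq hα hF y 0
  have h1 := m.reward_add_generator_eq hα hF y 1
  have hm1 := m.reward_add_generator_eq hα hF y (-1)
  set w := m.feedback α₁ α₂ y
  have key : m.exploratoryReward y θ + discountedGenerator m.σhi m.ρ α₀ α₁ α₂ y
      (m.exploratoryDrift y θ) (m.exploratoryVol y θ) =
      -(m.curvature α₂ / 2 * (m₂ - 2 * w * m₁ + w ^ 2)) := by
    rw [discountedGenerator, e1, e2, e3]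
    rw [reward, discountedGenerator, drift, vol] at h0 h1 hm1
    linear_combination (1 - m₂) * h0 + (m₁ + m₂) / 2 * h1 + (m₂ - m₁) / 2 * hm1
  have hsplit : m.runningReward y θ + discountedGenerator m.σhi m.ρ (α₀ + m.entropyBonus α₂) α₁ α₂ y
      (m.exploratoryDrift y θ) (m.exploratoryVol y θ) =
      (m.exploratoryReward y θ + discountedGenerator m.σhi m.ρ α₀ α₁ α₂ y
      (m.exploratoryDrift y θ) (m.exploratoryVol y θ)) - m.lam * negEntropy θ
        - m.ρ * m.entropyBonus α₂ := by
    rw [runningReward, discountedGenerator, discountedGenerator]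
    ring
  have hexp : m.lam * (-(1 / 2 * Real.log (2 * Real.pi * m.loopVar α₂)) -
      1 / (2 * m.loopVar α₂) * (m₂ - 2 * w * m₁ + w ^ 2)) =
      -(m.lam / 2 * Real.log (2 * Real.pi * m.loopVar α₂)) -
        m.curvature α₂ / 2 * (m₂ - 2 * w * m₁ + w ^ 2) := by
    rw [← hlv]
    ring
  rw [hexp] at hg'
  rw [hsplit, key, hb]
  linarith

end LQModel

/-! ## Upper bounds of the payoffs of admissible controls -/

section Measurability

variable {P : Measure PathSpace}

theorem exists_le_integral_of_upperExpENN {Ps : Set (Measure PathSpace)} {ρ : ℝ}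
    {g : ℝ≥0 → PathSpace → ℝ}
    (h : upperExpENN Ps (fun ω => ∫⁻ t : ℝ≥0,
      ENNReal.ofReal (Real.exp (-ρ * t) * |g t ω|) ∂timeMeasure) < ∞) :
    ∃ w : ℝ, ∀ P ∈ Ps, w ≤ ∫ ω, ∫ t : ℝ≥0, Real.exp (-ρ * t) * g t ω ∂timeMeasure ∂P := by
  refine ⟨-ENNReal.toReal (upperExpENN Ps (fun ω => ∫⁻ t : ℝ≥0,
      ENNReal.ofReal (Real.exp (-ρ * t) * |g t ω|) ∂timeMeasure)), fun P hP => ?_⟩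
  have h1 : ‖∫ ω, ∫ t : ℝ≥0, Real.exp (-ρ * t) * g t ω ∂timeMeasure ∂P‖ₑ ≤
      upperExpENN Ps (fun ω => ∫⁻ t : ℝ≥0,
        ENNReal.ofReal (Real.exp (-ρ * t) * |g t ω|) ∂timeMeasure) := by
    refine (enorm_integral_le_lintegral_enorm _).trans
      (le_trans (lintegral_mono fun ω => ?_) (lintegral_le_upperExpENN hP _))
    refine (enorm_integral_le_lintegral_enorm _).trans (lintegral_mono fun t => ?_)
    rw [Real.enorm_eq_ofReal_abs, abs_mul, Real.abs_exp]
  have h2 := ENNReal.toReal_mono h.ne h1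
  rw [toReal_enorm, Real.norm_eq_abs] at h2
  exact (neg_le_neg h2).trans (neg_abs_le _)

theorem ae_timeMeasure_of_forall_Iic {p : ℝ≥0 → Prop}
    (h : ∀ n : ℕ, ∀ᵐ t ∂(timeMeasure.restrict (Set.Iic (n : ℝ≥0))), p t) :
    ∀ᵐ t ∂timeMeasure, p t := by
  have h' : ∀ᵐ t ∂timeMeasure, ∀ n : ℕ, t ∈ Set.Iic (n : ℝ≥0) → p t :=
    ae_all_iff.2 fun n => (ae_restrict_iff' measurableSet_Iic).1 (h n)
  filter_upwards [h'] with t ht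
  obtain ⟨n, hn⟩ := exists_nat_ge t
  exact ht n hn

theorem aestronglyMeasurable_prod_of_forall_Iic [SFinite P] {f : ℝ≥0 × PathSpace → ℝ}
    (h : ∀ n : ℕ, AEStronglyMeasurable f ((timeMeasure.restrict (Set.Iic (n : ℝ≥0))).prod P)) :
    AEStronglyMeasurable f (timeMeasure.prod P) := by
  have hU : (⋃ n : ℕ, Set.Iic (n : ℝ≥0) ×ˢ (Set.univ : Set PathSpace)) = Set.univ := by
    refine Set.eq_univ_of_forall fun p => Set.mem_iUnion.2 ?_
    exact (exists_nat_ge p.1).imp fun n hn => ⟨hn, trivial⟩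
  rw [← Measure.restrict_univ (μ := timeMeasure.prod P), ← hU, aestronglyMeasurable_iUnion_iff]
  intro n
  rw [← Measure.prod_restrict, Measure.restrict_univ]
  exact h n

theorem ae_ae_swap {p : ℝ≥0 × PathSpace → Prop} [SFinite P]
    (hp : ∀ᵐ z ∂(timeMeasure.prod P), p z) : ∀ᵐ ω ∂P, ∀ᵐ t ∂timeMeasure, p (t, ω) := by
  rw [← Measure.prod_swap] at hp
  exact Measure.ae_ae_of_ae_prod (ae_of_ae_map measurable_swap.aemeasurable hp)

/-- For a measurable function, almost sure nonnegativity can be checked in either order. -/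
theorem ae_prod_nonneg_of_ae_ae [SFinite P] {f : ℝ≥0 × PathSpace → ℝ}
    (hf : AEStronglyMeasurable f (timeMeasure.prod P))
    (h : ∀ᵐ ω ∂P, ∀ᵐ t ∂timeMeasure, 0 ≤ f (t, ω)) : ∀ᵐ p ∂(timeMeasure.prod P), 0 ≤ f p := by
  obtain ⟨f', hf', hfe⟩ := hf
  have h1 : ∀ᵐ ω ∂P, ∀ᵐ t ∂timeMeasure, 0 ≤ f' (t, ω) := by
    filter_upwards [h, ae_ae_swap hfe] with ω h2 h3
    filter_upwards [h2, h3] with t h4 h5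
    rwa [← h5]
  have hmeas : MeasurableSet {z : PathSpace × ℝ≥0 | 0 ≤ f' z.swap} :=
    measurableSet_le measurable_const (hf'.measurable.comp measurable_swap)
  have h2 := (Measure.ae_prod_mem_iff_ae_ae_mem hmeas).2 h1
  have h3 : ∀ᵐ p ∂(timeMeasure.prod P), 0 ≤ f' p := by
    rw [← Measure.prod_swap, ae_map_iff measurable_swap.aemeasurable
      (measurableSet_le measurable_const hf'.measurable)]
    exact h2
  filter_upwards [h3, hfe] with p h4 h5
  rwa [h5]

theorem IsState.aestronglyMeasurable_discountedGenerator {σ x c q₀ q₁ q₂ : ℝ}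
    {b s X : ℝ≥0 → PathSpace → ℝ} [SFinite P] (hX : IsState P x b s X) :
    AEStronglyMeasurable (fun p : ℝ≥0 × PathSpace =>
      discountedGenerator σ c q₀ q₁ q₂ (X p.1 p.2) (b p.1 p.2) (s p.1 p.2))
      (timeMeasure.prod P) := by
  have hb := aestronglyMeasurable_prod_of_forall_Iic fun n : ℕ => (hX.drift_memLp n).1
  have hs := aestronglyMeasurable_prod_of_forall_Iic fun n : ℕ => (hX.equation.1 n).1
  have hx : AEStronglyMeasurable (fun p : ℝ≥0 × PathSpace => X p.1 p.2) (timeMeasure.prod P) :=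
    hX.measurable.aestronglyMeasurable
  exact ((((hx.const_mul q₂).add aestronglyMeasurable_const).mul hb).add
    ((hs.pow 2).const_mul (1 / 2 * q₂ * σ ^ 2))).sub
    (((((hx.pow 2).const_mul (1 / 2 * q₂)).add (hx.const_mul q₁)).add
      aestronglyMeasurable_const).const_mul c)

end Measurability

namespace LQModel

variable {m : LQModel} {α₀ α₁ α₂ x : ℝ}

theorem priorSet_isProbabilityMeasure : ∀ P ∈ m.priorSet, IsProbabilityMeasure P := fun _ hP => hP.1

theorem priorSet_nonempty : m.priorSet.Nonempty :=
  (exists_mem_priors m.σhi_pos.ne').mono (priors_mono m.σlo_pos.le m.σlo_le_σhi)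

/-- A lower expectation is at most the expectation under any single prior. Under Wiener measure
scaled by σhi the Dynkin formula has no remainder, and the completed square makes the quadratic
function a supersolution. -/
theorem classicalPayoff_le (hα : α₂ < 0) (hF : m.FeedbackEquation α₀ α₁ α₂)
    {u X : ℝ≥0 → PathSpace → ℝ} (h : m.ClassicalAdmissible x u X) :
    m.classicalPayoff u X ≤ 1 / 2 * α₂ * x ^ 2 + α₁ * x + α₀ := by
  obtain ⟨P, hPhi⟩ := exists_mem_priors m.σhi_pos.ne'
  have hP : P ∈ m.priorSet := priors_mono m.σlo_pos.le m.σlo_le_σhi hPhi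
  have := hP.1
  have hXm := measurable_of_isStronglyProgressive h.state.progressive
  have hS := h.state.isState hP (ae_of_all _ fun r => by
    have h1 := h.state.progressive.stronglyAdapted r
    exact ((h1.const_mul m.A).add ((h.adapted r).const_mul m.F)).aestronglyMeasurable)
  have hum := h.measurable
  have hr : Measurable fun p : ℝ≥0 × PathSpace => m.reward (X p.1 p.2) (u p.1 p.2) := by
    unfold reward
    fun_prop
  have hint := integrable_prod_of_upperExpENN (ρ := m.ρ)
    (g := fun t ω => m.reward (X t ω) (u t ω)) hr.aestronglyMeasurable h.reward_finite hP
  obtain ⟨w, hw⟩ := exists_le_integral_of_upperExpENN h.reward_finite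
  refine (lowerExp_le hw hP).trans ?_
  rw [integral_integral_eq_integral_prod hint]
  refine hS.integral_le hPhi m.ρ_pos (liminf_growth_of_upperExpENN h.growth hP)
    (g := fun p => m.reward (X p.1 p.2) (u p.1 p.2)) hint (ae_of_all _ fun p => ?_)
  rw [m.reward_add_generator_eq hα hF]
  have := m.curvature_pos hα
  have : 0 ≤ m.curvature α₂ / 2 * (u p.1 p.2 - m.feedback α₁ α₂ (X p.1 p.2)) ^ 2 := by positivity
  linarith

/-! ### Measurability and upper bound for randomized controls -/

section Exploratory

variable {θ : ℝ≥0 → PathSpace → ℝ → ℝ} {X : ℝ≥0 → PathSpace → ℝ} {P : Measure PathSpace}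
  (h : m.ExploratoryAdmissible x θ X) (hP : P ∈ m.priorSet)
include h

theorem ExploratoryAdmissible.measurable_setIntegral (S : Set ℝ) (hS : MeasurableSet S) :
    Measurable fun p : ℝ≥0 × PathSpace => ∫ u in S, θ p.1 p.2 u :=
  measurable_of_isStronglyProgressive (h.progressive S hS)

include hP

/-- The density property is given at each fixed time; the set is measurable since countably many
integrals describe it, and Fubini gives the property for almost every (t, ω). -/
theorem ExploratoryAdmissible.ae_mem_densitySet :
    ∀ᵐ p ∂(timeMeasure.prod P), p ∈ densitySet fun p : ℝ≥0 × PathSpace => θ p.1 p.2 := by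
  have := hP.1
  rw [Measure.ae_prod_mem_iff_ae_ae_mem (measurableSet_densitySet h.measurable_setIntegral)]
  refine ae_of_all _ fun t => ?_
  filter_upwards [h.density t P hP] with ω hω
  exact mem_densitySet_iff.2 hω

theorem ExploratoryAdmissible.ae_isDensity :
    ∀ᵐ p ∂(timeMeasure.prod P), IsDensity (θ p.1 p.2) := by
  filter_upwards [h.ae_mem_densitySet hP] with p hp
  exact mem_densitySet_iff.1 hp

/-- Joint measurability of θ in (t, ω, u) is not part of admissibility, only that of its integrals
over Borel sets. The kernel built from these makes the second moment a measurable function of (t,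
ω), after which Fubini turns the moment condition into almost everywhere finiteness. -/
theorem ExploratoryAdmissible.ae_second_moment_lt_top :
    ∀ᵐ p ∂(timeMeasure.prod P), ∫⁻ u, ENNReal.ofReal (u ^ 2 * θ p.1 p.2 u) < ∞ := by
  have := hP.1
  obtain ⟨κ, hκ⟩ := exists_kernel_of_density h.measurable_setIntegral
  set g : ℝ≥0 × PathSpace → ℝ≥0∞ := fun p => ∫⁻ u, ENNReal.ofReal (u ^ 2) ∂κ p with hg
  have hgm : Measurable g := Measurable.lintegral_kernel (by fun_prop)
  have hgeq : ∀ᵐ p ∂(timeMeasure.prod P), g p = ∫⁻ u, ENNReal.ofReal (u ^ 2 * θ p.1 p.2 u) := by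
    filter_upwards [h.ae_mem_densitySet hP] with p hp
    exact lintegral_kernel_of_density hp (hκ p hp) (by fun_prop) fun u => sq_nonneg u
  have hfin : ∀ᵐ p ∂(timeMeasure.prod P), g p < ∞ := by
    have hset : MeasurableSet {p | g p < ∞} := measurableSet_lt hgm measurable_const
    refine (Measure.ae_prod_mem_iff_ae_ae_mem hset).2 (ae_timeMeasure_of_forall_Iic fun n =>
      (Measure.ae_prod_mem_iff_ae_ae_mem (μ := timeMeasure.restrict (Set.Iic (n : ℝ≥0))) hset).1 ?_)
    refine ae_lt_top hgm (ne_of_lt ?_)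
    rw [lintegral_prod_symm _ hgm.aemeasurable]
    refine lt_of_le_of_lt (le_of_eq (lintegral_congr_ae ?_))
      ((lintegral_le_upperExpENN hP _).trans_lt (h.moment n))
    filter_upwards [ae_ae_swap hgeq] with ω hω
    exact lintegral_congr_ae (ae_restrict_of_ae hω)
  filter_upwards [hfin, hgeq] with p h1 h2
  rwa [← h2]

/-- At fixed r the kernel is built relative to the σ-algebra at time r, so the mean of the control
is adapted up to a null set, and the drift is an affine function of state and mean. -/
theorem ExploratoryAdmissible.drift_adapted : ∀ᵐ r ∂timeMeasure,
    AEStronglyMeasurable[pathFiltration r] (fun ω => m.exploratoryDrift (X r ω) (θ r ω)) P := by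
  have := hP.1
  filter_upwards [Measure.ae_ae_of_ae_prod (h.ae_second_moment_lt_top hP)] with r hr
  obtain ⟨κ, hκ⟩ := exists_kernel_of_density (mΩ := pathFiltration r) (θ := θ r) fun S hS =>
    ((h.progressive S hS).stronglyAdapted r).measurable
  have hmean : StronglyMeasurable[pathFiltration r] fun ω => ∫ u, u ∂κ ω :=
    StronglyMeasurable.integral_kernel (κ := κ) (f := fun u : ℝ => u) stronglyMeasurable_id
  have hX := h.state.progressive.stronglyAdapted r
  refine ⟨fun ω => m.A * X r ω + m.F * ∫ u, u ∂κ ω, (hX.const_mul m.A).add (hmean.const_mul m.F), ?_⟩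
  filter_upwards [hr, h.density r P hP] with ω h1 h2
  have h3 : ω ∈ densitySet (θ r) := mem_densitySet_iff.2 h2
  rw [h2.exploratoryDrift_eq m h1, integral_kernel_of_density h3 (hκ ω h3)]

omit hP in
theorem exploratoryPayoff_le (hα : α₂ < 0) (hF : m.FeedbackEquation α₀ α₁ α₂) :
    m.exploratoryPayoff θ X ≤ 1 / 2 * α₂ * x ^ 2 + α₁ * x + (α₀ + m.entropyBonus α₂) := by
  obtain ⟨P, hPhi⟩ := exists_mem_priors m.σhi_pos.ne'
  have hP : P ∈ m.priorSet := priors_mono m.σlo_pos.le m.σlo_le_σhi hPhi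
  have := hP.1
  have hS := h.state.isState hP (h.drift_adapted hP)
  have hint := integrable_prod_of_upperExpENN (ρ := m.ρ)
    (g := fun t ω => m.runningReward (X t ω) (θ t ω)) (h.reward_measurable P hP) h.reward_finite hP
  obtain ⟨w, hw⟩ := exists_le_integral_of_upperExpENN h.reward_finite
  refine (lowerExp_le hw hP).trans ?_
  rw [integral_integral_eq_integral_prod hint]
  refine hS.integral_le hPhi m.ρ_pos (liminf_growth_of_upperExpENN h.growth hP)
    (g := fun p => m.runningReward (X p.1 p.2) (θ p.1 p.2)) hint ?_
  have hm := ((h.reward_measurable P hP).add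
    (hS.aestronglyMeasurable_discountedGenerator (σ := m.σhi) (c := m.ρ)
      (q₀ := α₀ + m.entropyBonus α₂) (q₁ := α₁) (q₂ := α₂))).neg
  -- Integrability of the entropy is given for almost every ω and then almost every t, a set whose
  -- measurability is unknown. The inequality is shown in that order and transferred through the
  -- measurability of its two sides.
  have hae := ae_prod_nonneg_of_ae_ae hm (by
    filter_upwards [ae_ae_swap (h.ae_isDensity hP),
      ae_ae_swap (h.ae_second_moment_lt_top hP), h.entropy_integrable P hP] with ω h1 h2 h3
    filter_upwards [h1, h2, h3] with t h4 h5 h6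
    have := m.runningReward_add_generator_le hα hF (X t ω) h4 h5 h6
    simpa using neg_nonneg.2 this)
  filter_upwards [hae] with p hp
  exact neg_nonneg.1 hp

end Exploratory

end LQModel

/-! ## Optimality of the feedback laws -/

namespace LQModel

variable {m : LQModel} {α₀ α₁ α₂ x : ℝ} {X : ℝ≥0 → PathSpace → ℝ}

theorem memLp_of_isAffineState {a b c d e : ℝ}
    (hX : ∀ P ∈ m.priorSet, IsAffineState P x a b c d e X) : ∀ P ∈ m.priorSet, ∀ t, MemLp (X t) 2 P := by
  intro P hP t
  obtain ⟨s, -, hS⟩ := hX P hP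
  exact hS.memLp_apply hP t

theorem exists_moment_bound {a b c d e : ℝ}
    (hstab : 2 * a + c ^ 2 * m.σhi ^ 2 < m.ρ)
    (hX : ∀ P ∈ m.priorSet, IsAffineState P x a b c d e X) : ∃ γ C : ℝ, γ < m.ρ ∧
      ∀ P ∈ m.priorSet, ∀ T : ℝ≥0, ∫ ω, X T ω ^ 2 ∂P ≤ C * Real.exp (γ * T) := by
  obtain ⟨γ, hγ, h⟩ := IsAffineState.exists_integral_sq_le (σlo := m.σlo) (b := b) (d := d) (e := e)
    m.ρ_pos hstab
  obtain ⟨C, -, hC⟩ := h x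
  exact ⟨γ, C, hγ, fun P hP T => hC P hP X (hX P hP) T⟩

theorem feedback_sq_le (y : ℝ) : m.feedback α₁ α₂ y ^ 2 ≤
    2 * (m.slope α₂ ^ 2 + m.intercept α₁ α₂ ^ 2) * (1 + y ^ 2) := by
  rw [feedback_eq]
  nlinarith [sq_nonneg (m.slope α₂ * y - m.intercept α₁ α₂), sq_nonneg (m.slope α₂),
    mul_nonneg (sq_nonneg (m.intercept α₁ α₂)) (sq_nonneg y), sq_nonneg (m.slope α₂ * y)]

theorem measurable_feedback : Measurable (m.feedback α₁ α₂) := by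
  unfold feedback
  fun_prop

/-- Stability bounds the second moment at a rate below ρ uniformly in the priors, which yields every
integrability and growth condition; the Riccati identity evaluates the payoff, and the upper bound
for arbitrary controls has the same value. -/
theorem classicalOptimal_of_isStrongSolution (hα : α₂ < 0) (hstab : m.StableLoop α₂)
    (hF : m.FeedbackEquation α₀ α₁ α₂)
    (hX : IsStrongSolution m.priorSet x
      (fun t ω => m.loopDrift α₂ * X t ω + m.F * m.intercept α₁ α₂)
      (fun t ω => m.loopVol α₂ * X t ω + m.D * m.intercept α₁ α₂) X) :
    m.ClassicalOptimal x (m.generatedControl α₁ α₂ X) X ∧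
      m.classicalPayoff (m.generatedControl α₁ α₂ X) X = 1 / 2 * α₂ * x ^ 2 + α₁ * x + α₀ := by
  have hPs := m.priorSet_isProbabilityMeasure
  have hXm := measurable_of_isStronglyProgressive hX.progressive
  have hXa : ∀ P ∈ m.priorSet, IsAffineState P x (m.loopDrift α₂) (m.F * m.intercept α₁ α₂)
      (m.loopVol α₂) (m.D * m.intercept α₁ α₂) 0 X := fun P hP =>
    hX.isAffineState (fun _ _ => rfl) (fun _ _ => by rw [add_zero]) hP
  have hX2 := memLp_of_isAffineState hXa
  obtain ⟨γ, C, hγ, hC⟩ := exists_moment_bound hstab hXa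
  have hgr := liminf_growth_eq_zero hX2 hγ hC
  have hreward := upperExpENN_discounted_lt_top hPs hXm hX2 m.ρ_pos hγ
    (K := |m.loopReward₀ α₁ α₂| + |m.loopReward₁ α₁ α₂| + |m.loopReward₂ α₂|)
    (by positivity) hC (g := fun t ω => m.reward (X t ω) (m.feedback α₁ α₂ (X t ω))) (fun t ω => by
      rw [m.reward_feedback]
      exact abs_quadratic_le _ _ _ _)
  have hadm : m.ClassicalAdmissible x (m.generatedControl α₁ α₂ X) X :=
    { adapted := fun t => (measurable_feedback.comp
        (hX.progressive.stronglyAdapted t).measurable).stronglyMeasurable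
      measurable := measurable_feedback.comp hXm
      moment := upperExpENN_Iic_lt_top hPs hXm hX2 (by positivity) hC fun t ω =>
        ENNReal.ofReal_le_ofReal (feedback_sq_le _)
      state := hX.congr (fun t ω => m.drift_feedback α₁ α₂ _) (fun t ω => m.vol_feedback α₁ α₂ _)
      growth := hgr
      reward_finite := hreward }
  obtain ⟨P, hPhi⟩ := exists_mem_priors m.σhi_pos.ne'
  have hpay : m.classicalPayoff (m.generatedControl α₁ α₂ X) X =
      1 / 2 * α₂ * x ^ 2 + α₁ * x + α₀ := by
    refine IsAffineState.lowerExp_eq m.σlo_pos.le m.σlo_le_σhi hPhi m.ρ_pos hXa hgr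
      (G := fun y => m.reward y (m.feedback α₁ α₂ y)) (fun P hP => ?_) hα.le fun y s hs => ?_
    · have := hP.1
      refine integrable_prod_of_upperExpENN
        (g := fun t ω => m.reward (X t ω) (m.feedback α₁ α₂ (X t ω))) ?_ hreward hP
      simp only [m.reward_feedback]
      exact Measurable.aestronglyMeasurable (by fun_prop)
    · have h := hF y
      rw [m.drift_feedback, discountedGenerator, m.vol_feedback] at h
      rw [discountedGenerator, hs, add_zero]
      exact h
  refine ⟨⟨hadm, ⟨_, X, hadm, rfl⟩, ?_⟩, hpay⟩
  rintro _ ⟨u, Y, hY, rfl⟩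
  rw [hpay]
  exact classicalPayoff_le hα hF hY

theorem exploratoryVol_randomizedFeedback (hα : α₂ < 0) (y : ℝ) :
    m.exploratoryVol y (m.randomizedFeedback α₁ α₂ y) =
      √((m.loopVol α₂ * y + m.D * m.intercept α₁ α₂) ^ 2 + m.D ^ 2 * m.loopVar α₂) := by
  rw [← m.exploratoryVol_randomizedFeedback_sq α₁ hα]
  exact (Real.sqrt_sq (show 0 ≤ m.exploratoryVol y _ from Real.sqrt_nonneg _)).symm

theorem lintegral_sq_randomizedFeedback_le (hα : α₂ < 0) (y : ℝ) :
    ∫⁻ u, ENNReal.ofReal (u ^ 2 * m.randomizedFeedback α₁ α₂ y u) ≤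
      ENNReal.ofReal ((2 * (m.slope α₂ ^ 2 + m.intercept α₁ α₂ ^ 2) + m.loopVar α₂) *
        (1 + y ^ 2)) := by
  have hv := m.loopVar_toNNReal_ne_zero hα
  have hv' := m.loopVar_pos hα
  have hi : Integrable fun u => u ^ 2 * m.randomizedFeedback α₁ α₂ y u := by
    refine (integrable_gaussianPDFReal_mul_iff hv).2 ?_
    simpa using integrable_quadratic_gaussianReal (μ := m.feedback α₁ α₂ y)
      (v := (m.lam / m.curvature α₂).toNNReal) 0 0 1
  rw [← ofReal_integral_eq_lintegral_ofReal hi (ae_of_all _ fun u =>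
    mul_nonneg (sq_nonneg u) (gaussianPDFReal_nonneg _ _ _)), randomizedFeedback,
    integral_mul_gaussianPDFReal hv, integral_sq_gaussianReal, m.coe_loopVar hα]
  refine ENNReal.ofReal_le_ofReal ?_
  have h1 := feedback_sq_le (m := m) (α₁ := α₁) (α₂ := α₂) y
  have h2 : 0 ≤ m.loopVar α₂ * y ^ 2 := by positivity
  linarith

theorem measurable_setIntegral_randomizedFeedback {S : Set ℝ} :
    Measurable fun y => ∫ u in S, m.randomizedFeedback α₁ α₂ y u := by
  have h : Measurable fun p : ℝ × ℝ => m.randomizedFeedback α₁ α₂ p.1 p.2 :=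
    measurable_uncurry_gaussianPDFReal.comp
      ((measurable_feedback.comp measurable_fst).prodMk (measurable_const.prodMk measurable_snd))
  exact h.stronglyMeasurable.integral_prod_right.measurable

/-- As in the classical case: the running reward along the normal feedback is again quadratic in the
state, and the shift of α₀ by the entropy bonus turns the Riccati identity into its exploratory
form. -/
theorem exploratoryOptimal_of_isStrongSolution (hα : α₂ < 0) (hstab : m.StableLoop α₂)
    (hF : m.FeedbackEquation α₀ α₁ α₂)
    (hX : IsStrongSolution m.priorSet x
      (fun t ω => m.loopDrift α₂ * X t ω + m.F * m.intercept α₁ α₂)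
      (fun t ω => √((m.loopVol α₂ * X t ω + m.D * m.intercept α₁ α₂) ^ 2 +
        m.D ^ 2 * m.loopVar α₂)) X) :
    m.ExploratoryOptimal x (m.generatedRandomizedControl α₁ α₂ X) X ∧
      m.exploratoryPayoff (m.generatedRandomizedControl α₁ α₂ X) X =
        1 / 2 * α₂ * x ^ 2 + α₁ * x + (α₀ + m.entropyBonus α₂) := by
  have hv := m.loopVar_toNNReal_ne_zero hα
  have hv' := m.loopVar_pos hα
  have hPs := m.priorSet_isProbabilityMeasure
  have hXm := measurable_of_isStronglyProgressive hX.progressive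
  have hXa : ∀ P ∈ m.priorSet, IsAffineState P x (m.loopDrift α₂) (m.F * m.intercept α₁ α₂)
      (m.loopVol α₂) (m.D * m.intercept α₁ α₂) (m.D ^ 2 * m.loopVar α₂) X := fun P hP =>
    hX.isAffineState (fun _ _ => rfl) (fun _ _ => Real.sq_sqrt (by positivity)) hP
  have hX2 := memLp_of_isAffineState hXa
  obtain ⟨γ, C, hγ, hC⟩ := exists_moment_bound hstab hXa
  have hgr := liminf_growth_eq_zero hX2 hγ hC
  set G₀ := m.loopReward₀ α₁ α₂ - m.K / 2 * m.loopVar α₂ +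
    m.lam / 2 * Real.log (2 * Real.pi * Real.exp 1 * m.lam / m.curvature α₂) with hG₀
  have hG : ∀ y, m.runningReward y (m.randomizedFeedback α₁ α₂ y) =
      1 / 2 * m.loopReward₂ α₂ * y ^ 2 + m.loopReward₁ α₁ α₂ * y + G₀ := by
    intro y
    rw [m.runningReward_randomizedFeedback α₁ hα, m.reward_feedback, hG₀]
    ring
  have hreward := upperExpENN_discounted_lt_top hPs hXm hX2 m.ρ_pos hγ
    (K := |G₀| + |m.loopReward₁ α₁ α₂| + |m.loopReward₂ α₂|) (by positivity) hC
    (g := fun t ω => m.runningReward (X t ω) (m.randomizedFeedback α₁ α₂ (X t ω))) (fun t ω => by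
      rw [hG]
      exact abs_quadratic_le _ _ _ _)
  have hrm : ∀ P ∈ m.priorSet, AEStronglyMeasurable (fun p : ℝ≥0 × PathSpace =>
      m.runningReward (X p.1 p.2) (m.randomizedFeedback α₁ α₂ (X p.1 p.2)))
      (timeMeasure.prod P) := by
    intro P _
    simp only [hG]
    exact Measurable.aestronglyMeasurable (by fun_prop)
  have hadm : m.ExploratoryAdmissible x (m.generatedRandomizedControl α₁ α₂ X) X :=
    { density := fun t P _ => ae_of_all _ fun ω => isDensity_gaussianPDFReal hv
      progressive := fun S _ i => (measurable_setIntegral_randomizedFeedback.comp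
        (hX.progressive i).measurable).stronglyMeasurable
      moment := upperExpENN_Iic_lt_top hPs hXm hX2 (by positivity) hC fun t ω =>
        lintegral_sq_randomizedFeedback_le hα _
      state := hX.congr (fun t ω => m.exploratoryDrift_randomizedFeedback α₁ hα _)
        (fun t ω => exploratoryVol_randomizedFeedback hα _)
      growth := hgr
      entropy_integrable := fun P _ => ae_of_all _ fun ω => ae_of_all _ fun t =>
        integrable_gaussianPDFReal_mul_log hv
      reward_measurable := hrm
      reward_finite := hreward }
  obtain ⟨P, hPhi⟩ := exists_mem_priors m.σhi_pos.ne'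
  have hpay : m.exploratoryPayoff (m.generatedRandomizedControl α₁ α₂ X) X =
      1 / 2 * α₂ * x ^ 2 + α₁ * x + (α₀ + m.entropyBonus α₂) := by
    refine IsAffineState.lowerExp_eq m.σlo_pos.le m.σlo_le_σhi hPhi m.ρ_pos hXa hgr
      (G := fun y => m.runningReward y (m.randomizedFeedback α₁ α₂ y)) (fun P hP => ?_) hα.le
      fun y s hs => ?_
    · have := hP.1
      exact integrable_prod_of_upperExpENN
        (g := fun t ω => m.runningReward (X t ω) (m.randomizedFeedback α₁ α₂ (X t ω)))
        (hrm P hP) hreward hP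
    · have h := hF y
      rw [m.drift_feedback] at h
      rw [m.feedback_reward_add_generator α₀ α₁ hα y s (m.vol y (m.feedback α₁ α₂ y)) hs
        (by rw [m.vol_feedback]), h]
  refine ⟨⟨hadm, ⟨_, X, hadm, rfl⟩, ?_⟩, hpay⟩
  rintro _ ⟨θ, Y, hY, rfl⟩
  rw [hpay]
  exact exploratoryPayoff_le hY hα hF

/-! ### The exploration cost -/

theorem finiteDiscountedEntropy_generatedRandomizedControl (hα : α₂ < 0) :
    m.FiniteDiscountedEntropy (m.generatedRandomizedControl α₁ α₂ X) := by
  have h : ∀ t ω, negEntropy (m.generatedRandomizedControl α₁ α₂ X t ω) =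
      -(1 / 2 * Real.log (2 * Real.pi * Real.exp 1 * m.lam / m.curvature α₂)) :=
    fun t ω => m.negEntropy_randomizedFeedback α₁ hα _
  rw [FiniteDiscountedEntropy]
  simp only [h]
  refine lt_of_le_of_lt (iSup₂_le fun P hP => ?_)
    (((integrable_exp_neg_timeMeasure m.ρ_pos).mul_const
      |-(1 / 2 * Real.log (2 * Real.pi * Real.exp 1 * m.lam / m.curvature α₂))|).lintegral_lt_top)
  have := hP.1
  simp

theorem lowerExp_negEntropy_generatedRandomizedControl (hα : α₂ < 0) :
    lowerExp m.priorSet (fun ω => ∫ t : ℝ≥0,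
      Real.exp (-m.ρ * t) * negEntropy (m.generatedRandomizedControl α₁ α₂ X t ω) ∂timeMeasure) =
      1 / m.ρ * -(1 / 2 * Real.log (2 * Real.pi * Real.exp 1 * m.lam / m.curvature α₂)) := by
  have h : ∀ t ω, negEntropy (m.generatedRandomizedControl α₁ α₂ X t ω) =
      -(1 / 2 * Real.log (2 * Real.pi * Real.exp 1 * m.lam / m.curvature α₂)) :=
    fun t ω => m.negEntropy_randomizedFeedback α₁ hα _
  simp only [h, integral_mul_const, integral_exp_neg_timeMeasure m.ρ_pos]
  exact lowerExp_const m.priorSet_nonempty m.priorSet_isProbabilityMeasure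

/-- The normal law has a variance independent of the state, so its entropy is constant and the
logarithm in the entropy bonus cancels against it. Only the contribution of the −1 remains. -/
theorem explorationCost_eq (hα : α₂ < 0) {v : ℝ} (h₁ : m.classicalValue x = v)
    (h₂ : m.exploratoryValue x = v + m.entropyBonus α₂) :
    m.explorationCost x (m.generatedRandomizedControl α₁ α₂ X) = m.lam / (2 * m.ρ) := by
  have hρ := m.ρ_pos
  rw [explorationCost, h₁, h₂, lowerExp_negEntropy_generatedRandomizedControl hα, entropyBonus]
  field_simp
  ring

end LQModel

/-! ### Maximal inequality in continuous time -/

/-- Doob's maximal inequality on the dyadic grids, applied to |M| as the supremum of the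
submartingales M and −M. The grid events increase, and a strict excess at some time is seen on a
fine grid by continuity. -/
theorem ProbabilityTheory.measure_exists_lt_abs_le {Ω : Type*} {m0 : MeasurableSpace Ω}
    {P : Measure Ω} [IsFiniteMeasure P] {𝓕 : Filtration ℝ≥0 m0} {M : ℝ≥0 → Ω → ℝ}
    (hM : Martingale M 𝓕 P) (hc : ∀ ω, Continuous fun t => M t ω) (T : ℕ) {ε : ℝ≥0} (hε : 0 < ε) :
    P {ω | ∃ t ≤ (T : ℝ≥0), (ε : ℝ) < |M t ω|} ≤ ENNReal.ofReal (∫ ω, |M T ω| ∂P) / ε := by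
  set A : ℕ → Set Ω := fun j => {ω | ∃ k ≤ T * 2 ^ j, (ε : ℝ) ≤ |M ((k : ℝ≥0) / 2 ^ j) ω|}
  have hmono : Monotone A := by
    refine monotone_nat_of_le_succ fun j ω => ?_
    rintro ⟨k, hk, h⟩
    refine ⟨2 * k, by rw [pow_succ]; linarith, ?_⟩
    have e : ((2 * k : ℕ) : ℝ≥0) / 2 ^ (j + 1) = k / 2 ^ j := by
      rw [pow_succ', Nat.cast_mul, Nat.cast_two, mul_div_mul_left _ _ two_ne_zero]
    rwa [e]
  have hsub : {ω | ∃ t ≤ (T : ℝ≥0), (ε : ℝ) < |M t ω|} ⊆ ⋃ j, A j := by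
    rintro ω ⟨t, ht, h⟩
    have hl : Tendsto (fun j => |M (dyadicFloor j t) ω|) atTop (𝓝 |M t ω|) :=
      (((hc ω).tendsto t).comp (tendsto_dyadicFloor t)).abs
    obtain ⟨j, hj⟩ := (hl.eventually (lt_mem_nhds h)).exists
    refine Set.mem_iUnion.2 ⟨j, ⌊2 ^ j * t⌋₊, Nat.floor_le_of_le ?_, hj.le⟩
    push_cast
    rw [mul_comm]
    gcongr
  refine (measure_mono hsub).trans ?_
  rw [hmono.measure_iUnion]
  refine iSup_le fun j => ?_
  have hgrid : Monotone fun k : ℕ => (k : ℝ≥0) / 2 ^ j := fun a b h => by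
    have : (a : ℝ≥0) ≤ b := by exact_mod_cast h
    change (a : ℝ≥0) / 2 ^ j ≤ b / 2 ^ j
    gcongr
  let 𝒢 : Filtration ℕ m0 :=
    { seq := fun k => 𝓕 ((k : ℝ≥0) / 2 ^ j)
      mono' := fun a b h => 𝓕.mono (hgrid h)
      le' := fun k => 𝓕.le _ }
  have hN : Martingale (fun k : ℕ => M ((k : ℝ≥0) / 2 ^ j)) 𝒢 P :=
    ⟨fun k => hM.1 _, fun a b h => hM.2 _ _ (hgrid h)⟩
  have hS := hN.submartingale.sup hN.neg.submartingale
  have hmax := maximal_ineq hS (fun k ω => by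
    change 0 ≤ M _ ω ⊔ -M _ ω
    exact abs_nonneg (M ((k : ℝ≥0) / 2 ^ j) ω)) (ε := ε) (T * 2 ^ j)
  have hint : Integrable (fun ω => |M T ω|) P := (hM.integrable T).abs
  rw [ENNReal.le_div_iff_mul_le (Or.inl (by exact_mod_cast hε.ne')) (Or.inl ENNReal.coe_ne_top),
    mul_comm]
  refine le_trans (mul_le_mul' le_rfl (measure_mono ?_)) (hmax.trans (ENNReal.ofReal_le_ofReal ?_))
  · rintro ω ⟨k, hk, h⟩
    exact h.trans (Finset.le_sup' (fun k : ℕ => ((fun k : ℕ => M ((k : ℝ≥0) / 2 ^ j)) ⊔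
      -fun k : ℕ => M ((k : ℝ≥0) / 2 ^ j)) k ω) (Finset.mem_range.2 (by omega)))
  · have e : ((T * 2 ^ j : ℕ) : ℝ≥0) / 2 ^ j = T := by
      push_cast
      exact mul_div_cancel_right₀ _ (by positivity)
    have e2 : (fun ω => ((fun k : ℕ => M ((k : ℝ≥0) / 2 ^ j)) ⊔
        -fun k : ℕ => M ((k : ℝ≥0) / 2 ^ j)) (T * 2 ^ j) ω) = fun ω => |M T ω| := by
      funext ω
      change M _ ω ⊔ -M _ ω = _
      rw [e]
      rfl
    rw [e2]
    exact setIntegral_le_integral hint (ae_of_all _ fun _ => abs_nonneg _)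

/-! ### Sums of increments -/

/-- The sum of the increments over `[0, t]` of the function `g`, weighted with `z i` on
`(τ i, τ (i + 1)]` for `i < N`. -/
def stepSum (τ : ℕ → ℝ≥0) (z : ℕ → ℝ) (N : ℕ) (g : ℝ≥0 → ℝ) (t : ℝ≥0) : ℝ :=
  ∑ i ∈ Finset.range N, z i * (g (min (τ (i + 1)) t) - g (min (τ i) t))

section StepSum

variable {τ : ℕ → ℝ≥0} {z : ℕ → ℝ} {g : ℝ≥0 → ℝ} {t : ℝ≥0}

theorem stepSum_succ (N : ℕ) : stepSum τ z (N + 1) g t =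
    stepSum τ z N g t + z N * (g (min (τ (N + 1)) t) - g (min (τ N) t)) :=
  Finset.sum_range_succ _ _

theorem stepSum_of_le (hτ : Monotone τ) {N N' : ℕ} (h : N ≤ N') (ht : t ≤ τ N) :
    stepSum τ z N' g t = stepSum τ z N g t := by
  induction N', h using Nat.le_induction with
  | base => rfl
  | succ k hk ih =>
    have h1 : t ≤ τ k := ht.trans (hτ hk)
    rw [stepSum_succ, ih, min_eq_right h1, min_eq_right (h1.trans (hτ k.le_succ)), sub_self,
      mul_zero, add_zero]

theorem stepSum_eq_of_ge (hτ : Monotone τ) {N : ℕ} (ht : τ N ≤ t) :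
    stepSum τ z N g t = stepSum τ z N g (τ N) := by
  refine Finset.sum_congr rfl fun i hi => ?_
  have h1 : τ (i + 1) ≤ τ N := hτ (Finset.mem_range.1 hi)
  have h2 : τ i ≤ τ N := hτ (Finset.mem_range.1 hi).le
  rw [min_eq_left (h1.trans ht), min_eq_left (h2.trans ht), min_eq_left h1, min_eq_left h2]

theorem stepSum_of_mem (hτ : Monotone τ) {k N : ℕ} (hk : k < N) (h1 : τ k ≤ t)
    (h2 : t ≤ τ (k + 1)) :
    stepSum τ z N g t = stepSum τ z N g (τ k) + z k * (g t - g (τ k)) := by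
  rw [stepSum_of_le hτ hk h2, stepSum_succ, stepSum_eq_of_ge hτ h1, min_eq_right h2,
    min_eq_left h1, stepSum_of_le hτ hk.le le_rfl]

theorem stepSum_sub (z z' : ℕ → ℝ) (N : ℕ) :
    stepSum τ (fun i => z i - z' i) N g t = stepSum τ z N g t - stepSum τ z' N g t := by
  simp only [stepSum, sub_mul, Finset.sum_sub_distrib]

/-- Inserting a grid point and repeating the weight leaves the sum unchanged, as the two increments
telescope. This puts Euler schemes of successive levels on one grid. -/
theorem stepSum_refine {τ' : ℕ → ℝ≥0} (h : ∀ k, τ' (2 * k) = τ k) (N : ℕ) :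
    stepSum τ' (fun j => z (j / 2)) (2 * N) g t = stepSum τ z N g t := by
  induction N with
  | zero => rfl
  | succ k ih =>
    rw [mul_add_one, stepSum_succ, stepSum_succ, stepSum_succ, ih, Nat.mul_div_cancel_left _ two_pos,
      show (2 * k + 1) / 2 = k by omega, h k, show 2 * k + 1 + 1 = 2 * (k + 1) by ring, h (k + 1)]
    ring

theorem continuous_stepSum (hg : Continuous g) (N : ℕ) : Continuous (stepSum τ z N g) := by
  unfold stepSum
  fun_prop

theorem sum_min_sub_min (τ : ℕ → ℝ≥0) (N : ℕ) (t : ℝ≥0) :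
    ∑ i ∈ Finset.range N, (((min (τ (i + 1)) t : ℝ≥0) : ℝ) - (min (τ i) t : ℝ≥0)) ≤ t := by
  rw [Finset.sum_range_sub (fun i => ((min (τ i) t : ℝ≥0) : ℝ))]
  have h1 : ((min (τ N) t : ℝ≥0) : ℝ) ≤ t := by exact_mod_cast min_le_right _ _
  have h2 := (min (τ 0) t).2
  linarith

theorem sq_stepSum_coe_le (hτ : Monotone τ) (N : ℕ) :
    stepSum τ z N (↑) t ^ 2 ≤ t * ∑ i ∈ Finset.range N,
      (((min (τ (i + 1)) t : ℝ≥0) : ℝ) - (min (τ i) t : ℝ≥0)) * z i ^ 2 := by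
  have hw : ∀ i, 0 ≤ ((min (τ (i + 1)) t : ℝ≥0) : ℝ) - (min (τ i) t : ℝ≥0) := fun i =>
    sub_nonneg.2 (by exact_mod_cast min_le_min_right t (hτ i.le_succ))
  refine (Finset.sum_sq_le_sum_mul_sum_of_sq_le_mul _ (fun i _ => hw i)
    (fun i _ => mul_nonneg (hw i) (sq_nonneg (z i))) fun i _ => le_of_eq (by ring)).trans ?_
  exact mul_le_mul_of_nonneg_right (sum_min_sub_min τ N t)
    (Finset.sum_nonneg fun i _ => mul_nonneg (hw i) (sq_nonneg _))

end StepSum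

/-! ### Step processes with a drift -/

section StepDiffusion

variable {σlo σhi : ℝ} {P : Measure PathSpace} {τ : ℕ → ℝ≥0} {b Z : ℕ → PathSpace → ℝ}

/-- The process with drift `b i` and volatility `Z i` on `(τ i, τ (i + 1)]` for `i < N`. -/
def stepDiffusion (τ : ℕ → ℝ≥0) (b Z : ℕ → PathSpace → ℝ) (N : ℕ) (t : ℝ≥0) (ω : PathSpace) : ℝ :=
  stepSum τ (fun i => b i ω) N (↑) t + stepIntegral τ Z N t ω

theorem stepIntegral_eq_stepSum (N : ℕ) (t : ℝ≥0) (ω : PathSpace) :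
    stepIntegral τ Z N t ω = stepSum τ (fun i => Z i ω) N (fun r => canonB r ω) t :=
  rfl

theorem continuous_stepDiffusion (N : ℕ) (ω : PathSpace) :
    Continuous fun t => stepDiffusion τ b Z N t ω :=
  (continuous_stepSum NNReal.continuous_coe N).add
    (continuous_stepSum (g := fun r => canonB r ω) ω.2.1 N)

theorem stronglyMeasurable_stepDiffusion (hτ : Monotone τ)
    (hb : ∀ i, StronglyMeasurable[pathFiltration (τ i)] (b i))
    (hZ : ∀ i, StronglyMeasurable[pathFiltration (τ i)] (Z i)) (N : ℕ) (t : ℝ≥0) :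
    StronglyMeasurable[pathFiltration t] (stepDiffusion τ b Z N t) := by
  refine StronglyMeasurable.add ?_ (stronglyMeasurable_stepIntegral hτ hZ N t)
  refine Finset.stronglyMeasurable_fun_sum _ fun i _ => ?_
  rcases le_or_gt (τ i) t with h | h
  · exact ((hb i).mono (pathFiltration.mono h)).mul stronglyMeasurable_const
  · have h2 : t ≤ τ (i + 1) := h.le.trans (hτ i.le_succ)
    simp only [min_eq_right h.le, min_eq_right h2, sub_self, mul_zero]
    exact stronglyMeasurable_const

theorem memLp_stepIntegral (hP : P ∈ priors σlo σhi) (hτ : Monotone τ)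
    (hZ : ∀ i, StronglyMeasurable[pathFiltration (τ i)] (Z i)) (hZ2 : ∀ i, MemLp (Z i) 2 P)
    (N : ℕ) (t : ℝ≥0) : MemLp (stepIntegral τ Z N t) 2 P :=
  (isItoIntegral_step hP hτ hZ hZ2 N).memLp hP ((stronglyMeasurable_stepIntegral hτ hZ N t).mono
    (pathFiltration.le t)).aestronglyMeasurable

theorem memLp_stepSum {g : ℝ≥0 → ℝ} (hb2 : ∀ i, MemLp (b i) 2 P) (N : ℕ) (t : ℝ≥0) :
    MemLp (fun ω => stepSum τ (fun i => b i ω) N g t) 2 P :=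
  memLp_finsetSum _ fun i _ => (hb2 i).mul_const _

theorem memLp_stepDiffusion (hP : P ∈ priors σlo σhi) (hτ : Monotone τ)
    (hb2 : ∀ i, MemLp (b i) 2 P)
    (hZ : ∀ i, StronglyMeasurable[pathFiltration (τ i)] (Z i)) (hZ2 : ∀ i, MemLp (Z i) 2 P)
    (N : ℕ) (t : ℝ≥0) : MemLp (stepDiffusion τ b Z N t) 2 P :=
  (memLp_stepSum hb2 N t).add (memLp_stepIntegral hP hτ hZ hZ2 N t)

theorem integral_stepVal_sq [IsProbabilityMeasure P] (hτ : Monotone τ)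
    (hZ2 : ∀ i, MemLp (Z i) 2 P) (N : ℕ) (t : ℝ≥0) :
    ∫ p : ℝ≥0 × PathSpace, stepVal τ Z N p.1 p.2 ^ 2 ∂((timeMeasure.restrict (Set.Iic t)).prod P) =
      ∑ i ∈ Finset.range N, (((min (τ (i + 1)) t : ℝ≥0) : ℝ) - (min (τ i) t : ℝ≥0)) *
        ∫ ω, Z i ω ^ 2 ∂P := by
  have e : ∀ i (p : ℝ≥0 × PathSpace),
      (Set.Ioc (τ i) (τ (i + 1))).indicator (fun _ => Z i p.2 ^ 2) p.1 =
        (Set.Ioc (τ i) (τ (i + 1))).indicator (fun _ => (1 : ℝ)) p.1 * Z i p.2 ^ 2 := by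
    intro i p
    by_cases h : p.1 ∈ Set.Ioc (τ i) (τ (i + 1)) <;> simp [h]
  have hind : ∀ i, Integrable ((Set.Ioc (τ i) (τ (i + 1))).indicator (fun _ => (1 : ℝ)))
      (timeMeasure.restrict (Set.Iic t)) := fun i =>
    (integrable_const _).indicator measurableSet_Ioc
  simp only [stepVal_sq_eq hτ, e]
  rw [integral_finsetSum _ fun i _ => (hind i).mul_prod (hZ2 i).integrable_sq]
  refine Finset.sum_congr rfl fun i _ => ?_
  rw [← SimpleProcess.setIntegral_indicator_Ioc _ _ _ (hτ i.le_succ)]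
  exact integral_prod_mul ((Set.Ioc (τ i) (τ (i + 1))).indicator fun _ => (1 : ℝ))
    fun ω => Z i ω ^ 2

theorem integral_stepIntegral_sq_le (hP : P ∈ priors σlo σhi) (hτ : Monotone τ)
    (hZ : ∀ i, StronglyMeasurable[pathFiltration (τ i)] (Z i)) (hZ2 : ∀ i, MemLp (Z i) 2 P)
    (N : ℕ) (t : ℝ≥0) : ∫ ω, stepIntegral τ Z N t ω ^ 2 ∂P ≤
      σhi ^ 2 * ∑ i ∈ Finset.range N, (((min (τ (i + 1)) t : ℝ≥0) : ℝ) - (min (τ i) t : ℝ≥0)) *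
        ∫ ω, Z i ω ^ 2 ∂P := by
  have := hP.1
  rw [← integral_stepVal_sq hτ hZ2]
  exact ((isItoIntegral_step hP hτ hZ hZ2 N).integral_sq_bounds hP
    ((stronglyMeasurable_stepIntegral hτ hZ N t).mono
      (pathFiltration.le t)).aestronglyMeasurable).2

theorem integral_stepSum_sq_le [IsProbabilityMeasure P] (hτ : Monotone τ)
    (hb2 : ∀ i, MemLp (b i) 2 P) (N : ℕ) (t : ℝ≥0) :
    ∫ ω, stepSum τ (fun i => b i ω) N (↑) t ^ 2 ∂P ≤
      t * ∑ i ∈ Finset.range N, (((min (τ (i + 1)) t : ℝ≥0) : ℝ) - (min (τ i) t : ℝ≥0)) *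
        ∫ ω, b i ω ^ 2 ∂P := by
  simp only [← integral_const_mul]
  rw [← integral_finsetSum _ fun i _ => (hb2 i).integrable_sq.const_mul _, ← integral_const_mul]
  exact integral_mono (memLp_stepSum hb2 N t).integrable_sq
    ((integrable_finsetSum _ fun i _ => (hb2 i).integrable_sq.const_mul _).const_mul _)
    fun ω => sq_stepSum_coe_le hτ N

theorem integral_stepDiffusion_sq_le (hP : P ∈ priors σlo σhi) (hτ : Monotone τ)
    (hb2 : ∀ i, MemLp (b i) 2 P)
    (hZ : ∀ i, StronglyMeasurable[pathFiltration (τ i)] (Z i)) (hZ2 : ∀ i, MemLp (Z i) 2 P)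
    (N : ℕ) (t : ℝ≥0) : ∫ ω, stepDiffusion τ b Z N t ω ^ 2 ∂P ≤
      2 * ∑ i ∈ Finset.range N, (((min (τ (i + 1)) t : ℝ≥0) : ℝ) - (min (τ i) t : ℝ≥0)) *
        (t * ∫ ω, b i ω ^ 2 ∂P + σhi ^ 2 * ∫ ω, Z i ω ^ 2 ∂P) := by
  have := hP.1
  have h1 := (memLp_stepSum (τ := τ) (g := (↑)) hb2 N t).integrable_sq
  have h2 := (memLp_stepIntegral hP hτ hZ hZ2 N t).integrable_sq
  calc ∫ ω, stepDiffusion τ b Z N t ω ^ 2 ∂P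
      ≤ ∫ ω, (2 * stepSum τ (fun i => b i ω) N (↑) t ^ 2 + 2 * stepIntegral τ Z N t ω ^ 2) ∂P := by
        refine integral_mono (memLp_stepDiffusion hP hτ hb2 hZ hZ2 N t).integrable_sq
          ((h1.const_mul 2).add (h2.const_mul 2)) fun ω => ?_
        change (stepSum τ (fun i => b i ω) N (↑) t + stepIntegral τ Z N t ω) ^ 2 ≤
          2 * stepSum τ (fun i => b i ω) N (↑) t ^ 2 + 2 * stepIntegral τ Z N t ω ^ 2
        linarith [add_sq_le (a := stepSum τ (fun i => b i ω) N (↑) t)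
          (b := stepIntegral τ Z N t ω)]
    _ = 2 * ∫ ω, stepSum τ (fun i => b i ω) N (↑) t ^ 2 ∂P +
        2 * ∫ ω, stepIntegral τ Z N t ω ^ 2 ∂P := by
        rw [integral_add (h1.const_mul 2) (h2.const_mul 2), integral_const_mul, integral_const_mul]
    _ ≤ 2 * (t * ∑ i ∈ Finset.range N,
          (((min (τ (i + 1)) t : ℝ≥0) : ℝ) - (min (τ i) t : ℝ≥0)) * ∫ ω, b i ω ^ 2 ∂P) +
        2 * (σhi ^ 2 * ∑ i ∈ Finset.range N,
          (((min (τ (i + 1)) t : ℝ≥0) : ℝ) - (min (τ i) t : ℝ≥0)) * ∫ ω, Z i ω ^ 2 ∂P) := by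
        linarith [integral_stepSum_sq_le hτ hb2 N t, integral_stepIntegral_sq_le hP hτ hZ hZ2 N t]
    _ = _ := by
        simp only [Finset.mul_sum]
        rw [← Finset.sum_add_distrib]
        exact Finset.sum_congr rfl fun i _ => by ring

/-- Orthogonality to the past is tested with indicators of events at time s, which characterizes the
conditional expectation. -/
theorem martingale_stepIntegral (hP : P ∈ priors σlo σhi) (hτ : Monotone τ)
    (hZ : ∀ i, StronglyMeasurable[pathFiltration (τ i)] (Z i)) (hZ2 : ∀ i, MemLp (Z i) 2 P)
    (N : ℕ) : Martingale (stepIntegral τ Z N) pathFiltration P := by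
  have := hP.1
  have hm : ∀ t, AEStronglyMeasurable (stepIntegral τ Z N t) P := fun t =>
    ((stronglyMeasurable_stepIntegral hτ hZ N t).mono (pathFiltration.le t)).aestronglyMeasurable
  have hi : ∀ t, Integrable (stepIntegral τ Z N t) P := fun t =>
    (memLp_stepIntegral hP hτ hZ hZ2 N t).integrable one_le_two
  refine ⟨stronglyMeasurable_stepIntegral hτ hZ N, fun s t hst => ?_⟩
  refine (ae_eq_condExp_of_forall_setIntegral_eq (pathFiltration.le s) (hi t)
    (fun _ _ _ => (hi s).integrableOn) (fun A hA _ => ?_)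
    (stronglyMeasurable_stepIntegral hτ hZ N s).aestronglyMeasurable).symm
  have hA' := pathFiltration.le s A hA
  have h := (isItoIntegral_step hP hτ hZ hZ2 N).integral_mul_sub hP hst (hm s) (hm t)
    (W := A.indicator fun _ => 1)
    ((stronglyMeasurable_const (b := (1 : ℝ))).indicator hA).aestronglyMeasurable
    ((memLp_const 1).indicator hA')
  have e : (fun ω => A.indicator (fun _ => (1 : ℝ)) ω *
      (stepIntegral τ Z N t ω - stepIntegral τ Z N s ω)) =
      A.indicator fun ω => stepIntegral τ Z N t ω - stepIntegral τ Z N s ω := by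
    funext ω
    by_cases hω : ω ∈ A <;> simp [hω]
  rw [e, integral_indicator hA', integral_sub (hi t).integrableOn (hi s).integrableOn] at h
  linarith

theorem MeasureTheory.MemLp.integral_abs_le_sqrt {Ω : Type*} {m0 : MeasurableSpace Ω}
    {μ : Measure Ω} [IsProbabilityMeasure μ] {f : Ω → ℝ} (hf : MemLp f 2 μ) :
    ∫ ω, |f ω| ∂μ ≤ √(∫ ω, f ω ^ 2 ∂μ) := by
  refine Real.le_sqrt_of_sq_le ?_
  have h := sq_integral_le_mul_integral_sq hf.abs
  simpa using h

/-- The threshold 2ε is split between drift and martingale part. By Cauchy–Schwarz one random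
variable G bounds the drift at all times up to T, and Markov's inequality applies to it; the
martingale part is controlled by the maximal inequality. Both first absolute moments are at most √q.
-/
theorem measure_exists_lt_abs_stepDiffusion_le (hP : P ∈ priors σlo σhi) (hτ : Monotone τ)
    (hb2 : ∀ i, MemLp (b i) 2 P)
    (hZ : ∀ i, StronglyMeasurable[pathFiltration (τ i)] (Z i)) (hZ2 : ∀ i, MemLp (Z i) 2 P)
    (N T : ℕ) {q : ℝ} (hq : ∑ i ∈ Finset.range N,
      (((min (τ (i + 1)) T : ℝ≥0) : ℝ) - (min (τ i) T : ℝ≥0)) *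
        (T * ∫ ω, b i ω ^ 2 ∂P + σhi ^ 2 * ∫ ω, Z i ω ^ 2 ∂P) ≤ q) {ε : ℝ≥0} (hε : 0 < ε) :
    P {ω | ∃ t ≤ (T : ℝ≥0), 2 * (ε : ℝ) < |stepDiffusion τ b Z N t ω|} ≤
      ENNReal.ofReal (2 * √q) / ε := by
  have := hP.1
  have hw : ∀ i (t : ℝ≥0), 0 ≤ ((min (τ (i + 1)) t : ℝ≥0) : ℝ) - (min (τ i) t : ℝ≥0) := fun i t =>
    sub_nonneg.2 (by exact_mod_cast min_le_min_right t (hτ i.le_succ))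
  have hwm : ∀ i (t : ℝ≥0), t ≤ T → ((min (τ (i + 1)) t : ℝ≥0) : ℝ) - (min (τ i) t : ℝ≥0) ≤
      ((min (τ (i + 1)) (T : ℝ≥0) : ℝ≥0) : ℝ) - (min (τ i) (T : ℝ≥0) : ℝ≥0) := by
    intro i t ht
    have h1 : (τ i : ℝ) ≤ τ (i + 1) := by exact_mod_cast hτ i.le_succ
    have h2 : (t : ℝ) ≤ (T : ℝ≥0) := by exact_mod_cast ht
    push_cast at h2 ⊢
    rcases min_cases (τ (i + 1) : ℝ) (t : ℝ) with h | h <;>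
    rcases min_cases (τ i : ℝ) (t : ℝ) with h' | h' <;>
    rcases min_cases (τ (i + 1) : ℝ) (T : ℝ) with h'' | h'' <;>
    rcases min_cases (τ i : ℝ) (T : ℝ) with h''' | h''' <;> linarith
  have hsum := integral_stepSum_sq_le (P := P) hτ hb2 N T
  have hint := integral_stepIntegral_sq_le hP hτ hZ hZ2 N T
  have hqe : (T : ℝ) * ∑ i ∈ Finset.range N,
      (((min (τ (i + 1)) T : ℝ≥0) : ℝ) - (min (τ i) T : ℝ≥0)) * ∫ ω, b i ω ^ 2 ∂P +
      σhi ^ 2 * ∑ i ∈ Finset.range N,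
      (((min (τ (i + 1)) T : ℝ≥0) : ℝ) - (min (τ i) T : ℝ≥0)) * ∫ ω, Z i ω ^ 2 ∂P ≤ q := by
    refine le_trans (le_of_eq ?_) hq
    simp only [Finset.mul_sum]
    rw [← Finset.sum_add_distrib]
    exact Finset.sum_congr rfl fun i _ => by ring
  have hn1 : 0 ≤ (T : ℝ) * ∑ i ∈ Finset.range N,
      (((min (τ (i + 1)) T : ℝ≥0) : ℝ) - (min (τ i) T : ℝ≥0)) * ∫ ω, b i ω ^ 2 ∂P :=
    mul_nonneg (Nat.cast_nonneg _) (Finset.sum_nonneg fun i _ =>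
      mul_nonneg (hw i T) (integral_nonneg fun _ => sq_nonneg _))
  have hn2 : 0 ≤ σhi ^ 2 * ∑ i ∈ Finset.range N,
      (((min (τ (i + 1)) T : ℝ≥0) : ℝ) - (min (τ i) T : ℝ≥0)) * ∫ ω, Z i ω ^ 2 ∂P :=
    mul_nonneg (sq_nonneg _) (Finset.sum_nonneg fun i _ =>
      mul_nonneg (hw i T) (integral_nonneg fun _ => sq_nonneg _))
  set G : PathSpace → ℝ := fun ω => √(T * ∑ i ∈ Finset.range N,
    (((min (τ (i + 1)) T : ℝ≥0) : ℝ) - (min (τ i) T : ℝ≥0)) * b i ω ^ 2) with hG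
  have hsqi : Integrable (fun ω => (T : ℝ) * ∑ i ∈ Finset.range N,
      (((min (τ (i + 1)) T : ℝ≥0) : ℝ) - (min (τ i) T : ℝ≥0)) * b i ω ^ 2) P :=
    (integrable_finsetSum _ fun i _ => (hb2 i).integrable_sq.const_mul _).const_mul _
  have hG2 : ∀ ω, G ω ^ 2 = T * ∑ i ∈ Finset.range N,
      (((min (τ (i + 1)) T : ℝ≥0) : ℝ) - (min (τ i) T : ℝ≥0)) * b i ω ^ 2 := fun ω =>
    Real.sq_sqrt (mul_nonneg (Nat.cast_nonneg _) (Finset.sum_nonneg fun i _ =>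
      mul_nonneg (hw i T) (sq_nonneg _)))
  have hGm : MemLp G 2 P := by
    refine (memLp_two_iff_integrable_sq (hsqi.1.aemeasurable.sqrt.aestronglyMeasurable)).2 ?_
    exact hsqi.congr (ae_of_all _ fun ω => (hG2 ω).symm)
  have hGi : ∫ ω, |G ω| ∂P ≤ √q := by
    refine hGm.integral_abs_le_sqrt.trans (Real.sqrt_le_sqrt (le_trans (le_of_eq ?_)
      (le_trans (le_add_of_nonneg_right hn2) hqe)))
    simp only [hG2]
    rw [integral_const_mul, integral_finsetSum _ fun i _ => (hb2 i).integrable_sq.const_mul _]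
    simp only [integral_const_mul]
  have hMi : ∫ ω, |stepIntegral τ Z N T ω| ∂P ≤ √q :=
    (memLp_stepIntegral hP hτ hZ hZ2 N T).integral_abs_le_sqrt.trans
      (Real.sqrt_le_sqrt (hint.trans (le_trans (le_add_of_nonneg_left hn1) hqe)))
  have hsub : {ω | ∃ t ≤ (T : ℝ≥0), 2 * (ε : ℝ) < |stepDiffusion τ b Z N t ω|} ⊆
      {ω | ENNReal.ofReal ε ≤ ENNReal.ofReal |G ω|} ∪
        {ω | ∃ t ≤ (T : ℝ≥0), (ε : ℝ) < |stepIntegral τ Z N t ω|} := by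
    rintro ω ⟨t, ht, h⟩
    by_contra hcon
    rw [Set.mem_union, not_or] at hcon
    have h1 : |G ω| < ε := by
      by_contra! h'
      exact hcon.1 (ENNReal.ofReal_le_ofReal h')
    have h2 : |stepIntegral τ Z N t ω| ≤ ε := by
      by_contra! h'
      exact hcon.2 ⟨t, ht, h'⟩
    have h3 : |stepSum τ (fun i => b i ω) N (↑) t| ≤ |G ω| := by
      refine sq_le_sq.1 ?_
      rw [hG2]
      refine (sq_stepSum_coe_le hτ N).trans ?_
      have ht' : (t : ℝ) ≤ T := by exact_mod_cast ht
      refine mul_le_mul ht' (Finset.sum_le_sum fun i _ =>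
        mul_le_mul_of_nonneg_right (hwm i t ht) (sq_nonneg _))
        (Finset.sum_nonneg fun i _ => mul_nonneg (hw i t) (sq_nonneg _)) (Nat.cast_nonneg _)
    have h4 := abs_add_le (stepSum τ (fun i => b i ω) N (↑) t) (stepIntegral τ Z N t ω)
    rw [stepDiffusion] at h
    linarith
  refine (measure_mono hsub).trans ((measure_union_le _ _).trans ?_)
  have hdiv : ENNReal.ofReal (2 * √q) / ε = ENNReal.ofReal √q / ε + ENNReal.ofReal √q / ε := by
    rw [two_mul, ENNReal.ofReal_add (Real.sqrt_nonneg _) (Real.sqrt_nonneg _), ENNReal.add_div]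
  rw [hdiv]
  refine add_le_add ?_ ?_
  · rw [ENNReal.ofReal_coe_nnreal]
    refine (meas_ge_le_lintegral_div ?_ (by exact_mod_cast hε.ne') ENNReal.coe_ne_top).trans ?_
    · exact hGm.1.aemeasurable.abs.ennreal_ofReal
    · rw [← ofReal_integral_eq_lintegral_ofReal (hGm.integrable one_le_two).abs
        (ae_of_all _ fun _ => abs_nonneg _)]
      exact ENNReal.div_le_div_right (ENNReal.ofReal_le_ofReal hGi) _
  · refine (measure_exists_lt_abs_le (martingale_stepIntegral hP hτ hZ hZ2 N)
      (fun ω => continuous_stepSum (g := fun r => canonB r ω) ω.2.1 N) T hε).trans ?_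
    exact ENNReal.div_le_div_right (ENNReal.ofReal_le_ofReal hMi) _

end StepDiffusion

/-! ### The Euler scheme -/

/-- Discrete Grönwall inequality: the majorant a + c ∑ v grows by a factor of at most 1 + c ≤ exp c
per step. The restriction to k < N reflects estimates that hold up to a horizon only. -/
theorem le_mul_exp_of_le_add_sum {v : ℕ → ℝ} {a c : ℝ} (hc : 0 ≤ c) {N : ℕ}
    (h : ∀ k < N, v k ≤ a + c * ∑ i ∈ Finset.range k, v i) (ha : 0 ≤ a) :
    ∀ k < N, v k ≤ a * Real.exp (c * k) := by
  have hS : ∀ k ≤ N, a + c * ∑ i ∈ Finset.range k, v i ≤ a * Real.exp (c * k) := by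
    intro k
    induction k with
    | zero => simp
    | succ k ih =>
      intro hk
      have h1 := ih (by omega)
      have h2 := h k hk
      have h3 : 1 + c ≤ Real.exp c := by linarith [Real.add_one_le_exp c]
      rw [Finset.sum_range_succ]
      calc a + c * (∑ i ∈ Finset.range k, v i + v k)
          ≤ (1 + c) * (a + c * ∑ i ∈ Finset.range k, v i) := by
            linarith [mul_le_mul_of_nonneg_left h2 hc]
        _ ≤ (1 + c) * (a * Real.exp (c * k)) := mul_le_mul_of_nonneg_left h1 (by linarith)
        _ ≤ Real.exp c * (a * Real.exp (c * k)) :=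
            mul_le_mul_of_nonneg_right h3 (mul_nonneg ha (Real.exp_pos _).le)
        _ = a * Real.exp (c * (k + 1 : ℕ)) := by
            push_cast
            rw [mul_add, mul_one, Real.exp_add]
            ring
  exact fun k hk => (h k hk).trans (hS k hk.le)

/-- The points of the dyadic grid of level `n`. -/
def dyadicGrid (n k : ℕ) : ℝ≥0 := (k : ℝ≥0) / 2 ^ n

theorem monotone_dyadicGrid (n : ℕ) : Monotone (dyadicGrid n) := fun a b h => by
  have : (a : ℝ≥0) ≤ b := by exact_mod_cast h
  unfold dyadicGrid
  gcongr

theorem dyadicGrid_two_mul (n k : ℕ) : dyadicGrid (n + 1) (2 * k) = dyadicGrid n k := by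
  rw [dyadicGrid, dyadicGrid, pow_succ', Nat.cast_mul, Nat.cast_two,
    mul_div_mul_left _ _ two_ne_zero]

theorem dyadicGrid_mul (n T : ℕ) : dyadicGrid n (T * 2 ^ n) = T := by
  rw [dyadicGrid]
  push_cast
  exact mul_div_cancel_right₀ _ (by positivity)

theorem coe_dyadicGrid (n k : ℕ) : (dyadicGrid n k : ℝ) = k / 2 ^ n := by
  simp [dyadicGrid]

theorem dyadicGrid_le {n k T : ℕ} (h : k ≤ T * 2 ^ n) : dyadicGrid n k ≤ T :=
  (monotone_dyadicGrid n h).trans (dyadicGrid_mul n T).le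

theorem min_dyadicGrid_succ_sub {n i k : ℕ} (h : i < k) :
    ((min (dyadicGrid n (i + 1)) (dyadicGrid n k) : ℝ≥0) : ℝ) -
      (min (dyadicGrid n i) (dyadicGrid n k) : ℝ≥0) = 1 / 2 ^ n := by
  rw [min_eq_left (monotone_dyadicGrid n h), min_eq_left (monotone_dyadicGrid n h.le),
    coe_dyadicGrid, coe_dyadicGrid]
  push_cast
  ring

section OneStep

variable {σlo σhi : ℝ} {P : Measure PathSpace} {a t : ℝ≥0} {Y Z : PathSpace → ℝ}

/-- One step of the Euler scheme. -/
theorem memLp_and_integral_increment_sq_le (hP : P ∈ priors σlo σhi) (hat : a ≤ t)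
    (hY2 : MemLp Y 2 P) (hZ : StronglyMeasurable[pathFiltration a] Z)
    (hZ2 : MemLp Z 2 P) :
    MemLp (fun ω => Y ω * ((t : ℝ) - a) + Z ω * (canonB t ω - canonB a ω)) 2 P ∧
    ∫ ω, (Y ω * ((t : ℝ) - a) + Z ω * (canonB t ω - canonB a ω)) ^ 2 ∂P ≤
      2 * (((t : ℝ) - a) * (t * ∫ ω, Y ω ^ 2 ∂P + σhi ^ 2 * ∫ ω, Z ω ^ 2 ∂P)) := by
  -- A single step is a step diffusion on the grid a, t, t, …, so the general estimate applies.
  set τ : ℕ → ℝ≥0 := fun i => if i = 0 then a else t with hτd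
  have hτ : Monotone τ := by
    refine monotone_nat_of_le_succ fun i => ?_
    rcases Nat.eq_zero_or_pos i with rfl | hi
    · simpa [hτd] using hat
    · simp [hτd, hi.ne']
  have hZ' : ∀ i, StronglyMeasurable[pathFiltration (τ i)] Z := by
    intro i
    have : a ≤ τ i := by
      simp only [hτd]
      split_ifs
      exacts [le_rfl, hat]
    exact hZ.mono (pathFiltration.mono this)
  have e : (fun ω => Y ω * ((t : ℝ) - a) + Z ω * (canonB t ω - canonB a ω)) =
      stepDiffusion τ (fun _ => Y) (fun _ => Z) 1 t := by
    funext ω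
    simp [stepDiffusion, stepSum, stepIntegral, hτd, hat]
  have h := integral_stepDiffusion_sq_le hP hτ (fun _ => hY2) hZ' (fun _ => hZ2) 1 t
  refine ⟨e ▸ memLp_stepDiffusion hP hτ (fun _ => hY2) hZ' (fun _ => hZ2) 1 t, ?_⟩
  rw [← e] at h
  have hat' : (a : ℝ) ≤ t := by exact_mod_cast hat
  simpa [hτd, min_eq_left hat'] using h

end OneStep

/-- The Euler scheme of level `n` for `dX = β(X) dt + s(X) dB`, `X 0 = x`, on the grid. -/
def eulerState (β s : ℝ → ℝ) (x : ℝ) (n : ℕ) : ℕ → PathSpace → ℝ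
  | 0, _ => x
  | k + 1, ω => eulerState β s x n k ω +
      (β (eulerState β s x n k ω) * ((dyadicGrid n (k + 1) : ℝ) - dyadicGrid n k) +
      s (eulerState β s x n k ω) * (canonB (dyadicGrid n (k + 1)) ω - canonB (dyadicGrid n k) ω))

/-- The interpolated Euler scheme of level `n` with `N` steps. -/
def eulerPath (β s : ℝ → ℝ) (x : ℝ) (n N : ℕ) (t : ℝ≥0) (ω : PathSpace) : ℝ :=
  x + stepDiffusion (dyadicGrid n) (fun i ω => β (eulerState β s x n i ω))
    (fun i ω => s (eulerState β s x n i ω)) N t ω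

section Euler

variable {σlo σhi : ℝ} {P : Measure PathSpace} {β s : ℝ → ℝ} {x : ℝ} {K : ℝ≥0}

theorem stepDiffusion_of_le {τ : ℕ → ℝ≥0} {b Z : ℕ → PathSpace → ℝ} (hτ : Monotone τ) {N N' : ℕ}
    (h : N ≤ N') {t : ℝ≥0} (ht : t ≤ τ N) (ω : PathSpace) :
    stepDiffusion τ b Z N' t ω = stepDiffusion τ b Z N t ω := by
  simp only [stepDiffusion, stepIntegral_eq_stepSum]
  rw [stepSum_of_le hτ h ht, stepSum_of_le hτ h ht]

theorem stepDiffusion_sub {τ : ℕ → ℝ≥0} {b Z b' Z' : ℕ → PathSpace → ℝ} {N : ℕ} {t : ℝ≥0}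
    (ω : PathSpace) : stepDiffusion τ (fun i ω => b i ω - b' i ω) (fun i ω => Z i ω - Z' i ω) N t ω =
      stepDiffusion τ b Z N t ω - stepDiffusion τ b' Z' N t ω := by
  simp only [stepDiffusion, stepIntegral_eq_stepSum, stepSum_sub]
  ring

theorem stepDiffusion_refine {τ τ' : ℕ → ℝ≥0} {b Z : ℕ → PathSpace → ℝ}
    (h : ∀ k, τ' (2 * k) = τ k) (N : ℕ) (t : ℝ≥0) (ω : PathSpace) :
    stepDiffusion τ' (fun j => b (j / 2)) (fun j => Z (j / 2)) (2 * N) t ω =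
      stepDiffusion τ b Z N t ω := by
  simp only [stepDiffusion, stepIntegral_eq_stepSum]
  rw [stepSum_refine (z := fun i => b i ω) h, stepSum_refine (z := fun i => Z i ω) h]

/-- Steps beyond t do not contribute, so schemes that run to different horizons can be compared. -/
theorem eulerPath_of_le {n N N' : ℕ} (h : N ≤ N') {t : ℝ≥0} (ht : t ≤ dyadicGrid n N)
    (ω : PathSpace) : eulerPath β s x n N' t ω = eulerPath β s x n N t ω := by
  rw [eulerPath, eulerPath, stepDiffusion_of_le (monotone_dyadicGrid n) h ht]

theorem eulerPath_of_mem {n k N : ℕ} (hk : k < N) {t : ℝ≥0} (h1 : dyadicGrid n k ≤ t)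
    (h2 : t ≤ dyadicGrid n (k + 1)) (ω : PathSpace) :
    eulerPath β s x n N t ω = eulerPath β s x n N (dyadicGrid n k) ω +
      (β (eulerState β s x n k ω) * ((t : ℝ) - dyadicGrid n k) +
      s (eulerState β s x n k ω) * (canonB t ω - canonB (dyadicGrid n k) ω)) := by
  simp only [eulerPath, stepDiffusion, stepIntegral_eq_stepSum]
  rw [stepSum_of_mem (monotone_dyadicGrid n) hk h1 h2,
    stepSum_of_mem (monotone_dyadicGrid n) hk h1 h2]
  ring

theorem eulerPath_dyadicGrid {n k N : ℕ} (hk : k ≤ N) (ω : PathSpace) :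
    eulerPath β s x n N (dyadicGrid n k) ω = eulerState β s x n k ω := by
  induction k with
  | zero => simp [eulerPath, stepDiffusion, stepSum, stepIntegral, eulerState, dyadicGrid]
  | succ k ih =>
    rw [eulerPath_of_mem (Nat.lt_of_succ_le hk) (monotone_dyadicGrid n k.le_succ) le_rfl,
      ih (by omega), eulerState]

theorem continuous_eulerPath (n N : ℕ) (ω : PathSpace) :
    Continuous fun t => eulerPath β s x n N t ω :=
  continuous_const.add (continuous_stepDiffusion N ω)

theorem stronglyMeasurable_eulerState (hβ : Continuous β) (hs : Continuous s) (n k : ℕ) :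
    StronglyMeasurable[pathFiltration (dyadicGrid n k)] (eulerState β s x n k) := by
  induction k with
  | zero => exact stronglyMeasurable_const
  | succ k ih =>
    have hle := monotone_dyadicGrid n k.le_succ
    have ih' := ih.mono (pathFiltration.mono hle)
    have hB := Filtration.stronglyAdapted_natural canonB_stronglyMeasurable
    exact ih'.add (((hβ.comp_stronglyMeasurable ih').mul stronglyMeasurable_const).add
      ((hs.comp_stronglyMeasurable ih').mul
        ((hB _).sub ((hB _).mono (pathFiltration.mono hle)))))

theorem stronglyMeasurable_eulerPath (hβ : Continuous β) (hs : Continuous s) (n N : ℕ)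
    (t : ℝ≥0) : StronglyMeasurable[pathFiltration t] (eulerPath β s x n N t) :=
  stronglyMeasurable_const.add (stronglyMeasurable_stepDiffusion (monotone_dyadicGrid n)
    (fun i => hβ.comp_stronglyMeasurable (stronglyMeasurable_eulerState hβ hs n i))
    (fun i => hs.comp_stronglyMeasurable (stronglyMeasurable_eulerState hβ hs n i)) N t)

theorem LipschitzWith.abs_le_add (hβ : LipschitzWith K β) (y : ℝ) : |β y| ≤ |β 0| + K * |y| := by
  have h := hβ.dist_le_mul y 0
  rw [Real.dist_eq, Real.dist_eq, sub_zero] at h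
  linarith [abs_sub_abs_le_abs_sub (β y) (β 0)]

theorem LipschitzWith.sq_le (hβ : LipschitzWith K β) (y : ℝ) :
    β y ^ 2 ≤ 2 * (β 0 ^ 2 + K ^ 2) * (1 + y ^ 2) := by
  have h := pow_le_pow_left₀ (abs_nonneg _) (hβ.abs_le_add y) 2
  rw [sq_abs] at h
  have h2 := add_sq_le (a := |β 0|) (b := K * |y|)
  rw [mul_pow, sq_abs, sq_abs] at h2
  have h3 : 0 ≤ β 0 ^ 2 * y ^ 2 := by positivity
  have h4 : 0 ≤ (K : ℝ) ^ 2 := by positivity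
  linarith

theorem LipschitzWith.sub_sq_le (hβ : LipschitzWith K β) (y z : ℝ) :
    (β y - β z) ^ 2 ≤ K ^ 2 * (y - z) ^ 2 := by
  have h := hβ.dist_le_mul y z
  rw [Real.dist_eq, Real.dist_eq] at h
  have h := pow_le_pow_left₀ (abs_nonneg _) h 2
  rwa [mul_pow, sq_abs, sq_abs] at h

theorem LipschitzWith.comp_memLp_two {α : Type*} {m0 : MeasurableSpace α} {μ : Measure α}
    [IsFiniteMeasure μ] {f : α → ℝ} (hβ : LipschitzWith K β) (hf : MemLp f 2 μ) :
    MemLp (fun a => β (f a)) 2 μ := by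
  refine ((memLp_const |β 0|).add (hf.abs.const_mul (K : ℝ))).of_le
    (hβ.continuous.comp_aestronglyMeasurable hf.1) (ae_of_all _ fun a => ?_)
  rw [Real.norm_eq_abs]
  exact (hβ.abs_le_add _).trans (le_abs_self _)

theorem memLp_eulerState (hP : P ∈ priors σlo σhi) (hβ : LipschitzWith K β)
    (hs : LipschitzWith K s) (n k : ℕ) : MemLp (eulerState β s x n k) 2 P := by
  have := hP.1
  induction k with
  | zero => exact memLp_const x
  | succ k ih =>
    exact ih.add (memLp_and_integral_increment_sq_le hP (monotone_dyadicGrid n k.le_succ)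
      (hβ.comp_memLp_two ih) (hs.continuous.comp_stronglyMeasurable
        (stronglyMeasurable_eulerState hβ.continuous hs.continuous n k))
      (hs.comp_memLp_two ih)).1

theorem memLp_eulerPath (hP : P ∈ priors σlo σhi) (hβ : LipschitzWith K β)
    (hs : LipschitzWith K s) (n N : ℕ) (t : ℝ≥0) : MemLp (eulerPath β s x n N t) 2 P := by
  have := hP.1
  exact (memLp_const x).add (memLp_stepDiffusion hP (monotone_dyadicGrid n)
    (fun i => hβ.comp_memLp_two (memLp_eulerState hP hβ hs n i))
    (fun i => hs.continuous.comp_stronglyMeasurable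
        (stronglyMeasurable_eulerState hβ.continuous hs.continuous n i))
    (fun i => hs.comp_memLp_two (memLp_eulerState hP hβ hs n i)) N t)

theorem LipschitzWith.integral_sq_le {f : PathSpace → ℝ} [IsProbabilityMeasure P]
    (hβ : LipschitzWith K β) (hf : MemLp f 2 P) :
    ∫ ω, β (f ω) ^ 2 ∂P ≤ 2 * (β 0 ^ 2 + K ^ 2) * (1 + ∫ ω, f ω ^ 2 ∂P) := by
  calc ∫ ω, β (f ω) ^ 2 ∂P ≤ ∫ ω, 2 * (β 0 ^ 2 + K ^ 2) * (1 + f ω ^ 2) ∂P :=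
        integral_mono (hβ.comp_memLp_two hf).integrable_sq
          (((integrable_const 1).add hf.integrable_sq).const_mul _) fun ω => hβ.sq_le _
    _ = _ := by
        rw [integral_const_mul, integral_add (integrable_const 1) hf.integrable_sq]
        simp

theorem LipschitzWith.integral_sub_sq_le {f g : PathSpace → ℝ} [IsProbabilityMeasure P]
    (hβ : LipschitzWith K β) (hf : MemLp f 2 P) (hg : MemLp g 2 P) :
    ∫ ω, (β (f ω) - β (g ω)) ^ 2 ∂P ≤ K ^ 2 * ∫ ω, (f ω - g ω) ^ 2 ∂P := by
  rw [← integral_const_mul]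
  exact integral_mono ((hβ.comp_memLp_two hf).sub (hβ.comp_memLp_two hg)).integrable_sq
    ((hf.sub hg).integrable_sq.const_mul _) fun ω => hβ.sub_sq_le _ _

theorem integral_add_sq_le {f g : PathSpace → ℝ} (hf : MemLp f 2 P) (hg : MemLp g 2 P) :
    ∫ ω, (f ω + g ω) ^ 2 ∂P ≤ 2 * ∫ ω, f ω ^ 2 ∂P + 2 * ∫ ω, g ω ^ 2 ∂P := by
  rw [← integral_const_mul, ← integral_const_mul,
    ← integral_add (hf.integrable_sq.const_mul 2) (hg.integrable_sq.const_mul 2)]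
  exact integral_mono (hf.add hg).integrable_sq
    ((hf.integrable_sq.const_mul 2).add (hg.integrable_sq.const_mul 2))
    fun ω => by
      change (f ω + g ω) ^ 2 ≤ 2 * f ω ^ 2 + 2 * g ω ^ 2
      linarith [add_sq_le (a := f ω) (b := g ω)]

theorem div_two_pow_le {n k T : ℕ} (h : k ≤ T * 2 ^ n) : (1 : ℝ) / 2 ^ n * k ≤ T := by
  rw [one_div_mul_eq_div, div_le_iff₀ (by positivity)]
  exact_mod_cast h

/-- Second moments of the Euler scheme, uniformly in the level and in the prior. -/
theorem exists_integral_eulerState_sq_le (hβ : LipschitzWith K β) (hs : LipschitzWith K s)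
    (σlo σhi x : ℝ) (T : ℕ) : ∃ C, 0 ≤ C ∧ ∀ P ∈ priors σlo σhi, ∀ n, ∀ k < T * 2 ^ n,
      1 + ∫ ω, eulerState β s x n k ω ^ 2 ∂P ≤ C := by
  -- One factor 2 comes from splitting off the initial value and one from the bound for step
  -- diffusions; the bracket is the linear growth of the Lipschitz coefficients in mean square.
  set c : ℝ := 4 * (T * (2 * (β 0 ^ 2 + K ^ 2)) + σhi ^ 2 * (2 * (s 0 ^ 2 + K ^ 2))) with hc
  have hc0 : 0 ≤ c := by positivity
  refine ⟨(1 + 2 * x ^ 2) * Real.exp (c * T), by positivity, fun P hP n => ?_⟩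
  have := hP.1
  have hE := memLp_eulerState (x := x) hP hβ hs n
  have hEm := stronglyMeasurable_eulerState (x := x) hβ.continuous hs.continuous n
  have key := le_mul_exp_of_le_add_sum (v := fun k => 1 + ∫ ω, eulerState β s x n k ω ^ 2 ∂P)
    (a := 1 + 2 * x ^ 2) (c := c * (1 / 2 ^ n)) (by positivity) (N := T * 2 ^ n) (fun k hk => ?_)
    (by positivity)
  · intro k hk
    refine (key k hk).trans ?_
    rw [mul_assoc]
    gcongr
    exact div_two_pow_le hk.le
  · have e : ∀ ω, eulerState β s x n k ω = x + stepDiffusion (dyadicGrid n)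
        (fun i ω => β (eulerState β s x n i ω)) (fun i ω => s (eulerState β s x n i ω)) k
        (dyadicGrid n k) ω := fun ω => (eulerPath_dyadicGrid le_rfl ω).symm
    have hb2 := fun i => hβ.comp_memLp_two (hE i)
    have hZ2 := fun i => hs.comp_memLp_two (hE i)
    have hZ := fun i => hs.continuous.comp_stronglyMeasurable (hEm i)
    have hY := memLp_stepDiffusion hP (monotone_dyadicGrid n) hb2 hZ hZ2 k (dyadicGrid n k)
    have h1 : ∫ ω, eulerState β s x n k ω ^ 2 ∂P ≤ 2 * x ^ 2 + 2 * ∫ ω, stepDiffusion (dyadicGrid n)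
        (fun i ω => β (eulerState β s x n i ω)) (fun i ω => s (eulerState β s x n i ω)) k
        (dyadicGrid n k) ω ^ 2 ∂P := by
      have := integral_add_sq_le (memLp_const (μ := P) x) hY
      simp only [← e] at this
      simpa using this
    have h2 := integral_stepDiffusion_sq_le hP (monotone_dyadicGrid n) hb2 hZ hZ2 k (dyadicGrid n k)
    have h3 : ∑ i ∈ Finset.range k,
        (((min (dyadicGrid n (i + 1)) (dyadicGrid n k) : ℝ≥0) : ℝ) -
          (min (dyadicGrid n i) (dyadicGrid n k) : ℝ≥0)) *
        (dyadicGrid n k * ∫ ω, β (eulerState β s x n i ω) ^ 2 ∂P +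
          σhi ^ 2 * ∫ ω, s (eulerState β s x n i ω) ^ 2 ∂P) ≤
        ∑ i ∈ Finset.range k, 1 / 2 ^ n * (c / 4 * (1 + ∫ ω, eulerState β s x n i ω ^ 2 ∂P)) := by
      refine Finset.sum_le_sum fun i hi => ?_
      rw [min_dyadicGrid_succ_sub (Finset.mem_range.1 hi)]
      refine mul_le_mul_of_nonneg_left ?_ (by positivity)
      have hT : (dyadicGrid n k : ℝ) ≤ T := by exact_mod_cast dyadicGrid_le hk.le
      have i1 := mul_le_mul hT (hβ.integral_sq_le (hE i)) (integral_nonneg fun _ => sq_nonneg _)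
        (Nat.cast_nonneg T)
      have i2 := mul_le_mul_of_nonneg_left (hs.integral_sq_le (hE i)) (sq_nonneg σhi)
      refine (add_le_add i1 i2).trans (le_of_eq ?_)
      rw [hc]
      ring
    rw [← Finset.mul_sum, ← Finset.mul_sum] at h3
    linarith

/-- The Euler scheme moves little between two points of the grid. -/
theorem exists_integral_eulerPath_sub_sq_le (hβ : LipschitzWith K β) (hs : LipschitzWith K s)
    (σlo σhi x : ℝ) (T : ℕ) : ∃ C, 0 ≤ C ∧ ∀ P ∈ priors σlo σhi, ∀ n, ∀ k < T * 2 ^ n,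
      ∀ t, dyadicGrid n k ≤ t → t ≤ dyadicGrid n (k + 1) →
      ∫ ω, (eulerPath β s x n (T * 2 ^ n) t ω - eulerState β s x n k ω) ^ 2 ∂P ≤
        C * (1 / 2 ^ n) := by
  obtain ⟨C, hC, h⟩ := exists_integral_eulerState_sq_le hβ hs σlo σhi x T
  refine ⟨2 * ((T * (2 * (β 0 ^ 2 + K ^ 2)) + σhi ^ 2 * (2 * (s 0 ^ 2 + K ^ 2))) * C),
    by positivity, fun P hP n k hk t h1 h2 => ?_⟩
  have := hP.1
  have hE := memLp_eulerState (x := x) hP hβ hs n k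
  have e : ∀ ω, eulerPath β s x n (T * 2 ^ n) t ω - eulerState β s x n k ω =
      β (eulerState β s x n k ω) * ((t : ℝ) - dyadicGrid n k) +
      s (eulerState β s x n k ω) * (canonB t ω - canonB (dyadicGrid n k) ω) := fun ω => by
    rw [eulerPath_of_mem hk h1 h2, eulerPath_dyadicGrid hk.le]
    ring
  simp only [e]
  refine (memLp_and_integral_increment_sq_le hP h1 (hβ.comp_memLp_two hE)
    (hs.continuous.comp_stronglyMeasurable
        (stronglyMeasurable_eulerState hβ.continuous hs.continuous n k))
    (hs.comp_memLp_two hE)).2.trans ?_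
  have hT : (t : ℝ) ≤ T := by exact_mod_cast h2.trans (dyadicGrid_le hk)
  have h3 : (t : ℝ) - dyadicGrid n k ≤ 1 / 2 ^ n := by
    have h2' : (t : ℝ) ≤ dyadicGrid n (k + 1) := by exact_mod_cast h2
    rw [coe_dyadicGrid] at h2' ⊢
    push_cast at h2'
    rw [add_div] at h2'
    linarith
  have h4 : (0 : ℝ) ≤ t - dyadicGrid n k := sub_nonneg.2 (by exact_mod_cast h1)
  have hCk := h P hP n k hk
  have i1 : ∫ ω, β (eulerState β s x n k ω) ^ 2 ∂P ≤ 2 * (β 0 ^ 2 + K ^ 2) * C :=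
    (hβ.integral_sq_le hE).trans (by gcongr)
  have i2 : ∫ ω, s (eulerState β s x n k ω) ^ 2 ∂P ≤ 2 * (s 0 ^ 2 + K ^ 2) * C :=
    (hs.integral_sq_le hE).trans (by gcongr)
  have j1 : 0 ≤ ∫ ω, β (eulerState β s x n k ω) ^ 2 ∂P := integral_nonneg fun _ => sq_nonneg _
  have j2 : 0 ≤ ∫ ω, s (eulerState β s x n k ω) ^ 2 ∂P := integral_nonneg fun _ => sq_nonneg _
  calc 2 * (((t : ℝ) - dyadicGrid n k) * (t * ∫ ω, β (eulerState β s x n k ω) ^ 2 ∂P +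
        σhi ^ 2 * ∫ ω, s (eulerState β s x n k ω) ^ 2 ∂P))
      ≤ 2 * (1 / 2 ^ n * (T * (2 * (β 0 ^ 2 + K ^ 2) * C) +
        σhi ^ 2 * (2 * (s 0 ^ 2 + K ^ 2) * C))) := by gcongr
    _ = _ := by ring

end Euler

/-! ### Comparison of successive Euler schemes -/

section EulerDifference

variable {σlo σhi : ℝ} {P : Measure PathSpace} {β s : ℝ → ℝ} {x : ℝ} {K : ℝ≥0}

/-- Successive Euler schemes as a step process on the finer grid. -/
theorem eulerPath_succ_sub (n N : ℕ) (t : ℝ≥0) (ω : PathSpace) :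
    eulerPath β s x (n + 1) (2 * N) t ω - eulerPath β s x n N t ω =
      stepDiffusion (dyadicGrid (n + 1))
        (fun i ω => β (eulerState β s x (n + 1) i ω) - β (eulerState β s x n (i / 2) ω))
        (fun i ω => s (eulerState β s x (n + 1) i ω) - s (eulerState β s x n (i / 2) ω))
        (2 * N) t ω := by
  rw [stepDiffusion_sub, eulerPath, eulerPath, ← stepDiffusion_refine (dyadicGrid_two_mul n) N]
  ring

theorem dyadicGrid_half_le (n j : ℕ) : dyadicGrid n (j / 2) ≤ dyadicGrid (n + 1) j := by
  rw [← dyadicGrid_two_mul]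
  exact monotone_dyadicGrid _ (by omega)

theorem dyadicGrid_le_half_succ (n j : ℕ) : dyadicGrid (n + 1) j ≤ dyadicGrid n (j / 2 + 1) := by
  rw [← dyadicGrid_two_mul n (j / 2 + 1)]
  exact monotone_dyadicGrid _ (by omega)

theorem stronglyMeasurable_eulerState_half (hβ : Continuous β) (hs : Continuous s) (n i : ℕ) :
    StronglyMeasurable[pathFiltration (dyadicGrid (n + 1) i)] (eulerState β s x n (i / 2)) :=
  (stronglyMeasurable_eulerState hβ hs n (i / 2)).mono (pathFiltration.mono (dyadicGrid_half_le n i))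

theorem mul_two_pow_succ (T n : ℕ) : T * 2 ^ (n + 1) = 2 * (T * 2 ^ n) := by ring

/-- The coefficients of successive Euler schemes are close in mean square, uniformly in the
prior. -/
theorem exists_integral_eulerState_succ_sub_sq_le (hβ : LipschitzWith K β)
    (hs : LipschitzWith K s) (σlo σhi x : ℝ) (T : ℕ) :
    ∃ C, 0 ≤ C ∧ ∀ P ∈ priors σlo σhi, ∀ n, ∀ j < T * 2 ^ (n + 1),
      ∫ ω, (eulerState β s x (n + 1) j ω - eulerState β s x n (j / 2) ω) ^ 2 ∂P ≤
        C * (1 / 2 ^ n) := by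
  obtain ⟨C, hC, h⟩ := exists_integral_eulerPath_sub_sq_le hβ hs σlo σhi x T
  set c : ℝ := 4 * (K ^ 2 * (T + σhi ^ 2)) with hc
  have hc0 : 0 ≤ c := by positivity
  refine ⟨2 * C * Real.exp (c * T), by positivity, fun P hP n => ?_⟩
  have := hP.1
  have hE := memLp_eulerState (x := x) hP hβ hs
  have hEm := stronglyMeasurable_eulerState (x := x) hβ.continuous hs.continuous (n + 1)
  have hEm' := stronglyMeasurable_eulerState_half (x := x) hβ.continuous hs.continuous n
  have key := le_mul_exp_of_le_add_sum
    (v := fun j => ∫ ω, (eulerState β s x (n + 1) j ω - eulerState β s x n (j / 2) ω) ^ 2 ∂P)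
    (a := 2 * C * (1 / 2 ^ n)) (c := c * (1 / 2 ^ (n + 1))) (by positivity) (N := T * 2 ^ (n + 1))
    (fun j hj => ?_) (by positivity)
  · intro j hj
    refine (key j hj).trans ?_
    rw [mul_right_comm (2 * C), mul_assoc c]
    gcongr
    exact div_two_pow_le hj.le
  · set b := fun (i : ℕ) ω => β (eulerState β s x (n + 1) i ω) - β (eulerState β s x n (i / 2) ω)
    set Z := fun (i : ℕ) ω => s (eulerState β s x (n + 1) i ω) - s (eulerState β s x n (i / 2) ω)
    have hb2 : ∀ i, MemLp (b i) 2 P := fun i =>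
      (hβ.comp_memLp_two (hE (n + 1) i)).sub (hβ.comp_memLp_two (hE n (i / 2)))
    have hZ2 : ∀ i, MemLp (Z i) 2 P := fun i =>
      (hs.comp_memLp_two (hE (n + 1) i)).sub (hs.comp_memLp_two (hE n (i / 2)))
    have hZ : ∀ i, StronglyMeasurable[pathFiltration (dyadicGrid (n + 1) i)] (Z i) := fun i =>
      (hs.continuous.comp_stronglyMeasurable (hEm i)).sub
        (hs.continuous.comp_stronglyMeasurable (hEm' i))
    have hY := memLp_stepDiffusion hP (monotone_dyadicGrid (n + 1)) hb2 hZ hZ2 j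
      (dyadicGrid (n + 1) j)
    have hj2 : j / 2 < T * 2 ^ n := by rw [mul_two_pow_succ] at hj; omega
    have hI := h P hP n (j / 2) hj2 (dyadicGrid (n + 1) j) (dyadicGrid_half_le n j)
      (dyadicGrid_le_half_succ n j)
    -- The coarse coefficient is frozen at the coarse grid point j / 2. Its deviation from the fine
    -- state is the accumulated difference of the schemes, to which Grönwall applies, plus the
    -- movement of the coarse scheme since that point, of order 2⁻ⁿ in mean square.
    have e : ∀ ω, eulerState β s x (n + 1) j ω - eulerState β s x n (j / 2) ω =
        stepDiffusion (dyadicGrid (n + 1)) b Z j (dyadicGrid (n + 1) j) ω +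
        (eulerPath β s x n (T * 2 ^ n) (dyadicGrid (n + 1) j) ω -
          eulerState β s x n (j / 2) ω) := by
      intro ω
      have h1 := eulerPath_succ_sub (β := β) (s := s) (x := x) n (T * 2 ^ n)
        (dyadicGrid (n + 1) j) ω
      rw [← mul_two_pow_succ, eulerPath_dyadicGrid hj.le,
        stepDiffusion_of_le (monotone_dyadicGrid (n + 1)) hj.le le_rfl] at h1
      linarith
    have h1 := integral_add_sq_le hY
      ((memLp_eulerPath (x := x) hP hβ hs n (T * 2 ^ n) (dyadicGrid (n + 1) j)).sub (hE n (j / 2)))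
    simp only [Pi.sub_apply, ← e] at h1
    have h2 := integral_stepDiffusion_sq_le hP (monotone_dyadicGrid (n + 1)) hb2 hZ hZ2 j
      (dyadicGrid (n + 1) j)
    have h3 : ∑ i ∈ Finset.range j,
        (((min (dyadicGrid (n + 1) (i + 1)) (dyadicGrid (n + 1) j) : ℝ≥0) : ℝ) -
          (min (dyadicGrid (n + 1) i) (dyadicGrid (n + 1) j) : ℝ≥0)) *
        (dyadicGrid (n + 1) j * ∫ ω, b i ω ^ 2 ∂P + σhi ^ 2 * ∫ ω, Z i ω ^ 2 ∂P) ≤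
        ∑ i ∈ Finset.range j, 1 / 2 ^ (n + 1) * (c / 4 *
          ∫ ω, (eulerState β s x (n + 1) i ω - eulerState β s x n (i / 2) ω) ^ 2 ∂P) := by
      refine Finset.sum_le_sum fun i hi => ?_
      rw [min_dyadicGrid_succ_sub (Finset.mem_range.1 hi)]
      refine mul_le_mul_of_nonneg_left ?_ (by positivity)
      have hT : (dyadicGrid (n + 1) j : ℝ) ≤ T := by exact_mod_cast dyadicGrid_le hj.le
      have i1 := mul_le_mul hT (hβ.integral_sub_sq_le (hE (n + 1) i) (hE n (i / 2)))
        (integral_nonneg fun _ => sq_nonneg _) (Nat.cast_nonneg T)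
      have i2 := mul_le_mul_of_nonneg_left
        (hs.integral_sub_sq_le (hE (n + 1) i) (hE n (i / 2))) (sq_nonneg σhi)
      refine (add_le_add i1 i2).trans (le_of_eq ?_)
      rw [hc]
      ring
    rw [← Finset.mul_sum, ← Finset.mul_sum] at h3
    linarith

/-- The difference is a step diffusion whose coefficients have second moments of order 2⁻ⁿ, so the
mean square bound and the maximal bound follow with one constant, common to all priors. -/
theorem exists_eulerPath_succ_sub_bounds (hβ : LipschitzWith K β)
    (hs : LipschitzWith K s) (σlo σhi x : ℝ) (T : ℕ) :
    ∃ C, 0 ≤ C ∧ ∀ P ∈ priors σlo σhi, ∀ n,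
      (∀ t ≤ (T : ℝ≥0), ∫ ω, (eulerPath β s x (n + 1) (T * 2 ^ (n + 1)) t ω -
        eulerPath β s x n (T * 2 ^ n) t ω) ^ 2 ∂P ≤ C * (1 / 2 ^ n)) ∧
      ∀ ε : ℝ≥0, 0 < ε → P {ω | ∃ t ≤ (T : ℝ≥0), 2 * (ε : ℝ) <
        |eulerPath β s x (n + 1) (T * 2 ^ (n + 1)) t ω -
          eulerPath β s x n (T * 2 ^ n) t ω|} ≤
        ENNReal.ofReal (2 * √(C * (1 / 2 ^ n))) / ε := by
  obtain ⟨C, hC, h⟩ := exists_integral_eulerState_succ_sub_sq_le hβ hs σlo σhi x T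
  refine ⟨2 * (T * ((T + σhi ^ 2) * (K ^ 2 * C))), by positivity, fun P hP n => ?_⟩
  have := hP.1
  have hE := memLp_eulerState (x := x) hP hβ hs
  have hEm := stronglyMeasurable_eulerState (x := x) hβ.continuous hs.continuous (n + 1)
  have hEm' := stronglyMeasurable_eulerState_half (x := x) hβ.continuous hs.continuous n
  simp only [mul_two_pow_succ, eulerPath_succ_sub]
  set b := fun (i : ℕ) ω => β (eulerState β s x (n + 1) i ω) - β (eulerState β s x n (i / 2) ω)
  set Z := fun (i : ℕ) ω => s (eulerState β s x (n + 1) i ω) - s (eulerState β s x n (i / 2) ω)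
  have hb2 : ∀ i, MemLp (b i) 2 P := fun i =>
    (hβ.comp_memLp_two (hE (n + 1) i)).sub (hβ.comp_memLp_two (hE n (i / 2)))
  have hZ2 : ∀ i, MemLp (Z i) 2 P := fun i =>
    (hs.comp_memLp_two (hE (n + 1) i)).sub (hs.comp_memLp_two (hE n (i / 2)))
  have hZ : ∀ i, StronglyMeasurable[pathFiltration (dyadicGrid (n + 1) i)] (Z i) := fun i =>
    (hs.continuous.comp_stronglyMeasurable (hEm i)).sub
      (hs.continuous.comp_stronglyMeasurable (hEm' i))
  have hq : ∀ t ≤ (T : ℝ≥0), ∑ i ∈ Finset.range (2 * (T * 2 ^ n)),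
      (((min (dyadicGrid (n + 1) (i + 1)) t : ℝ≥0) : ℝ) - (min (dyadicGrid (n + 1) i) t : ℝ≥0)) *
      (t * ∫ ω, b i ω ^ 2 ∂P + σhi ^ 2 * ∫ ω, Z i ω ^ 2 ∂P) ≤
      T * ((T + σhi ^ 2) * (K ^ 2 * C)) * (1 / 2 ^ n) := by
    intro t ht
    have ht' : (t : ℝ) ≤ T := by exact_mod_cast ht
    calc _ ≤ ∑ i ∈ Finset.range (2 * (T * 2 ^ n)), (((min (dyadicGrid (n + 1) (i + 1)) t : ℝ≥0) : ℝ) -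
          (min (dyadicGrid (n + 1) i) t : ℝ≥0)) *
          ((T + σhi ^ 2) * (K ^ 2 * C) * (1 / 2 ^ n)) := by
          refine Finset.sum_le_sum fun i hi => mul_le_mul_of_nonneg_left ?_ (sub_nonneg.2 (by
            exact_mod_cast min_le_min_right t (monotone_dyadicGrid (n + 1) i.le_succ)))
          have hij := h P hP n i (by rw [mul_two_pow_succ]; exact Finset.mem_range.1 hi)
          have hk := mul_le_mul_of_nonneg_left hij (sq_nonneg (K : ℝ))
          have i1 := mul_le_mul ht' ((hβ.integral_sub_sq_le (hE (n + 1) i) (hE n (i / 2))).trans hk)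
            (integral_nonneg fun _ => sq_nonneg _) (Nat.cast_nonneg T)
          have i2 := mul_le_mul_of_nonneg_left
            ((hs.integral_sub_sq_le (hE (n + 1) i) (hE n (i / 2))).trans hk) (sq_nonneg σhi)
          refine (add_le_add i1 i2).trans (le_of_eq ?_)
          ring
      _ ≤ T * ((T + σhi ^ 2) * (K ^ 2 * C) * (1 / 2 ^ n)) := by
          rw [← Finset.sum_mul]
          exact mul_le_mul_of_nonneg_right ((sum_min_sub_min _ _ t).trans ht') (by positivity)
      _ = _ := by ring
  refine ⟨fun t ht => ?_, fun ε hε => ?_⟩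
  · refine (integral_stepDiffusion_sq_le hP (monotone_dyadicGrid (n + 1)) hb2 hZ hZ2
      (2 * (T * 2 ^ n)) t).trans ?_
    linarith [hq t ht]
  · refine measure_exists_lt_abs_stepDiffusion_le hP (monotone_dyadicGrid (n + 1)) hb2 hZ hZ2 _ T
      ((hq T le_rfl).trans ?_) hε
    have : 0 ≤ T * ((T + σhi ^ 2) * (K ^ 2 * C)) * (1 / 2 ^ n) := by positivity
    linarith

end EulerDifference

/-! ### Convergence of the Euler scheme -/

/-- The Euler scheme of level `n`, run up to time `n`. -/
def eulerApprox (β s : ℝ → ℝ) (x : ℝ) (n : ℕ) : ℝ≥0 → PathSpace → ℝ :=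
  eulerPath β s x n (n * 2 ^ n)

/-- The limit of the Euler schemes. -/
def eulerLimit (β s : ℝ → ℝ) (x : ℝ) (t : ℝ≥0) (ω : PathSpace) : ℝ :=
  limUnder atTop fun n => eulerApprox β s x n t ω

section EulerLimit

variable {σlo σhi : ℝ} {P : Measure PathSpace} {β s : ℝ → ℝ} {x : ℝ} {K : ℝ≥0}

theorem eulerApprox_eq {n T : ℕ} (h : T ≤ n) {t : ℝ≥0} (ht : t ≤ T) (ω : PathSpace) :
    eulerApprox β s x n t ω = eulerPath β s x n (T * 2 ^ n) t ω :=
  eulerPath_of_le (Nat.mul_le_mul_right _ h) (by rwa [dyadicGrid_mul]) ω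

/-- The rational number 5/7 stands in for 1/√2, as (5/7)² = 25/49 exceeds 1/2. -/
theorem sqrt_mul_one_div_two_pow_le {C : ℝ} (hC : 0 ≤ C) (n : ℕ) :
    √(C * (1 / 2 ^ n)) ≤ √C * (5 / 7) ^ n := by
  rw [Real.sqrt_mul hC]
  refine mul_le_mul_of_nonneg_left (Real.sqrt_le_iff.2 ⟨by positivity, ?_⟩) (Real.sqrt_nonneg _)
  rw [← pow_mul, mul_comm n 2, pow_mul, ← one_div_pow]
  exact pow_le_pow_left₀ (by norm_num) (by norm_num) n

/-- Under every prior the Euler schemes converge locally uniformly. -/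
theorem ae_eulerApprox_geometric (hP : P ∈ priors σlo σhi) (hβ : LipschitzWith K β)
    (hs : LipschitzWith K s) : ∀ᵐ ω ∂P, ∀ T : ℕ, ∃ N, ∀ n ≥ N, ∀ t ≤ (T : ℝ≥0),
      |eulerApprox β s x (n + 1) t ω - eulerApprox β s x n t ω| ≤ (3 / 4) ^ n := by
  rw [ae_all_iff]
  intro T
  obtain ⟨C, hC, h⟩ := exists_eulerPath_succ_sub_bounds hβ hs σlo σhi x T
  -- The maximal inequality concerns the threshold 2ε, hence the division by 2. As 3/4 exceeds 5/7,
  -- the probabilities decay like ((5/7) / (3/4))ⁿ = (20/21)ⁿ and Borel–Cantelli applies.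
  set ε : ℕ → ℝ≥0 := fun n => (3 / 4) ^ n / 2
  have hε : ∀ n, 0 < ε n := fun n => by positivity
  have hε2 : ∀ n, 2 * (ε n : ℝ) = (3 / 4) ^ n := fun n => by
    simp only [ε]
    push_cast
    ring
  have hb : ∀ n, P {ω | ∃ t ≤ (T : ℝ≥0), 2 * (ε n : ℝ) <
      |eulerPath β s x (n + 1) (T * 2 ^ (n + 1)) t ω -
        eulerPath β s x n (T * 2 ^ n) t ω|} ≤ ENNReal.ofReal (4 * √C * (20 / 21) ^ n) := by
    intro n
    refine ((h P hP n).2 (ε n) (hε n)).trans ?_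
    rw [← ENNReal.ofReal_coe_nnreal, ← ENNReal.ofReal_div_of_pos (by exact_mod_cast hε n)]
    refine ENNReal.ofReal_le_ofReal ?_
    rw [div_le_iff₀ (by exact_mod_cast hε n)]
    have e : (4 * √C * (20 / 21) ^ n) * (ε n : ℝ) = 2 * (√C * (5 / 7) ^ n) := by
      have h1 : (20 / 21 : ℝ) ^ n * (3 / 4) ^ n = (5 / 7) ^ n := by
        rw [← mul_pow]; norm_num
      linear_combination (2 * √C * (20 / 21) ^ n) * hε2 n + 2 * √C * h1
    rw [e]
    exact mul_le_mul_of_nonneg_left (sqrt_mul_one_div_two_pow_le hC n) two_pos.le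
  have hsum : ∑' n, P {ω | ∃ t ≤ (T : ℝ≥0), 2 * (ε n : ℝ) <
      |eulerPath β s x (n + 1) (T * 2 ^ (n + 1)) t ω -
        eulerPath β s x n (T * 2 ^ n) t ω|} ≠ ∞ := by
    refine ne_top_of_le_ne_top ?_ (ENNReal.tsum_le_tsum hb)
    exact ((summable_geometric_of_lt_one (by norm_num) (by norm_num)).mul_left _).tsum_ofReal_ne_top
  filter_upwards [ae_eventually_notMem hsum] with ω hω
  obtain ⟨N, hN⟩ := eventually_atTop.1 hω
  refine ⟨max N T, fun n hn t ht => ?_⟩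
  have h1 := hN n (le_of_max_le_left hn)
  have hT : T ≤ n := le_of_max_le_right hn
  rw [eulerApprox_eq (hT.trans n.le_succ) ht, eulerApprox_eq hT ht, ← hε2]
  by_contra! hcon
  exact h1 ⟨t, ht, hcon⟩

theorem ae_tendsto_eulerApprox (hP : P ∈ priors σlo σhi) (hβ : LipschitzWith K β)
    (hs : LipschitzWith K s) : ∀ᵐ ω ∂P, ∀ t,
      Tendsto (fun n => eulerApprox β s x n t ω) atTop (𝓝 (eulerLimit β s x t ω)) := by
  filter_upwards [ae_eulerApprox_geometric (x := x) hP hβ hs] with ω hω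
  exact (exists_limUnder_geometric (f := fun n t => eulerApprox β s x n t ω)
    (by norm_num : (3 / 4 : ℝ) < 1) hω).1

theorem ae_continuous_eulerLimit (hP : P ∈ priors σlo σhi) (hβ : LipschitzWith K β)
    (hs : LipschitzWith K s) : ∀ᵐ ω ∂P, Continuous fun t => eulerLimit β s x t ω := by
  filter_upwards [ae_eulerApprox_geometric (x := x) hP hβ hs] with ω hω
  have h := (exists_limUnder_geometric (f := fun n t => eulerApprox β s x n t ω)
    (by norm_num : (3 / 4 : ℝ) < 1) hω).2
  have hr : Tendsto (fun n : ℕ => (3 / 4 : ℝ) ^ n / (1 - 3 / 4)) atTop (𝓝 0) := by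
    simpa using (tendsto_pow_atTop_nhds_zero_of_lt_one (r := (3 / 4 : ℝ)) (by norm_num)
      (by norm_num)).div_const (1 - 3 / 4)
  refine continuous_iff_continuousAt.2 fun t => ?_
  obtain ⟨T, hT⟩ := exists_nat_gt t
  obtain ⟨N, hN⟩ := h T
  have hu : TendstoUniformlyOn (fun n t => eulerApprox β s x n t ω)
      (fun t => eulerLimit β s x t ω) atTop (Set.Iic (T : ℝ≥0)) := by
    rw [Metric.tendstoUniformlyOn_iff]
    intro ε hε
    filter_upwards [hr.eventually (gt_mem_nhds hε), eventually_ge_atTop N] with n h1 h2 r hr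
    rw [dist_comm, Real.dist_eq]
    exact (hN n h2 r hr).trans_lt h1
  exact (hu.continuousOn (Frequently.of_forall fun n =>
    (continuous_eulerPath n _ ω).continuousOn)).continuousAt (Iic_mem_nhds hT)

theorem eulerLimit_zero (ω : PathSpace) : eulerLimit β s x 0 ω = x := by
  have h : ∀ n, eulerApprox β s x n 0 ω = x := fun n => by
    have h0 := eulerPath_dyadicGrid (β := β) (s := s) (x := x) (n := n) (Nat.zero_le (n * 2 ^ n)) ω
    rwa [show dyadicGrid n 0 = 0 by simp [dyadicGrid]] at h0
  simp only [eulerLimit, h]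
  exact tendsto_const_nhds.limUnder_eq

/-- The limit is defined on every path without reference to a prior, and `limUnder` preserves
measurability even where the sequence diverges. So the process is progressive for the raw
filtration, with no completion by null sets. -/
theorem isStronglyProgressive_eulerLimit (hβ : Continuous β) (hs : Continuous s) :
    IsStronglyProgressive pathFiltration (eulerLimit β s x) := fun i =>
  @StronglyMeasurable.limUnder ℕ (Set.Iic i × PathSpace) ℝ
    (MeasurableSpace.prod Subtype.instMeasurableSpace (pathFiltration i)) _ _ atTop _ _ _ _ fun n =>
    (StronglyAdapted.isStronglyProgressive_of_continuous
      (fun t => stronglyMeasurable_eulerPath hβ hs n (n * 2 ^ n) t)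
      fun ω => continuous_eulerPath n (n * 2 ^ n) ω) i

theorem measurable_eulerLimit (hβ : Continuous β) (hs : Continuous s) (t : ℝ≥0) :
    Measurable (eulerLimit β s x t) :=
  (((isStronglyProgressive_eulerLimit hβ hs).stronglyAdapted t).mono
    (pathFiltration.le t)).measurable

theorem MeasureTheory.MemLp.eLpNorm_two_eq {α : Type*} {m0 : MeasurableSpace α} {μ : Measure α}
    {f : α → ℝ} (hf : MemLp f 2 μ) : eLpNorm f 2 μ = ENNReal.ofReal √(∫ a, f a ^ 2 ∂μ) := by
  refine (ENNReal.pow_right_strictMono two_ne_zero).injective ?_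
  rw [hf.eLpNorm_two_sq, ← ENNReal.ofReal_pow (Real.sqrt_nonneg _),
    Real.sq_sqrt (integral_nonneg fun _ => sq_nonneg _)]

/-- Mean square rate of convergence of the Euler schemes. -/
theorem exists_eLpNorm_eulerPath_sub_le (hP : P ∈ priors σlo σhi) (hβ : LipschitzWith K β)
    (hs : LipschitzWith K s) (x : ℝ) (T : ℕ) : ∃ C, 0 ≤ C ∧ ∀ n ≥ T, ∀ t ≤ (T : ℝ≥0),
      eLpNorm (fun ω => eulerPath β s x n (T * 2 ^ n) t ω - eulerLimit β s x t ω) 2 P ≤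
        ENNReal.ofReal (C * (5 / 7) ^ n) := by
  have := hP.1
  obtain ⟨C, hC, h⟩ := exists_eulerPath_succ_sub_bounds hβ hs σlo σhi x T
  refine ⟨√C * (7 / 2), by positivity, fun n hn t ht => ?_⟩
  have hL := fun m => memLp_eulerPath (x := x) hP hβ hs m (T * 2 ^ m) t
  have hstep : ∀ m, eLpNorm (fun ω => eulerPath β s x m (T * 2 ^ m) t ω -
      eulerPath β s x (m + 1) (T * 2 ^ (m + 1)) t ω) 2 P ≤ ENNReal.ofReal (√C * (5 / 7) ^ m) := by
    intro m
    refine (le_of_eq ((hL m).sub (hL (m + 1))).eLpNorm_two_eq).trans ?_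
    refine ENNReal.ofReal_le_ofReal (le_trans (Real.sqrt_le_sqrt ?_)
      (sqrt_mul_one_div_two_pow_le hC m))
    refine le_trans (le_of_eq ?_) ((h P hP m).1 t ht)
    exact integral_congr_ae (ae_of_all _ fun ω => by simp only [Pi.sub_apply]; ring)
  -- The steps are summed as a geometric series; 7/2 is 1 / (1 − 5/7).
  have hind : ∀ k, eLpNorm (fun ω => eulerPath β s x n (T * 2 ^ n) t ω -
      eulerPath β s x (n + k) (T * 2 ^ (n + k)) t ω) 2 P ≤
      ENNReal.ofReal (√C * (7 / 2) * ((5 / 7) ^ n - (5 / 7) ^ (n + k))) := by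
    intro k
    induction k with
    | zero => simp
    | succ k ih =>
      have e : (fun ω => eulerPath β s x n (T * 2 ^ n) t ω -
          eulerPath β s x (n + (k + 1)) (T * 2 ^ (n + (k + 1))) t ω) =
          (fun ω => eulerPath β s x n (T * 2 ^ n) t ω -
            eulerPath β s x (n + k) (T * 2 ^ (n + k)) t ω) +
          fun ω => eulerPath β s x (n + k) (T * 2 ^ (n + k)) t ω -
            eulerPath β s x (n + k + 1) (T * 2 ^ (n + k + 1)) t ω := by
        funext ω
        simp only [Pi.add_apply]
        rw [← add_assoc]
        ring
      rw [e]
      refine (eLpNorm_add_le ((hL n).sub (hL (n + k))).1 ((hL (n + k)).sub (hL (n + k + 1))).1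
        one_le_two).trans ((add_le_add ih (hstep (n + k))).trans (le_of_eq ?_))
      have hle : (5 / 7 : ℝ) ^ (n + k) ≤ (5 / 7) ^ n :=
        pow_le_pow_of_le_one (by norm_num) (by norm_num) (Nat.le_add_right n k)
      rw [← ENNReal.ofReal_add (mul_nonneg (by positivity) (sub_nonneg.2 hle)) (by positivity)]
      congr 1
      rw [← add_assoc, pow_succ _ (n + k)]
      ring
  have hlim : ∀ᵐ ω ∂P, Tendsto (fun k => eulerPath β s x n (T * 2 ^ n) t ω -
      eulerPath β s x (n + k) (T * 2 ^ (n + k)) t ω) atTop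
      (𝓝 (eulerPath β s x n (T * 2 ^ n) t ω - eulerLimit β s x t ω)) := by
    filter_upwards [ae_tendsto_eulerApprox (x := x) hP hβ hs] with ω hω
    refine tendsto_const_nhds.sub ?_
    have h1 := ((tendsto_add_atTop_iff_nat n).2 (hω t))
    refine h1.congr fun k => ?_
    rw [add_comm k n, eulerApprox_eq (hn.trans (Nat.le_add_right n k)) ht]
  -- Fatou's lemma transfers the bounds to the almost sure limit.
  refine (Lp.eLpNorm_lim_le_liminf_eLpNorm (fun k => ((hL n).sub (hL (n + k))).1) _ hlim).trans ?_
  refine liminf_le_of_frequently_le' (Frequently.of_forall fun k => (hind k).trans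
    (ENNReal.ofReal_le_ofReal ?_))
  refine mul_le_mul_of_nonneg_left ?_ (by positivity)
  have : (0 : ℝ) ≤ (5 / 7) ^ (n + k) := by positivity
  linarith

end EulerLimit

/-! ### Existence of strong solutions -/

section Existence

variable {σlo σhi : ℝ} {P : Measure PathSpace} {β s : ℝ → ℝ} {x : ℝ} {K : ℝ≥0}

theorem stepVal_of_mem {τ : ℕ → ℝ≥0} {Z : ℕ → PathSpace → ℝ} (hτ : Monotone τ) {k N : ℕ}
    (hk : k < N) {r : ℝ≥0} (hr : r ∈ Set.Ioc (τ k) (τ (k + 1))) (ω : PathSpace) :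
    stepVal τ Z N r ω = Z k ω := by
  rw [stepVal, Finset.sum_eq_single k]
  · exact Set.indicator_of_mem hr _
  · intro i _ hik
    refine Set.indicator_of_notMem (fun h => ?_) _
    rcases lt_or_gt_of_ne hik with h' | h'
    · exact absurd (h.2.trans (hτ h')) (not_le.2 hr.1)
    · exact absurd (hr.2.trans (hτ h')) (not_le.2 h.1)
  · exact fun h => absurd (Finset.mem_range.2 hk) h

theorem exists_mem_Ioc_dyadicGrid (n T : ℕ) {r : ℝ≥0} (h0 : 0 < r) (hr : r ≤ T) :
    ∃ k < T * 2 ^ n, r ∈ Set.Ioc (dyadicGrid n k) (dyadicGrid n (k + 1)) := by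
  have hpos : 0 < ⌈r * 2 ^ n⌉₊ := Nat.ceil_pos.2 (by positivity)
  obtain ⟨k, hk⟩ := Nat.exists_eq_succ_of_ne_zero hpos.ne'
  have hT : ⌈r * 2 ^ n⌉₊ ≤ T * 2 ^ n := Nat.ceil_le.2 (by push_cast; gcongr)
  refine ⟨k, by omega, ?_, ?_⟩
  · rw [dyadicGrid, div_lt_iff₀ (by positivity)]
    exact Nat.lt_ceil.1 (by omega)
  · rw [dyadicGrid, le_div_iff₀ (by positivity)]
    exact Nat.ceil_le.1 hk.le

theorem timeIntegral_stepVal {τ : ℕ → ℝ≥0} {b : ℕ → PathSpace → ℝ} (hτ : Monotone τ) (N : ℕ)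
    (t : ℝ≥0) (ω : PathSpace) :
    timeIntegral (stepVal τ b N) t ω = stepSum τ (fun i => b i ω) N (↑) t := by
  have e : ∀ i (r : ℝ≥0), (Set.Ioc (τ i) (τ (i + 1))).indicator (fun _ => b i ω) r =
      b i ω * (Set.Ioc (τ i) (τ (i + 1))).indicator (fun _ => (1 : ℝ)) r := by
    intro i r
    by_cases h : r ∈ Set.Ioc (τ i) (τ (i + 1)) <;> simp [h]
  have hind : ∀ i, Integrable ((Set.Ioc (τ i) (τ (i + 1))).indicator (fun _ => (1 : ℝ)))
      (timeMeasure.restrict (Set.Iic t)) := fun i =>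
    (integrable_const _).indicator measurableSet_Ioc
  simp only [timeIntegral, stepVal, e]
  rw [integral_finsetSum _ fun i _ => (hind i).const_mul _]
  refine Finset.sum_congr rfl fun i _ => ?_
  rw [integral_const_mul, SimpleProcess.setIntegral_indicator_Ioc _ _ _ (hτ i.le_succ)]

theorem eLpNorm_timeIntegral_le [IsProbabilityMeasure P] {b : ℝ≥0 → PathSpace → ℝ}
    (hb : LocallySquareIntegrable P b) (t : ℝ≥0) :
    eLpNorm (timeIntegral b t) 2 P ^ 2 ≤ t *
      eLpNorm (fun p : ℝ≥0 × PathSpace => b p.1 p.2) 2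
        ((timeMeasure.restrict (Set.Iic t)).prod P) ^ 2 := by
  rw [(memLp_timeIntegral hb t).eLpNorm_two_sq, (hb t).eLpNorm_two_sq, ← ENNReal.ofReal_coe_nnreal,
    ← ENNReal.ofReal_mul t.coe_nonneg]
  refine ENNReal.ofReal_le_ofReal ?_
  have h := integral_mono_ae (memLp_timeIntegral hb t).integrable_sq
    ((hb t).integrable_sq.integral_prod_right.const_mul (t : ℝ))
    ((sq_timeIntegral_le hb t).mono fun ω hω => hω t le_rfl)
  rw [integral_const_mul] at h
  refine h.trans (le_of_eq ?_)
  rw [integral_prod_symm _ (hb t).integrable_sq]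

/-- The frozen coefficient differs from the limit by the movement of the scheme within one grid
interval and by the error of the scheme at time r. Time 0 is excluded because step processes live on
left-open intervals. A general Lipschitz ψ serves drift and volatility alike. -/
theorem exists_eLpNorm_stepVal_eulerState_sub_le (hP : P ∈ priors σlo σhi) (hβ : LipschitzWith K β)
    (hs : LipschitzWith K s) (x : ℝ) {ψ : ℝ → ℝ} (hψ : LipschitzWith K ψ) (T : ℕ) :
    ∃ C, 0 ≤ C ∧ ∀ n ≥ T, ∀ r : ℝ≥0, 0 < r → r ≤ T → eLpNorm (fun ω => stepVal (dyadicGrid n)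
      (fun i ω => ψ (eulerState β s x n i ω)) (T * 2 ^ n) r ω - ψ (eulerLimit β s x r ω)) 2 P ≤
        ENNReal.ofReal (C * (5 / 7) ^ n) := by
  have := hP.1
  obtain ⟨C, hC, h⟩ := exists_integral_eulerPath_sub_sq_le hβ hs σlo σhi x T
  obtain ⟨C', hC', h'⟩ := exists_eLpNorm_eulerPath_sub_le hP hβ hs x T
  have hE := memLp_eulerState (x := x) hP hβ hs
  refine ⟨K * (√C + C'), by positivity, fun n hn r h0 hrT => ?_⟩
  obtain ⟨k, hk, hkr⟩ := exists_mem_Ioc_dyadicGrid n T h0 hrT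
  simp only [stepVal_of_mem (monotone_dyadicGrid n) hk hkr]
  have hY := memLp_eulerPath (x := x) hP hβ hs n (T * 2 ^ n) r
  have h1 : eLpNorm (fun ω => ψ (eulerState β s x n k ω) - ψ (eulerLimit β s x r ω)) 2 P ≤
      ENNReal.ofReal K * eLpNorm (fun ω => eulerState β s x n k ω - eulerLimit β s x r ω) 2 P :=
    eLpNorm_le_mul_eLpNorm_of_ae_le_mul (ae_of_all _ fun ω => by
      rw [← dist_eq_norm_sub, ← dist_eq_norm_sub]
      exact hψ.dist_le_mul _ _) 2
  have e : (fun ω => eulerState β s x n k ω - eulerLimit β s x r ω) =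
      (fun ω => eulerState β s x n k ω - eulerPath β s x n (T * 2 ^ n) r ω) +
      fun ω => eulerPath β s x n (T * 2 ^ n) r ω - eulerLimit β s x r ω := by
    funext ω
    simp only [Pi.add_apply]
    ring
  have h2 : eLpNorm (fun ω => eulerState β s x n k ω -
      eulerPath β s x n (T * 2 ^ n) r ω) 2 P ≤ ENNReal.ofReal (√C * (5 / 7) ^ n) := by
    refine (le_of_eq ((hE n k).sub hY).eLpNorm_two_eq).trans ?_
    refine ENNReal.ofReal_le_ofReal (le_trans (Real.sqrt_le_sqrt ?_)
      (sqrt_mul_one_div_two_pow_le hC n))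
    refine le_trans (le_of_eq ?_) (h P hP n k hk r hkr.1.le hkr.2)
    exact integral_congr_ae (ae_of_all _ fun ω => by simp only [Pi.sub_apply]; ring)
  have hXr := measurable_eulerLimit (x := x) hβ.continuous hs.continuous r
  have h3 := eLpNorm_add_le ((hE n k).sub hY).1
    (hY.1.sub hXr.aestronglyMeasurable) (one_le_two : (1 : ℝ≥0∞) ≤ 2)
  refine h1.trans ?_
  rw [mul_assoc, ENNReal.ofReal_mul K.coe_nonneg, e]
  refine mul_le_mul' le_rfl (h3.trans ((add_le_add h2 (h' n hn r hrT)).trans ?_))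
  rw [← ENNReal.ofReal_add (by positivity) (by positivity), add_mul]

/-- The coefficients of the Euler schemes converge in mean square. -/
theorem tendsto_eLpNorm_stepVal_eulerState (hP : P ∈ priors σlo σhi) (hβ : LipschitzWith K β)
    (hs : LipschitzWith K s) (x : ℝ) {ψ : ℝ → ℝ} (hψ : LipschitzWith K ψ) (T : ℕ) :
    Tendsto (fun n => eLpNorm (fun p : ℝ≥0 × PathSpace => stepVal (dyadicGrid n)
      (fun i ω => ψ (eulerState β s x n i ω)) (T * 2 ^ n) p.1 p.2 -
        ψ (eulerLimit β s x p.1 p.2)) 2 ((timeMeasure.restrict (Set.Iic (T : ℝ≥0))).prod P))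
      atTop (𝓝 0) := by
  have := hP.1
  obtain ⟨C, hC, hpt⟩ := exists_eLpNorm_stepVal_eulerState_sub_le hP hβ hs x hψ T
  have hXm : Measurable fun p : ℝ≥0 × PathSpace => eulerLimit β s x p.1 p.2 :=
    measurable_of_isStronglyProgressive
      (isStronglyProgressive_eulerLimit hβ.continuous hs.continuous)
  have hEm := stronglyMeasurable_eulerState (x := x) hβ.continuous hs.continuous
  have hb : ∀ n ≥ T, eLpNorm (fun p : ℝ≥0 × PathSpace => stepVal (dyadicGrid n)
      (fun i ω => ψ (eulerState β s x n i ω)) (T * 2 ^ n) p.1 p.2 -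
        ψ (eulerLimit β s x p.1 p.2)) 2 ((timeMeasure.restrict (Set.Iic (T : ℝ≥0))).prod P) ≤
      ENNReal.ofReal (√T * (C * (5 / 7) ^ n)) := by
    intro n hn
    have hr := hpt n hn
    rw [ENNReal.ofReal_mul (Real.sqrt_nonneg _)]
    refine (ENNReal.pow_right_strictMono two_ne_zero).le_iff_le.1 ?_
    have hm : Measurable fun p : ℝ≥0 × PathSpace => ENNReal.ofReal ((stepVal (dyadicGrid n)
        (fun i ω => ψ (eulerState β s x n i ω)) (T * 2 ^ n) p.1 p.2 -
        ψ (eulerLimit β s x p.1 p.2)) ^ 2) := by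
      have h1 := measurable_stepVal (fun i => hψ.continuous.comp_stronglyMeasurable (hEm n i))
        (T * 2 ^ n)
      have h2 := hψ.continuous.measurable.comp hXm
      exact ((h1.sub h2).pow_const 2).ennreal_ofReal
    rw [eLpNorm_two_sq, lintegral_prod _ hm.aemeasurable, mul_pow,
      ← ENNReal.ofReal_pow (Real.sqrt_nonneg _), Real.sq_sqrt (Nat.cast_nonneg _)]
    have h0 : ∀ᵐ r ∂timeMeasure, r ≠ 0 := by
      rw [ae_iff]
      have : {a : ℝ≥0 | ¬a ≠ 0} = Set.Iic 0 := by ext; simp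
      rw [this, timeMeasure_Iic, ENNReal.coe_zero]
    calc _ ≤ ∫⁻ r in Set.Iic (T : ℝ≥0),
          ENNReal.ofReal (C * (5 / 7) ^ n) ^ 2 ∂timeMeasure := by
          refine lintegral_mono_ae ?_
          filter_upwards [ae_restrict_mem measurableSet_Iic, ae_restrict_of_ae h0] with r h1 h2
          rw [← eLpNorm_two_sq]
          gcongr
          exact hr r (pos_iff_ne_zero.2 h2) h1
      _ = _ := by
          rw [setLIntegral_const, timeMeasure_Iic, ENNReal.ofReal_natCast, ENNReal.coe_natCast, mul_comm]
  have hlim : Tendsto (fun n : ℕ => ENNReal.ofReal (√T * (C * (5 / 7) ^ n)))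
      atTop (𝓝 0) := by
    have h1 := tendsto_pow_atTop_nhds_zero_of_lt_one (r := (5 / 7 : ℝ)) (by norm_num) (by norm_num)
    have h2 := ENNReal.tendsto_ofReal
      ((h1.const_mul C).const_mul √(T : ℝ))
    simpa using h2
  exact tendsto_of_tendsto_of_tendsto_of_le_of_le' tendsto_const_nhds hlim
    (Eventually.of_forall fun _ => zero_le) ((eventually_ge_atTop T).mono hb)

/-- Square integrability is inherited as a mean square limit of square integrable step processes. -/
theorem locallySquareIntegrable_eulerLimit (hP : P ∈ priors σlo σhi) (hβ : LipschitzWith K β)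
    (hs : LipschitzWith K s) (x : ℝ) {ψ : ℝ → ℝ} (hψ : LipschitzWith K ψ) :
    LocallySquareIntegrable P fun t ω => ψ (eulerLimit β s x t ω) := by
  have := hP.1
  intro T
  obtain ⟨N, hN⟩ := exists_nat_ge T
  have hXm : Measurable fun p : ℝ≥0 × PathSpace => eulerLimit β s x p.1 p.2 :=
    measurable_of_isStronglyProgressive
      (isStronglyProgressive_eulerLimit hβ.continuous hs.continuous)
  have h := memLp_two_of_tendsto_sub (fun n => memLp_stepVal (τ := dyadicGrid n)
    (fun i => hψ.comp_memLp_two (memLp_eulerState (x := x) hP hβ hs n i)) (N * 2 ^ n) N)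
    (hψ.continuous.measurable.comp hXm).aestronglyMeasurable
    (tendsto_eLpNorm_stepVal_eulerState hP hβ hs x hψ N)
  exact h.mono_measure (Measure.prod_mono (Measure.restrict_mono
    (Set.Iic_subset_Iic.2 hN) le_rfl) le_rfl)

/-- Existence of strong solutions of equations with Lipschitz coefficients. -/
theorem isStrongSolution_eulerLimit (hβ : LipschitzWith K β) (hs : LipschitzWith K s)
    (σlo σhi x : ℝ) : IsStrongSolution (priors σlo σhi) x (fun t ω => β (eulerLimit β s x t ω))
      (fun t ω => s (eulerLimit β s x t ω)) (eulerLimit β s x) := by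
  have hprog := isStronglyProgressive_eulerLimit (x := x) hβ.continuous hs.continuous
  refine ⟨hprog, fun P hP => ae_continuous_eulerLimit hP hβ hs,
    fun P _ => ae_of_all _ eulerLimit_zero,
    fun P hP => locallySquareIntegrable_eulerLimit hP hβ hs x hβ, fun P hP => ?_⟩
  have := hP.1
  have hdrift := locallySquareIntegrable_eulerLimit hP hβ hs x hβ
  have hE := memLp_eulerState (x := x) hP hβ hs
  have hEm := stronglyMeasurable_eulerState (x := x) hβ.continuous hs.continuous
  have hXt : ∀ t, AEStronglyMeasurable (eulerLimit β s x t) P := fun t =>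
    (measurable_eulerLimit hβ.continuous hs.continuous t).aestronglyMeasurable
  have hJ : ∀ t, AEStronglyMeasurable (fun ω => eulerLimit β s x t ω - x -
      timeIntegral (fun t ω => β (eulerLimit β s x t ω)) t ω) P := fun t =>
    ((hXt t).sub aestronglyMeasurable_const).sub (aestronglyMeasurable_timeIntegral hdrift t)
  refine isItoIntegral_of_tendsto_step hP (locallySquareIntegrable_eulerLimit hP hβ hs x hs) hJ
    fun T => ?_
  obtain ⟨N, hN⟩ := exists_nat_ge T
  have hmono : ∀ {a b : ℝ≥0}, a ≤ b →
      (timeMeasure.restrict (Set.Iic a)).prod P ≤ (timeMeasure.restrict (Set.Iic b)).prod P :=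
    fun h => Measure.prod_mono (Measure.restrict_mono (Set.Iic_subset_Iic.2 h) le_rfl) le_rfl
  refine ⟨dyadicGrid, fun n i ω => s (eulerState β s x n i ω), fun n => N * 2 ^ n,
    monotone_dyadicGrid, fun n i => hs.continuous.comp_stronglyMeasurable (hEm n i),
    fun n i => hs.comp_memLp_two (hE n i), ?_, fun t ht => ?_⟩
  · exact tendsto_of_tendsto_of_tendsto_of_le_of_le tendsto_const_nhds
      (tendsto_eLpNorm_stepVal_eulerState hP hβ hs x hs N) (fun _ => zero_le)
      fun n => eLpNorm_mono_measure _ (hmono hN)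
  · have htN := ht.trans hN
    obtain ⟨C, hC, hrate⟩ := exists_eLpNorm_eulerPath_sub_le hP hβ hs x N
    set D : ℕ → ℝ≥0 → PathSpace → ℝ := fun n r ω => stepVal (dyadicGrid n)
      (fun i ω => β (eulerState β s x n i ω)) (N * 2 ^ n) r ω - β (eulerLimit β s x r ω) with hD
    have hval : ∀ n, LocallySquareIntegrable P (stepVal (dyadicGrid n)
        (fun i ω => β (eulerState β s x n i ω)) (N * 2 ^ n)) := fun n =>
      memLp_stepVal (fun i => hβ.comp_memLp_two (hE n i)) _
    have hDl : ∀ n, LocallySquareIntegrable P (D n) := fun n T => (hval n T).sub (hdrift T)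
    have hD0 : Tendsto (fun n => eLpNorm (timeIntegral (D n) t) 2 P) atTop (𝓝 0) := by
      have h1 : Tendsto (fun n => (t : ℝ≥0∞) * eLpNorm (fun p : ℝ≥0 × PathSpace => D n p.1 p.2) 2
          ((timeMeasure.restrict (Set.Iic (N : ℝ≥0))).prod P) ^ 2) atTop (𝓝 0) := by
        have := ENNReal.Tendsto.const_mul (a := (t : ℝ≥0∞)) (ENNReal.Tendsto.pow (n := 2)
          (tendsto_eLpNorm_stepVal_eulerState hP hβ hs x hβ N)) (Or.inr ENNReal.coe_ne_top)
        simpa using this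
      have h2 : Tendsto (fun n => eLpNorm (timeIntegral (D n) t) 2 P ^ 2) atTop (𝓝 0) :=
        tendsto_of_tendsto_of_tendsto_of_le_of_le tendsto_const_nhds h1 (fun _ => zero_le)
          fun n => (eLpNorm_timeIntegral_le (hDl n) t).trans (mul_le_mul' le_rfl
            (pow_le_pow_left' (eLpNorm_mono_measure _ (hmono htN)) 2))
      have h3 := h2.ennrpow_const (1 / 2 : ℝ)
      simp only [one_div, inv_pos, Nat.ofNat_pos, ENNReal.zero_rpow_of_pos] at h3
      refine h3.congr fun n => ?_
      rw [← ENNReal.rpow_natCast, ← ENNReal.rpow_mul]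
      norm_num
    have hX0 : Tendsto (fun n => eLpNorm (fun ω => eulerPath β s x n (N * 2 ^ n) t ω -
        eulerLimit β s x t ω) 2 P) atTop (𝓝 0) := by
      have h1 := tendsto_pow_atTop_nhds_zero_of_lt_one (r := (5 / 7 : ℝ)) (by norm_num)
        (by norm_num)
      have h2 : Tendsto (fun n : ℕ => ENNReal.ofReal (C * (5 / 7) ^ n)) atTop (𝓝 0) := by
        simpa using ENNReal.tendsto_ofReal (h1.const_mul C)
      exact tendsto_of_tendsto_of_tendsto_of_le_of_le' tendsto_const_nhds h2
        (Eventually.of_forall fun _ => zero_le)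
        ((eventually_ge_atTop N).mono fun n hn => hrate n hn t htN)
    have hsum : Tendsto (fun n => eLpNorm (fun ω => eulerPath β s x n (N * 2 ^ n) t ω -
        eulerLimit β s x t ω) 2 P + eLpNorm (timeIntegral (D n) t) 2 P) atTop (𝓝 0) := by
      simpa using hX0.add hD0
    refine tendsto_of_tendsto_of_tendsto_of_le_of_le tendsto_const_nhds hsum (fun _ => zero_le)
      fun n => ?_
    -- The Euler path minus x and its drift integral is exactly the step integral, so the error of
    -- the step integral is the error of the path minus the time integral of the drift error.
    refine le_trans (le_of_eq (eLpNorm_congr_ae ?_)) (eLpNorm_sub_le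
      ((memLp_eulerPath hP hβ hs n (N * 2 ^ n) t).1.sub (hXt t))
      (memLp_timeIntegral (hDl n) t).1 one_le_two)
    filter_upwards [(hval n).ae_memLp t, hdrift.ae_memLp t] with ω h1 h2
    have h3 : timeIntegral (D n) t ω = timeIntegral (stepVal (dyadicGrid n)
        (fun i ω => β (eulerState β s x n i ω)) (N * 2 ^ n)) t ω -
        timeIntegral (fun t ω => β (eulerLimit β s x t ω)) t ω :=
      integral_sub (h1.integrable one_le_two) (h2.integrable one_le_two)
    rw [timeIntegral_stepVal (monotone_dyadicGrid n)] at h3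
    simp only [Pi.sub_apply, h3, eulerPath, stepDiffusion]
    unfold timeIntegral
    ring

end Existence

/-! ### Lipschitz coefficients of the two closed loops -/

theorem lipschitzWith_affine (a b : ℝ) : LipschitzWith ‖a‖₊ fun y : ℝ => a * y + b :=
  LipschitzWith.of_dist_le_mul fun y z => by
    rw [dist_add_right, Real.dist_eq, Real.dist_eq, ← mul_sub, abs_mul]
    rfl

/-- The square root is the Euclidean norm of the vector with entries ay + b and √e, hence
1-Lipschitz in its first entry; the triangle inequality is checked by squaring. -/
theorem lipschitzWith_sqrt_sq_add {e : ℝ} (he : 0 ≤ e) (a b : ℝ) :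
    LipschitzWith ‖a‖₊ fun y : ℝ => √((a * y + b) ^ 2 + e) := by
  have key : ∀ u v : ℝ, √(u ^ 2 + e) - √(v ^ 2 + e) ≤ |u - v| := by
    intro u v
    rw [sub_le_iff_le_add']
    have h1 : |v| ≤ √(v ^ 2 + e) := Real.abs_le_sqrt (by linarith)
    have h2 : √(v ^ 2 + e) ^ 2 = v ^ 2 + e := Real.sq_sqrt (by positivity)
    refine Real.sqrt_le_iff.2 ⟨by positivity, ?_⟩
    have h3 : v * (u - v) ≤ |v| * |u - v| := by
      rw [← abs_mul]
      exact le_abs_self _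
    have h4 := mul_le_mul_of_nonneg_right h1 (abs_nonneg (u - v))
    have h5 := sq_abs (u - v)
    nlinarith
  refine LipschitzWith.of_dist_le_mul fun y z => ?_
  have e1 : |(a * y + b) - (a * z + b)| = ‖a‖₊ * dist y z := by
    rw [add_sub_add_right_eq_sub, ← mul_sub, abs_mul, Real.dist_eq]
    rfl
  rw [Real.dist_eq, ← e1]
  refine abs_sub_le_iff.2 ⟨key _ _, ?_⟩
  rw [abs_sub_comm (a * y + b)]
  exact key _ _

theorem exists_isStrongSolution {β s : ℝ → ℝ} {K₁ K₂ : ℝ≥0} (hβ : LipschitzWith K₁ β)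
    (hs : LipschitzWith K₂ s) (σlo σhi x : ℝ) : ∃ X, IsStrongSolution (priors σlo σhi) x
      (fun t ω => β (X t ω)) (fun t ω => s (X t ω)) X :=
  ⟨_, isStrongSolution_eulerLimit (hβ.weaken (le_max_left K₁ K₂)) (hs.weaken (le_max_right K₁ K₂))
    σlo σhi x⟩

end

/-! ### Assembly of the proposition -/

theorem proposition3 (m : LQModel) (α₀ α₁ α₂ : ℝ)
    (h : m.ExploratorySolution α₀ α₁ α₂ ∨ m.ClassicalSolution α₀ α₁ α₂) (x : ℝ) :
    (∃ X, m.ClassicalOptimal x (m.generatedControl α₁ α₂ X) X) ∧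
    (∃ X, m.ExploratoryOptimal x (m.generatedRandomizedControl α₁ α₂ X) X) ∧
    ∀ X, m.ExploratoryOptimal x (m.generatedRandomizedControl α₁ α₂ X) X →
      m.FiniteDiscountedEntropy (m.generatedRandomizedControl α₁ α₂ X) ∧
      m.explorationCost x (m.generatedRandomizedControl α₁ α₂ X) = m.lam / (2 * m.ρ) := by
  have hα : α₂ < 0 := h.elim And.left And.left
  obtain ⟨hstab, hF⟩ := h.elim m.stableLoop_and_feedbackEquation_of_exploratory
    m.stableLoop_and_feedbackEquation_of_classical
  have he : 0 ≤ m.D ^ 2 * m.loopVar α₂ := mul_nonneg (sq_nonneg _) (m.loopVar_pos hα).le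
  -- The two loops share their drift and differ in their volatility. A hypothesis supplies a state
  -- process for one of the problems only, so states for both are constructed.
  have hdrift := lipschitzWith_affine (m.loopDrift α₂) (m.F * m.intercept α₁ α₂)
  obtain ⟨X, hX⟩ := exists_isStrongSolution hdrift
    (lipschitzWith_affine (m.loopVol α₂) (m.D * m.intercept α₁ α₂)) m.σlo m.σhi x
  obtain ⟨Y, hY⟩ := exists_isStrongSolution hdrift
    (lipschitzWith_sqrt_sq_add he (m.loopVol α₂) (m.D * m.intercept α₁ α₂)) m.σlo m.σhi x
  obtain ⟨hXo, hXv⟩ := LQModel.classicalOptimal_of_isStrongSolution hα hstab hF hX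
  obtain ⟨hYo, hYv⟩ := LQModel.exploratoryOptimal_of_isStrongSolution hα hstab hF hY
  -- Both values are read off from X and Y; the cost depends on Z only through the entropy of the
  -- generated control, which is the same constant for every state process.
  refine ⟨⟨X, hXo⟩, ⟨Y, hYo⟩, fun Z _ =>
    ⟨LQModel.finiteDiscountedEntropy_generatedRandomizedControl hα,
      LQModel.explorationCost_eq hα (v := 1 / 2 * α₂ * x ^ 2 + α₁ * x + α₀)
        (hXo.2.csSup_eq.trans hXv) ?_⟩⟩
  rw [add_assoc]
  exact hYo.2.csSup_eq.trans hYv
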